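/- **Setting.** Let $N\in\mathbb N$, $1<p<N$, $p^*=\frac{Np}{N-p}$, $\mu>0$ and $\max\{p,p^*-1\}<r<q<p^*$. Assume - $(V_1)$ $V\in C^1(\mathbb R^N)$ and there are $0<\tilde a<\tilde b$ with $\tilde a\le V\le\tilde b$ on $\mathbb R^N$; - $(V_2)$ $\mathcal M\subset\mathbb R^N$ is a bounded domain with smooth boundary and $\vec n(x)\cdot\nabla V(x)>0$ for all $x\in\partial\mathcal M$, where $\vec n$ is the outward unit normal. Let $\varphi\in C_0^\infty(\mathbb R)$ be even, with $\varphi(s)=1$ for $|s|\le1$, $\varphi(s)=0$ for $|s|\ge2$, $|\varphi'|\le2$, and $\varphi$ decreasing on $[1,2]$. Let $\zeta\in C^1(\mathbb R)$ with $0\le\zeta\le1$, $\zeta'\ge0$, $\zeta(t)=0$ for $t\le0$, $\zeta(t)>0$ for $t>0$, $\zeta(t)=1$ for $t\ge1$, and such that for some $C,a,\rho>0$ one has $t\zeta'(t)\ge C\zeta(t)$ and $\zeta(t)\ge Ct^a$ for $0\le t\le\rho$. Let $\gamma>\max\left\{\frac{(p+a)p}{N-p},\frac{p^2r}{(r-p)(N-p)}\right\}$,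 $1<\beta<r/p$, and moreover $\beta\le\frac1{2-p}$ if $p<2$. For $\epsilon\in(0,1]$ put $$b_\epsilon(x,t)=\varphi\big(\epsilon e^{\mathrm{dist}(\epsilon x,\mathcal M)}t\big),\quad m_\epsilon(x,t)=\int_0^t b_\epsilon(x,\tau)\,d\tau,\quad F_\epsilon(x,t)=\tfrac1{p^*}|t|^r|m_\epsilon(x,t)|^{p^*-r}+\tfrac\mu q|t|^r|m_\epsilon(x,t)|^{q-r},$$ let $\mathcal M_\epsilon=\{x:\epsilon x\in\mathcal M\}$, $\xi_\epsilon=0$ on $\mathcal M_\epsilon$, $\xi_\epsilon(x)=\epsilon^{-\gamma}\zeta(\mathrm{dist}(x,\mathcal M_\epsilon))$ for $x\notin\mathcal M_\epsilon$, and on $X=W^{1,p}(\mathbb R^N)$, normed by $\|u\|^p=\int|\nabla u|^p+|u|^p$, let $$I_\epsilon(u)=\frac1p\int_{\mathbb R^N}\big(|\nabla u|^p+V(\epsilon x)|u|^p\big)+\frac1{p\beta}\Big(\int_{\mathbb R^N}\xi_\epsilon|u|^p-1\Big)_+^\beta-\int_{\mathbb R^N}F_\epsilon(x,u).$$ For $\delta>0$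 let $P=\{u\in X:u\ge0\text{ a.e.}\}$, $P^\delta=\{u:\mathrm{dist}(u,P)<\delta\}$, $Q^\delta=-P^\delta$, $O=P^\delta\cup Q^\delta$, $\Sigma=\partial P^\delta\cap\partial Q^\delta$. For symmetric $E\subset X$ let the genus $\mathrm{gen}(E)\in\{0,1,\dots,\infty\}$ be the least $n$ for which there is an odd continuous map $E\to\mathbb R^n\setminus\{0\}$ ($\infty$ if there is none). Let $$\Lambda=\{\eta\in C(X,X):\eta\text{ odd},\ \eta(P^\delta)\subset P^\delta,\ \eta(Q^\delta)\subset Q^\delta,\ \eta(u)=u\text{ if }I_\epsilon(u)<0\},$$ $$\Gamma_j=\{E\subset X:E\text{ compact},\ -E=E,\ \mathrm{gen}(E\cap\eta^{-1}(\Sigma))\ge j\ \ \forall\eta\in\Lambda\},\qquad c_j(\epsilon)=\inf_{E\in\Gamma_j}\ \sup_{u\in E\setminus O}I_\epsilon(u),$$ $$K_c^*=\{u\in X:I_\epsilon'(u)=0,\ I_\epsilon(u)=c\}\setminus O .$$ **Theorem 3.2.** There are constants $m_j\in\mathbb R$, $j=1,2,\dots$, independent of $\epsilon$, such that for every $\epsilon\in(0,1]$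 there is $\delta_0=\delta_0(\epsilon)>0$ such that for every $\delta\in(0,\delta_0)$ the following hold. 1. For every $j\ge1$, $c_j(\epsilon)$ is a real number, $c_j(\epsilon)\le m_j$, and $K^*_{c_j(\epsilon)}\neq\emptyset$. Every element of $K^*_c$, $c\in\mathbb R$, is sign-changing (neither $\ge0$ a.e. nor $\le0$ a.e.), and $\bigcup_{j\ge1}K^*_{c_j(\epsilon)}$ is infinite. In particular $I_\epsilon$ has infinitely many sign-changing critical points, with critical values $c_j(\epsilon)$. 2. If $j\ge1$, $k\ge0$ and $c_j(\epsilon)=\dots=c_{j+k}(\epsilon)=c$, then $\mathrm{gen}(K_c^*)\ge k+1$. -/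

import Mathlib

open MeasureTheory
open scoped ENNReal ContDiff

noncomputable section

/-- Euclidean space `ℝ^N`. -/
abbrev RN (N : ℕ) : Type := EuclideanSpace ℝ (Fin N)

/-! ### The Sobolev space `W^{1,p}(ℝ^N)` -/

/-- `G` is the weak (distributional) gradient of `u`: for every test function `ψ ∈ C_c^∞(ℝ^N)` and
every direction `v`, `∫ u ∂_v ψ = - ∫ (G · v) ψ`. -/
def IsWeakGradient {N : ℕ} (u : RN N → ℝ) (G : RN N → RN N) : Prop :=
  ∀ ψ : RN N → ℝ, ContDiff ℝ ∞ ψ → HasCompactSupport ψ → ∀ v : RN N,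
    ∫ x, u x * fderiv ℝ ψ x v = - ∫ x, inner ℝ (G x) v * ψ x

theorem integrable_mul_fderiv_test {N : ℕ} {P : ℝ≥0∞} (hP : 1 ≤ P)
    (u : Lp ℝ P (volume : Measure (RN N))) {ψ : RN N → ℝ} (h1 : ContDiff ℝ ∞ ψ)
    (h2 : HasCompactSupport ψ) (v : RN N) :
    Integrable (fun x => u x * fderiv ℝ ψ x v) := by
  have hc : Continuous fun x => fderiv ℝ ψ x v :=
    (h1.continuous_fderiv (by simp)).clm_apply continuous_const
  have hs : HasCompactSupport fun x => fderiv ℝ ψ x v := h2.fderiv_apply (𝕜 := ℝ) v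
  simpa [mul_comm] using
    ((Lp.memLp u).locallyIntegrable hP).integrable_smul_left_of_hasCompactSupport hc hs

theorem integrable_inner_mul_test {N : ℕ} {P : ℝ≥0∞} (hP : 1 ≤ P)
    (G : Lp (RN N) P (volume : Measure (RN N))) {ψ : RN N → ℝ} (h1 : ContDiff ℝ ∞ ψ)
    (h2 : HasCompactSupport ψ) (v : RN N) :
    Integrable (fun x => inner ℝ (G x) v * ψ x) := by
  have h : Integrable (fun x => inner ℝ (ψ x • G x) v) :=
    (((Lp.memLp G).locallyIntegrable hP).integrable_smul_left_of_hasCompactSupport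
      h1.continuous h2).inner_const (𝕜 := ℝ) v
  refine h.congr (Filter.Eventually.of_forall fun x => ?_)
  simp [real_inner_smul_left, mul_comm]

/-- `W^{1,P}(ℝ^N)`, realized as the space of pairs `(u, ∇u)` in `L^P × L^P` whose second component
is the weak gradient of the first. The norm inherited from the `ℓ^P`-product is
`‖u‖ = (∫ |u|^P + |∇u|^P)^{1/P}`. -/
def sobolevSpace (N : ℕ) (P : ℝ≥0∞) [hP : Fact (1 ≤ P)] :
    Submodule ℝ (WithLp P (Lp ℝ P (volume : Measure (RN N)) ×
      Lp (RN N) P (volume : Measure (RN N)))) where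
  carrier := {w | IsWeakGradient (w.fst : RN N → ℝ) (w.snd : RN N → RN N)}
  zero_mem' := by
    intro ψ h1 h2 v
    have e1 : ∫ x, ((0 : Lp ℝ P (volume : Measure (RN N))) x) * fderiv ℝ ψ x v = 0 := by
      rw [integral_eq_zero_of_ae]
      filter_upwards [Lp.coeFn_zero ℝ P (volume : Measure (RN N))] with x hx
      rw [hx]
      simp
    have e2 : ∫ x, inner ℝ ((0 : Lp (RN N) P (volume : Measure (RN N))) x) v * ψ x = 0 := by
      rw [integral_eq_zero_of_ae]
      filter_upwards [Lp.coeFn_zero (RN N) P (volume : Measure (RN N))] with x hx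
      rw [hx]
      simp
    change ∫ x, ((0 : Lp ℝ P (volume : Measure (RN N))) x) * fderiv ℝ ψ x v =
      - ∫ x, inner ℝ ((0 : Lp (RN N) P (volume : Measure (RN N))) x) v * ψ x
    rw [e1, e2, neg_zero]
  add_mem' := by
    intro a b ha hb ψ h1 h2 v
    have e1 : ∫ x, ((a.fst + b.fst : Lp ℝ P (volume : Measure (RN N))) x) * fderiv ℝ ψ x v =
        (∫ x, a.fst x * fderiv ℝ ψ x v) + ∫ x, b.fst x * fderiv ℝ ψ x v := by
      rw [← integral_add (integrable_mul_fderiv_test hP.out a.fst h1 h2 v)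
        (integrable_mul_fderiv_test hP.out b.fst h1 h2 v)]
      refine integral_congr_ae ?_
      filter_upwards [Lp.coeFn_add a.fst b.fst] with x hx
      rw [hx, Pi.add_apply, add_mul]
    have e2 : ∫ x, inner ℝ ((a.snd + b.snd : Lp (RN N) P (volume : Measure (RN N))) x) v * ψ x =
        (∫ x, inner ℝ (a.snd x) v * ψ x) + ∫ x, inner ℝ (b.snd x) v * ψ x := by
      rw [← integral_add (integrable_inner_mul_test hP.out a.snd h1 h2 v)
        (integrable_inner_mul_test hP.out b.snd h1 h2 v)]
      refine integral_congr_ae ?_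
      filter_upwards [Lp.coeFn_add a.snd b.snd] with x hx
      rw [hx, Pi.add_apply, inner_add_left, add_mul]
    change ∫ x, ((a.fst + b.fst : Lp ℝ P (volume : Measure (RN N))) x) * fderiv ℝ ψ x v =
      - ∫ x, inner ℝ ((a.snd + b.snd : Lp (RN N) P (volume : Measure (RN N))) x) v * ψ x
    rw [e1, e2, ha ψ h1 h2 v, hb ψ h1 h2 v, neg_add]
  smul_mem' := by
    intro c a ha ψ h1 h2 v
    have e1 : ∫ x, ((c • a.fst : Lp ℝ P (volume : Measure (RN N))) x) * fderiv ℝ ψ x v =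
        c * ∫ x, a.fst x * fderiv ℝ ψ x v := by
      rw [← integral_const_mul]
      refine integral_congr_ae ?_
      filter_upwards [Lp.coeFn_smul c a.fst] with x hx
      simp [hx, mul_assoc]
    have e2 : ∫ x, inner ℝ ((c • a.snd : Lp (RN N) P (volume : Measure (RN N))) x) v * ψ x =
        c * ∫ x, inner ℝ (a.snd x) v * ψ x := by
      rw [← integral_const_mul]
      refine integral_congr_ae ?_
      filter_upwards [Lp.coeFn_smul c a.snd] with x hx
      simp [hx, real_inner_smul_left, mul_assoc]
    change ∫ x, ((c • a.fst : Lp ℝ P (volume : Measure (RN N))) x) * fderiv ℝ ψ x v =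
      - ∫ x, inner ℝ ((c • a.snd : Lp (RN N) P (volume : Measure (RN N))) x) v * ψ x
    rw [e1, e2, ha ψ h1 h2 v, mul_neg]

/-! ### Domains with smooth boundary, outward normals -/

/-- `n` is the outward unit normal at `x` to a set `M` whose boundary is smooth near `x`: near `x`,
`M` is the sublevel set `{g < 0}` of a smooth `g` with `g x = 0`, and `∇g x` is a positive multiple
of the unit vector `n`. -/
def IsOutwardUnitNormal {N : ℕ} (M : Set (RN N)) (x n : RN N) : Prop :=
  ‖n‖ = 1 ∧ ∃ (U : Set (RN N)) (g : RN N → ℝ) (s : ℝ), IsOpen U ∧ x ∈ U ∧ ContDiffOn ℝ ∞ g U ∧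
    g x = 0 ∧ 0 < s ∧ gradient g x = s • n ∧ ∀ y ∈ U, y ∈ M ↔ g y < 0

/-- A bounded domain (nonempty connected open set) of `ℝ^N` with smooth boundary. -/
structure IsSmoothBoundedDomain {N : ℕ} (M : Set (RN N)) : Prop where
  isOpen : IsOpen M
  isConnected : IsConnected M
  isBounded : Bornology.IsBounded M
  smooth_boundary : ∀ x ∈ frontier M, ∃ n, IsOutwardUnitNormal M x n

/-! ### Genus -/

/-- The genus of a symmetric subset `E` of a normed space: the least `n` such that there is an odd
continuous map `E → ℝ^n ∖ {0}`, and `∞` if there is no such `n`. -/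
def genus {X : Type*} [NormedAddCommGroup X] (E : Set X) : ℕ∞ :=
  sInf {k : ℕ∞ | ∃ n : ℕ, k = n ∧ ∃ h : X → EuclideanSpace ℝ (Fin n),
    ContinuousOn h E ∧ (∀ x ∈ E, h (-x) = - h x) ∧ ∀ x ∈ E, h x ≠ 0}

/-! ### The penalized and truncated problem -/

/-- The data of the penalized and truncated problem on `ℝ^N`: the exponents and constants, the
potential `V`, the set `M` and the two cut-off functions, with the standing assumptions on the
exponents and cut-offs. The assumptions on `V` and `M` are `V1` and `V2` below. -/
structure PLaplaceData (N : ℕ) where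
  /-- the exponent of the `p`-Laplacian -/
  p : ℝ
  /-- the subcritical exponent -/
  q : ℝ
  /-- the auxiliary exponent of the truncation -/
  r : ℝ
  /-- the coefficient of the subcritical term -/
  μ : ℝ
  /-- the exponent of the penalization -/
  β : ℝ
  /-- the power of `ε` in the penalization -/
  γ : ℝ
  /-- the growth exponent of `ζ` at `0` -/
  a : ℝ
  /-- the potential -/
  V : RN N → ℝ
  /-- the trapping region -/
  M : Set (RN N)
  /-- the truncation cut-off -/
  φ : ℝ → ℝ
  /-- the penalization cut-off -/
  ζ : ℝ → ℝ
  one_lt_p : 1 < p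
  p_lt_N : p < N
  μ_pos : 0 < μ
  lt_r : max p (N * p / (N - p) - 1) < r
  r_lt_q : r < q
  q_lt : q < N * p / (N - p)
  one_lt_β : 1 < β
  β_lt : β < r / p
  β_le : p < 2 → β ≤ 1 / (2 - p)
  a_pos : 0 < a
  γ_gt : max ((p + a) * p / (N - p)) (p ^ 2 * r / ((r - p) * (N - p))) < γ
  φ_smooth : ContDiff ℝ ∞ φ
  φ_one : ∀ s, |s| ≤ 1 → φ s = 1
  φ_zero : ∀ s, 2 ≤ |s| → φ s = 0
  φ_deriv : ∀ s, |deriv φ s| ≤ 2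
  φ_even : ∀ s, φ (-s) = φ s
  φ_anti : AntitoneOn φ (Set.Icc 1 2)
  ζ_C1 : ContDiff ℝ 1 ζ
  ζ_mem : ∀ t, 0 ≤ ζ t ∧ ζ t ≤ 1
  ζ_deriv : ∀ t, 0 ≤ deriv ζ t
  ζ_zero : ∀ t ≤ 0, ζ t = 0
  ζ_pos : ∀ t > 0, 0 < ζ t
  ζ_one : ∀ t ≥ 1, ζ t = 1
  ζ_growth : ∃ C > 0, ∃ ρ > 0, ∀ t ∈ Set.Icc 0 ρ, C * ζ t ≤ t * deriv ζ t ∧ C * t ^ a ≤ ζ t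

namespace PLaplaceData

variable {N : ℕ} (D : PLaplaceData N)

instance : Fact (1 ≤ ENNReal.ofReal D.p) :=
  ⟨by rw [ENNReal.one_le_ofReal]; exact D.one_lt_p.le⟩

/-- `V` is `C¹` and bounded between two positive constants. -/
def V1 : Prop :=
  ContDiff ℝ 1 D.V ∧ ∃ a' b' : ℝ, 0 < a' ∧ a' < b' ∧ ∀ x, a' ≤ D.V x ∧ D.V x ≤ b'

/-- `M` is a bounded domain with smooth boundary, along which the outward normal derivative of `V`
is positive. -/
def V2 : Prop :=
  IsSmoothBoundedDomain D.M ∧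
    ∀ x ∈ frontier D.M, ∀ n, IsOutwardUnitNormal D.M x n → 0 < inner ℝ n (gradient D.V x)

/-- The critical Sobolev exponent `p^* = N p / (N - p)`. -/
def pStar : ℝ := N * D.p / (N - D.p)

/-- The space `W^{1,p}(ℝ^N)`. -/
abbrev W : Type := sobolevSpace N (ENNReal.ofReal D.p)

/-- The function underlying an element of `W^{1,p}`. -/
def val (u : D.W) : RN N → ℝ := u.1.fst

/-- The weak gradient of an element of `W^{1,p}`. -/
def grad (u : D.W) : RN N → RN N := u.1.snd

/-- `b_σ(x,t) = φ(σ e^{dist(σx,M)} t)`. -/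
def b (σ : ℝ) (x : RN N) (t : ℝ) : ℝ :=
  D.φ (σ * Real.exp (Metric.infDist (σ • x) D.M) * t)

/-- `m_σ(x,t) = ∫₀ᵗ b_σ(x,τ) dτ`. -/
def m (σ : ℝ) (x : RN N) (t : ℝ) : ℝ := ∫ τ in (0 : ℝ)..t, D.b σ x τ

/-- `F_σ(x,t) = (1/p^*) |t|^r |m_σ(x,t)|^{p^*-r} + (μ/q) |t|^r |m_σ(x,t)|^{q-r}`. -/
def F (σ : ℝ) (x : RN N) (t : ℝ) : ℝ :=
  1 / D.pStar * |t| ^ D.r * |D.m σ x t| ^ (D.pStar - D.r) +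
    D.μ / D.q * |t| ^ D.r * |D.m σ x t| ^ (D.q - D.r)

/-- The dilated set `M_ε = {x | ε x ∈ M}`. -/
def dilated (ε : ℝ) : Set (RN N) := {x | ε • x ∈ D.M}

open Classical in
/-- `ξ_ε = 0` on `M_ε` and `ξ_ε(x) = ε^{-γ} ζ(dist(x, M_ε))` off `M_ε`. -/
def ξ (ε : ℝ) (x : RN N) : ℝ :=
  if x ∈ D.dilated ε then 0 else ε ^ (-D.γ) * D.ζ (Metric.infDist x (D.dilated ε))

/-- The penalization `Q_ε(u) = (1/(pβ)) (∫ ξ_ε |u|^p - 1)_+^β`. -/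
def penalty (ε : ℝ) (u : D.W) : ℝ :=
  1 / (D.p * D.β) * (max ((∫ x, D.ξ ε x * |D.val u x| ^ D.p) - 1) 0) ^ D.β

/-- The penalized and truncated functional `I_ε` on `W^{1,p}(ℝ^N)`. -/
def I (ε : ℝ) (u : D.W) : ℝ :=
  1 / D.p * (∫ x, (‖D.grad u x‖ ^ D.p + D.V (ε • x) * |D.val u x| ^ D.p)) +
    D.penalty ε u - ∫ x, D.F ε x (D.val u x)

/-- `u` is a critical point of `I_ε`: the Fréchet derivative of `I_ε` at `u` exists and is `0`. -/
def IsCriticalPoint (ε : ℝ) (u : D.W) : Prop :=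
  HasFDerivAt (D.I ε) (0 : D.W →L[ℝ] ℝ) u

/-- The cone `P` of the a.e. nonnegative elements of `W^{1,p}`. -/
def P : Set D.W := {u | ∀ᵐ x, 0 ≤ D.val u x}

/-- `u` changes sign: it is neither a.e. nonnegative nor a.e. nonpositive. -/
def IsSignChanging (u : D.W) : Prop :=
  ¬ (∀ᵐ x, 0 ≤ D.val u x) ∧ ¬ (∀ᵐ x, D.val u x ≤ 0)

/-- The open neighbourhood `P^δ = {u | dist(u, P) < δ}`. -/
def Pδ (δ : ℝ) : Set D.W := {u | Metric.infDist u D.P < δ}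

/-- `Q^δ = -P^δ`. -/
def Qδ (δ : ℝ) : Set D.W := {u | -u ∈ D.Pδ δ}

/-- `O = P^δ ∪ Q^δ`. -/
def O (δ : ℝ) : Set D.W := D.Pδ δ ∪ D.Qδ δ

/-- `Σ = ∂P^δ ∩ ∂Q^δ`. -/
def bdry (δ : ℝ) : Set D.W := frontier (D.Pδ δ) ∩ frontier (D.Qδ δ)

/-- The class `Λ` of admissible odd maps. -/
def Λ (ε δ : ℝ) : Set (D.W → D.W) :=
  {η | Continuous η ∧ (∀ u, η (-u) = - η u) ∧ Set.MapsTo η (D.Pδ δ) (D.Pδ δ) ∧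
    Set.MapsTo η (D.Qδ δ) (D.Qδ δ) ∧ ∀ u, D.I ε u < 0 → η u = u}

/-- The class `Γ_j` of compact symmetric sets `E` with `γ(E ∩ η⁻¹(Σ)) ≥ j` for all `η ∈ Λ`. -/
def Γ (ε δ : ℝ) (j : ℕ) : Set (Set D.W) :=
  {E | IsCompact E ∧ (∀ u, -u ∈ E ↔ u ∈ E) ∧
    ∀ η ∈ D.Λ ε δ, (j : ℕ∞) ≤ genus (E ∩ η ⁻¹' D.bdry δ)}

/-- The minimax level `c_j(ε) = inf_{E ∈ Γ_j} sup_{E ∖ O} I_ε`, as an extended real number. -/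
def level (ε δ : ℝ) (j : ℕ) : EReal :=
  ⨅ E ∈ D.Γ ε δ j, ⨆ u ∈ E \ D.O δ, ((D.I ε u : ℝ) : EReal)

/-- `K_c^*`: the critical points of `I_ε` at level `c` that lie outside `O`. -/
def Kstar (ε δ c : ℝ) : Set D.W :=
  {u | D.IsCriticalPoint ε u ∧ D.I ε u = c} \ D.O δ

end PLaplaceData

end

set_option linter.unusedSectionVars false

/-! Write `I ε = J - Φ`, where `J` collects the gradient, potential and penalty terms and `Φ u = ∫ F
ε x u`. The truncation scale grows exponentially with the distance to `M`. Hence `|∂F/∂t| ≤ C k(x)^r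
|t|^(r-1)` with a positive continuous weight `k` that vanishes at infinity (`abs_f_le`,
`tendsto_decay`). As `p < r < p^*`, multiplication by `k` is compact from `W^{1,p}` to `L^r`
(`exists_compact_embedding`), and `Φ'` factors through it. This restores the compactness missing on
the whole space.

The energy `J` is uniformly convex at the scale `‖u‖^p`. So `J - Φ'(u)` has a unique minimizer `A
u`, odd and continuous in `u`, and by convexity the fixed points of `A` are exactly the critical
points (`isCritical_iff`). The nonnegative gap `G u = J u - J (A u) - Φ'(u)(u - A u)` plays the role
of the norm of the derivative: a small step from `u` towards `A u` lowers the functional at a rate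
close to `G u` (`descent`). Testing minimality of `A u` with `(1 + s) u`, where `pβ < r` is
decisive, bounds `‖u‖^p` by the gap (`coercive_gap`). Uniform convexity and compactness then give a
Palais-Smale property (`palaisSmale`).

Signs enter through two estimates for small `δ`, both resting on `p < r`. Comparing `A u` with its
positive part shows that `A` preserves the neighbourhood of the cone
(`exists_infDist_lt_of_minimizer`). On the common boundary `Σ` the functional has a positive lower
bound, since the norm is at least `δ` while the `L^r` norms of both parts are at most a multiple of
`δ` (`exists_pos_on_boundary`).

The minimax argument is abstract. Iterating short steps towards `A u` deforms sets without an
ordinary differential equation (`deformation`), and subadditivity of the genus turns coinciding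
levels into large critical sets (`add_one_le_genus`). Finitely many critical points would force two
consecutive levels to coincide; the critical set there would have genus at least 2, while a finite
set avoiding the origin has genus at most 1 (`infinite_critical`). The classes are nonempty because
a large ball of a suitable `(j + 1)`-dimensional space belongs to `Γ_j` (`mem_Gam_of_linear`). That
step is Borsuk's theorem (`exists_zero_of_odd`), derived here from a Tucker lemma for the
Freudenthal triangulation with chains modulo 2 (`exists_complementary`).

The upper bounds are uniform in `ε` because the test space consists of bumps of fixed radius around
`x₀ / ε` inside the dilated set, where the penalty vanishes and the truncation does not act below
height 1 (`exists_mem_Gam`). -/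

noncomputable section

/-! ### Mod 2 simplicial chains -/

namespace ModTwoChain

variable {V : Type*} [DecidableEq V]

/-- Simplicial chains with coefficients in `ℤ/2`, in the augmented complex of all finite sets. -/
abbrev Chain (V : Type*) := Finset V →₀ ZMod 2

/-- The boundary operator. -/
def bd : Chain V →ₗ[ZMod 2] Chain V :=
  Finsupp.linearCombination (ZMod 2) fun σ => ∑ v ∈ σ, Finsupp.single (σ.erase v) 1

theorem bd_single (σ : Finset V) :
    bd (Finsupp.single σ 1) = ∑ v ∈ σ, Finsupp.single (σ.erase v) (1 : ZMod 2) := by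
  simp [bd]

theorem add_self_eq_zero_chain (c : Chain V) : c + c = 0 := by
  ext σ
  simpa using CharTwo.add_self_eq_zero (c σ)

/-- Deleting `v` then `w` gives the same face as deleting `w` then `v`; the involution swapping the
two vertices cancels the terms in pairs modulo 2. -/
theorem bd_bd (c : Chain V) : bd (bd c) = 0 := by
  induction c using Finsupp.induction_linear with
  | zero => simp
  | add f g hf hg => rw [map_add, map_add, hf, hg, add_zero]
  | single σ a =>
    have : (Finsupp.single σ a : Chain V) = a • Finsupp.single σ 1 := by simp
    rw [this, map_smul, map_smul, bd_single, map_sum]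
    suffices h : ∑ v ∈ σ, bd (Finsupp.single (σ.erase v) (1 : ZMod 2)) = 0 by rw [h, smul_zero]
    simp only [bd_single]
    rw [Finset.sum_sigma']
    refine Finset.sum_involution (fun a _ => ⟨a.2, a.1⟩) ?_ ?_ ?_ ?_
    · rintro ⟨v, w⟩ _
      simp only
      rw [Finset.erase_right_comm]
      exact add_self_eq_zero_chain _
    · rintro ⟨v, w⟩ h _ he
      simp only [Finset.mem_sigma, Finset.mem_erase] at h
      simp only [Sigma.mk.injEq] at he
      exact h.2.1 he.1
    · rintro ⟨v, w⟩ h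
      simp only [Finset.mem_sigma, Finset.mem_erase] at h ⊢
      exact ⟨h.2.2, fun e => h.2.1 e.symm, h.1⟩
    · rintro ⟨v, w⟩ _
      rfl

/-- The chain of a finite set of simplices. -/
def chi (A : Finset (Finset V)) : Chain V := ∑ σ ∈ A, Finsupp.single σ 1

theorem chi_apply (A : Finset (Finset V)) (σ : Finset V) :
    chi A σ = if σ ∈ A then 1 else 0 := by
  simp [chi, Finsupp.finsetSum_apply, Finsupp.single_apply]

/-- A pair `(σ, v)` with `σ.erase v = τ` is determined by `v`, so the coefficient counts the cofaces
of `τ` in `A`. The set `B` is only a finite place to look for the extra vertex. -/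
theorem bd_chi_apply (A : Finset (Finset V)) (τ : Finset V) (B : Finset V)
    (hB : ∀ σ ∈ A, σ ⊆ B) :
    bd (chi A) τ = ((B.filter fun w => w ∉ τ ∧ insert w τ ∈ A).card : ZMod 2) := by
  have h1 : bd (chi A) τ =
      ∑ σ ∈ A, ∑ v ∈ σ, if σ.erase v = τ then (1 : ZMod 2) else 0 := by
    simp [chi, map_sum, bd_single, Finsupp.finsetSum_apply, Finsupp.single_apply]
  rw [h1, Finset.sum_sigma', Finset.card_eq_sum_ones, Nat.cast_sum, ← Finset.sum_filter]
  simp only [Nat.cast_one]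
  refine Finset.sum_bij' (fun a _ => a.2) (fun w _ => ⟨insert w τ, w⟩) ?_ ?_ ?_ ?_ ?_
  · rintro ⟨σ, v⟩ h
    simp only [Finset.mem_filter, Finset.mem_sigma] at h ⊢
    obtain ⟨⟨h1, h2⟩, h3⟩ := h
    refine ⟨hB σ h1 h2, ?_, ?_⟩
    · rw [← h3]; simp
    · rw [← h3, Finset.insert_erase h2]; exact h1
  · intro w h
    simp only [Finset.mem_filter, Finset.mem_sigma] at h ⊢
    exact ⟨⟨h.2.2, Finset.mem_insert_self _ _⟩, Finset.erase_insert h.2.1⟩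
  · rintro ⟨σ, v⟩ h
    simp only [Finset.mem_filter, Finset.mem_sigma] at h
    obtain ⟨⟨h1, h2⟩, h3⟩ := h
    simp only [← h3, Finset.insert_erase h2]
  · intro w _; rfl
  · intro a _; rfl

/-! ### Alternating labellings -/

variable (lab : V → ℤ)

/-- Whether `v` is the strict minimum of `|lab|` on `τ`. -/
def IsStrictMin (τ : Finset V) (v : V) : Prop := v ∈ τ ∧ ∀ w ∈ τ, w ≠ v → |lab v| < |lab w|

open Classical in
/-- The indicator of the simplices with `k` vertices whose labels have strictly increasing absolute
values and alternating signs, starting with the sign `s`. -/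
def alt : ℕ → ℤ → Finset V → ZMod 2
  | 0, _, _ => 1
  | k + 1, s, τ => ∑ v ∈ τ, if (lab v).sign = s ∧ IsStrictMin lab τ v then alt k (-s) (τ.erase v)
      else 0

variable {lab}

theorem alt_of_strictMin {k : ℕ} {s : ℤ} {τ : Finset V} {v : V} (h : IsStrictMin lab τ v) :
    alt lab (k + 1) s τ = if (lab v).sign = s then alt lab k (-s) (τ.erase v) else 0 := by
  classical
  rw [alt, Finset.sum_eq_single v]
  · simp [h]
  · intro w hw hwv
    rw [if_neg]
    rintro ⟨_, h2⟩
    exact absurd (h.2 w hw hwv) (not_lt.2 (h2.2 v h.1 hwv.symm).le)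
  · exact fun hv => absurd h.1 hv

theorem alt_of_not_strictMin {k : ℕ} {s : ℤ} {τ : Finset V} (h : ∀ v, ¬ IsStrictMin lab τ v) :
    alt lab (k + 1) s τ = 0 := by
  classical
  rw [alt]
  exact Finset.sum_eq_zero fun v _ => if_neg fun h' => h v h'.2

variable (lab) in
/-- A simplex without zero label and without complementary edge. -/
def Good (τ : Finset V) : Prop :=
  (∀ v ∈ τ, lab v ≠ 0) ∧ ∀ v ∈ τ, ∀ w ∈ τ, lab v ≠ - lab w

theorem Good.mono {τ τ' : Finset V} (h : Good lab τ) (hs : τ' ⊆ τ) : Good lab τ' :=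
  ⟨fun v hv => h.1 v (hs hv), fun v hv w hw => h.2 v (hs hv) w (hs hw)⟩

/-- The combinatorial core of the Tucker lemma, by induction on removing the strict minimum `v` of
`|lab|`: the facets that keep `v` are governed by the facets of the remaining simplex. If there is
no strict minimum, two vertices share the least absolute value, hence the same label since
complementary edges are excluded. Deleting either of the two gives equal contributions, which cancel
modulo 2. -/
theorem sum_alt_erase {k : ℕ} {τ : Finset V} (hc : τ.card = k + 1) (hg : Good lab τ) {s : ℤ}
    (hs : s = 1 ∨ s = -1) :
    ∑ v ∈ τ, alt lab k s (τ.erase v) = alt lab (k + 1) s τ + alt lab (k + 1) (-s) τ := by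
  classical
  induction k generalizing τ s with
  | zero =>
    obtain ⟨v, rfl⟩ := Finset.card_eq_one.1 hc
    have hv : IsStrictMin lab {v} v := ⟨by simp, by simp⟩
    have h0 : lab v ≠ 0 := hg.1 v (by simp)
    rw [alt_of_strictMin hv, alt_of_strictMin hv]
    simp only [alt, Finset.sum_singleton]
    rcases hs with rfl | rfl <;> rcases lt_or_gt_of_ne h0 with h | h <;>
      simp [Int.sign_eq_neg_one_of_neg, Int.sign_eq_one_of_pos, h]
  | succ k ih =>
    by_cases hmin : ∃ v, IsStrictMin lab τ v
    · obtain ⟨v, hv⟩ := hmin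
      have h0 : lab v ≠ 0 := hg.1 v hv.1
      have hc' : (τ.erase v).card = k + 1 := by rw [Finset.card_erase_of_mem hv.1, hc]; rfl
      have hg' : Good lab (τ.erase v) := hg.mono (Finset.erase_subset _ _)
      have key : ∑ w ∈ τ.erase v, alt lab (k + 1) s (τ.erase w) =
          if (lab v).sign = s then alt lab (k + 1) (-s) (τ.erase v) + alt lab (k + 1) s (τ.erase v)
            else 0 := by
        have h1 : ∀ w ∈ τ.erase v, alt lab (k + 1) s (τ.erase w) =
            if (lab v).sign = s then alt lab k (-s) ((τ.erase v).erase w) else 0 := by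
          intro w hw
          have hwv : w ≠ v := (Finset.mem_erase.1 hw).1
          rw [alt_of_strictMin (v := v), Finset.erase_right_comm]
          exact ⟨Finset.mem_erase.2 ⟨hwv.symm, hv.1⟩, fun u hu => hv.2 u (Finset.mem_of_mem_erase hu)⟩
        rw [Finset.sum_congr rfl h1]
        split_ifs with hsg
        · rw [ih hc' hg' (s := -s) (by rcases hs with rfl | rfl <;> simp), neg_neg]
        · simp
      rw [← Finset.add_sum_erase _ _ hv.1, key, alt_of_strictMin hv, alt_of_strictMin hv]
      rcases hs with rfl | rfl <;> rcases lt_or_gt_of_ne h0 with h | h <;>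
        simp [Int.sign_eq_neg_one_of_neg, Int.sign_eq_one_of_pos, h]
      all_goals
        rw [add_comm (alt lab (k + 1) _ _) (alt lab (k + 1) _ _ + _), add_assoc,
          CharTwo.add_self_eq_zero, add_zero]
    · push Not at hmin
      rw [alt_of_not_strictMin hmin, alt_of_not_strictMin hmin, add_zero]
      obtain ⟨v, hv, hvmin⟩ := Finset.exists_min_image τ (fun v => |lab v|)
        (Finset.card_pos.1 (by omega))
      have hv' := hmin v
      simp only [IsStrictMin, not_and, not_forall, not_lt] at hv'
      obtain ⟨w, hw, hwv, hle⟩ := hv' hv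
      have heq : |lab w| = |lab v| := le_antisymm hle (hvmin w hw)
      have hlab : lab w = lab v := by
        rcases abs_eq_abs.1 heq with h | h
        · exact h
        · exact absurd h (hg.2 w hw v hv)
      have hother : ∀ u ∈ τ, u ≠ v → u ≠ w → alt lab (k + 1) s (τ.erase u) = 0 := by
        intro u hu huv huw
        refine alt_of_not_strictMin fun x hx => ?_
        obtain ⟨hx1, hx2⟩ := hx
        rw [Finset.mem_erase] at hx1
        rcases eq_or_ne x v with rfl | hxv
        · have := hx2 w (Finset.mem_erase.2 ⟨huw.symm, hw⟩) hwv
          omega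
        · have := hx2 v (Finset.mem_erase.2 ⟨huv.symm, hv⟩) hxv.symm
          have := hvmin x hx1.2
          omega
      -- If a third vertex attains the minimum, neither facet has a strict minimum. Otherwise each
      -- has one, with the same label and the same remaining vertices.
      have hpair : alt lab (k + 1) s (τ.erase v) = alt lab (k + 1) s (τ.erase w) := by
        by_cases h3 : ∃ u ∈ τ, u ≠ v ∧ u ≠ w ∧ |lab u| = |lab v|
        · obtain ⟨u, hu, huv, huw, hl⟩ := h3
          rw [alt_of_not_strictMin, alt_of_not_strictMin]
          · rintro x ⟨hx1, hx2⟩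
            rw [Finset.mem_erase] at hx1
            rcases eq_or_ne x v with rfl | hxv
            · have := hx2 u (Finset.mem_erase.2 ⟨huw, hu⟩) huv
              omega
            · have := hx2 v (Finset.mem_erase.2 ⟨hwv.symm, hv⟩) hxv.symm
              have := hvmin x hx1.2
              omega
          · rintro x ⟨hx1, hx2⟩
            rw [Finset.mem_erase] at hx1
            rcases eq_or_ne x w with rfl | hxv
            · have := hx2 u (Finset.mem_erase.2 ⟨huv, hu⟩) huw
              omega
            · have := hx2 w (Finset.mem_erase.2 ⟨hwv, hw⟩) hxv.symm
              have := hvmin x hx1.2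
              omega
        · push Not at h3
          have hm1 : IsStrictMin lab (τ.erase v) w := by
            refine ⟨Finset.mem_erase.2 ⟨hwv, hw⟩, fun u hu huw => ?_⟩
            rw [Finset.mem_erase] at hu
            have := hvmin u hu.2
            have := h3 u hu.2 hu.1 huw
            omega
          have hm2 : IsStrictMin lab (τ.erase w) v := by
            refine ⟨Finset.mem_erase.2 ⟨hwv.symm, hv⟩, fun u hu huw => ?_⟩
            rw [Finset.mem_erase] at hu
            have := hvmin u hu.2
            have := h3 u hu.2 huw hu.1
            omega
          rw [alt_of_strictMin hm1, alt_of_strictMin hm2, hlab, Finset.erase_right_comm]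
      rw [← Finset.add_sum_erase _ _ hv, ← Finset.add_sum_erase _ _ (Finset.mem_erase.2 ⟨hwv, hw⟩),
        Finset.sum_eq_zero, add_zero, hpair, CharTwo.add_self_eq_zero]
      intro u hu
      simp only [Finset.mem_erase] at hu
      exact hother u hu.2.2 hu.2.1 hu.1

/-- Strict minima are peeled off one at a time, so the absolute values are distinct. This excludes
alternating simplices with more vertices than there are available absolute values. -/
theorem card_image_abs_of_alt_ne_zero {k : ℕ} {s : ℤ} {τ : Finset V} (hc : τ.card = k)
    (h : alt lab k s τ ≠ 0) : (τ.image fun v => |lab v|).card = k := by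
  classical
  induction k generalizing τ s with
  | zero => simp [Finset.card_eq_zero.1 hc]
  | succ k ih =>
    by_cases hmin : ∃ v, IsStrictMin lab τ v
    · obtain ⟨v, hv⟩ := hmin
      rw [alt_of_strictMin hv] at h
      have hc' : (τ.erase v).card = k := by rw [Finset.card_erase_of_mem hv.1, hc]; rfl
      split_ifs at h
      · have := ih hc' h
        rw [← Finset.insert_erase hv.1, Finset.image_insert, Finset.card_insert_of_notMem, this]
        intro hmem
        obtain ⟨w, hw, hwe⟩ := Finset.mem_image.1 hmem
        have := hv.2 w (Finset.mem_of_mem_erase hw) (Finset.mem_erase.1 hw).1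
        omega
      · exact absurd rfl h
    · push Not at hmin
      exact absurd (alt_of_not_strictMin hmin) h

variable (lab) in
/-- The number modulo 2 of alternating simplices of a chain with first sign `s`. -/
def altSum (s : ℤ) : Chain V →ₗ[ZMod 2] ZMod 2 :=
  Finsupp.linearCombination (ZMod 2) fun σ => alt lab σ.card s σ

/-- Linear extension of `sum_alt_erase` to chains of good simplices. -/
theorem altSum_bd {s : ℤ} (hs : s = 1 ∨ s = -1) (c : Chain V)
    (hc : ∀ τ ∈ c.support, τ.Nonempty ∧ Good lab τ) :
    altSum lab s (bd c) = altSum lab s c + altSum lab (-s) c := by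
  have h : ∀ τ ∈ c.support, altSum lab s (bd (Finsupp.single τ 1)) =
      altSum lab s (Finsupp.single τ 1) + altSum lab (-s) (Finsupp.single τ 1) := by
    intro τ hτ
    obtain ⟨hne, hg⟩ := hc τ hτ
    obtain ⟨k, hk⟩ : ∃ k, τ.card = k + 1 := ⟨τ.card - 1, by have := hne.card_pos; omega⟩
    rw [bd_single, map_sum]
    simp only [altSum, Finsupp.linearCombination_single, one_smul]
    rw [hk, ← sum_alt_erase hk hg hs]
    refine Finset.sum_congr rfl fun v hv => ?_
    rw [Finset.card_erase_of_mem hv, hk]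
    rfl
  have hrep : c = ∑ τ ∈ c.support, c τ • (Finsupp.single τ (1 : ZMod 2)) := by
    conv_lhs => rw [← Finsupp.sum_single c]
    simp [Finsupp.sum]
  rw [hrep]
  simp only [map_sum, map_smul, ← Finset.sum_add_distrib, ← smul_add]
  exact Finset.sum_congr rfl fun τ hτ => by rw [h τ hτ]

end ModTwoChain

end

noncomputable section

/-! ### The Freudenthal triangulation of `ℝ^n` -/

namespace Freudenthal

open ModTwoChain

variable {n : ℕ}

/-- Two lattice points span an edge of the Freudenthal triangulation. -/
def Adj (v w : Fin n → ℤ) : Prop := (v ≤ w ∧ w ≤ v + 1) ∨ (w ≤ v ∧ v ≤ w + 1)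

theorem Adj.symm {v w : Fin n → ℤ} (h : Adj v w) : Adj w v := Or.symm h

theorem Adj.refl (v : Fin n → ℤ) : Adj v v := Or.inl ⟨le_rfl, fun i => by simp⟩

theorem Adj.neg {v w : Fin n → ℤ} (h : Adj v w) : Adj (-v) (-w) := by
  rcases h with ⟨h1, h2⟩ | ⟨h1, h2⟩
  · exact Or.inr ⟨fun i => neg_le_neg (h1 i), fun i => by
      have := h2 i; simp only [Pi.add_apply, Pi.one_apply, Pi.neg_apply] at *; omega⟩
  · exact Or.inl ⟨fun i => neg_le_neg (h1 i), fun i => by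
      have := h2 i; simp only [Pi.add_apply, Pi.one_apply, Pi.neg_apply] at *; omega⟩

theorem Adj.abs_sub_le {v w : Fin n → ℤ} (h : Adj v w) (i : Fin n) : |v i - w i| ≤ 1 := by
  rw [abs_le]
  rcases h with ⟨h1, h2⟩ | ⟨h1, h2⟩ <;>
  · have := h1 i
    have := h2 i
    simp only [Pi.add_apply, Pi.one_apply] at *
    omega

/-- A finite set of lattice points is a simplex of the Freudenthal triangulation. -/
def IsSimplex (σ : Finset (Fin n → ℤ)) : Prop := ∀ v ∈ σ, ∀ w ∈ σ, Adj v w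

/-- The coordinate subspace spanned by the first `k` coordinates. -/
def Flat (k : ℕ) (v : Fin n → ℤ) : Prop := ∀ i : Fin n, k ≤ i → v i = 0

/-- The sum of the coordinates. -/
def csum (v : Fin n → ℤ) : ℤ := ∑ i, v i

theorem csum_le {v w : Fin n → ℤ} (h : v ≤ w) : csum v ≤ csum w :=
  Finset.sum_le_sum fun i _ => h i

/-- The coordinate sum is strictly monotone. It serves as a height that separates the vertices of a
simplex, which form a chain in the product order. -/
theorem eq_of_csum_eq {v w : Fin n → ℤ} (h : v ≤ w) (hs : csum v = csum w) : v = w := by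
  funext i
  exact (Finset.sum_eq_sum_iff_of_le fun i _ => h i).1 hs i (Finset.mem_univ i)

theorem eq_of_le_of_csum_le {v w : Fin n → ℤ} (h : v ≤ w) (hs : csum w ≤ csum v) : v = w :=
  eq_of_csum_eq h (le_antisymm (csum_le h) hs)

theorem csum_add (v w : Fin n → ℤ) : csum (v + w) = csum v + csum w := Finset.sum_add_distrib

theorem csum_sub (v w : Fin n → ℤ) : csum (v - w) = csum v - csum w := Finset.sum_sub_distrib _ _

theorem csum_single (j : Fin n) : csum (Pi.single j 1) = 1 := by
  simp [csum]

/-- The indicator of the first `k` coordinates. -/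
def ones (k : ℕ) : Fin n → ℤ := fun i => if (i : ℕ) < k then 1 else 0

theorem csum_ones {k : ℕ} (hk : k ≤ n) : csum (ones k : Fin n → ℤ) = k := by
  simp only [csum, ones, Finset.sum_boole]
  have : (Finset.univ.filter fun i : Fin n => (i : ℕ) < k).card = k := by
    rw [Fin.card_filter_val_lt]; omega
  exact_mod_cast this

theorem ones_le_one (k : ℕ) : (ones k : Fin n → ℤ) ≤ 1 := fun i => by
  simp only [ones, Pi.one_apply]; split_ifs <;> omega

theorem le_add_ones {k : ℕ} {v w : Fin n → ℤ} (hv : Flat k v) (hw : Flat k w) (h : w ≤ v + 1) :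
    w ≤ v + ones k := fun i => by
  have := h i
  simp only [Pi.add_apply, Pi.one_apply, ones] at *
  split_ifs with hi
  · exact this
  · rw [hv i (by omega), hw i (by omega)]; simp

theorem eq_single_of_csum_eq_one {z : Fin n → ℤ} (h0 : 0 ≤ z) (h1 : csum z = 1) :
    ∃ j, z = Pi.single j 1 := by
  obtain ⟨j, hj⟩ : ∃ j, z j ≠ 0 := by
    by_contra! h
    rw [csum, Finset.sum_eq_zero fun i _ => h i] at h1
    omega
  refine ⟨j, (eq_of_csum_eq (fun i => ?_) (by rw [csum_single, h1])).symm⟩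
  have h0i := h0 i
  have h0j := h0 j
  simp only [Pi.zero_apply] at h0i h0j
  by_cases hij : i = j
  · subst hij
    have : (1 : ℤ) ≤ z i := by omega
    simpa using this
  · rw [Pi.single_eq_of_ne hij]; exact h0i

theorem eq_single_add_single_of_csum_eq_two {z : Fin n → ℤ} (h0 : 0 ≤ z) (h1 : z ≤ 1)
    (h2 : csum z = 2) : ∃ j l, j ≠ l ∧ z = Pi.single j 1 + Pi.single l 1 := by
  obtain ⟨j, hj⟩ : ∃ j, z j ≠ 0 := by
    by_contra! h
    rw [csum, Finset.sum_eq_zero fun i _ => h i] at h2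
    omega
  have hj1 : z j = 1 := by
    have h0j := h0 j
    have h1j := h1 j
    simp only [Pi.zero_apply, Pi.one_apply] at h0j h1j
    omega
  obtain ⟨l, hl⟩ := eq_single_of_csum_eq_one (z := z - Pi.single j 1) (fun i => by
    have h0i := h0 i
    by_cases hij : i = j
    · subst hij; simp [hj1]
    · simpa [Pi.single_eq_of_ne hij] using h0i) (by rw [csum_sub, csum_single, h2]; rfl)
  refine ⟨j, l, ?_, by rw [← hl]; simp⟩
  rintro rfl
  have := congrFun hl j
  simp [hj1] at this

/-- A codimension one simplex has exactly two cofaces. -/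
theorem exists_cofaces {k : ℕ} (hk : k < n) {τ : Finset (Fin n → ℤ)} (hτ : IsSimplex τ)
    (hc : τ.card = k + 1) (hf : ∀ v ∈ τ, Flat (k + 1) v) (hp : ∀ v ∈ τ, 0 ≤ v ⟨k, hk⟩) :
    ∃ w₁ w₂ : Fin n → ℤ, w₁ ≠ w₂ ∧
      (∀ w, (Flat (k + 1) w ∧ w ∉ τ ∧ ∀ v ∈ τ, Adj w v) ↔ w = w₁ ∨ w = w₂) ∧
      ((∀ v ∈ τ, v ⟨k, hk⟩ = 0) → w₁ ⟨k, hk⟩ = 1 ∧ w₂ ⟨k, hk⟩ = -1) ∧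
      ((∃ v ∈ τ, v ⟨k, hk⟩ ≠ 0) → 0 ≤ w₁ ⟨k, hk⟩ ∧ 0 ≤ w₂ ⟨k, hk⟩) := by
  have hne : τ.Nonempty := Finset.card_pos.1 (by omega)
  have hcomp : ∀ v w : Fin n → ℤ, Adj v w → csum v ≤ csum w → v ≤ w ∧ w ≤ v + 1 := by
    intro v w hvw hs
    rcases hvw with h | h
    · exact h
    · have := eq_of_le_of_csum_le h.1 hs
      subst this
      exact ⟨le_rfl, fun i => by simp⟩
  obtain ⟨v0, hv0, hmin⟩ := Finset.exists_min_image τ csum hne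
  obtain ⟨u, hu, hmax⟩ := Finset.exists_max_image τ csum hne
  have hinj : Set.InjOn csum (τ : Set (Fin n → ℤ)) := by
    intro v hv w hw h
    exact eq_of_csum_eq (hcomp v w (hτ v hv w hw) h.le).1 h
  have hv0le : ∀ v ∈ τ, v0 ≤ v ∧ v ≤ v0 + 1 := fun v hv => hcomp v0 v (hτ v0 hv0 v hv) (hmin v hv)
  have hleu : ∀ v ∈ τ, v ≤ u ∧ u ≤ v + 1 := fun v hv => hcomp v u (hτ v hv u hu) (hmax v hv)
  have huv0 : u ≤ v0 + ones (k + 1) := le_add_ones (hf v0 hv0) (hf u hu) (hv0le u hu).2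
  set a := csum v0 with ha
  have hones : csum (ones (k + 1) : Fin n → ℤ) = k + 1 := by
    rw [csum_ones (by omega)]; push_cast; rfl
  have hsu : csum u ≤ a + (k + 1) := by
    have := csum_le huv0
    rwa [csum_add, hones] at this
  have hsub : τ.image csum ⊆ Finset.Icc a (a + (k + 1)) := by
    intro s hs
    obtain ⟨v, hv, rfl⟩ := Finset.mem_image.1 hs
    exact Finset.mem_Icc.2 ⟨hmin v hv, (hmax v hv).trans hsu⟩
  -- The `k + 1` vertices have distinct heights among `k + 2` consecutive integers, so exactly one
  -- height `m` is missing. The two cofaces are found according to whether `m` is the top height or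
  -- an intermediate one.
  have hcard : (Finset.Icc a (a + (k + 1)) \ τ.image csum).card = 1 := by
    rw [Finset.card_sdiff_of_subset hsub, Finset.card_image_of_injOn hinj, hc, Int.card_Icc]
    omega
  obtain ⟨m, hm⟩ := Finset.card_eq_one.1 hcard
  have hm1 : a ≤ m ∧ m ≤ a + (k + 1) ∧ ∀ v ∈ τ, csum v ≠ m := by
    have : m ∈ Finset.Icc a (a + (k + 1)) \ τ.image csum := by rw [hm]; simp
    rw [Finset.mem_sdiff, Finset.mem_Icc] at this
    exact ⟨this.1.1, this.1.2, fun v hv h => this.2 (Finset.mem_image.2 ⟨v, hv, h⟩)⟩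
  have hatt : ∀ s, a ≤ s → s ≤ a + (k + 1) → s ≠ m → ∃ v ∈ τ, csum v = s := by
    intro s h1 h2 h3
    by_contra! h
    have : s ∈ Finset.Icc a (a + (k + 1)) \ τ.image csum := by
      rw [Finset.mem_sdiff, Finset.mem_Icc]
      refine ⟨⟨h1, h2⟩, fun hs => ?_⟩
      obtain ⟨v, hv, hvs⟩ := Finset.mem_image.1 hs
      exact h v hv hvs
    rw [hm, Finset.mem_singleton] at this
    exact h3 this
  have hma : m ≠ a := fun h => hm1.2.2 v0 hv0 h.symm
  have hnotsum : ∀ w, w ∉ τ → (∀ v ∈ τ, Adj w v) → ∀ v ∈ τ, csum v ≠ csum w := by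
    intro w hw hadj v hv h
    exact hw (eq_of_csum_eq (hcomp w v (hadj v hv) h.ge).1 h.symm ▸ hv)
  by_cases hmtop : m = a + (k + 1)
  · have hsu' : csum u = a + k := by
      obtain ⟨v, hv, hvs⟩ := hatt (a + k) (by omega) (by omega) (by omega)
      have h1 := hmax v hv
      have h2 := hm1.2.2 u hu
      omega
    -- With the top height missing, `v0 + ones (k + 1)` exceeds `u` by one unit vector `e_j`. The
    -- new vertex is either `u + e_j` above the chain or `v0 - e_j` below it.
    obtain ⟨j, hj⟩ := eq_single_of_csum_eq_one (z := v0 + ones (k + 1) - u)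
      (sub_nonneg.2 huv0) (by rw [csum_sub, csum_add, hones]; omega)
    have hjk : (j : ℕ) < k + 1 := by
      by_contra hcon
      have h1 := congrFun hj j
      simp only [Pi.sub_apply, Pi.add_apply, ones, if_neg hcon, Pi.single_eq_same,
        hf v0 hv0 j (by omega), hf u hu j (by omega)] at h1
      omega
    have hflat : Flat (k + 1) (Pi.single j 1 : Fin n → ℤ) := fun i hi =>
      Pi.single_eq_of_ne (fun h => by rw [h] at hi; omega) _
    have hw1 : u + Pi.single j 1 = v0 + ones (k + 1) := by rw [← hj]; abel
    have hw2 : v0 - Pi.single j 1 + ones (k + 1) = u := by rw [← hj]; abel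
    have hs0 : (0 : Fin n → ℤ) ≤ Pi.single j 1 := Pi.single_nonneg.2 zero_le_one
    refine ⟨u + Pi.single j 1, v0 - Pi.single j 1, ?_, ?_, ?_, ?_⟩
    · intro h
      have := congrArg csum h
      rw [csum_add, csum_sub, csum_single] at this
      omega
    · intro w
      constructor
      · rintro ⟨hwf, hwτ, hadj⟩
        have hns := hnotsum w hwτ hadj
        rcases lt_or_ge (csum w) a with h | h
        · right
          have h1 := (hcomp w u (hadj u hu) (by omega)).2
          have h2 := le_add_ones hwf (hf u hu) h1
          rw [← hw2] at h2
          have h3 : v0 - Pi.single j 1 ≤ w := fun i => by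
            have := h2 i; simp only [Pi.add_apply, Pi.sub_apply] at *; omega
          exact (eq_of_le_of_csum_le h3 (by rw [csum_sub, csum_single]; omega)).symm
        · rcases le_or_gt (csum w) (a + k) with h' | h'
          · obtain ⟨v, hv, hvs⟩ := hatt (csum w) h (by omega) (by omega)
            exact absurd hvs (hns v hv)
          · left
            have h1 := (hcomp v0 w (hadj v0 hv0).symm h).2
            have h2 := le_add_ones (hf v0 hv0) hwf h1
            rw [← hw1] at h2
            exact eq_of_le_of_csum_le h2 (by rw [csum_add, csum_single]; omega)
      · rintro (rfl | rfl)
        · refine ⟨fun i hi => by simp [hf u hu i hi, hflat i hi], fun h => ?_, fun v hv => ?_⟩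
          · have := hmax _ h
            rw [csum_add, csum_single] at this
            omega
          · refine Or.inr ⟨(hleu v hv).1.trans (le_add_of_nonneg_right hs0), ?_⟩
            rw [hw1]
            exact add_le_add (hv0le v hv).1 (ones_le_one _)
        · refine ⟨fun i hi => by simp [hf v0 hv0 i hi, hflat i hi], fun h => ?_, fun v hv => ?_⟩
          · have := hmin _ h
            rw [csum_sub, csum_single] at this
            omega
          · refine Or.inl ⟨(sub_le_self _ hs0).trans (hv0le v hv).1, (hleu v hv).1.trans ?_⟩
            conv_lhs => rw [← hw2]
            gcongr
            exact ones_le_one _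
    · intro h0
      -- If `τ` lies in the hyperplane, the missing direction must be the `k`-th one, so the two
      -- cofaces lie on opposite sides.
      have hjk' : j = ⟨k, hk⟩ := by
        by_contra hcon
        have := congrFun hj ⟨k, hk⟩
        rw [Pi.single_eq_of_ne (Ne.symm hcon)] at this
        simp [ones, h0 v0 hv0, h0 u hu] at this
      rw [← hjk'] at h0 ⊢
      simp [h0 v0 hv0, h0 u hu]
    · rintro ⟨v, hv, hvne⟩
      have h1 := hp v hv
      have h2 := (hleu v hv).1 ⟨k, hk⟩
      have h3 := hp v0 hv0
      have h4 := hs0 ⟨k, hk⟩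
      refine ⟨?_, ?_⟩
      · simp only [Pi.add_apply, Pi.zero_apply] at *
        omega
      · have h5 := congrFun hw2 ⟨k, hk⟩
        simp only [Pi.add_apply, Pi.zero_apply, Pi.sub_apply, ones, Nat.lt_succ_self, if_true] at *
        omega
  · obtain ⟨v', hv', hs'⟩ := hatt (m - 1) (by omega) (by omega) (by omega)
    obtain ⟨v'', hv'', hs''⟩ := hatt (m + 1) (by omega) (by omega) (by omega)
    obtain ⟨ht, htu, hts⟩ := hatt (a + (k + 1)) (by omega) le_rfl (Ne.symm hmtop)
    have hsu' : csum u = a + (k + 1) := le_antisymm hsu (hts ▸ hmax _ htu)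
    have huv : u = v0 + ones (k + 1) := eq_of_csum_eq huv0 (by rw [csum_add, hones]; exact hsu')
    have hlt := hcomp v' v'' (hτ v' hv' v'' hv'') (by omega)
    -- An intermediate height is missing: its neighbours differ by two unit vectors, which can be
    -- added in either order. This gives the two new vertices.
    obtain ⟨j, l, hjl, hz⟩ := eq_single_add_single_of_csum_eq_two (z := v'' - v')
      (sub_nonneg.2 hlt.1) (sub_le_iff_le_add'.2 hlt.2) (by rw [csum_sub]; omega)
    have hflat : ∀ t, (v'' - v') t ≠ 0 → Flat (k + 1) (Pi.single t 1 : Fin n → ℤ) := by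
      intro t ht i hi
      refine Pi.single_eq_of_ne (fun h => ht ?_) _
      subst h
      simp [hf v'' hv'' i hi, hf v' hv' i hi]
    have key : ∀ t t', t ≠ t' → v'' - v' = Pi.single t 1 + Pi.single t' 1 →
        Flat (k + 1) (v' + Pi.single t 1) ∧ v' + Pi.single t 1 ∉ τ ∧
          ∀ v ∈ τ, Adj (v' + Pi.single t 1) v := by
      intro t t' htt hz
      have hs0 : ∀ t, (0 : Fin n → ℤ) ≤ Pi.single t 1 := fun t => Pi.single_nonneg.2 zero_le_one
      have hle : v' + Pi.single t 1 ≤ v'' := by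
        have : v'' = v' + Pi.single t 1 + Pi.single t' 1 := by rw [add_assoc, ← hz]; abel
        rw [this]
        exact le_add_of_nonneg_right (hs0 t')
      have hge : v' ≤ v' + Pi.single t 1 := le_add_of_nonneg_right (hs0 t)
      refine ⟨fun i hi => ?_, fun h => ?_, fun v hv => ?_⟩
      · have h1 := hf v' hv' i hi
        have h2 := hf v'' hv'' i hi
        have h3 := hle i
        have h4 := hge i
        exact le_antisymm (h3.trans h2.le) (h1.ge.trans h4)
      · exact hm1.2.2 _ h (by rw [csum_add, csum_single]; omega)
      · have hvm := hm1.2.2 v hv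
        rcases lt_or_gt_of_ne hvm with h | h
        · exact Or.inr ⟨(hcomp v v' (hτ v hv v' hv') (by omega)).1.trans hge,
            hle.trans (hcomp v v'' (hτ v hv v'' hv'') (by omega)).2⟩
        · refine Or.inl ⟨hle.trans (hcomp v'' v (hτ v'' hv'' v hv) (by omega)).1,
            (hcomp v' v (hτ v' hv' v hv) (by omega)).2.trans ?_⟩
          gcongr
    refine ⟨v' + Pi.single j 1, v' + Pi.single l 1, ?_, ?_, ?_, ?_⟩
    · intro h
      have := congrFun (add_left_cancel h) j
      rw [Pi.single_eq_same, Pi.single_eq_of_ne hjl] at this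
      omega
    · intro w
      constructor
      · rintro ⟨hwf, hwτ, hadj⟩
        have hns := hnotsum w hwτ hadj
        have hw0 : a ≤ csum w := by
          by_contra! h
          have h1 := (hcomp w u (hadj u hu) (by omega)).2
          have h2 := le_add_ones hwf (hf u hu) h1
          rw [huv] at h2
          have := csum_le (le_of_add_le_add_right h2)
          omega
        have hw1 : csum w ≤ a + (k + 1) := by
          have h1 := (hcomp v0 w (hadj v0 hv0).symm hw0).2
          have h2 := csum_le (le_add_ones (hf v0 hv0) hwf h1)
          rw [csum_add, hones] at h2
          exact h2
        have hwm : csum w = m := by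
          by_contra h
          obtain ⟨v, hv, hvs⟩ := hatt (csum w) hw0 hw1 h
          exact hns v hv hvs
        have h1 := (hcomp v' w (hadj v' hv').symm (by omega)).1
        have h2 := (hcomp w v'' (hadj v'' hv'') (by omega)).1
        obtain ⟨t, ht⟩ := eq_single_of_csum_eq_one (z := w - v') (sub_nonneg.2 h1)
          (by rw [csum_sub]; omega)
        have hwt : w = v' + Pi.single t 1 := by rw [← ht]; abel
        have h3 : w - v' ≤ v'' - v' := sub_le_sub_right h2 _
        rw [ht, hz] at h3
        have h4 := h3 t
        by_cases htj : t = j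
        · left; rw [hwt, htj]
        · by_cases htl : t = l
          · right; rw [hwt, htl]
          · rw [Pi.add_apply, Pi.single_eq_same, Pi.single_eq_of_ne htj,
              Pi.single_eq_of_ne htl] at h4
            norm_num at h4
      · rintro (rfl | rfl)
        · exact key j l hjl hz
        · exact key l j hjl.symm (by rw [hz, add_comm])
    · intro h0
      -- This case cannot occur inside the hyperplane, since `u - v0` has `k`-th coordinate 1.
      have := congrFun huv ⟨k, hk⟩
      simp [ones, h0 u hu, h0 v0 hv0] at this
    · intro _
      have h1 := hp v' hv'
      have h2 : ∀ t, (0 : ℤ) ≤ (Pi.single t 1 : Fin n → ℤ) ⟨k, hk⟩ := fun t =>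
        (Pi.single_nonneg.2 zero_le_one : (0 : Fin n → ℤ) ≤ Pi.single t 1) _
      exact ⟨add_nonneg h1 (h2 j), add_nonneg h1 (h2 l)⟩

end Freudenthal

end

/-! ### Antipodal symmetry of the triangulation and the Tucker lemma -/

noncomputable section

namespace Freudenthal

open ModTwoChain

variable {n : ℕ}

/-- The antipode of a simplex. -/
def antipode (σ : Finset (Fin n → ℤ)) : Finset (Fin n → ℤ) := σ.image fun v => -v

/-- The antipodal map on chains. -/
def anti : Chain (Fin n → ℤ) →ₗ[ZMod 2] Chain (Fin n → ℤ) := Finsupp.lmapDomain _ _ antipode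

theorem mem_antipode {σ : Finset (Fin n → ℤ)} {v : Fin n → ℤ} : v ∈ antipode σ ↔ -v ∈ σ := by
  simp only [antipode, Finset.mem_image]
  exact ⟨fun ⟨w, hw, h⟩ => by rw [← h, neg_neg]; exact hw, fun h => ⟨-v, h, neg_neg v⟩⟩

theorem antipode_antipode (σ : Finset (Fin n → ℤ)) : antipode (antipode σ) = σ := by
  ext v; simp [mem_antipode]

theorem card_antipode (σ : Finset (Fin n → ℤ)) : (antipode σ).card = σ.card :=
  Finset.card_image_of_injective _ neg_injective

theorem antipode_erase (σ : Finset (Fin n → ℤ)) (v : Fin n → ℤ) :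
    antipode (σ.erase v) = (antipode σ).erase (-v) := by
  ext w
  simp [mem_antipode, Finset.mem_erase, neg_eq_iff_eq_neg]

theorem anti_single (σ : Finset (Fin n → ℤ)) :
    anti (Finsupp.single σ 1) = Finsupp.single (antipode σ) 1 := by
  simp [anti]

theorem bd_anti (c : Chain (Fin n → ℤ)) : bd (anti c) = anti (bd c) := by
  induction c using Finsupp.induction_linear with
  | zero => simp
  | add f g hf hg => simp only [map_add, hf, hg]
  | single σ a =>
    have : (Finsupp.single σ a : Chain (Fin n → ℤ)) = a • Finsupp.single σ 1 := by simp
    rw [this]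
    simp only [map_smul, anti_single, bd_single, map_sum]
    congr 1
    rw [antipode, Finset.sum_image (fun a _ b _ h => neg_injective h)]
    exact Finset.sum_congr rfl fun v _ => by rw [antipode_erase]; rfl

/-- An odd labelling keeps the absolute values and reverses all signs, so the antipodal map
exchanges the two possible starting signs. -/
theorem alt_antipode {lab : (Fin n → ℤ) → ℤ} (hl : ∀ v, lab (-v) = - lab v) (k : ℕ) (s : ℤ)
    (τ : Finset (Fin n → ℤ)) : alt lab k s (antipode τ) = alt lab k (-s) τ := by
  classical
  induction k generalizing s τ with
  | zero => rfl
  | succ k ih =>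
    have hm : ∀ v, IsStrictMin lab (antipode τ) (-v) ↔ IsStrictMin lab τ v := by
      intro v
      simp only [IsStrictMin, mem_antipode, neg_neg, hl, abs_neg]
      refine and_congr_right fun _ => ⟨fun h w hw hwv => ?_, fun h w hw hwv => ?_⟩
      · have := h (-w) (by rwa [neg_neg]) (fun h => hwv (neg_injective h))
        rwa [hl, abs_neg] at this
      · have := h (-w) hw (fun h => hwv (by rw [← h, neg_neg]))
        rwa [hl, abs_neg] at this
    simp only [alt]
    conv_lhs => rw [antipode, Finset.sum_image (fun a _ b _ h => neg_injective h)]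
    refine Finset.sum_congr rfl fun v _ => ?_
    rw [show (Finset.image (fun v => -v) τ).erase (-v) = antipode (τ.erase v) from
      (antipode_erase τ v).symm, ih, hl, Int.sign_neg]
    refine if_congr (and_congr ⟨fun h => by omega, fun h => by omega⟩ (hm v)) rfl rfl

theorem altSum_anti {lab : (Fin n → ℤ) → ℤ} (hl : ∀ v, lab (-v) = - lab v) (s : ℤ)
    (c : Chain (Fin n → ℤ)) : altSum lab s (anti c) = altSum lab (-s) c := by
  induction c using Finsupp.induction_linear with
  | zero => simp
  | add f g hf hg => simp only [map_add, hf, hg]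
  | single σ a =>
    have : (Finsupp.single σ a : Chain (Fin n → ℤ)) = a • Finsupp.single σ 1 := by simp
    rw [this]
    simp only [map_smul, anti_single, altSum, Finsupp.linearCombination_single, one_smul,
      card_antipode, alt_antipode hl]

open Classical in
/-- The `k`-dimensional simplices of the coordinate subspace of dimension `k` with a vertex in the
finite set `U`. -/
def cells (U : Finset (Fin n → ℤ)) (k : ℕ) : Finset (Finset (Fin n → ℤ)) :=
  (U.biUnion fun u => Finset.Icc (u - 1) (u + 1)).powerset.filter fun σ =>
    IsSimplex σ ∧ σ.card = k + 1 ∧ (∀ v ∈ σ, Flat k v) ∧ ∃ v ∈ σ, v ∈ U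

/-- A simplex with a vertex `u` in `U` lies in the box `u ± 1`, so the finite powerset in the
definition omits nothing. -/
theorem mem_cells {U : Finset (Fin n → ℤ)} {k : ℕ} {σ : Finset (Fin n → ℤ)} :
    σ ∈ cells U k ↔ IsSimplex σ ∧ σ.card = k + 1 ∧ (∀ v ∈ σ, Flat k v) ∧ ∃ v ∈ σ, v ∈ U := by
  classical
  rw [cells, Finset.mem_filter, and_iff_right_iff_imp]
  rintro ⟨h, -, -, u, hu, huU⟩
  rw [Finset.mem_powerset]
  intro v hv
  refine Finset.mem_biUnion.2 ⟨u, huU, Finset.mem_Icc.2 ?_⟩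
  have := fun i => abs_le.1 ((h v hv u hu).abs_sub_le i)
  exact ⟨fun i => by have := this i; simp only [Pi.sub_apply, Pi.one_apply]; omega,
    fun i => by have := this i; simp only [Pi.add_apply, Pi.one_apply]; omega⟩

open Classical in
/-- The cells in the half space where the last coordinate is nonnegative. -/
def half (U : Finset (Fin n → ℤ)) (k : ℕ) (hk : k < n) : Finset (Finset (Fin n → ℤ)) :=
  (cells U (k + 1)).filter fun σ => ∀ v ∈ σ, 0 ≤ v ⟨k, hk⟩

theorem mem_half {U : Finset (Fin n → ℤ)} {k : ℕ} {hk : k < n} {σ : Finset (Fin n → ℤ)} :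
    σ ∈ half U k hk ↔ σ ∈ cells U (k + 1) ∧ ∀ v ∈ σ, 0 ≤ v ⟨k, hk⟩ := by
  classical
  rw [half, Finset.mem_filter]

theorem antipode_mem_cells {U : Finset (Fin n → ℤ)} (hU : ∀ v ∈ U, -v ∈ U) {k : ℕ}
    {σ : Finset (Fin n → ℤ)} (h : σ ∈ cells U k) : antipode σ ∈ cells U k := by
  rw [mem_cells] at h ⊢
  obtain ⟨h1, h2, h3, u, hu, huU⟩ := h
  refine ⟨fun v hv w hw => ?_, by rw [card_antipode, h2], fun v hv i hi => ?_, -u, ?_, hU u huU⟩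
  · simpa using (h1 _ (mem_antipode.1 hv) _ (mem_antipode.1 hw)).neg
  · simpa using h3 _ (mem_antipode.1 hv) i hi
  · rw [mem_antipode, neg_neg]; exact hu

theorem anti_chi (A : Finset (Finset (Fin n → ℤ))) :
    anti (chi A) = ∑ σ ∈ A, Finsupp.single (antipode σ) 1 := by
  simp [chi, map_sum, anti_single]

theorem anti_chi_cells {U : Finset (Fin n → ℤ)} (hU : ∀ v ∈ U, -v ∈ U) (k : ℕ) :
    anti (chi (cells U k)) = chi (cells U k) := by
  rw [anti_chi, chi]
  exact Finset.sum_bij' (fun σ _ => antipode σ) (fun σ _ => antipode σ)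
    (fun σ h => antipode_mem_cells hU h) (fun σ h => antipode_mem_cells hU h)
    (fun σ _ => antipode_antipode σ) (fun σ _ => antipode_antipode σ) (fun σ _ => rfl)

/-- The heights of the vertices are distinct and lie in an interval of length `k`. -/
theorem card_le_of_flat {k : ℕ} (hk : k ≤ n) {σ : Finset (Fin n → ℤ)} (h : IsSimplex σ)
    (hf : ∀ v ∈ σ, Flat k v) : σ.card ≤ k + 1 := by
  rcases σ.eq_empty_or_nonempty with rfl | hne
  · simp
  obtain ⟨v0, hv0, hmin⟩ := Finset.exists_min_image σ csum hne
  have hcomp : ∀ v w : Fin n → ℤ, Adj v w → csum v ≤ csum w → v ≤ w ∧ w ≤ v + 1 := by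
    intro v w hvw hs
    rcases hvw with h | h
    · exact h
    · have := eq_of_le_of_csum_le h.1 hs
      subst this
      exact ⟨le_rfl, fun i => by simp⟩
  have hinj : Set.InjOn csum (σ : Set (Fin n → ℤ)) := fun v hv w hw e =>
    eq_of_csum_eq (hcomp v w (h v hv w hw) e.le).1 e
  have hsub : σ.image csum ⊆ Finset.Icc (csum v0) (csum v0 + k) := by
    intro s hs
    obtain ⟨v, hv, rfl⟩ := Finset.mem_image.1 hs
    refine Finset.mem_Icc.2 ⟨hmin v hv, ?_⟩
    have := csum_le (le_add_ones (hf v0 hv0) (hf v hv) (hcomp v0 v (h v0 hv0 v hv) (hmin v hv)).2)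
    rwa [csum_add, csum_ones hk] at this
  have := Finset.card_le_card hsub
  rw [Finset.card_image_of_injOn hinj, Int.card_Icc] at this
  omega

/-- Coordinates of adjacent points differ by at most 1, so no simplex has vertices strictly on both
sides of the hyperplane. A cell belonging to both halves would lie in the hyperplane and have one
vertex too many. -/
theorem chi_cells_succ {U : Finset (Fin n → ℤ)} (hU : ∀ v ∈ U, -v ∈ U) {k : ℕ} (hk : k < n) :
    chi (cells U (k + 1)) = chi (half U k hk) + anti (chi (half U k hk)) := by
  classical
  have h1 : anti (chi (half U k hk)) = chi ((half U k hk).image antipode) := by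
    rw [anti_chi, chi, Finset.sum_image]
    intro a _ b _ h
    rw [← antipode_antipode a, h, antipode_antipode]
  have hdisj : Disjoint (half U k hk) ((half U k hk).image antipode) := by
    rw [Finset.disjoint_left]
    intro σ h1 h2
    obtain ⟨σ', h3, rfl⟩ := Finset.mem_image.1 h2
    obtain ⟨h4, h5⟩ := mem_half.1 h1
    obtain ⟨-, h6⟩ := mem_half.1 h3
    obtain ⟨h7, h8, h9, -⟩ := mem_cells.1 h4
    have := card_le_of_flat (k := k) hk.le h7 (fun v hv i hi => by
      rcases hi.eq_or_lt with hi | hi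
      · have hi' : i = ⟨k, hk⟩ := Fin.ext hi.symm
        have e1 := h5 v hv
        have e2 := h6 _ (mem_antipode.1 hv)
        rw [hi']
        simp only [Pi.neg_apply] at e2
        omega
      · exact h9 v hv i hi)
    omega
  rw [h1, chi, chi, chi, ← Finset.sum_union hdisj]
  congr 1
  ext σ
  rw [Finset.mem_union, Finset.mem_image]
  constructor
  · intro h
    by_cases hpos : ∀ v ∈ σ, 0 ≤ v ⟨k, hk⟩
    · exact Or.inl (mem_half.2 ⟨h, hpos⟩)
    · right
      refine ⟨antipode σ, mem_half.2 ⟨antipode_mem_cells hU h, fun v hv => ?_⟩,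
        antipode_antipode σ⟩
      push Not at hpos
      obtain ⟨w, hw, hwneg⟩ := hpos
      have hv' := mem_antipode.1 hv
      have := abs_le.1 (((mem_cells.1 h).1 _ hv' w hw).abs_sub_le ⟨k, hk⟩)
      rcases (mem_cells.1 h).1 _ hv' w hw with h | h
      · have h1 := h.1 ⟨k, hk⟩
        simp only [Pi.neg_apply] at *
        omega
      · have h1 := h.2 ⟨k, hk⟩
        simp only [Pi.neg_apply, Pi.add_apply, Pi.one_apply] at *
        omega
  · rintro (h | ⟨σ', h, rfl⟩)
    · exact (mem_half.1 h).1
    · exact antipode_mem_cells hU (mem_half.1 h).1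

/-- The part of the boundary of the half cells outside of the coordinate hyperplane. -/
def rim (U : Finset (Fin n → ℤ)) (k : ℕ) (hk : k < n) : Chain (Fin n → ℤ) :=
  bd (chi (half U k hk)) + chi (cells U k)

/-- Suppose a simplex of the right dimension in the half space has a vertex in `U`; then both its
cofaces are cells. Off the hyperplane both lie in the half space and cancel; in the hyperplane
exactly one does, and it cancels against the equatorial cell. The surviving faces avoid `U`, and the
vertex deleted from the coface is the one in `U`. -/
theorem rim_support {U : Finset (Fin n → ℤ)} {k : ℕ} {hk : k < n} {τ : Finset (Fin n → ℤ)}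
    (hτ : τ ∈ (rim U k hk).support) :
    τ.card = k + 1 ∧ IsSimplex τ ∧ (∀ v ∈ τ, v ∉ U) ∧ ∃ w ∈ U, ∀ v ∈ τ, Adj w v := by
  classical
  set B := (half U k hk).biUnion id with hB
  have hBs : ∀ σ ∈ half U k hk, σ ⊆ B := fun σ hσ => Finset.subset_biUnion_of_mem id hσ
  rw [Finsupp.mem_support_iff, rim, Finsupp.add_apply, bd_chi_apply _ _ B hBs, chi_apply] at hτ
  have hins : ∀ w, w ∉ τ → insert w τ ∈ half U k hk → IsSimplex τ ∧ τ.card = k + 1 ∧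
      (∀ v ∈ τ, Flat (k + 1) v) ∧ (∀ v ∈ τ, 0 ≤ v ⟨k, hk⟩) ∧
      (∀ v ∈ τ, Adj w v) ∧ ∃ v ∈ insert w τ, v ∈ U := by
    intro w hw h
    obtain ⟨h1, h2⟩ := mem_half.1 h
    obtain ⟨h3, h4, h5, h6⟩ := mem_cells.1 h1
    rw [Finset.card_insert_of_notMem hw] at h4
    have hs : ∀ v ∈ τ, v ∈ insert w τ := fun v hv => Finset.mem_insert_of_mem hv
    exact ⟨fun v hv w hw => h3 v (hs v hv) w (hs w hw), by omega, fun v hv => h5 v (hs v hv),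
      fun v hv => h2 v (hs v hv), fun v hv => h3 w (Finset.mem_insert_self _ _) v (hs v hv), h6⟩
  have hcofaces : IsSimplex τ → τ.card = k + 1 → (∀ v ∈ τ, Flat (k + 1) v) →
      (∀ v ∈ τ, 0 ≤ v ⟨k, hk⟩) → (∃ v ∈ τ, v ∈ U) →
      ∀ w, (w ∈ B ∧ w ∉ τ ∧ insert w τ ∈ half U k hk) ↔
        ((Flat (k + 1) w ∧ w ∉ τ ∧ ∀ v ∈ τ, Adj w v) ∧ 0 ≤ w ⟨k, hk⟩) := by
    intro h1 h2 h3 h4 ⟨u, hu, huU⟩ w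
    constructor
    · rintro ⟨-, h5, h6⟩
      have h7 := mem_half.1 h6
      have h8 := mem_cells.1 h7.1
      exact ⟨⟨h8.2.2.1 w (Finset.mem_insert_self _ _), h5, (hins w h5 h6).2.2.2.2.1⟩,
        h7.2 w (Finset.mem_insert_self _ _)⟩
    · rintro ⟨⟨h5, h6, h7⟩, h8⟩
      have h9 : insert w τ ∈ half U k hk := by
        rw [mem_half, mem_cells, Finset.card_insert_of_notMem h6, h2]
        refine ⟨⟨?_, rfl, ?_, u, Finset.mem_insert_of_mem hu, huU⟩, ?_⟩
        · intro a ha b hb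
          rcases Finset.mem_insert.1 ha with ha' | ha' <;>
            rcases Finset.mem_insert.1 hb with hb' | hb'
          · rw [ha', hb']; exact Adj.refl _
          · rw [ha']; exact h7 b hb'
          · rw [hb']; exact (h7 a ha').symm
          · exact h1 a ha' b hb'
        · intro a ha
          rcases Finset.mem_insert.1 ha with rfl | ha
          exacts [h5, h3 a ha]
        · intro a ha
          rcases Finset.mem_insert.1 ha with rfl | ha
          exacts [h8, h4 a ha]
      exact ⟨hBs _ h9 (Finset.mem_insert_self _ _), h6, h9⟩
  by_cases hcell : τ ∈ cells U k
  · exfalso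
    apply hτ
    rw [if_pos hcell]
    obtain ⟨h1, h2, h3, h4⟩ := mem_cells.1 hcell
    have h0 : ∀ v ∈ τ, v ⟨k, hk⟩ = 0 := fun v hv => h3 v hv ⟨k, hk⟩ le_rfl
    have h3' : ∀ v ∈ τ, Flat (k + 1) v := fun v hv i hi => h3 v hv i (by omega)
    have hp : ∀ v ∈ τ, 0 ≤ v ⟨k, hk⟩ := fun v hv => (h0 v hv).ge
    obtain ⟨w₁, w₂, hne, hw, hz, -⟩ := exists_cofaces hk h1 h2 h3' hp
    have hf : B.filter (fun w => w ∉ τ ∧ insert w τ ∈ half U k hk) = {w₁} := by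
      ext w
      rw [Finset.mem_filter, hcofaces h1 h2 h3' hp h4, hw, Finset.mem_singleton]
      have := hz h0
      constructor
      · rintro ⟨rfl | rfl, h⟩
        · rfl
        · omega
      · rintro rfl
        exact ⟨Or.inl rfl, by omega⟩
    rw [hf, Finset.card_singleton]
    decide
  · rw [if_neg hcell, add_zero] at hτ
    have hne : (B.filter fun w => w ∉ τ ∧ insert w τ ∈ half U k hk).Nonempty := by
      rw [Finset.nonempty_iff_ne_empty]
      intro h
      rw [h] at hτ
      simp at hτ
    obtain ⟨w, hw⟩ := hne
    rw [Finset.mem_filter] at hw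
    obtain ⟨h1, h2, h3, h4, h5, h6⟩ := hins w hw.2.1 hw.2.2
    have hnoU : ∀ v ∈ τ, v ∉ U := by
      intro u hu huU
      by_cases h0 : ∀ v ∈ τ, v ⟨k, hk⟩ = 0
      · refine hcell (mem_cells.2 ⟨h1, h2, fun v hv i hi => ?_, u, hu, huU⟩)
        rcases hi.eq_or_lt with hi | hi
        · have hi' : i = ⟨k, hk⟩ := Fin.ext hi.symm
          rw [hi']; exact h0 v hv
        · exact h3 v hv i hi
      · push Not at h0
        obtain ⟨w₁, w₂, hne, hw', -, hz⟩ := exists_cofaces hk h1 h2 h3 h4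
        have hf : B.filter (fun w => w ∉ τ ∧ insert w τ ∈ half U k hk) = {w₁, w₂} := by
          ext w
          rw [Finset.mem_filter, hcofaces h1 h2 h3 h4 ⟨u, hu, huU⟩, hw', Finset.mem_insert,
            Finset.mem_singleton, and_iff_left_iff_imp]
          have := hz h0
          rintro (rfl | rfl)
          exacts [this.1, this.2]
        rw [hf, Finset.card_pair hne] at hτ
        exact hτ (by decide)
    refine ⟨h2, h1, hnoU, w, ?_, h5⟩
    obtain ⟨v, hv, hvU⟩ := h6
    rcases Finset.mem_insert.1 hv with rfl | hv
    · exact hvU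
    · exact absurd hvU (hnoU v hv)

/-- Each half contributes its rim and the equatorial cells. The equatorial part is antipodally
symmetric and occurs twice, so it vanishes modulo 2. -/
theorem bd_chi_cells_succ {U : Finset (Fin n → ℤ)} (hU : ∀ v ∈ U, -v ∈ U) {k : ℕ} (hk : k < n) :
    bd (chi (cells U (k + 1))) = rim U k hk + anti (rim U k hk) := by
  rw [chi_cells_succ hU hk, map_add, bd_anti, rim, map_add, anti_chi_cells hU]
  have := add_self_eq_zero_chain (chi (cells U k))
  generalize bd (chi (half U k hk)) = x at *
  generalize chi (cells U k) = y at *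
  rw [add_add_add_comm, this, add_zero]

/-- Induction on the dimension. By symmetry the count on the boundary equals the count of both
starting signs on the rim, which by `altSum_bd` is the count on the boundary of the rim. That
boundary is also the boundary of the cells one dimension lower. The induction starts at the single
cell `{0}`, whose boundary is the empty simplex and counts 1. -/
theorem altSum_bd_chi_cells {U : Finset (Fin n → ℤ)} (hU : ∀ v ∈ U, -v ∈ U) (h0 : 0 ∈ U)
    {lab : (Fin n → ℤ) → ℤ} (hl : ∀ v, lab (-v) = - lab v)
    (hgood : ∀ τ : Finset (Fin n → ℤ), IsSimplex τ → (∀ v ∈ τ, v ∉ U) →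
      (∃ w ∈ U, ∀ v ∈ τ, Adj w v) → Good lab τ) {k : ℕ} (hk : k ≤ n) :
    altSum lab 1 (bd (chi (cells U k))) = 1 := by
  induction k with
  | zero =>
    have : cells U 0 = {{0}} := by
      ext σ
      rw [mem_cells, Finset.mem_singleton]
      constructor
      · rintro ⟨-, h2, h3, -⟩
        obtain ⟨v, rfl⟩ := Finset.card_eq_one.1 h2
        rw [show v = 0 from funext fun i => h3 v (by simp) i (by simp)]
      · rintro rfl
        refine ⟨fun v hv w hw => ?_, by simp, fun v hv i _ => ?_, 0, by simp, h0⟩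
        · rw [Finset.mem_singleton.1 hv, Finset.mem_singleton.1 hw]; exact Adj.refl _
        · rw [Finset.mem_singleton.1 hv]; rfl
    rw [this]
    simp [chi, bd_single, altSum, alt]
  | succ k ih =>
    have hk' : k < n := hk
    rw [bd_chi_cells_succ hU hk', map_add, altSum_anti hl, ← altSum_bd (Or.inl rfl), rim, map_add,
      bd_bd, zero_add, ih hk'.le]
    intro τ hτ
    obtain ⟨h1, h2, h3, h4⟩ := rim_support hτ
    exact ⟨Finset.card_pos.1 (by omega), hgood τ h2 h3 h4⟩

/-- A Tucker lemma: an odd labelling with fewer than `n` absolute values has a zero label or a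
complementary edge on the rim of a finite symmetric set of lattice points containing the origin. -/
theorem exists_complementary {U : Finset (Fin n → ℤ)} (hU : ∀ v ∈ U, -v ∈ U) (h0 : 0 ∈ U)
    {lab : (Fin n → ℤ) → ℤ} (hl : ∀ v, lab (-v) = - lab v) {m : ℕ} (hm : m < n)
    (hlm : ∀ v, |lab v| ≤ m) :
    ∃ w ∈ U, ∃ v ∉ U, ∃ v' ∉ U, Adj w v ∧ Adj w v' ∧ Adj v v' ∧ (lab v = 0 ∨ lab v = - lab v') := by
  classical
  by_contra! hcon
  have hgood : ∀ τ : Finset (Fin n → ℤ), IsSimplex τ → (∀ v ∈ τ, v ∉ U) →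
      (∃ w ∈ U, ∀ v ∈ τ, Adj w v) → Good lab τ := by
    rintro τ h1 h2 ⟨w, hw, h3⟩
    exact ⟨fun v hv => (hcon w hw v (h2 v hv) v (h2 v hv) (h3 v hv) (h3 v hv) (h1 v hv v hv)).1,
      fun v hv v' hv' =>
        (hcon w hw v (h2 v hv) v' (h2 v' hv') (h3 v hv) (h3 v' hv') (h1 v hv v' hv')).2⟩
  obtain ⟨k, rfl⟩ : ∃ k, n = k + 1 := ⟨n - 1, by omega⟩
  have h1 := altSum_bd_chi_cells hU h0 hl hgood (k := k + 1) le_rfl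
  have hk : k < k + 1 := Nat.lt_succ_self k
  rw [bd_chi_cells_succ hU hk, map_add, altSum_anti hl] at h1
  -- An alternating simplex of the rim would need `n` different absolute values between 1 and `m <
  -- n`.
  have hzero : ∀ s, altSum lab s (rim U k hk) = 0 := by
    intro s
    rw [altSum, Finsupp.linearCombination_apply, Finsupp.sum]
    refine Finset.sum_eq_zero fun τ hτ => ?_
    obtain ⟨h2, h3, h4, h5⟩ := rim_support hτ
    have hg := hgood τ h3 h4 h5
    by_contra hne
    have halt : alt lab (k + 1) s τ ≠ 0 := by
      rw [h2] at hne
      exact right_ne_zero_of_smul hne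
    have hc := card_image_abs_of_alt_ne_zero h2 halt
    have hsub : τ.image (fun v => |lab v|) ⊆ Finset.Icc 1 (m : ℤ) := by
      intro x hx
      obtain ⟨v, hv, rfl⟩ := Finset.mem_image.1 hx
      exact Finset.mem_Icc.2 ⟨Int.one_le_abs (hg.1 v hv), hlm v⟩
    have := Finset.card_le_card hsub
    rw [hc, Int.card_Icc] at this
    omega
  rw [hzero, hzero] at h1
  exact absurd h1 (by decide)

end Freudenthal

/-! ### Borsuk's theorem -/

/-- The label is the number of a coordinate of largest absolute value, with the sign of that
coordinate. The coordinate is chosen as a function of the absolute values alone, so `y` and `-y`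
choose the same one and the label is odd. Opposite labels mean opposite signs in a common maximal
coordinate, so the two points are at least `‖y‖` apart. -/
theorem exists_odd_label (m : ℕ) : ∃ L : (Fin m → ℝ) → ℤ, (∀ y, L (-y) = - L y) ∧
    (∀ y, |L y| ≤ m) ∧ (∀ y, L y = 0 → y = 0) ∧
    ∀ y y', L y = - L y' → ‖y‖ ≤ ‖y - y'‖ := by
  classical
  have hidx : ∀ z : Fin m → ℝ, z ≠ 0 → ∃ i, ∀ j, z j ≤ z i := by
    intro z hz
    have : Nonempty (Fin m) := by
      by_contra h
      rw [not_nonempty_iff] at h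
      exact hz (Subsingleton.elim _ _)
    exact Finite.exists_max z
  let ab : (Fin m → ℝ) → Fin m → ℝ := fun y i => |y i|
  have hab0 : ∀ y, ab y = 0 → y = 0 := fun y h => funext fun i => abs_eq_zero.1 (congrFun h i)
  let L : (Fin m → ℝ) → ℤ := fun y => if h : ab y = 0 then 0 else
    SignType.sign (y (Classical.choose (hidx (ab y) h))) * (((Classical.choose (hidx (ab y) h) : Fin m) : ℕ) + 1)
  have hL : ∀ y, y ≠ 0 → ∃ i, (∀ z, ab z = ab y → L z = SignType.sign (z i) * ((i : ℕ) + 1)) ∧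
      (∀ j, |y j| ≤ |y i|) ∧ y i ≠ 0 := by
    intro y hy
    have h : ab y ≠ 0 := fun h => hy (hab0 y h)
    have hsp := Classical.choose_spec (hidx (ab y) h)
    refine ⟨Classical.choose (hidx (ab y) h), fun z hz => ?_, hsp, fun h0 => hy ?_⟩
    · have hz0 : ab z ≠ 0 := by rw [hz]; exact h
      simp only [L, dif_neg hz0]
      congr! 3 <;> simp [hz]
    · funext j
      have := hsp j
      simp only [ab, h0, abs_zero] at this
      exact abs_eq_zero.1 (le_antisymm this (abs_nonneg _))
  have hL0 : L 0 = 0 := by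
    simp only [L]
    rw [dif_pos]
    funext i
    simp [ab]
  have habs : ∀ (t : ℝ) (i : Fin m), t ≠ 0 → |(SignType.sign t : ℤ) * ((i : ℕ) + 1)| = (i : ℕ) + 1 := by
    intro t i ht
    rw [abs_mul]
    have h1 : |(SignType.sign t : ℤ)| = 1 := by
      rcases lt_or_gt_of_ne ht with h | h
      · simp [sign_neg h]
      · simp [sign_pos h]
    rw [h1, one_mul, abs_of_nonneg (by positivity)]
  refine ⟨L, fun y => ?_, fun y => ?_, fun y h => ?_, fun y y' h => ?_⟩
  · by_cases hy : y = 0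
    · simp [hy, hL0]
    · obtain ⟨i, h1, -, -⟩ := hL y hy
      rw [h1 y rfl, h1 (-y) (funext fun i => by simp [ab])]
      simp [Left.sign_neg]
  · by_cases hy : y = 0
    · simp [hy, hL0]
    · obtain ⟨i, h1, -, h2⟩ := hL y hy
      rw [h1 y rfl, habs _ _ h2]
      have := i.2
      omega
  · by_contra hy
    obtain ⟨i, h1, -, h2⟩ := hL y hy
    have := habs _ i h2
    rw [← h1 y rfl, h, abs_zero] at this
    omega
  · by_cases hy : y = 0
    · simp [hy]
    obtain ⟨i, h1, h2, h3⟩ := hL y hy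
    have hy' : y' ≠ 0 := by
      rintro rfl
      rw [hL0, neg_zero] at h
      have := habs _ i h3
      rw [← h1 y rfl, h, abs_zero] at this
      omega
    obtain ⟨i', h1', h2', h3'⟩ := hL y' hy'
    have e1 := habs _ i h3
    have e2 := habs _ i' h3'
    rw [← h1 y rfl, h, abs_neg, h1' y' rfl, e2] at e1
    have hii : i' = i := Fin.ext (by omega)
    subst hii
    rw [h1 y rfl, h1' y' rfl] at h
    have hs : (SignType.sign (y i') : ℤ) = - SignType.sign (y' i') := by
      have : ((i' : ℕ) : ℤ) + 1 ≠ 0 := by omega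
      rw [← neg_mul] at h
      exact mul_right_cancel₀ this h
    have hle : |y i'| ≤ |y i' - y' i'| := by
      rcases lt_or_gt_of_ne h3 with ha | ha <;> rcases lt_or_gt_of_ne h3' with hb | hb
      · simp [sign_neg ha, sign_neg hb] at hs
      · rw [abs_of_neg ha, abs_of_neg (by linarith)]; linarith
      · rw [abs_of_pos ha, abs_of_pos (by linarith)]; linarith
      · simp [sign_pos ha, sign_pos hb] at hs
    refine (pi_norm_le_iff_of_nonneg (norm_nonneg _)).2 fun j => ?_
    exact ((h2 j).trans hle).trans (norm_le_pi_norm (y - y') i')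

/-- Borsuk's theorem: an odd map from `ℝ^n` to a space of smaller dimension has a zero on the
boundary of each bounded symmetric neighbourhood `{d < 0}` of the origin. -/
theorem exists_zero_of_odd {n m : ℕ} (hmn : m < n) {d : (Fin n → ℝ) → ℝ} (hd : Continuous d)
    (hde : ∀ x, d (-x) = d x) (hd0 : d 0 < 0) {R : ℝ} (hR : ∀ x, R ≤ ‖x‖ → 0 < d x)
    {H : (Fin n → ℝ) → Fin m → ℝ} (hH : Continuous H) (hHo : ∀ x, H (-x) = - H x) :
    ∃ x, d x = 0 ∧ H x = 0 := by
  classical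
  by_contra! hcon
  obtain ⟨L, hLodd, hLm, hL0, hLc⟩ := exists_odd_label m
  have hKc : IsCompact (Metric.closedBall (0 : Fin n → ℝ) (|R| + 1)) := isCompact_closedBall _ _
  -- By assumption `d` and `H` have no common zero, and compactness makes this quantitative. The
  -- radius `|R| + 1` leaves room for the grid neighbours of points inside radius `|R|`.
  obtain ⟨c, hc, hcK⟩ : ∃ c > 0, ∀ x ∈ Metric.closedBall (0 : Fin n → ℝ) (|R| + 1),
      2 * c ≤ max |d x| ‖H x‖ := by
    obtain ⟨x0, _, hx0⟩ := hKc.exists_isMinOn (f := fun x => max |d x| ‖H x‖)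
      ⟨0, Metric.mem_closedBall_self (by positivity)⟩ (by fun_prop)
    refine ⟨max |d x0| ‖H x0‖ / 2, ?_, fun x hx => by
      have : max |d x0| ‖H x0‖ ≤ max |d x| ‖H x‖ := hx0 hx
      linarith⟩
    have : 0 < max |d x0| ‖H x0‖ := by
      by_cases h : d x0 = 0
      · exact lt_max_of_lt_right (norm_pos_iff.2 (hcon x0 h))
      · exact lt_max_of_lt_left (abs_pos.2 h)
    linarith
  have hud := Metric.uniformContinuousOn_iff.1 (hKc.uniformContinuousOn_of_continuous
    hd.continuousOn) c hc
  have huH := Metric.uniformContinuousOn_iff.1 (hKc.uniformContinuousOn_of_continuous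
    hH.continuousOn) c hc
  obtain ⟨δ₁, hδ₁, hud⟩ := hud
  obtain ⟨δ₂, hδ₂, huH⟩ := huH
  -- The mesh `1 / M` is below 1 and below both moduli of uniform continuity for `c`.
  obtain ⟨M, hM⟩ := exists_nat_gt (max 1 (max (1 / δ₁) (1 / δ₂)))
  have hM1 : (1 : ℝ) < M := (le_max_left _ _).trans_lt hM
  have hMpos : (0 : ℝ) < M := by linarith
  have hMδ₁ : 1 / (M : ℝ) < δ₁ := by
    rw [div_lt_iff₀ hMpos, ← div_lt_iff₀' hδ₁]
    exact ((le_max_left _ _).trans (le_max_right _ _)).trans_lt hM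
  have hMδ₂ : 1 / (M : ℝ) < δ₂ := by
    rw [div_lt_iff₀ hMpos, ← div_lt_iff₀' hδ₂]
    exact ((le_max_right _ _).trans (le_max_right _ _)).trans_lt hM
  let pt : (Fin n → ℤ) → Fin n → ℝ := fun v i => (v i : ℝ) / M
  have hptneg : ∀ v, pt (-v) = - pt v := fun v => funext fun i => by simp [pt, neg_div]
  have hptadj : ∀ v w, Freudenthal.Adj v w → dist (pt v) (pt w) ≤ 1 / M := by
    intro v w h
    refine (dist_pi_le_iff (by positivity)).2 fun i => ?_
    rw [Real.dist_eq, ← sub_div, abs_div, abs_of_pos hMpos]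
    gcongr
    exact_mod_cast h.abs_sub_le i
  have hfin : {v : Fin n → ℤ | d (pt v) < 0}.Finite := by
    refine (Set.finite_Icc (fun _ => -⌈|R| * M⌉) (fun _ => ⌈|R| * M⌉)).subset fun v hv => ?_
    have h1 : ‖pt v‖ < |R| := by
      by_contra! h
      exact absurd (hR (pt v) ((le_abs_self R).trans h)) (not_lt.2 (le_of_lt hv))
    have h2 : ∀ i, |(v i : ℝ)| ≤ |R| * M := fun i => by
      have := (norm_le_pi_norm (pt v) i).trans h1.le
      rw [Real.norm_eq_abs, abs_div, abs_of_pos hMpos, div_le_iff₀ hMpos] at this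
      exact this
    have h3 : ∀ i, -⌈|R| * M⌉ ≤ v i ∧ v i ≤ ⌈|R| * M⌉ := fun i => by
      have h4 := abs_le.1 ((h2 i).trans (Int.le_ceil _))
      exact ⟨by exact_mod_cast h4.1, by exact_mod_cast h4.2⟩
    exact ⟨fun i => (h3 i).1, fun i => (h3 i).2⟩
  have hmem : ∀ v, v ∈ hfin.toFinset ↔ d (pt v) < 0 := fun v => by simp
  -- Tucker's lemma for the grid points with `d < 0`. The bad edge lies just outside this set, where
  -- `d` is below `c`, so `H` has norm at least `2 * c`. Yet a zero label forces `H` to vanish, and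
  -- complementary labels force `H` to vary by at least its norm along a short edge.
  obtain ⟨w, hw, v, hv, v', hv', hwv, hwv', hvv', hbad⟩ := Freudenthal.exists_complementary
    (U := hfin.toFinset) (lab := fun v => L (H (pt v)))
    (fun v hv => by rw [hmem] at hv ⊢; rwa [hptneg, hde])
    (by rw [hmem, show pt 0 = 0 from funext fun i => by simp [pt]]; exact hd0)
    (fun v => by rw [hptneg, hHo, hLodd]) hmn (fun v => hLm _)
  rw [hmem] at hw hv hv'
  have hwn : ‖pt w‖ < |R| := by
    by_contra! h
    exact absurd (hR (pt w) ((le_abs_self R).trans h)) (not_lt.2 hw.le)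
  have hM1' : 1 / (M : ℝ) ≤ 1 := by rw [div_le_one hMpos]; exact hM1.le
  have hball : ∀ v, Freudenthal.Adj w v → pt v ∈ Metric.closedBall (0 : Fin n → ℝ) (|R| + 1) := by
    intro v hv
    rw [Metric.mem_closedBall]
    have h1 := dist_triangle (pt v) (pt w) 0
    have h2 := hptadj _ _ hv
    rw [dist_comm] at h2
    rw [dist_zero_right (pt w)] at h1
    linarith
  have hwball := hball w (Freudenthal.Adj.refl w)
  have hdv : |d (pt v)| < c := by
    have h1 := hud _ hwball _ (hball v hwv) ((hptadj _ _ hwv).trans_lt hMδ₁)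
    rw [Real.dist_eq] at h1
    rw [abs_of_nonneg (not_lt.1 hv)]
    have := (abs_lt.1 h1).1
    linarith
  have hHv : 2 * c ≤ ‖H (pt v)‖ := by
    rcases le_max_iff.1 (hcK _ (hball v hwv)) with h | h
    · linarith
    · exact h
  rcases hbad with h | h
  · rw [hL0 _ h, norm_zero] at hHv
    linarith
  · have h1 := hLc _ _ h
    have h2 := huH _ (hball v hwv) _ (hball v' hwv') ((hptadj _ _ hvv').trans_lt hMδ₂)
    rw [dist_eq_norm] at h2
    linarith

end

noncomputable section

/-! ### Properties of the genus -/

section Genus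

variable {X Y : Type*} [NormedAddCommGroup X] [NormedAddCommGroup Y]

theorem genus_le_of_map {E : Set X} {n : ℕ} {h : X → EuclideanSpace ℝ (Fin n)}
    (hc : ContinuousOn h E) (ho : ∀ x ∈ E, h (-x) = - h x) (h0 : ∀ x ∈ E, h x ≠ 0) :
    genus E ≤ n := sInf_le ⟨n, rfl, h, hc, ho, h0⟩

theorem exists_map_of_genus_le {E : Set X} {k : ℕ} (hk : genus E ≤ k) :
    ∃ n ≤ k, ∃ h : X → EuclideanSpace ℝ (Fin n),
      ContinuousOn h E ∧ (∀ x ∈ E, h (-x) = - h x) ∧ ∀ x ∈ E, h x ≠ 0 := by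
  set S := {k : ℕ∞ | ∃ n : ℕ, k = n ∧ ∃ h : X → EuclideanSpace ℝ (Fin n),
    ContinuousOn h E ∧ (∀ x ∈ E, h (-x) = - h x) ∧ ∀ x ∈ E, h x ≠ 0} with hS
  have hne : S.Nonempty := by
    rw [Set.nonempty_iff_ne_empty]
    intro h
    have : genus E = ⊤ := by
      change sInf S = ⊤
      rw [h, sInf_empty]
    rw [this] at hk
    exact absurd hk (by simp)
  obtain ⟨n, hn, h⟩ := csInf_mem hne
  refine ⟨n, ?_, h⟩
  have : genus E = n := hn
  rw [this] at hk
  exact_mod_cast hk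

/-- Tietze's theorem followed by taking the odd part, which agrees with `h` on `E` by symmetry. -/
theorem exists_odd_extension [NormedSpace ℝ X] {E : Set X} (hE : IsClosed E)
    (hs : ∀ x ∈ E, -x ∈ E) {n : ℕ} {h : X → EuclideanSpace ℝ (Fin n)}
    (hc : ContinuousOn h E) (ho : ∀ x ∈ E, h (-x) = - h x) :
    ∃ g : X → EuclideanSpace ℝ (Fin n), Continuous g ∧ (∀ x, g (-x) = - g x) ∧
      ∀ x ∈ E, g x = h x := by
  obtain ⟨f, hf⟩ := ContinuousMap.exists_restrict_eq hE
    (⟨E.domRestrict h, hc.domRestrict⟩ : C(E, EuclideanSpace ℝ (Fin n)))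
  have hf' : ∀ x ∈ E, f x = h x := fun x hx => DFunLike.congr_fun hf ⟨x, hx⟩
  refine ⟨fun x => (2⁻¹ : ℝ) • (f x - f (-x)), by fun_prop, fun x => ?_, fun x hx => ?_⟩
  · change (2⁻¹ : ℝ) • (f (-x) - f (- -x)) = -((2⁻¹ : ℝ) • (f x - f (-x)))
    rw [neg_neg, ← smul_neg, neg_sub]
  · change (2⁻¹ : ℝ) • (f x - f (-x)) = h x
    rw [hf' x hx, hf' _ (hs x hx), ho x hx, sub_neg_eq_add, ← two_smul ℝ (h x), smul_smul]
    norm_num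

theorem genus_le_of_mapsTo {A : Set X} {B : Set Y} {f : X → Y} (hf : ContinuousOn f A)
    (hodd : ∀ x ∈ A, f (-x) = - f x) (hm : Set.MapsTo f A B) : genus A ≤ genus B := by
  refine le_sInf ?_
  rintro k ⟨n, rfl, h, hc, ho, h0⟩
  refine genus_le_of_map (h := h ∘ f) (hc.comp hf hm) (fun x hx => ?_) fun x hx => h0 _ (hm hx)
  simp only [Function.comp_apply]
  rw [hodd x hx, ho _ (hm hx)]

/-- Extend both odd maps to the whole space and juxtapose them: on `A` the first block is nonzero,
on `B` the second. -/
theorem genus_union_le [NormedSpace ℝ X] {S A B : Set X} (hA : IsClosed A) (hB : IsClosed B)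
    (hAs : ∀ x ∈ A, -x ∈ A) (hBs : ∀ x ∈ B, -x ∈ B) (hS : S ⊆ A ∪ B) :
    genus S ≤ genus A + genus B := by
  rcases eq_or_ne (genus A) ⊤ with h | h
  · rw [h]; simp
  rcases eq_or_ne (genus B) ⊤ with h' | h'
  · rw [h']; simp
  obtain ⟨a, ha⟩ := ENat.ne_top_iff_exists.1 h
  obtain ⟨b, hb⟩ := ENat.ne_top_iff_exists.1 h'
  obtain ⟨n, hn, f, hf, hfo, hf0⟩ := exists_map_of_genus_le ha.ge
  obtain ⟨m, hm, g, hg, hgo, hg0⟩ := exists_map_of_genus_le hb.ge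
  obtain ⟨F, hF, hFo, hFe⟩ := exists_odd_extension hA hAs hf hfo
  obtain ⟨G, hG, hGo, hGe⟩ := exists_odd_extension hB hBs hg hgo
  have hle : genus S ≤ ((n + m : ℕ) : ℕ∞) := by
    refine genus_le_of_map (h := fun x => WithLp.toLp 2 (Fin.append (F x) (G x))) ?_ ?_ ?_
    · refine (((PiLp.continuous_toLp 2 _).comp (continuous_pi fun i => ?_))).continuousOn
      refine Fin.addCases (fun i => ?_) (fun i => ?_) i
      · simp only [Fin.append_left]
        exact (continuous_apply i).comp ((PiLp.continuous_ofLp 2 _).comp hF)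
      · simp only [Fin.append_right]
        exact (continuous_apply i).comp ((PiLp.continuous_ofLp 2 _).comp hG)
    · intro x _
      ext i
      refine Fin.addCases (fun i => ?_) (fun i => ?_) i <;> simp [hFo, hGo]
    · intro x hx h0
      rcases hS hx with hxA | hxB
      · apply hf0 x hxA
        rw [← hFe x hxA]
        ext i
        have := congrArg (fun y : EuclideanSpace ℝ (Fin (n + m)) => y (Fin.castAdd m i)) h0
        simpa using this
      · apply hg0 x hxB
        rw [← hGe x hxB]
        ext i
        have := congrArg (fun y : EuclideanSpace ℝ (Fin (n + m)) => y (Fin.natAdd n i)) h0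
        simpa using this
  rw [← ha, ← hb]
  refine hle.trans ?_
  exact_mod_cast Nat.add_le_add hn hm

/-- The odd extension of a map without zeros on `K` is nonzero on an open neighbourhood, which by
compactness contains a closed thickening. -/
theorem exists_genus_cthickening_le [NormedSpace ℝ X] {K : Set X} (hK : IsCompact K)
    (hs : ∀ x ∈ K, -x ∈ K) {k : ℕ} (hk : genus K ≤ k) :
    ∃ ρ > 0, genus (Metric.cthickening ρ K) ≤ k := by
  obtain ⟨n, hn, f, hf, hfo, hf0⟩ := exists_map_of_genus_le hk
  obtain ⟨F, hF, hFo, hFe⟩ := exists_odd_extension hK.isClosed hs hf hfo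
  obtain ⟨ρ, hρ, hsub⟩ := hK.exists_cthickening_subset_open (t := {x | F x ≠ 0})
    (isOpen_ne_fun hF continuous_const) (fun x hx => by
      change F x ≠ 0
      rw [hFe x hx]; exact hf0 x hx)
  refine ⟨ρ, hρ, ?_⟩
  refine (genus_le_of_map hF.continuousOn (fun x _ => hFo x) fun x hx => hsub hx).trans ?_
  exact_mod_cast hn

/-- An arbitrary linear order selects one point of each antipodal pair. The resulting sign is odd,
and it is continuous on the set because the set is finite. -/
theorem genus_le_one_of_finite [NormedSpace ℝ X] {K : Set X} (hK : K.Finite) (h0 : 0 ∉ K) :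
    genus K ≤ 1 := by
  classical
  let _ : LinearOrder X := linearOrderOfSTO WellOrderingRel
  have hne : ∀ x ∈ K, x ≠ -x := by
    intro x hx h
    have h2 : (2 : ℝ) • x = 0 := by rw [two_smul]; nth_rw 2 [h]; simp
    rcases smul_eq_zero.1 h2 with h2 | h2
    · norm_num at h2
    · exact h0 (h2 ▸ hx)
  refine genus_le_of_map (n := 1)
    (h := fun x => if x < -x then WithLp.toLp 2 (fun _ => 1) else WithLp.toLp 2 (fun _ => -1))
    (hK.continuousOn _) (fun x hx => ?_) fun x hx h => ?_
  · rcases lt_or_gt_of_ne (hne x hx) with h | h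
    · simp only [neg_neg, if_pos h, if_neg h.not_gt]
      ext; simp
    · simp only [neg_neg, if_pos h, if_neg h.not_gt]
      ext; simp
  · have := congrArg (fun y : EuclideanSpace ℝ (Fin 1) => y 0) h
    simp only at this
    split_ifs at this <;> simp at this

end Genus

/-! ### An abstract minimax theorem in the presence of an invariant cone -/

namespace Minimax

variable {X : Type*} [NormedAddCommGroup X]

/-- The open `δ`-neighbourhood of `C`. -/
def Pn (C : Set X) (δ : ℝ) : Set X := {u | Metric.infDist u C < δ}

/-- The reflection of `Pn`. -/
def Qn (C : Set X) (δ : ℝ) : Set X := {u | -u ∈ Pn C δ}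

/-- The union of both neighbourhoods. -/
def On (C : Set X) (δ : ℝ) : Set X := Pn C δ ∪ Qn C δ

/-- The common boundary. -/
def Sg (C : Set X) (δ : ℝ) : Set X := frontier (Pn C δ) ∩ frontier (Qn C δ)

/-- The admissible odd maps. -/
def Lam (C : Set X) (δ : ℝ) (I : X → ℝ) : Set (X → X) :=
  {η | Continuous η ∧ (∀ u, η (-u) = - η u) ∧ Set.MapsTo η (Pn C δ) (Pn C δ) ∧
    Set.MapsTo η (Qn C δ) (Qn C δ) ∧ ∀ u, I u < 0 → η u = u}

/-- The minimax classes. -/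
def Gam (C : Set X) (δ : ℝ) (I : X → ℝ) (j : ℕ) : Set (Set X) :=
  {E | IsCompact E ∧ (∀ u, -u ∈ E ↔ u ∈ E) ∧
    ∀ η ∈ Lam C δ I, (j : ℕ∞) ≤ genus (E ∩ η ⁻¹' Sg C δ)}

/-- The minimax levels. -/
def lev (C : Set X) (δ : ℝ) (I : X → ℝ) (j : ℕ) : EReal :=
  ⨅ E ∈ Gam C δ I j, ⨆ u ∈ E \ On C δ, ((I u : ℝ) : EReal)

variable {C : Set X} {δ : ℝ} {I : X → ℝ}

theorem isOpen_Pn : IsOpen (Pn C δ) :=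
  isOpen_lt (Metric.continuous_infDist_pt C) continuous_const

theorem isOpen_Qn : IsOpen (Qn C δ) := isOpen_Pn.preimage continuous_neg

theorem isOpen_On : IsOpen (On C δ) := isOpen_Pn.union isOpen_Qn

theorem neg_mem_Qn {u : X} : -u ∈ Qn C δ ↔ u ∈ Pn C δ := by simp [Qn]

theorem neg_mem_On {u : X} : -u ∈ On C δ ↔ u ∈ On C δ := by
  simp only [On, Set.mem_union, neg_mem_Qn]
  exact or_comm

theorem isClosed_Sg : IsClosed (Sg C δ) := isClosed_frontier.inter isClosed_frontier

theorem mem_frontier_Qn {u : X} : u ∈ frontier (Qn C δ) ↔ -u ∈ frontier (Pn C δ) := by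
  have := (Homeomorph.neg X).preimage_frontier (Pn C δ)
  constructor
  · intro h
    have h' : u ∈ frontier ((Homeomorph.neg X) ⁻¹' Pn C δ) := h
    rw [← this] at h'
    exact h'
  · intro h
    have h' : u ∈ (Homeomorph.neg X) ⁻¹' frontier (Pn C δ) := h
    rw [this] at h'
    exact h'

theorem neg_mem_Sg {u : X} (h : u ∈ Sg C δ) : -u ∈ Sg C δ :=
  ⟨mem_frontier_Qn.1 h.2, mem_frontier_Qn.2 (by rw [neg_neg]; exact h.1)⟩

theorem infDist_of_mem_frontier {u : X} (h : u ∈ frontier (Pn C δ)) : Metric.infDist u C = δ :=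
  frontier_lt_subset_eq (Metric.continuous_infDist_pt C) continuous_const h

theorem infDist_of_mem_Sg {u : X} (h : u ∈ Sg C δ) :
    Metric.infDist u C = δ ∧ Metric.infDist (-u) C = δ :=
  ⟨infDist_of_mem_frontier h.1, infDist_of_mem_frontier (mem_frontier_Qn.1 h.2)⟩

theorem Sg_disjoint_On {u : X} (h : u ∈ Sg C δ) : u ∉ On C δ := by
  obtain ⟨h1, h2⟩ := infDist_of_mem_Sg h
  rintro (h | h)
  · exact absurd h1 (ne_of_lt h)
  · exact absurd h2 (ne_of_lt h)

theorem Lam_comp {η η' : X → X} (h : η ∈ Lam C δ I) (h' : η' ∈ Lam C δ I) :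
    η' ∘ η ∈ Lam C δ I :=
  ⟨h'.1.comp h.1, fun u => by simp only [Function.comp_apply]; rw [h.2.1, h'.2.1],
    h'.2.2.1.comp h.2.2.1, h'.2.2.2.1.comp h.2.2.2.1, fun u hu => by
      simp only [Function.comp_apply]; rw [h.2.2.2.2 u hu, h'.2.2.2.2 u hu]⟩

theorem id_mem_Lam : (id : X → X) ∈ Lam C δ I :=
  ⟨continuous_id, fun _ => rfl, fun _ h => h, fun _ h => h, fun _ _ => rfl⟩

theorem Lam_iterate {η : X → X} (h : η ∈ Lam C δ I) (n : ℕ) : η^[n] ∈ Lam C δ I := by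
  induction n with
  | zero => exact id_mem_Lam
  | succ n ih => rw [Function.iterate_succ']; exact Lam_comp ih h

theorem Gam_antitone {j k : ℕ} (h : j ≤ k) : Gam C δ I k ⊆ Gam C δ I j := fun _ hE =>
  ⟨hE.1, hE.2.1, fun η hη => le_trans (by exact_mod_cast h) (hE.2.2 η hη)⟩

theorem lev_mono : Monotone (lev C δ I) := fun _ _ h => biInf_mono (Gam_antitone h)

theorem lev_le_of_mem {j : ℕ} {E : Set X} (hE : E ∈ Gam C δ I j) {b : ℝ}
    (h : ∀ u ∈ E, u ∉ On C δ → I u ≤ b) : lev C δ I j ≤ (b : EReal) :=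
  (iInf₂_le E hE).trans (iSup₂_le fun u hu => by exact_mod_cast h u hu.1 hu.2)

/-- With the identity as admissible map, every set of the class meets `Sg`, and `Sg` lies outside
`On`. -/
theorem le_lev {j : ℕ} (hj : 1 ≤ j) {κ : ℝ} (h : ∀ u ∈ Sg C δ, κ ≤ I u) :
    (κ : EReal) ≤ lev C δ I j := by
  refine le_iInf₂ fun E hE => ?_
  have h1 := hE.2.2 id id_mem_Lam
  have hne : (E ∩ id ⁻¹' Sg C δ).Nonempty := by
    rw [Set.nonempty_iff_ne_empty]
    intro h0
    have : genus (E ∩ id ⁻¹' Sg C δ) ≤ ((0 : ℕ) : ℕ∞) := by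
      rw [h0]
      exact genus_le_of_map (h := fun _ => 0) continuousOn_const (by simp) (by simp)
    have := h1.trans this
    have : j ≤ 0 := by exact_mod_cast this
    omega
  obtain ⟨u, huE, huS⟩ := hne
  refine le_trans ?_ (le_iSup₂ (f := fun u (_ : u ∈ E \ On C δ) => ((I u : ℝ) : EReal)) u
    ⟨huE, Sg_disjoint_On huS⟩)
  exact_mod_cast h u huS

variable [NormedSpace ℝ X]

theorem infDist_smul_add_le (hC : Convex ℝ C) (hne : C.Nonempty) {u v : X} {s t : ℝ}
    (hs : 0 ≤ s) (ht : 0 ≤ t) (hst : s + t = 1) :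
    Metric.infDist (s • u + t • v) C ≤ s * Metric.infDist u C + t * Metric.infDist v C := by
  refine le_of_forall_pos_le_add fun e he => ?_
  obtain ⟨a, ha, hua⟩ := (Metric.infDist_lt_iff hne).1 (lt_add_of_pos_right (Metric.infDist u C) he)
  obtain ⟨b, hb, hvb⟩ := (Metric.infDist_lt_iff hne).1 (lt_add_of_pos_right (Metric.infDist v C) he)
  refine (Metric.infDist_le_dist_of_mem (hC ha hb hs ht hst)).trans ?_
  calc dist (s • u + t • v) (s • a + t • b) ≤ dist (s • u) (s • a) + dist (t • v) (t • b) :=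
        dist_add_add_le _ _ _ _
    _ = s * dist u a + t * dist v b := by
        rw [dist_smul₀, dist_smul₀, Real.norm_of_nonneg hs, Real.norm_of_nonneg ht]
    _ ≤ s * (Metric.infDist u C + e) + t * (Metric.infDist v C + e) := by gcongr
    _ = s * Metric.infDist u C + t * Metric.infDist v C + e := by
        linear_combination e * hst

theorem convex_Pn (hC : Convex ℝ C) (hne : C.Nonempty) : Convex ℝ (Pn C δ) := by
  intro u hu v hv s t hs ht hst
  refine (infDist_smul_add_le hC hne hs ht hst).trans_lt ?_
  have hu' : Metric.infDist u C < δ := hu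
  have hv' : Metric.infDist v C < δ := hv
  rcases hs.eq_or_lt with rfl | hs'
  · have : t = 1 := by linarith
    subst this; linarith
  · calc s * Metric.infDist u C + t * Metric.infDist v C < s * δ + t * δ :=
          add_lt_add_of_lt_of_le (by gcongr) (by gcongr)
      _ = δ := by rw [← add_mul, hst, one_mul]

/-- Moving from `u` towards a point of `C` strictly decreases the distance to the convex set, so `u`
is a limit of points of `Pn`. -/
theorem mem_frontier_Pn (hC : Convex ℝ C) (hne : C.Nonempty) (hδ : 0 < δ) {u : X}
    (h : Metric.infDist u C = δ) : u ∈ frontier (Pn C δ) := by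
  rw [frontier, isOpen_Pn.interior_eq]
  refine ⟨?_, fun hu => absurd h (ne_of_lt hu)⟩
  obtain ⟨a, ha⟩ := hne
  have hlim : Filter.Tendsto (fun t : ℝ => (1 - t) • u + t • a) (nhdsWithin 0 (Set.Ioi 0))
      (nhds u) := by
    have : Continuous fun t : ℝ => (1 - t) • u + t • a := by fun_prop
    have h := this.tendsto 0
    simp only [sub_zero, one_smul, zero_smul, add_zero] at h
    exact h.mono_left nhdsWithin_le_nhds
  refine mem_closure_of_tendsto hlim ?_
  filter_upwards [Ioo_mem_nhdsGT (zero_lt_one : (0 : ℝ) < 1)] with t ht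
  have := infDist_smul_add_le hC ⟨a, ha⟩ (u := u) (v := a) (s := 1 - t) (t := t)
    (by linarith [ht.2]) ht.1.le (by ring)
  rw [Metric.infDist_zero_of_mem ha, h] at this
  change Metric.infDist _ C < δ
  nlinarith [ht.1]

/-- If the genus were below `j`, an odd map into dimension `n < j` without zeros would exist on the
part of the ball sent into `Sg`. Together with the difference of the distances of `η (L a)` and `-η
(L a)` to `C`, it gives an odd map from dimension `j + 1` into dimension `n + 1`. A zero provided by
Borsuk's theorem on the level where the larger distance is `δ` lies in that part, a contradiction.
-/
theorem mem_Gam_of_linear (hC : Convex ℝ C) (h0 : (0 : X) ∈ C) (hδ : 0 < δ) {j : ℕ}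
    (L : (Fin (j + 1) → ℝ) →L[ℝ] X) {R : ℝ}
    (hR : ∀ a, R ≤ ‖a‖ → I (L a) < 0 ∧ (δ < Metric.infDist (L a) C ∨ δ < Metric.infDist (-L a) C)) :
    L '' Metric.closedBall 0 R ∈ Gam C δ I j := by
  have hE : IsCompact (L '' Metric.closedBall 0 R) := (isCompact_closedBall _ _).image L.continuous
  have hEs : ∀ u, -u ∈ L '' Metric.closedBall 0 R ↔ u ∈ L '' Metric.closedBall 0 R := by
    have : ∀ u, u ∈ L '' Metric.closedBall 0 R → -u ∈ L '' Metric.closedBall 0 R := by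
      rintro u ⟨a, ha, rfl⟩
      exact ⟨-a, by simpa using ha, by simp⟩
    exact fun u => ⟨fun h => by simpa using this _ h, this u⟩
  refine ⟨hE, hEs, fun η hη => ?_⟩
  by_contra hlt
  rw [not_le] at hlt
  set S := L '' Metric.closedBall 0 R ∩ η ⁻¹' Sg C δ with hS
  obtain ⟨g, hg⟩ := ENat.ne_top_iff_exists.1 hlt.ne_top
  obtain ⟨n, hn, h, hh, hho, hh0⟩ := exists_map_of_genus_le hg.ge
  have hgj : g < j := by rw [← hg] at hlt; exact_mod_cast hlt
  have hScl : IsClosed S := hE.isClosed.inter (isClosed_Sg.preimage hη.1)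
  have hSs : ∀ x ∈ S, -x ∈ S := by
    rintro x ⟨hx1, hx2⟩
    refine ⟨(hEs x).2 hx1, ?_⟩
    rw [Set.mem_preimage, hη.2.1]
    exact neg_mem_Sg hx2
  obtain ⟨G, hG, hGo, hGe⟩ := exists_odd_extension hScl hSs hh hho
  have hcp : Continuous fun a => Metric.infDist (η (L a)) C :=
    (Metric.continuous_infDist_pt C).comp (hη.1.comp L.continuous)
  have hcq : Continuous fun a => Metric.infDist (-η (L a)) C :=
    (Metric.continuous_infDist_pt C).comp (hη.1.comp L.continuous).neg
  have hη0 : η 0 = 0 := by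
    have := hη.2.1 0
    rw [neg_zero] at this
    have h2 : (2 : ℝ) • η 0 = 0 := by rw [two_smul]; nth_rw 2 [this]; simp
    exact (smul_eq_zero.1 h2).resolve_left two_ne_zero
  -- Outside radius `R` the functional is negative, so `η` is the identity there and the larger
  -- distance exceeds `δ`. Thus the neighbourhood where it is below `δ` is bounded, whatever `η` is.
  obtain ⟨a, ha1, ha2⟩ := exists_zero_of_odd (n := j + 1) (m := n + 1) (by omega)
    (d := fun a => max (Metric.infDist (η (L a)) C) (Metric.infDist (-η (L a)) C) - δ)
    ((hcp.max hcq).sub continuous_const)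
    (fun a => by rw [map_neg, hη.2.1, neg_neg, max_comm])
    (by
      simp only [map_zero, hη0, neg_zero, max_self, Metric.infDist_zero_of_mem h0]
      linarith)
    (R := R)
    (fun a ha => by
      obtain ⟨h1, h2⟩ := hR a ha
      rw [hη.2.2.2.2 _ h1]
      rw [sub_pos, lt_max_iff]
      exact h2)
    (H := fun a => Fin.snoc (α := fun _ => ℝ) (G (L a))
      (Metric.infDist (η (L a)) C - Metric.infDist (-η (L a)) C))
    (by
      refine continuous_pi fun i => ?_
      refine Fin.lastCases ?_ (fun i => ?_) i
      · simp only [Fin.snoc_last]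
        exact hcp.sub hcq
      · simp only [Fin.snoc_castSucc]
        exact (continuous_apply i).comp ((PiLp.continuous_ofLp 2 _).comp (hG.comp L.continuous)))
    (fun a => by
      funext i
      refine Fin.lastCases ?_ (fun i => ?_) i
      · simp [hη.2.1]
      · simp [hGo])
  have e1 : Metric.infDist (η (L a)) C = Metric.infDist (-η (L a)) C := by
    have := congrFun ha2 (Fin.last n)
    simp only [Fin.snoc_last, Pi.zero_apply] at this
    linarith
  have e2 : Metric.infDist (η (L a)) C = δ := by
    rw [← e1, max_self] at ha1
    linarith
  have e3 : G (L a) = 0 := by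
    ext i
    have := congrFun ha2 i.castSucc
    simpa [Fin.snoc_castSucc] using this
  have hmem : L a ∈ S := by
    refine ⟨⟨a, ?_, rfl⟩, mem_frontier_Pn hC ⟨0, h0⟩ hδ e2,
      mem_frontier_Qn.2 (mem_frontier_Pn hC ⟨0, h0⟩ hδ (e1 ▸ e2))⟩
    rw [mem_closedBall_zero_iff]
    by_contra! hcon
    obtain ⟨h1, h2⟩ := hR a hcon.le
    have h3 := hη.2.2.2.2 _ h1
    rw [h3] at e1 e2
    rcases h2 with h2 | h2
    · linarith
    · rw [← e1] at h2; linarith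
  exact hh0 _ hmem (by rw [← hGe _ hmem, e3])

end Minimax

end

/-! ### Deformation and multiplicity of critical levels -/

noncomputable section

namespace Minimax

open Filter Topology

variable {X : Type*} [NormedAddCommGroup X] [NormedSpace ℝ X]

/-- The hypotheses of the minimax theorem: `A` is an odd continuous map whose fixed points are the
critical points of the even functional `I`, moving from `u` in the direction of `A u` decreases `I`
at a rate controlled by `G u`, and a Palais-Smale condition holds. -/
structure Admissible (C : Set X) (δ : ℝ) (I : X → ℝ) (A : X → X) (G : X → ℝ) : Prop where
  convex : Convex ℝ C
  zero_mem : (0 : X) ∈ C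
  pos : 0 < δ
  continuous_functional : Continuous I
  even : ∀ u, I (-u) = I u
  continuous_map : Continuous A
  odd : ∀ u, A (-u) = - A u
  mapsTo : Set.MapsTo A (Pn C δ) (Pn C δ)
  gap_eq_zero : ∀ u, A u = u → G u = 0
  descent : ∀ R : ℝ, ∀ κ > 0, ∃ t₀ > 0, ∀ u, ‖u‖ ≤ R → ∀ t, 0 ≤ t → t * (1 + ‖u - A u‖) ≤ t₀ →
    I (u - t • (u - A u)) ≤ I u - t * (G u - κ * (1 + ‖u - A u‖))
  palaisSmale : ∀ (c : ℝ) (u : ℕ → X), Tendsto (fun n => I (u n)) atTop (𝓝 c) →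
    (∀ n : ℕ, G (u n) ≤ 1 / ((n : ℝ) + 1) * (1 + ‖u n - A (u n)‖)) →
    ∃ (v : X) (φ : ℕ → ℕ), StrictMono φ ∧ Tendsto (u ∘ φ) atTop (𝓝 v) ∧ A v = v
  pos_on_boundary : ∃ κ > 0, ∀ u ∈ Sg C δ, κ ≤ I u

variable {C : Set X} {δ : ℝ} {I : X → ℝ} {A : X → X} {G : X → ℝ}

variable (C δ I A) in
/-- The fixed points of `A` at level `c` outside `O`. -/
def Kfix (c : ℝ) : Set X := {u | A u = u ∧ I u = c} \ On C δ

namespace Admissible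

variable (h : Admissible C δ I A G)

include h

theorem exists_subseq_of_gap {c : ℝ} {u : ℕ → X}
    (hu : Tendsto (fun n => I (u n)) atTop (𝓝 c)) (hO : ∀ n, u n ∉ On C δ)
    (hG : ∀ n : ℕ, G (u n) ≤ 1 / ((n : ℝ) + 1) * (1 + ‖u n - A (u n)‖)) :
    ∃ v ∈ Kfix C δ I A c, ∃ φ : ℕ → ℕ, StrictMono φ ∧ Tendsto (u ∘ φ) atTop (𝓝 v) := by
  obtain ⟨v, φ, hφ, hv, hA⟩ := h.palaisSmale c u hu hG
  refine ⟨v, ⟨⟨hA, ?_⟩, ?_⟩, φ, hφ, hv⟩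
  · exact tendsto_nhds_unique ((h.continuous_functional.tendsto v).comp hv)
      (hu.comp hφ.tendsto_atTop)
  · exact isOpen_On.isClosed_compl.mem_of_tendsto hv (Eventually.of_forall fun n => hO _)

theorem isCompact_Kfix (c : ℝ) : IsCompact (Kfix C δ I A c) := by
  refine IsSeqCompact.isCompact fun u hu => ?_
  obtain ⟨v, hv, φ, hφ, hlim⟩ := h.exists_subseq_of_gap (c := c) (u := u)
    (by simp only [fun n => (hu n).1.2]; exact tendsto_const_nhds) (fun n => (hu n).2)
    (fun n => by
      rw [h.gap_eq_zero _ (hu n).1.1]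
      positivity)
  exact ⟨v, hv, φ, hφ, hlim⟩

theorem neg_mem_Kfix {c : ℝ} {u : X} (hu : u ∈ Kfix C δ I A c) : -u ∈ Kfix C δ I A c :=
  ⟨⟨by rw [h.odd, hu.1.1], by rw [h.even, hu.1.2]⟩, fun hO => hu.2 (neg_mem_On.1 hO)⟩

/-- A sequence violating this is a Palais-Smale sequence outside `On`. Its limit would be a critical
point at level `c`, yet remain outside the neighbourhood of all of these. -/
theorem exists_gap_bound (c : ℝ) {ρ : ℝ} (hρ : 0 < ρ) :
    ∃ e > 0, ∃ α > 0, ∀ u, u ∉ On C δ → |I u - c| ≤ e →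
      u ∉ Metric.thickening ρ (Kfix C δ I A c) → α * (1 + ‖u - A u‖) ≤ G u := by
  by_contra! hcon
  have hpos : ∀ n : ℕ, (0 : ℝ) < 1 / ((n : ℝ) + 1) := fun n => by positivity
  choose u hO hI hK hG using fun n : ℕ => hcon _ (hpos n) _ (hpos n)
  have hlim : Tendsto (fun n => I (u n)) atTop (𝓝 c) := by
    rw [tendsto_iff_norm_sub_tendsto_zero]
    exact squeeze_zero (fun _ => norm_nonneg _) hI tendsto_one_div_add_atTop_nhds_zero_nat
  obtain ⟨v, hv, φ, hφ, hlimv⟩ := h.exists_subseq_of_gap hlim hO fun n => (hG n).le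
  have : v ∉ Metric.thickening ρ (Kfix C δ I A c) :=
    Metric.isOpen_thickening.isClosed_compl.mem_of_tendsto hlimv
      (Eventually.of_forall fun n => hK _)
  exact this (Metric.self_subset_thickening hρ _ hv)

/-- Both endpoints `u` and `A u` lie in the convex set `Pn`. -/
theorem segment_mem_Pn {u : X} (hu : u ∈ Pn C δ) {t : ℝ} (ht0 : 0 ≤ t) (ht1 : t ≤ 1) :
    u - t • (u - A u) ∈ Pn C δ := by
  have := convex_Pn (δ := δ) h.convex ⟨0, h.zero_mem⟩ hu (h.mapsTo hu) (a := 1 - t) (b := t)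
    (by linarith) ht0 (by ring)
  convert this using 1
  module

/-- A discrete flow replaces the usual gradient flow. One step moves `u` towards `A u` by at most
`τ`, and `n` steps with `n * τ = ρ / 2` are taken. An orbit starting outside the `ρ`-neighbourhood
of the critical set stays outside the `ρ / 2`-neighbourhood, where the gap bound makes each full
step lose at least `τ * α / 2`. Continuity of `A` is enough for this. The step length depends on
`R`, but `e` does not. -/
theorem deformation {c : ℝ} (hc : 0 < c) {ρ : ℝ} (hρ : 0 < ρ) :
    ∃ e > 0, ∀ R : ℝ, ∃ η ∈ Lam C δ I, ∀ u, ‖u‖ ≤ R → I u ≤ c + e → u ∉ On C δ →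
      u ∉ Metric.thickening ρ (Kfix C δ I A c) → η u ∈ On C δ ∨ I (η u) ≤ c - e := by
  obtain ⟨e₀, he₀, α, hα, hgap⟩ := h.exists_gap_bound c (half_pos hρ)
  -- The first bound keeps levels between `c - 2e` and `c + e` in the range of the gap bound. The
  -- second keeps `c - 2e` positive, so that nothing moves where `I < 0`. The third makes the total
  -- descent `α * ρ / 4` at least `2e`.
  set e := min (e₀ / 2) (min (c / 4) (α * ρ / 8)) with he
  have hepos : 0 < e := by positivity
  have he1 : e ≤ e₀ / 2 := min_le_left _ _
  have he2 : e ≤ c / 4 := (min_le_right _ _).trans (min_le_left _ _)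
  have he3 : e ≤ α * ρ / 8 := (min_le_right _ _).trans (min_le_right _ _)
  refine ⟨e, hepos, fun R => ?_⟩
  obtain ⟨t₀, ht₀, hdesc⟩ := h.descent (R + ρ) (α / 2) (by positivity)
  obtain ⟨n, hn⟩ := exists_nat_gt (max 1 ((ρ / 2) / min t₀ 1))
  have hn1 : (1 : ℝ) < n := (le_max_left _ _).trans_lt hn
  have hn0 : (0 : ℝ) < n := by linarith
  set τ := ρ / 2 / n with hτ
  have hτ0 : 0 < τ := by positivity
  have hτm : τ ≤ min t₀ 1 := by
    rw [hτ, div_le_iff₀ hn0, mul_comm, ← div_le_iff₀ (by positivity)]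
    exact ((le_max_right _ _).trans_lt hn).le
  -- The cut-off stops all motion below `c - 2e` and permits full speed above `c - e`.
  let χ : ℝ → ℝ := fun s => max 0 (min 1 ((s - (c - 2 * e)) / e))
  have hχ0 : ∀ s, 0 ≤ χ s := fun s => le_max_left _ _
  have hχ1 : ∀ s, χ s ≤ 1 := fun s => max_le zero_le_one (min_le_left _ _)
  have hχlow : ∀ s, s ≤ c - 2 * e → χ s = 0 := fun s hs => by
    refine max_eq_left ((min_le_right _ _).trans ?_)
    exact div_nonpos_of_nonpos_of_nonneg (by linarith) hepos.le
  have hχhigh : ∀ s, c - e ≤ s → χ s = 1 := fun s hs => by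
    have : 1 ≤ (s - (c - 2 * e)) / e := by rw [le_div_iff₀ hepos]; linarith
    simp only [χ, min_eq_left this]
    norm_num
  have hχc : Continuous χ := by fun_prop
  let t : X → ℝ := fun u => τ * χ (I u) / (1 + ‖u - A u‖)
  have hD : ∀ u, 0 < 1 + ‖u - A u‖ := fun u => by positivity
  have htD : ∀ u, t u * (1 + ‖u - A u‖) = τ * χ (I u) := fun u =>
    div_mul_cancel₀ _ (hD u).ne'
  have ht0 : ∀ u, 0 ≤ t u := fun u => div_nonneg (mul_nonneg hτ0.le (hχ0 _)) (hD u).le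
  have htχ : ∀ u, τ * χ (I u) ≤ τ := fun u => mul_le_of_le_one_right hτ0.le (hχ1 _)
  have ht1 : ∀ u, t u ≤ 1 := fun u => by
    refine (div_le_self (mul_nonneg hτ0.le (hχ0 _)) (by linarith [norm_nonneg (u - A u)])).trans ?_
    exact (htχ u).trans (hτm.trans (min_le_right _ _))
  let σ : X → X := fun u => u - t u • (u - A u)
  have hσodd : ∀ u, σ (-u) = - σ u := by
    intro u
    have e1 : ‖-u - A (-u)‖ = ‖u - A u‖ := by rw [h.odd, ← neg_sub', norm_neg]
    have e2 : t (-u) = t u := by simp only [t, e1, h.even]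
    simp only [σ, e2, h.odd]
    module
  have hσL : σ ∈ Lam C δ I := by
    refine ⟨?_, hσodd, fun u hu => h.segment_mem_Pn hu (ht0 u) (ht1 u), fun u hu => ?_,
      fun u hu => ?_⟩
    · refine continuous_id.sub (Continuous.smul ?_ (continuous_id.sub h.continuous_map))
      refine Continuous.div ?_ ?_ fun u => (hD u).ne'
      · exact continuous_const.mul (hχc.comp h.continuous_functional)
      · exact continuous_const.add (continuous_id.sub h.continuous_map).norm
    · change -σ u ∈ Pn C δ
      rw [← hσodd]
      exact h.segment_mem_Pn hu (ht0 _) (ht1 _)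
    · have : t u = 0 := by
        simp only [t]
        rw [hχlow _ (by linarith)]
        simp
      simp [σ, this]
  have hσO : ∀ u, u ∈ On C δ → σ u ∈ On C δ := by
    rintro u (hu | hu)
    · exact Or.inl (hσL.2.2.1 hu)
    · exact Or.inr (hσL.2.2.2.1 hu)
  have hσd : ∀ u, dist (σ u) u ≤ τ := by
    intro u
    rw [dist_eq_norm, show σ u - u = -(t u • (u - A u)) by simp [σ], norm_neg, norm_smul,
      Real.norm_of_nonneg (ht0 u)]
    calc t u * ‖u - A u‖ ≤ t u * (1 + ‖u - A u‖) :=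
          mul_le_mul_of_nonneg_left (by linarith) (ht0 u)
      _ ≤ τ := by rw [htD]; exact htχ u
  refine ⟨σ^[n], Lam_iterate hσL n, fun w hwR hwI hwO hwK => ?_⟩
  -- Invariant along the orbit: the displacement is controlled, and the point is in `On`, or already
  -- below `c - e`, or has descended by the full amount in every step so far.
  have key : ∀ i : ℕ, i ≤ n → dist (σ^[i] w) w ≤ i * τ ∧ (σ^[i] w ∈ On C δ ∨
      I (σ^[i] w) ≤ c - e ∨ I (σ^[i] w) ≤ c + e - i * (τ * (α / 2))) := by
    intro i
    induction i with
    | zero => intro _; simp [hwI]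
    | succ i ih =>
      intro hi
      obtain ⟨hd, hor⟩ := ih (by omega)
      rw [Function.iterate_succ_apply']
      set u := σ^[i] w with hu
      refine ⟨?_, ?_⟩
      · refine (dist_triangle _ u _).trans ?_
        have := hσd u
        push_cast
        linarith
      · by_cases hO : u ∈ On C δ
        · exact Or.inl (hσO u hO)
        right
        have hor := hor.resolve_left hO
        have hin : (i : ℝ) * τ ≤ ρ / 2 := by
          have : (i : ℝ) ≤ n := by exact_mod_cast (by omega : i ≤ n)
          calc (i : ℝ) * τ ≤ n * τ := by gcongr
            _ = ρ / 2 := by rw [hτ]; field_simp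
        have hdw : dist u w ≤ ρ / 2 := hd.trans hin
        have huR : ‖u‖ ≤ R + ρ := by
          have := norm_le_norm_add_norm_sub' u w
          rw [← dist_eq_norm] at this
          linarith
        have huK : u ∉ Metric.thickening (ρ / 2) (Kfix C δ I A c) := by
          intro hu
          obtain ⟨z, hz, hzd⟩ := Metric.mem_thickening_iff.1 hu
          refine hwK (Metric.mem_thickening_iff.2 ⟨z, hz, ?_⟩)
          have := dist_triangle w u z
          rw [dist_comm w u] at this
          linarith
        have huI : I u ≤ c + e := by
          rcases hor with h1 | h1
          · linarith
          · have : 0 ≤ (i : ℝ) * (τ * (α / 2)) := by positivity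
            linarith
        by_cases hlow : I u ≤ c - 2 * e
        · left
          have : t u = 0 := by
            simp only [t]
            rw [hχlow _ hlow]
            simp
          have : σ u = u := by simp [σ, this]
          rw [this]
          linarith
        · push Not at hlow
          have hG := hgap u hO (abs_le.2 ⟨by linarith, by linarith⟩) huK
          have hd := hdesc u huR (t u) (ht0 u) (by
            rw [htD]; exact (htχ u).trans (hτm.trans (min_le_left _ _)))
          have hdec : I (σ u) ≤ I u - τ * χ (I u) * (α / 2) := by
            refine hd.trans ?_
            rw [← htD]
            have := mul_le_mul_of_nonneg_left hG (ht0 u)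
            nlinarith
          rcases hor with h1 | h1
          · left
            have : 0 ≤ τ * χ (I u) * (α / 2) := by have := hχ0 (I u); positivity
            linarith
          · by_cases h2 : I u ≤ c - e
            · left
              have : 0 ≤ τ * χ (I u) * (α / 2) := by have := hχ0 (I u); positivity
              linarith
            · right
              rw [hχhigh _ (by linarith), mul_one] at hdec
              push_cast
              linarith
  rcases (key n le_rfl).2 with h1 | h1 | h1
  · exact Or.inl h1
  · exact Or.inr h1
  · right
    have : (n : ℝ) * (τ * (α / 2)) = α * ρ / 4 := by rw [hτ]; field_simp; norm_num
    rw [this] at h1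
    linarith

/-- If the critical set had genus at most `k`, so would a small neighbourhood of it. Removing this
neighbourhood from a nearly optimal set for `j + k` costs at most `k` in genus, so the deformed
remainder belongs to the class for `j`. Its supremum outside `On` is at most `c - e`, contradicting
the value of the level `j`. -/
theorem add_one_le_genus {j k : ℕ} (hj : 1 ≤ j) {c : ℝ} (hcj : lev C δ I j = c)
    (hcjk : lev C δ I (j + k) = c) : ((k + 1 : ℕ) : ℕ∞) ≤ genus (Kfix C δ I A c) := by
  by_contra hlt
  rw [not_le] at hlt
  have hK : genus (Kfix C δ I A c) ≤ k := by
    have : genus (Kfix C δ I A c) < (k : ℕ∞) + 1 := by exact_mod_cast hlt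
    exact Order.lt_add_one_iff_of_not_isMax (by simp) |>.1 this
  obtain ⟨κ, hκ, hκS⟩ := h.pos_on_boundary
  have hc : 0 < c := by
    have := le_lev hj hκS
    rw [hcj] at this
    have : κ ≤ c := by exact_mod_cast this
    linarith
  have hKs : ∀ x ∈ Kfix C δ I A c, -x ∈ Kfix C δ I A c := fun x hx => h.neg_mem_Kfix hx
  obtain ⟨ρ, hρ, hgρ⟩ := exists_genus_cthickening_le (h.isCompact_Kfix c) hKs hK
  obtain ⟨e, he, hdef⟩ := h.deformation hc hρ
  have hlt' : lev C δ I (j + k) < ((c + e : ℝ) : EReal) := by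
    rw [hcjk]
    exact_mod_cast lt_add_of_pos_right c he
  obtain ⟨E, hE, hEI⟩ : ∃ E ∈ Gam C δ I (j + k), (⨆ u ∈ E \ On C δ, ((I u : ℝ) : EReal)) <
      ((c + e : ℝ) : EReal) := by
    simpa only [lev, iInf_lt_iff, exists_prop] using hlt'
  have hEI' : ∀ u ∈ E, u ∉ On C δ → I u ≤ c + e := by
    intro u hu hO
    have := (le_iSup₂ (f := fun u (_ : u ∈ E \ On C δ) => ((I u : ℝ) : EReal)) u ⟨hu, hO⟩).trans
      hEI.le
    exact_mod_cast this
  obtain ⟨R, hR⟩ := hE.1.isBounded.exists_norm_le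
  obtain ⟨η, hη, hηd⟩ := hdef R
  set N := Metric.thickening ρ (Kfix C δ I A c) with hN
  have hneg : ∀ r : ℝ, ∀ x, x ∈ Metric.thickening r (Kfix C δ I A c) →
      -x ∈ Metric.thickening r (Kfix C δ I A c) := by
    intro r x hx
    obtain ⟨z, hz, hzd⟩ := Metric.mem_thickening_iff.1 hx
    exact Metric.mem_thickening_iff.2 ⟨-z, hKs z hz, by rwa [dist_neg_neg]⟩
  have hnegc : ∀ x ∈ Metric.cthickening ρ (Kfix C δ I A c),
      -x ∈ Metric.cthickening ρ (Kfix C δ I A c) := by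
    intro x hx
    rw [Metric.cthickening_eq_iInter_thickening hρ.le] at hx ⊢
    simp only [Set.mem_iInter] at hx ⊢
    exact fun r hr => hneg r x (hx r hr)
  have hcomp : IsCompact (E \ N) := hE.1.diff Metric.isOpen_thickening
  have hsymm : ∀ x ∈ E \ N, -x ∈ E \ N := fun x hx =>
    ⟨(hE.2.1 x).2 hx.1, fun hx' => hx.2 (by simpa using hneg ρ _ hx')⟩
  have hmem : η '' (E \ N) ∈ Gam C δ I j := by
    refine ⟨hcomp.image hη.1, ?_, fun η' hη' => ?_⟩
    · have : ∀ u, u ∈ η '' (E \ N) → -u ∈ η '' (E \ N) := by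
        rintro u ⟨x, hx, rfl⟩
        exact ⟨-x, hsymm x hx, hη.2.1 x⟩
      exact fun u => ⟨fun hu => by simpa using this _ hu, this u⟩
    · have hcl : IsClosed ((η' ∘ η) ⁻¹' Sg C δ) := isClosed_Sg.preimage (hη'.1.comp hη.1)
      have hsub : E ∩ (η' ∘ η) ⁻¹' Sg C δ ⊆
          ((E \ N) ∩ (η' ∘ η) ⁻¹' Sg C δ) ∪ Metric.cthickening ρ (Kfix C δ I A c) := by
        intro x hx
        by_cases hxN : x ∈ N
        · exact Or.inr (Metric.thickening_subset_cthickening _ _ hxN)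
        · exact Or.inl ⟨⟨hx.1, hxN⟩, hx.2⟩
      have h1 := genus_union_le (hcomp.isClosed.inter hcl) Metric.isClosed_cthickening
        (fun x hx => ⟨hsymm x hx.1, by
          have e1 := (Lam_comp hη hη').2.1 x
          have : (η' ∘ η) (-x) ∈ Sg C δ := by rw [e1]; exact neg_mem_Sg hx.2
          exact this⟩) hnegc hsub
      have h2 := hE.2.2 _ (Lam_comp hη hη')
      have h3 : genus ((E \ N) ∩ (η' ∘ η) ⁻¹' Sg C δ) ≤ genus (η '' (E \ N) ∩ η' ⁻¹' Sg C δ) :=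
        genus_le_of_mapsTo (f := η) hη.1.continuousOn (fun x _ => hη.2.1 x)
          (fun x hx => ⟨⟨x, hx.1, rfl⟩, hx.2⟩)
      have h4 : (j : ℕ∞) + k ≤ genus (η '' (E \ N) ∩ η' ⁻¹' Sg C δ) + k := by
        calc (j : ℕ∞) + k = ((j + k : ℕ) : ℕ∞) := by push_cast; rfl
          _ ≤ _ := h2
          _ ≤ _ := h1
          _ ≤ _ := add_le_add h3 hgρ
      exact (ENat.add_le_add_iff_right (ENat.natCast_ne_top k)).1 h4
  have hle : lev C δ I j ≤ ((c - e : ℝ) : EReal) := by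
    refine lev_le_of_mem hmem ?_
    rintro _ ⟨x, hx, rfl⟩ hO
    have hxO : x ∉ On C δ := by
      rintro (hx' | hx')
      · exact hO (Or.inl (hη.2.2.1 hx'))
      · exact hO (Or.inr (hη.2.2.2.1 hx'))
    exact (hηd x (hR x hx.1) (hEI' x hx.1 hxO) hxO hx.2).resolve_left hO
  rw [hcj] at hle
  have : c ≤ c - e := by exact_mod_cast hle
  linarith

/-- The lower bound on `Sg` and the upper bound `b` make the level a real number; genus at least 1
excludes the empty set. -/
theorem exists_level {j : ℕ} (hj : 1 ≤ j) {b : ℝ} (hb : lev C δ I j ≤ (b : EReal)) :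
    ∃ c : ℝ, lev C δ I j = (c : EReal) ∧ (Kfix C δ I A c).Nonempty := by
  obtain ⟨κ, hκ, hκS⟩ := h.pos_on_boundary
  have h1 := le_lev hj hκS
  obtain ⟨c, hc⟩ : ∃ c : ℝ, (c : EReal) = lev C δ I j :=
    ⟨_, EReal.coe_toReal (ne_top_of_le_ne_top (EReal.coe_ne_top b) hb)
      (ne_bot_of_le_ne_bot (EReal.coe_ne_bot κ) h1)⟩
  refine ⟨c, hc.symm, ?_⟩
  have h2 := h.add_one_le_genus (k := 0) hj hc.symm hc.symm
  rw [Set.nonempty_iff_ne_empty]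
  intro h0
  rw [h0] at h2
  have h3 : genus (∅ : Set X) ≤ ((0 : ℕ) : ℕ∞) :=
    genus_le_of_map (h := fun _ => 0) continuousOn_const (by simp) (by simp)
  have := h2.trans h3
  have : 0 + 1 ≤ 0 := by exact_mod_cast this
  omega

/-- If the set were finite, the monotone levels would take finitely many values and two consecutive
ones would agree. The critical set there would have genus at least 2, whereas a finite set without
the origin has genus at most 1. -/
theorem infinite_critical {b : ℕ → ℝ} (hb : ∀ j, 1 ≤ j → lev C δ I j ≤ (b j : EReal)) :
    {u : X | ∃ j : ℕ, 1 ≤ j ∧ ∃ c : ℝ, lev C δ I j = (c : EReal) ∧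
      u ∈ Kfix C δ I A c}.Infinite := by
  intro hfin
  choose c hc hne using fun j : ℕ => h.exists_level (Nat.le_add_left 1 j) (hb _ (Nat.le_add_left 1 j))
  have hfr : (Set.range c).Finite := by
    refine (hfin.image I).subset ?_
    rintro _ ⟨j, rfl⟩
    obtain ⟨u, hu⟩ := hne j
    exact ⟨u, ⟨j + 1, Nat.le_add_left 1 j, c j, hc j, hu⟩, hu.1.2⟩
  -- An index realizing the largest level; by monotonicity the next level is the same. The index is
  -- shifted, `c i` being the level number `i + 1`.
  obtain ⟨_, ⟨i, rfl⟩, hmax⟩ := Set.exists_max_image _ id hfr (Set.range_nonempty c)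
  have hi1 : c (i + 1) = c i := by
    refine le_antisymm (hmax _ ⟨i + 1, rfl⟩) ?_
    have : lev C δ I (i + 1) ≤ lev C δ I (i + 1 + 1) := lev_mono (Nat.le_succ _)
    rw [hc, hc] at this
    exact_mod_cast this
  have hg := h.add_one_le_genus (j := i + 1) (k := 1) (Nat.le_add_left 1 i) (hc i)
    (by rw [hc (i + 1), hi1])
  have hK1 : genus (Kfix C δ I A (c i)) ≤ 1 := by
    refine genus_le_one_of_finite (hfin.subset fun u hu =>
      ⟨i + 1, Nat.le_add_left 1 i, c i, hc i, hu⟩) fun h0 => h0.2 (Or.inl ?_)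
    change Metric.infDist 0 C < δ
    rw [Metric.infDist_zero_of_mem h.zero_mem]
    exact h.pos
  have := hg.trans hK1
  have : 1 + 1 ≤ 1 := by exact_mod_cast this
  omega

end Admissible

end Minimax

end

noncomputable section

/-! ### Minimization of uniformly convex functionals -/

namespace ConvexSplit

open Filter Topology

/-- Beyond the crossover point `x₀` the power dominates the linear term; below it the linear term is
at most `|a| * x₀`. -/
theorem exists_mul_le_rpow {p : ℝ} (hp : 1 < p) {c : ℝ} (hc : 0 < c) (a : ℝ) :
    ∃ M, 0 ≤ M ∧ ∀ x, 0 ≤ x → ∀ b, b ≤ a → b * x ≤ c * x ^ p + M := by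
  set x₀ := (|a| / c) ^ (1 / (p - 1)) with hx₀
  have hx₀0 : 0 ≤ x₀ := by positivity
  refine ⟨|a| * x₀, by positivity, fun x hx b hb => ?_⟩
  have hb' : b * x ≤ |a| * x := mul_le_mul_of_nonneg_right (hb.trans (le_abs_self a)) hx
  refine hb'.trans ?_
  rcases le_or_gt x x₀ with h | h
  · have : 0 ≤ c * x ^ p := by positivity
    have := mul_le_mul_of_nonneg_left h (abs_nonneg a)
    linarith
  · have hx0 : 0 < x := hx₀0.trans_lt h
    have h1 : |a| / c ≤ x ^ (p - 1) := by
      calc |a| / c = x₀ ^ (p - 1) := by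
            rw [hx₀, ← Real.rpow_mul (by positivity), one_div,
              inv_mul_cancel₀ (by linarith), Real.rpow_one]
        _ ≤ x ^ (p - 1) := Real.rpow_le_rpow hx₀0 h.le (by linarith)
    have h2 : x ^ p = x ^ (p - 1) * x := by
      rw [← Real.rpow_add_one hx0.ne']; congr 1; ring
    rw [div_le_iff₀ hc] at h1
    have h3 : |a| * x ≤ c * x ^ p := by
      rw [h2]
      calc |a| * x ≤ (x ^ (p - 1) * c) * x := mul_le_mul_of_nonneg_right h1 hx
        _ = _ := by ring
    have : 0 ≤ |a| * x₀ := by positivity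
    linarith

theorem exists_bound_of_rpow_le {p : ℝ} (hp : 1 < p) (a b : ℝ) :
    ∃ M, ∀ x, 0 ≤ x → x ^ p ≤ a + b * x → x ≤ M := by
  obtain ⟨M, hM0, hM⟩ := exists_mul_le_rpow hp (c := 1 / 2) (by norm_num) b
  refine ⟨(2 * (|a| + M)) ^ (1 / p), fun x hx h => ?_⟩
  have h1 := hM x hx b le_rfl
  have h2 : x ^ p ≤ 2 * (|a| + M) := by linarith [le_abs_self a]
  calc x = (x ^ p) ^ (1 / p) := by
        rw [← Real.rpow_mul hx, mul_one_div_cancel (by linarith), Real.rpow_one]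
    _ ≤ _ := Real.rpow_le_rpow (by positivity) h2 (by positivity)

theorem tendsto_zero_of_rpow {p : ℝ} (hp : 0 < p) {x : ℕ → ℝ} (hx : ∀ n, 0 ≤ x n)
    (h : ∀ ε > 0, ∀ᶠ n in atTop, x n ^ p ≤ ε) : Tendsto x atTop (𝓝 0) := by
  rw [Metric.tendsto_nhds]
  intro ε hε
  filter_upwards [h ((ε / 2) ^ p) (by positivity)] with n hn
  rw [Real.dist_0_eq_abs, abs_of_nonneg (hx n)]
  have := (Real.rpow_le_rpow_iff (hx n) (by positivity) hp).1 hn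
  linarith

variable {X : Type*} [NormedAddCommGroup X] [NormedSpace ℝ X]

/-- A continuous, even, convex functional that is uniformly convex and coercive at the scale of
`‖u‖ ^ p`. -/
structure UniformlyConvex (p : ℝ) (J : X → ℝ) : Prop where
  one_lt : 1 < p
  continuous : Continuous J
  convex : ConvexOn ℝ Set.univ J
  even : ∀ u, J (-u) = J u
  gap : ∀ η > 0, ∃ K, 0 ≤ K ∧ ∀ u v : X, ‖u - v‖ ^ p ≤ η * (‖u‖ ^ p + ‖v‖ ^ p) +
    K * (J u / 2 + J v / 2 - J ((1 / 2 : ℝ) • (u + v)))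
  coercive : ∃ c > 0, ∀ u, c * ‖u‖ ^ p ≤ J u

namespace UniformlyConvex

variable {p : ℝ} {J : X → ℝ} (h : UniformlyConvex p J)

include h

/-- A linear term does not change the midpoint gap, and at the midpoint `J - l` is at least `m`. The
gap is therefore controlled by the excesses of `u` and `v` over `m`, so that almost minimizers are
close to each other, with a constant independent of `l`. -/
theorem gap_linear {η : ℝ} (hη : 0 < η) : ∃ K, 0 ≤ K ∧ ∀ (l : X →L[ℝ] ℝ) (u v : X) (m : ℝ),
    (∀ w, m ≤ J w - l w) →
    ‖u - v‖ ^ p ≤ η * (‖u‖ ^ p + ‖v‖ ^ p) + K * ((J u - l u - m) + (J v - l v - m)) := by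
  obtain ⟨K, hK, hgap⟩ := h.gap η hη
  refine ⟨K / 2, by positivity, fun l u v m hm => (hgap u v).trans ?_⟩
  have h1 := hm ((1 / 2 : ℝ) • (u + v))
  simp only [map_smul, map_add, smul_eq_mul] at h1
  have h2 : J u / 2 + J v / 2 - J ((1 / 2 : ℝ) • (u + v)) ≤
      ((J u - l u - m) + (J v - l v - m)) / 2 := by linarith
  have := mul_le_mul_of_nonneg_left h2 hK
  linarith

theorem exists_norm_bound (a b : ℝ) : ∃ B, 0 ≤ B ∧ ∀ (l : X →L[ℝ] ℝ) (u : X), ‖l‖ ≤ a →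
    J u - l u ≤ b → ‖u‖ ^ p ≤ B := by
  obtain ⟨c, hc, hcJ⟩ := h.coercive
  obtain ⟨M, hM0, hM⟩ := exists_mul_le_rpow h.one_lt (half_pos hc) a
  refine ⟨2 / c * (|b| + M), by positivity, fun l u hl hu => ?_⟩
  have h1 := hM ‖u‖ (norm_nonneg _) ‖l‖ hl
  have h2 := hcJ u
  have h3 := (le_abs_self _).trans (l.le_opNorm u)
  have h4 : c / 2 * ‖u‖ ^ p ≤ |b| + M := by linarith [le_abs_self b]
  calc ‖u‖ ^ p = 2 / c * (c / 2 * ‖u‖ ^ p) := by field_simp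
    _ ≤ _ := by gcongr

/-- Minimizing sequences are Cauchy by `gap_linear`, so no weak compactness is used. -/
theorem exists_minimizer [CompleteSpace X] (l : X →L[ℝ] ℝ) : ∃ v, ∀ w, J v - l v ≤ J w - l w := by
  have hp0 : 0 < p := by linarith [h.one_lt]
  obtain ⟨c, hc, hcJ⟩ := h.coercive
  obtain ⟨M, hM0, hM⟩ := exists_mul_le_rpow h.one_lt hc ‖l‖
  set f : X → ℝ := fun w => J w - l w with hf
  have hbdd : BddBelow (Set.range f) := by
    refine ⟨-M, ?_⟩
    rintro _ ⟨w, rfl⟩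
    have h1 := hM ‖w‖ (norm_nonneg _) _ le_rfl
    have h3 := (le_abs_self _).trans (l.le_opNorm w)
    have := hcJ w
    simp only [f]
    linarith
  set m := sInf (Set.range f) with hm
  have hmle : ∀ w, m ≤ f w := fun w => csInf_le hbdd ⟨w, rfl⟩
  have hex : ∀ n : ℕ, ∃ w, f w < m + 1 / ((n : ℝ) + 1) := by
    intro n
    obtain ⟨_, ⟨w, rfl⟩, hw⟩ := exists_lt_of_csInf_lt (Set.range_nonempty f)
      (lt_add_of_pos_right m (by positivity : (0 : ℝ) < 1 / ((n : ℝ) + 1)))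
    exact ⟨w, hw⟩
  choose w hw using hex
  have hwle : ∀ n, f (w n) ≤ m + 1 := fun n => (hw n).le.trans (by
    have : 1 / ((n : ℝ) + 1) ≤ 1 := by
      rw [div_le_one (by positivity)]; linarith [(Nat.cast_nonneg n : (0 : ℝ) ≤ n)]
    linarith)
  obtain ⟨B, hB0, hB⟩ := h.exists_norm_bound ‖l‖ (m + 1)
  have hcau : CauchySeq w := by
    rw [Metric.cauchySeq_iff']
    intro ε hε
    have hεp : 0 < (ε / 2) ^ p := by positivity
    -- As `B` bounds the `p`-th powers of the norms, this `η` makes the first term at most half of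
    -- `(ε / 2) ^ p`; the choice of `N` does the same for the second.
    obtain ⟨K, hK, hgap⟩ := h.gap_linear (η := (ε / 2) ^ p / (4 * (B + 1))) (by positivity)
    obtain ⟨N, hN⟩ := exists_nat_gt (4 * K / (ε / 2) ^ p)
    refine ⟨N, fun n hn => ?_⟩
    have h1 := hgap l (w n) (w N) m hmle
    have hsmall : ∀ k, N ≤ k → f (w k) - m ≤ 1 / ((N : ℝ) + 1) := fun k hk => by
      have : 1 / ((k : ℝ) + 1) ≤ 1 / ((N : ℝ) + 1) := by gcongr
      linarith [hw k]
    have h2 : K * (f (w n) - m + (f (w N) - m)) ≤ (ε / 2) ^ p / 2 := by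
      have hN' : K / ((N : ℝ) + 1) ≤ (ε / 2) ^ p / 4 := by
        rw [div_lt_iff₀ hεp] at hN
        rw [div_le_iff₀ (by positivity)]
        nlinarith
      calc K * (f (w n) - m + (f (w N) - m)) ≤ K * (1 / ((N : ℝ) + 1) + 1 / ((N : ℝ) + 1)) := by
            gcongr
            exacts [hsmall n hn, hsmall N le_rfl]
        _ = 2 * (K / ((N : ℝ) + 1)) := by ring
        _ ≤ _ := by linarith
    have h3 : (ε / 2) ^ p / (4 * (B + 1)) * (‖w n‖ ^ p + ‖w N‖ ^ p) ≤ (ε / 2) ^ p / 2 := by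
      have e1 := hB l (w n) le_rfl (hwle n)
      have e2 := hB l (w N) le_rfl (hwle N)
      calc _ ≤ (ε / 2) ^ p / (4 * (B + 1)) * (2 * (B + 1)) := by gcongr; linarith
        _ = _ := by field_simp; norm_num
    have h4 : ‖w n - w N‖ ^ p ≤ (ε / 2) ^ p := by linarith
    have h5 := (Real.rpow_le_rpow_iff (norm_nonneg _) (by positivity) hp0).1 h4
    rw [dist_eq_norm]
    linarith
  obtain ⟨v, hv⟩ := cauchySeq_tendsto_of_complete hcau
  refine ⟨v, fun x => ?_⟩
  have hfc : Continuous f := h.continuous.sub l.continuous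
  have h1 : Tendsto (fun n => f (w n)) atTop (𝓝 (f v)) := (hfc.tendsto v).comp hv
  have h2 : f v ≤ m := by
    have h3 : Tendsto (fun n : ℕ => m + 1 / ((n : ℝ) + 1)) atTop (𝓝 (m + 0)) :=
      tendsto_const_nhds.add tendsto_one_div_add_atTop_nhds_zero_nat
    rw [add_zero] at h3
    exact le_of_tendsto_of_tendsto' h1 h3 fun n => (hw n).le
  exact h2.trans (hmle x)

theorem minimizer_unique {l : X →L[ℝ] ℝ} {u v : X} (hu : ∀ w, J u - l u ≤ J w - l w)
    (hv : ∀ w, J v - l v ≤ J w - l w) : u = v := by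
  have hp0 : 0 < p := by linarith [h.one_lt]
  have heq : J u - l u = J v - l v := le_antisymm (hu v) (hv u)
  have hle : ∀ η > 0, ‖u - v‖ ^ p ≤ η * (‖u‖ ^ p + ‖v‖ ^ p) := fun η hη => by
    obtain ⟨K, hK, hg⟩ := h.gap_linear hη
    have := hg l u v _ hv
    rw [heq] at this
    simpa using this
  have h0 : ‖u - v‖ ^ p ≤ 0 := by
    refine le_of_forall_pos_le_add fun ε hε => ?_
    refine (hle (ε / (‖u‖ ^ p + ‖v‖ ^ p + 1)) (by positivity)).trans ?_
    rw [zero_add, div_mul_eq_mul_div, div_le_iff₀ (by positivity)]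
    nlinarith
  have h1 : ‖u - v‖ = 0 := by
    by_contra hne
    have : 0 < ‖u - v‖ ^ p := Real.rpow_pos_of_pos (lt_of_le_of_ne (norm_nonneg _) (Ne.symm hne)) p
    linarith
  exact sub_eq_zero.1 (norm_eq_zero.1 h1)

end UniformlyConvex

end ConvexSplit

end

/-! ### The solution operator and compact perturbations of convex functionals -/

noncomputable section

namespace ConvexSplit

open Filter Topology

variable {X : Type*} [NormedAddCommGroup X] [NormedSpace ℝ X]

namespace UniformlyConvex

variable {p : ℝ} {J : X → ℝ} (h : UniformlyConvex p J)

/-- The minimizer of `J - l`. -/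
def solve [CompleteSpace X] (l : X →L[ℝ] ℝ) : X := (h.exists_minimizer l).choose

theorem solve_spec [CompleteSpace X] (l : X →L[ℝ] ℝ) (w : X) :
    J (h.solve l) - l (h.solve l) ≤ J w - l w := (h.exists_minimizer l).choose_spec w

theorem solve_unique [CompleteSpace X] {l : X →L[ℝ] ℝ} {u : X}
    (hu : ∀ w, J u - l u ≤ J w - l w) : h.solve l = u :=
  h.minimizer_unique (h.solve_spec l) hu

theorem solve_neg [CompleteSpace X] (l : X →L[ℝ] ℝ) : h.solve (-l) = - h.solve l := by
  refine h.solve_unique fun w => ?_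
  have := h.solve_spec l (-w)
  simpa [h.even] using this

/-- The minimizer for `l'` almost minimizes `J - l`: its excess is at most `(l' - l) (u - v)`, where
`u` and `v` are the two minimizers. The norms being bounded, `gap_linear` concludes. -/
theorem continuous_solve [CompleteSpace X] : Continuous h.solve := by
  have hp0 : 0 < p := by linarith [h.one_lt]
  rw [Metric.continuous_iff]
  intro l ε hε
  have hεp : 0 < (ε / 2) ^ p := by positivity
  obtain ⟨B, hB0, hB⟩ := h.exists_norm_bound (‖l‖ + 1) (J 0)
  have hBl : ∀ l' : X →L[ℝ] ℝ, ‖l'‖ ≤ ‖l‖ + 1 → ‖h.solve l'‖ ^ p ≤ B := fun l' hl' =>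
    hB l' _ hl' (by simpa using h.solve_spec l' 0)
  have hBl' : ∀ l' : X →L[ℝ] ℝ, ‖l'‖ ≤ ‖l‖ + 1 → ‖h.solve l'‖ ≤ B ^ (1 / p) := fun l' hl' => by
    calc ‖h.solve l'‖ = (‖h.solve l'‖ ^ p) ^ (1 / p) := by
          rw [← Real.rpow_mul (norm_nonneg _), mul_one_div_cancel hp0.ne', Real.rpow_one]
      _ ≤ _ := Real.rpow_le_rpow (by positivity) (hBl l' hl') (by positivity)
  set b := B ^ (1 / p) with hb
  have hb0 : 0 ≤ b := by positivity
  obtain ⟨K, hK, hgap⟩ := h.gap_linear (η := (ε / 2) ^ p / (4 * (B + 1))) (by positivity)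
  refine ⟨min 1 ((ε / 2) ^ p / (4 * (K + 1) * (b + 1))), by positivity, fun l' hl' => ?_⟩
  rw [dist_eq_norm] at hl'
  have hl1 : ‖l' - l‖ ≤ 1 := hl'.le.trans (min_le_left _ _)
  have hl2 : ‖l' - l‖ ≤ (ε / 2) ^ p / (4 * (K + 1) * (b + 1)) := hl'.le.trans (min_le_right _ _)
  have hln : ‖l'‖ ≤ ‖l‖ + 1 := by
    have := norm_le_norm_add_norm_sub' l' l
    linarith
  set u := h.solve l' with hu
  set v := h.solve l with hv
  have h1 := hgap l u v _ (h.solve_spec l)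
  have h2 : (J u - l u - (J v - l v)) ≤ ‖l' - l‖ * (2 * b) := by
    have e1 := h.solve_spec l' v
    have e2 : J u - l u - (J v - l v) ≤ (l' - l) (u - v) := by
      simp only [sub_apply, map_sub]
      linarith
    refine e2.trans (((le_abs_self _).trans ((l' - l).le_opNorm _)).trans ?_)
    gcongr
    refine (norm_sub_le _ _).trans ?_
    have e3 := hBl' l' hln
    have e4 := hBl' l (by linarith)
    linarith
  have h3 : K * (J u - l u - (J v - l v) + (J v - l v - (J v - l v))) ≤ (ε / 2) ^ p / 2 := by
    rw [sub_self, add_zero]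
    calc K * (J u - l u - (J v - l v)) ≤ (K + 1) * (‖l' - l‖ * (2 * (b + 1))) := by
          refine (mul_le_mul_of_nonneg_left h2 hK).trans ?_
          gcongr <;> linarith
      _ ≤ (K + 1) * ((ε / 2) ^ p / (4 * (K + 1) * (b + 1)) * (2 * (b + 1))) := by gcongr
      _ = _ := by field_simp; norm_num
  have h4 : (ε / 2) ^ p / (4 * (B + 1)) * (‖u‖ ^ p + ‖v‖ ^ p) ≤ (ε / 2) ^ p / 2 := by
    have e1 := hBl l' hln
    have e2 := hBl l (by linarith)
    calc _ ≤ (ε / 2) ^ p / (4 * (B + 1)) * (2 * (B + 1)) := by gcongr; linarith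
      _ = _ := by field_simp; norm_num
  have h5 : ‖u - v‖ ^ p ≤ (ε / 2) ^ p := by linarith
  have h6 := (Real.rpow_le_rpow_iff (norm_nonneg _) (by positivity) hp0).1 h5
  rw [dist_eq_norm]
  linarith

end UniformlyConvex

/-- A convex function lies above its tangents: the chord slope bounds the difference quotients along
the segment, which tend to the derivative. -/
theorem le_of_convexOn_of_hasFDerivAt {J : X → ℝ} (hJ : ConvexOn ℝ Set.univ J) {u : X}
    {l : X →L[ℝ] ℝ} (hl : HasFDerivAt J l u) (w : X) : J u - l u ≤ J w - l w := by
  have h1 : HasDerivAt (fun t : ℝ => J (u + t • (w - u))) (l (w - u)) 0 :=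
    hl.hasLineDerivAt (w - u)
  have h2 := (hasDerivAt_iff_tendsto_slope.1 h1).mono_left
    (nhdsWithin_mono 0 (fun x (hx : 0 < x) => hx.ne') : 𝓝[>] (0 : ℝ) ≤ 𝓝[≠] 0)
  have h3 : l (w - u) ≤ J w - J u := by
    refine le_of_tendsto h2 ?_
    filter_upwards [Ioo_mem_nhdsGT (zero_lt_one : (0 : ℝ) < 1)] with t ht
    rw [slope_def_field, zero_smul, add_zero, sub_zero, div_le_iff₀ ht.1]
    have := hJ.2 (Set.mem_univ u) (Set.mem_univ w) (by linarith [ht.2] : (0 : ℝ) ≤ 1 - t)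
      ht.1.le (by ring)
    have e : (1 - t) • u + t • w = u + t • (w - u) := by module
    rw [e, smul_eq_mul, smul_eq_mul] at this
    linarith
  rw [map_sub] at h3
  linarith

/-- A functional `J - Φ` with `J` uniformly convex and `Φ` a superlinear functional with compact
derivative. -/
structure Split {Z : Type*} [NormedAddCommGroup Z] [NormedSpace ℝ Z] (p r : ℝ) (J Φ : X → ℝ)
    (dΦ : X → X →L[ℝ] ℝ) (ι : X →L[ℝ] Z) (Ψ : Z → X →L[ℝ] ℝ) : Prop where
  uc : UniformlyConvex p J
  hasFDerivAt : ∀ u, HasFDerivAt Φ (dΦ u) u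
  even : ∀ u, Φ (-u) = Φ u
  odd : ∀ u, dΦ (-u) = - dΦ u
  compact : IsCompactOperator ι
  continuous : Continuous Ψ
  factor : ∀ u, dΦ u = Ψ (ι u)
  superlinear : ∀ u, r * Φ u ≤ dΦ u u
  r_pos : 0 < r
  scaling : ∃ s > 0, ∃ c > 0, ∃ K, ∀ u, c * ‖u‖ ^ p - K ≤ (1 + s * r) * J u - J ((1 + s) • u)

namespace Split

variable {Z : Type*} [NormedAddCommGroup Z] [NormedSpace ℝ Z] {p r : ℝ} {J Φ : X → ℝ}
  {dΦ : X → X →L[ℝ] ℝ} {ι : X →L[ℝ] Z} {Ψ : Z → X →L[ℝ] ℝ} (h : Split p r J Φ dΦ ι Ψ)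

/-- The auxiliary operator `A`: `A u` minimizes `J - Φ'(u)`. -/
def op [CompleteSpace X] (u : X) : X := h.uc.solve (dΦ u)

/-- The gap between `u` and the minimizer `A u`. -/
def gap [CompleteSpace X] (u : X) : ℝ := J u - J (h.op u) - dΦ u (u - h.op u)

include h

theorem continuous_deriv : Continuous dΦ := by
  rw [show dΦ = Ψ ∘ ι from funext h.factor]
  exact h.continuous.comp ι.continuous

theorem continuous_op [CompleteSpace X] : Continuous h.op :=
  h.uc.continuous_solve.comp h.continuous_deriv

theorem op_neg [CompleteSpace X] (u : X) : h.op (-u) = - h.op u := by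
  rw [op, h.odd, h.uc.solve_neg, op]

theorem op_spec [CompleteSpace X] (u w : X) : J (h.op u) - dΦ u (h.op u) ≤ J w - dΦ u w :=
  h.uc.solve_spec (dΦ u) w

/-- Minimality of `op u` makes the gap the largest value of the left side over `w`, so every test
point gives a lower bound for it. -/
theorem le_gap [CompleteSpace X] (u w : X) : J u - J w - dΦ u (u - w) ≤ h.gap u := by
  have := h.op_spec u w
  simp only [gap, map_sub]
  linarith

theorem gap_nonneg [CompleteSpace X] (u : X) : 0 ≤ h.gap u := by
  simpa using h.le_gap u u

theorem continuous_functional : Continuous fun u => J u - Φ u :=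
  h.uc.continuous.sub (continuous_iff_continuousAt.2 fun u => (h.hasFDerivAt u).continuousAt)

theorem exists_compact (R : ℝ) : ∃ K : Set Z, IsCompact K ∧ ∀ u, ‖u‖ ≤ R → ι u ∈ K := by
  obtain ⟨K, hK, hsub⟩ := h.compact.image_closedBall_subset_compact (f := ι.toLinearMap) R
  exact ⟨K, hK, fun u hu => hsub ⟨u, by simpa using hu, rfl⟩⟩

/-- The compact operator `ι` sends bounded sets into a compact set, on which `Ψ` is uniformly
continuous. Uniformity on balls is what lets the step length in `descent` depend on `R` only. -/
theorem uniformContinuous_deriv (R : ℝ) {κ : ℝ} (hκ : 0 < κ) :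
    ∃ t > 0, ∀ u y, ‖u‖ ≤ R → ‖y - u‖ ≤ t → ‖dΦ y - dΦ u‖ ≤ κ := by
  obtain ⟨K, hK, hmem⟩ := h.exists_compact (R + 1)
  obtain ⟨t, ht, hu⟩ := Metric.uniformContinuousOn_iff.1
    (hK.uniformContinuousOn_of_continuous h.continuous.continuousOn) κ hκ
  refine ⟨min 1 (t / 2 / (‖ι‖ + 1)), by positivity, fun u y hu' hy => ?_⟩
  have h1 : ‖y - u‖ ≤ 1 := hy.trans (min_le_left _ _)
  have h2 : ‖y - u‖ ≤ t / 2 / (‖ι‖ + 1) := hy.trans (min_le_right _ _)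
  have h3 : ‖y‖ ≤ R + 1 := by
    have := norm_le_norm_add_norm_sub' y u
    linarith
  have h4 : dist (ι y) (ι u) < t := by
    rw [dist_eq_norm, ← map_sub]
    calc ‖ι (y - u)‖ ≤ ‖ι‖ * ‖y - u‖ := ι.le_opNorm _
      _ ≤ (‖ι‖ + 1) * (t / 2 / (‖ι‖ + 1)) := by gcongr; linarith
      _ = t / 2 := by field_simp
      _ < t := by linarith
  have := hu _ (hmem y h3) _ (hmem u (by linarith)) h4
  rw [h.factor, h.factor, ← dist_eq_norm]
  exact this.le

/-- Convexity bounds `J` along the segment to `op u`. For `Φ` the mean value inequality applies, its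
derivative varying by at most `κ` over a short step. -/
theorem descent [CompleteSpace X] (R : ℝ) {κ : ℝ} (hκ : 0 < κ) :
    ∃ t₀ > 0, ∀ u, ‖u‖ ≤ R → ∀ t, 0 ≤ t → t * (1 + ‖u - h.op u‖) ≤ t₀ →
      J (u - t • (u - h.op u)) - Φ (u - t • (u - h.op u)) ≤
        J u - Φ u - t * (h.gap u - κ * (1 + ‖u - h.op u‖)) := by
  obtain ⟨t₀, ht₀, huc⟩ := h.uniformContinuous_deriv R hκ
  refine ⟨min t₀ 1, by positivity, fun u hu t ht htD => ?_⟩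
  set w := u - h.op u with hw
  have htD1 : t * (1 + ‖w‖) ≤ 1 := htD.trans (min_le_right _ _)
  have htD0 : t * (1 + ‖w‖) ≤ t₀ := htD.trans (min_le_left _ _)
  have htw : t * ‖w‖ ≤ t₀ := le_trans (by nlinarith) htD0
  have ht1 : t ≤ 1 := le_trans (by nlinarith [norm_nonneg w]) htD1
  have hJ : J (u - t • w) ≤ (1 - t) * J u + t * J (h.op u) := by
    have := h.uc.convex.2 (Set.mem_univ u) (Set.mem_univ (h.op u))
      (by linarith : (0 : ℝ) ≤ 1 - t) ht (by ring)
    have e : (1 - t) • u + t • h.op u = u - t • w := by rw [hw]; module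
    rwa [e, smul_eq_mul, smul_eq_mul] at this
  have hΦ : ‖Φ (u - t • w) - Φ u - dΦ u (u - t • w - u)‖ ≤ κ * ‖u - t • w - u‖ := by
    refine (convex_closedBall u t₀).norm_image_sub_le_of_norm_hasFDerivWithin_le'
      (fun x _ => (h.hasFDerivAt x).hasFDerivWithinAt) (fun x hx => ?_)
      (Metric.mem_closedBall_self ht₀.le) ?_
    · exact huc u x hu (by rwa [← dist_eq_norm])
    · rw [Metric.mem_closedBall, dist_eq_norm, sub_sub_cancel_left, norm_neg, norm_smul,
        Real.norm_of_nonneg ht]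
      exact htw
  rw [sub_sub_cancel_left, norm_neg, norm_smul, Real.norm_of_nonneg ht, map_neg, map_smul,
    smul_eq_mul] at hΦ
  have h2 := (abs_le.1 hΦ).1
  have h3 : h.gap u = J u - J (h.op u) - dΦ u w := rfl
  rw [h3]
  have h4 : 0 ≤ t * κ := by positivity
  nlinarith

/-- Test the gap with `(1 + s) • u`. Superlinearity replaces `dΦ u u` by `r * Φ u`, and the scaling
hypothesis on `J` leaves a multiple of `‖u‖ ^ p` up to constants and the value of the functional.
The second estimate then follows from uniform convexity. -/
theorem coercive_gap [CompleteSpace X] (b : ℝ) : ∃ K₁ K₂ : ℝ, 0 ≤ K₁ ∧ 0 ≤ K₂ ∧ ∀ u,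
    J u - Φ u ≤ b → ‖u‖ ^ p ≤ K₁ * h.gap u + K₂ ∧ ‖u - h.op u‖ ^ p ≤ K₁ * h.gap u + K₂ := by
  have hp1 := h.uc.one_lt
  have hp0 : 0 < p := by linarith
  obtain ⟨s, hs, c, hc, K, hK⟩ := h.scaling
  have hr := h.r_pos
  have key1 : ∀ u, J u - Φ u ≤ b → ‖u‖ ^ p ≤ 1 / c * h.gap u + (|K| + s * r * |b|) / c := by
    intro u hu
    have h1 := h.le_gap u ((1 + s) • u)
    have e : u - (1 + s) • u = -(s • u) := by module
    rw [e, map_neg, map_smul, smul_eq_mul] at h1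
    have h2 := mul_le_mul_of_nonneg_left (h.superlinear u) hs.le
    have h3 := hK u
    have h4 : s * r * (J u - Φ u) ≤ s * r * |b| := by
      gcongr
      exact hu.trans (le_abs_self b)
    have h5 : c * ‖u‖ ^ p ≤ h.gap u + (|K| + s * r * |b|) := by
      have := le_abs_self K
      nlinarith
    calc ‖u‖ ^ p = 1 / c * (c * ‖u‖ ^ p) := by field_simp
      _ ≤ 1 / c * (h.gap u + (|K| + s * r * |b|)) := by gcongr
      _ = _ := by ring
  have h2p : (0 : ℝ) < 2 ^ p := by positivity
  -- With this `η`, the term in `‖op u‖ ^ p` contributes at most half of `‖u - op u‖ ^ p` and is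
  -- absorbed on the left.
  obtain ⟨C, hC, hgap⟩ := h.uc.gap_linear (η := 1 / (2 * 2 ^ p)) (by positivity)
  have key2 : ∀ u, ‖u - h.op u‖ ^ p ≤ 2 * ‖u‖ ^ p + 2 * C * h.gap u := by
    intro u
    have h1 := hgap (dΦ u) u (h.op u) _ (h.op_spec u)
    have h2 : ‖h.op u‖ ^ p ≤ 2 ^ p * (‖u‖ ^ p + ‖u - h.op u‖ ^ p) := by
      have e1 : ‖h.op u‖ ≤ 2 * max ‖u‖ ‖u - h.op u‖ := by
        have := norm_sub_le u (u - h.op u)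
        rw [sub_sub_cancel] at this
        linarith [le_max_left ‖u‖ ‖u - h.op u‖, le_max_right ‖u‖ ‖u - h.op u‖]
      calc ‖h.op u‖ ^ p ≤ (2 * max ‖u‖ ‖u - h.op u‖) ^ p := by gcongr
        _ = 2 ^ p * (max ‖u‖ ‖u - h.op u‖) ^ p := by
            rw [Real.mul_rpow (by norm_num) (by positivity)]
        _ ≤ _ := by
            gcongr
            have a1 : 0 ≤ ‖u‖ ^ p := by positivity
            have a2 : 0 ≤ ‖u - h.op u‖ ^ p := by positivity
            rcases max_cases ‖u‖ ‖u - h.op u‖ with ⟨e, _⟩ | ⟨e, _⟩ <;> rw [e] <;> linarith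
    have h3 : 1 / (2 * 2 ^ p) * (‖u‖ ^ p + ‖h.op u‖ ^ p) ≤
        ‖u‖ ^ p + 1 / 2 * ‖u - h.op u‖ ^ p := by
      have e1 : (1 : ℝ) ≤ 2 ^ p := Real.one_le_rpow (by norm_num) hp0.le
      have e2 : 0 ≤ ‖u‖ ^ p := by positivity
      calc 1 / (2 * 2 ^ p) * (‖u‖ ^ p + ‖h.op u‖ ^ p)
          ≤ 1 / (2 * 2 ^ p) * (2 ^ p * ‖u‖ ^ p + 2 ^ p * (‖u‖ ^ p + ‖u - h.op u‖ ^ p)) := by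
            gcongr
            nlinarith
        _ = _ := by field_simp; ring
    have h4 : J u - dΦ u u - (J (h.op u) - dΦ u (h.op u)) +
        (J (h.op u) - dΦ u (h.op u) - (J (h.op u) - dΦ u (h.op u))) = h.gap u := by
      simp only [gap, map_sub]; ring
    rw [h4] at h1
    linarith
  set K₂ := (|K| + s * r * |b|) / c with hK₂
  have hK₂0 : 0 ≤ K₂ := by positivity
  refine ⟨2 / c + 2 * C, 2 * K₂, by positivity, by positivity, fun u hu => ⟨?_, ?_⟩⟩
  · have h1 := key1 u hu
    have h2 := h.gap_nonneg u
    have h3 : 0 ≤ C * h.gap u := by positivity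
    have h4 : 0 ≤ 1 / c * h.gap u := by positivity
    have h5 : 2 / c * h.gap u = 2 * (1 / c * h.gap u) := by ring
    rw [add_mul]
    linarith
  · have h1 := key1 u hu
    have h2 := key2 u
    have h5 : 2 / c * h.gap u = 2 * (1 / c * h.gap u) := by ring
    rw [add_mul]
    linarith

/-- The gap is at most linear in `‖u - op u‖`, which by `coercive_gap` dominates the `p`-th power of
the same quantity; as `p > 1`, everything is bounded. So the gap tends to zero, and uniform
convexity gives `u - op u → 0`. Finally `op u` depends on `ι u` alone, so compactness of `ι`
provides a convergent subsequence. -/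
theorem palaisSmale [CompleteSpace X] {c : ℝ} {u : ℕ → X}
    (hu : Tendsto (fun n => J (u n) - Φ (u n)) atTop (𝓝 c))
    (hG : ∀ n : ℕ, h.gap (u n) ≤ 1 / ((n : ℝ) + 1) * (1 + ‖u n - h.op (u n)‖)) :
    ∃ (v : X) (φ : ℕ → ℕ), StrictMono φ ∧ Tendsto (u ∘ φ) atTop (𝓝 v) ∧ h.op v = v := by
  have hp1 := h.uc.one_lt
  have hp0 : 0 < p := by linarith
  obtain ⟨b, hb⟩ := hu.bddAbove_range
  have hb' : ∀ n, J (u n) - Φ (u n) ≤ b := fun n => hb ⟨n, rfl⟩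
  obtain ⟨K₁, K₂, hK₁, hK₂, hcg⟩ := h.coercive_gap b
  have hone : ∀ n : ℕ, 1 / ((n : ℝ) + 1) ≤ 1 := fun n => by
    rw [div_le_one (by positivity)]; linarith [(Nat.cast_nonneg n : (0 : ℝ) ≤ n)]
  have hG1 : ∀ n, h.gap (u n) ≤ 1 + ‖u n - h.op (u n)‖ := fun n =>
    (hG n).trans (mul_le_of_le_one_left (by positivity) (hone n))
  obtain ⟨M, hM⟩ := exists_bound_of_rpow_le hp1 (K₁ + K₂) K₁
  have hD : ∀ n, ‖u n - h.op (u n)‖ ≤ M := fun n => by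
    refine hM _ (norm_nonneg _) (((hcg _ (hb' n)).2).trans ?_)
    have := mul_le_mul_of_nonneg_left (hG1 n) hK₁
    linarith
  have hM0 : 0 ≤ M := (norm_nonneg _).trans (hD 0)
  set B := K₁ * (1 + M) + K₂ with hB
  have hun : ∀ n, ‖u n‖ ^ p ≤ B := fun n => by
    refine ((hcg _ (hb' n)).1).trans ?_
    have := mul_le_mul_of_nonneg_left ((hG1 n).trans (by linarith [hD n] : _ ≤ 1 + M)) hK₁
    linarith
  have hB0 : 0 ≤ B := by positivity
  have hun' : ∀ n, ‖u n‖ ≤ B ^ (1 / p) := fun n => by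
    calc ‖u n‖ = (‖u n‖ ^ p) ^ (1 / p) := by
          rw [← Real.rpow_mul (norm_nonneg _), mul_one_div_cancel hp0.ne', Real.rpow_one]
      _ ≤ _ := Real.rpow_le_rpow (by positivity) (hun n) (by positivity)
  set B' := (B ^ (1 / p) + M) ^ p with hB'
  have hop : ∀ n, ‖h.op (u n)‖ ^ p ≤ B' := fun n => by
    have : ‖h.op (u n)‖ ≤ B ^ (1 / p) + M := by
      have := norm_sub_le (u n) (u n - h.op (u n))
      rw [sub_sub_cancel] at this
      linarith [hun' n, hD n]
    exact Real.rpow_le_rpow (norm_nonneg _) this hp0.le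
  have hB'0 : 0 ≤ B' := by positivity
  have hD0 : Tendsto (fun n => ‖u n - h.op (u n)‖) atTop (𝓝 0) := by
    refine tendsto_zero_of_rpow hp0 (fun n => norm_nonneg _) fun ε hε => ?_
    obtain ⟨C, hC, hgap⟩ := h.uc.gap_linear (η := ε / 2 / (B + B' + 1)) (by positivity)
    have hlim : Tendsto (fun n : ℕ => C * (1 / ((n : ℝ) + 1) * (1 + M))) atTop (𝓝 (C * (0 * (1 + M)))) :=
      (tendsto_one_div_add_atTop_nhds_zero_nat.mul_const _).const_mul _
    rw [zero_mul, mul_zero] at hlim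
    filter_upwards [hlim.eventually (ge_mem_nhds (half_pos hε))] with n hn
    have h1 := hgap (dΦ (u n)) (u n) (h.op (u n)) _ (h.op_spec (u n))
    have h4 : J (u n) - dΦ (u n) (u n) - (J (h.op (u n)) - dΦ (u n) (h.op (u n))) +
        (J (h.op (u n)) - dΦ (u n) (h.op (u n)) - (J (h.op (u n)) - dΦ (u n) (h.op (u n)))) =
          h.gap (u n) := by
      simp only [gap, map_sub]; ring
    rw [h4] at h1
    have h5 : C * h.gap (u n) ≤ ε / 2 := by
      refine le_trans (mul_le_mul_of_nonneg_left ((hG n).trans ?_) hC) hn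
      gcongr
      exact hD n
    have h6 : ε / 2 / (B + B' + 1) * (‖u n‖ ^ p + ‖h.op (u n)‖ ^ p) ≤ ε / 2 := by
      calc _ ≤ ε / 2 / (B + B' + 1) * (B + B' + 1) :=
            mul_le_mul_of_nonneg_left (by linarith [hun n, hop n]) (by positivity)
        _ = _ := by field_simp
    linarith
  obtain ⟨K, hK, hKm⟩ := h.exists_compact (B ^ (1 / p))
  obtain ⟨z, _, φ, hφ, hz⟩ := hK.tendsto_subseq (fun n => hKm (u n) (hun' n))
  set v := h.uc.solve (Ψ z) with hv
  have h1 : Tendsto (fun n => h.op (u (φ n))) atTop (𝓝 v) := by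
    have : (fun n => h.op (u (φ n))) = fun n => h.uc.solve (Ψ (ι (u (φ n)))) := by
      funext n
      rw [op, h.factor]
    rw [this]
    exact ((h.uc.continuous_solve.comp h.continuous).tendsto z).comp hz
  have h2 : Tendsto (u ∘ φ) atTop (𝓝 v) := by
    have e : u ∘ φ = fun n => (u (φ n) - h.op (u (φ n))) + h.op (u (φ n)) := by
      funext n; simp
    rw [e, ← zero_add v]
    exact (tendsto_zero_iff_norm_tendsto_zero.2 (hD0.comp hφ.tendsto_atTop)).add h1
  exact ⟨v, φ, hφ, h2, tendsto_nhds_unique ((h.continuous_op.tendsto v).comp h2) h1⟩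

/-- Criticality means that `J` has derivative `dΦ u` at `u`. Since `J` is convex and differentiable,
this is the same as `u` minimizing `J - dΦ u`. -/
theorem isCritical_iff [CompleteSpace X] (hJ : ∀ u, ∃ l : X →L[ℝ] ℝ, HasFDerivAt J l u) (u : X) :
    HasFDerivAt (fun u => J u - Φ u) (0 : X →L[ℝ] ℝ) u ↔ h.op u = u := by
  constructor
  · intro hu
    have h1 : HasFDerivAt J (dΦ u) u := by
      have := hu.add (h.hasFDerivAt u)
      rw [zero_add] at this
      refine this.congr_of_eventuallyEq (Eventually.of_forall fun x => ?_)
      simp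
    exact h.uc.solve_unique (le_of_convexOn_of_hasFDerivAt h.uc.convex h1)
  · intro hu
    obtain ⟨l, hl⟩ := hJ u
    have hmin : IsLocalMin (fun w => J w - dΦ u w) u := by
      refine Eventually.of_forall fun w => ?_
      have := h.op_spec u w
      rwa [hu] at this
    have h1 := hmin.hasFDerivAt_eq_zero (hl.sub (dΦ u).hasFDerivAt)
    rw [← h1]
    have h2 : l = dΦ u := sub_eq_zero.1 h1
    have h3 := hl.sub (h.hasFDerivAt u)
    exact h3

theorem admissible [CompleteSpace X] {C : Set X} {δ : ℝ} (hC : Convex ℝ C) (h0 : (0 : X) ∈ C)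
    (hδ : 0 < δ) (hmaps : Set.MapsTo h.op (Minimax.Pn C δ) (Minimax.Pn C δ))
    (hpos : ∃ κ > 0, ∀ u ∈ Minimax.Sg C δ, κ ≤ J u - Φ u) :
    Minimax.Admissible C δ (fun u => J u - Φ u) h.op h.gap where
  convex := hC
  zero_mem := h0
  pos := hδ
  continuous_functional := h.continuous_functional
  even u := by rw [h.uc.even, h.even]
  continuous_map := h.continuous_op
  odd := h.op_neg
  mapsTo := hmaps
  gap_eq_zero u hu := by simp [gap, hu]
  descent R _ hκ := h.descent R hκ
  palaisSmale _ _ hu hG := h.palaisSmale hu hG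
  pos_on_boundary := hpos

end Split

end ConvexSplit

end

noncomputable section

/-! ### Translations, mollification and dominated convergence in `L^P` -/

namespace LpTools

open Filter Topology

variable {N : ℕ} {F : Type*} [NormedAddCommGroup F] {P : ℝ≥0∞}

theorem eLpNorm_eq_ofReal_norm {α : Type*} [MeasurableSpace α] {μ : Measure α} (f : Lp F P μ) :
    eLpNorm f P μ = ENNReal.ofReal ‖f‖ := by
  rw [Lp.norm_def, ENNReal.ofReal_toReal (Lp.memLp f).eLpNorm_ne_top]

/-- Translations act continuously on `L^P` for finite `P`; continuity at the origin is used. -/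
theorem exists_eLpNorm_translate_le [Fact (1 ≤ P)] (hP : P ≠ ⊤)
    (f : Lp F P (volume : Measure (RN N))) {κ : ℝ} (hκ : 0 < κ) :
    ∃ r > 0, ∀ t, ‖t‖ < r → eLpNorm (fun x => f (x - t) - f x) P volume ≤ ENNReal.ofReal κ := by
  have : Fact (P ≠ ⊤) := ⟨hP⟩
  have hc : Continuous fun t : RN N => DomAddAct.mk (-t) +ᵥ f := by
    have h1 : Continuous fun t : RN N => DomAddAct.mk (-t) :=
      DomAddAct.continuous_mk.comp continuous_neg
    exact h1.vadd continuous_const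
  obtain ⟨r, hr, h⟩ := Metric.continuousAt_iff.1 (hc.continuousAt (x := 0)) κ hκ
  refine ⟨r, hr, fun t ht => ?_⟩
  have h2 := h (by simpa using ht : dist t 0 < r)
  have h0 : DomAddAct.mk (-(0 : RN N)) +ᵥ f = f := by simp
  rw [h0, dist_eq_norm] at h2
  have h3 : eLpNorm (fun x => f (x - t) - f x) P volume =
      eLpNorm (((DomAddAct.mk (-t) +ᵥ f) - f : Lp F P volume) : RN N → F) P volume := by
    refine eLpNorm_congr_ae ?_
    filter_upwards [Lp.coeFn_sub (DomAddAct.mk (-t) +ᵥ f) f,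
      DomAddAct.vadd_Lp_ae_eq (DomAddAct.mk (-t)) f] with x h1 h2
    rw [h1, Pi.sub_apply, h2]
    simp [sub_eq_neg_add]
  rw [h3, eLpNorm_eq_ofReal_norm]
  exact ENNReal.ofReal_le_ofReal h2.le

/-- Jensen's inequality and Tonelli's theorem, combined. -/
theorem eLpNorm_le_of_enorm_le_lintegral {α β : Type*} [MeasurableSpace α] [MeasurableSpace β]
    {μ : Measure α} [SFinite μ] {ν : Measure β} [IsProbabilityMeasure ν] (hP1 : 1 ≤ P) (hP : P ≠ ⊤)
    {g : α → F} {k : α → β → ℝ≥0∞} (hk : Measurable (Function.uncurry k))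
    (hg : ∀ x, ‖g x‖ₑ ≤ ∫⁻ t, k x t ∂ν) {K : ℝ≥0∞}
    (hK : ∀ᵐ t ∂ν, ∫⁻ x, k x t ^ P.toReal ∂μ ≤ K ^ P.toReal) : eLpNorm g P μ ≤ K := by
  have hP0 : P ≠ 0 := (zero_lt_one.trans_le hP1).ne'
  have hp0 : 0 < P.toReal := ENNReal.toReal_pos hP0 hP
  -- Jensen's inequality in the form of monotonicity of the `L^P` norms in the exponent for the
  -- probability measure `ν`.
  have key : ∀ x, ‖g x‖ₑ ^ P.toReal ≤ ∫⁻ t, k x t ^ P.toReal ∂ν := by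
    intro x
    have hkx : Measurable (k x) := hk.comp measurable_prodMk_left
    have e2 : ‖g x‖ₑ ≤ eLpNorm (k x) 1 ν := by
      rw [eLpNorm_one_eq_lintegral_enorm]
      exact hg x
    have e3 := e2.trans (eLpNorm_le_eLpNorm_of_exponent_le hP1 hkx.aestronglyMeasurable)
    rw [eLpNorm_eq_lintegral_rpow_enorm_toReal hP0 hP] at e3
    calc _ ≤ ((∫⁻ t, ‖k x t‖ₑ ^ P.toReal ∂ν) ^ (1 / P.toReal)) ^ P.toReal :=
          ENNReal.rpow_le_rpow e3 hp0.le
      _ = _ := by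
          rw [← ENNReal.rpow_mul, one_div_mul_cancel hp0.ne', ENNReal.rpow_one]
          rfl
  rw [eLpNorm_eq_lintegral_rpow_enorm_toReal hP0 hP, one_div, ENNReal.rpow_inv_le_iff hp0]
  calc ∫⁻ x, ‖g x‖ₑ ^ P.toReal ∂μ
      ≤ ∫⁻ x, ∫⁻ t, k x t ^ P.toReal ∂ν ∂μ := lintegral_mono key
    _ = ∫⁻ t, ∫⁻ x, k x t ^ P.toReal ∂μ ∂ν :=
        lintegral_lintegral_swap (hk.pow_const _).aemeasurable
    _ ≤ ∫⁻ _, K ^ P.toReal ∂ν := lintegral_mono_ae hK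
    _ = K ^ P.toReal := by simp

variable [NormedSpace ℝ F]

-- The error of mollification is the average of `f (x - t) - f x` against the probability density
-- `ρ`, so only translations in the support of `ρ` matter.
open ContinuousLinearMap in
open scoped Convolution in
theorem eLpNorm_convolution_sub_le [CompleteSpace F] (hP1 : 1 ≤ P) (hP : P ≠ ⊤) {f : RN N → F}
    (hf : StronglyMeasurable f) (hfl : LocallyIntegrable f) {ρ : RN N → ℝ} (hc : Continuous ρ)
    (hs : HasCompactSupport ρ) (h0 : ∀ x, 0 ≤ ρ x) (h1 : ∫ x, ρ x = 1) {K : ℝ≥0∞}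
    (hK : ∀ t, ρ t ≠ 0 → eLpNorm (fun x => f (x - t) - f x) P volume ≤ K) :
    eLpNorm (fun x => (ρ ⋆[lsmul ℝ ℝ, volume] f) x - f x) P volume ≤ K := by
  have hP0 : P ≠ 0 := (zero_lt_one.trans_le hP1).ne'
  have hp0 : 0 < P.toReal := ENNReal.toReal_pos hP0 hP
  set w : RN N → ℝ≥0∞ := fun t => ENNReal.ofReal (ρ t) with hw
  have hwm : Measurable w := hc.measurable.ennreal_ofReal
  set ν := (volume : Measure (RN N)).withDensity w with hν
  have hρi : Integrable ρ := hc.integrable_of_hasCompactSupport hs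
  have : IsProbabilityMeasure ν := ⟨by
    rw [hν, withDensity_apply _ MeasurableSet.univ, Measure.restrict_univ, hw,
      ← ofReal_integral_eq_lintegral_ofReal hρi (Eventually.of_forall h0), h1, ENNReal.ofReal_one]⟩
  have hm : StronglyMeasurable fun z : RN N × RN N => f (z.1 - z.2) - f z.1 :=
    (hf.comp_measurable measurable_sub).sub (hf.comp_measurable measurable_fst)
  refine eLpNorm_le_of_enorm_le_lintegral hP1 hP (ν := ν) (k := fun x t => ‖f (x - t) - f x‖ₑ)
    hm.enorm (fun x => ?_) ?_
  · have e1 : (ρ ⋆[lsmul ℝ ℝ, volume] f) x - f x = ∫ t, ρ t • (f (x - t) - f x) := by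
      have hx : Integrable (fun t => ρ t • f (x - t)) :=
        (hs.convolutionExists_left (L := lsmul ℝ ℝ) hc hfl) x
      have : f x = ∫ t, ρ t • f x := by rw [integral_smul_const, h1, one_smul]
      rw [convolution_lsmul]
      conv_lhs => rw [this]
      rw [← integral_sub hx (hρi.smul_const _)]
      simp_rw [smul_sub]
    rw [e1, hν, lintegral_withDensity_eq_lintegral_mul₀ hwm.aemeasurable]
    · refine (enorm_integral_le_lintegral_enorm _).trans_eq (lintegral_congr fun t => ?_)
      rw [enorm_smul, Pi.mul_apply, Real.enorm_of_nonneg (h0 t)]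
    · exact (hm.comp_measurable measurable_prodMk_left).enorm.aemeasurable
  · have : ∀ᵐ t ∂ν, w t ≠ 0 := by
      rw [hν, ae_withDensity_iff hwm]
      exact Eventually.of_forall fun _ h => h
    filter_upwards [this] with t ht
    have ht' : ρ t ≠ 0 := fun h => ht (by simp [hw, h])
    have := hK t ht'
    rwa [eLpNorm_eq_lintegral_rpow_enorm_toReal hP0 hP, one_div,
      ENNReal.rpow_inv_le_iff hp0] at this

omit [NormedSpace ℝ F] in
theorem tendsto_eLpNorm_of_dominated {α : Type*} [MeasurableSpace α] {μ : Measure α}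
    (hP0 : P ≠ 0) (hP : P ≠ ⊤) {f : ℕ → α → F} {g : α → ℝ} (hf : ∀ n, AEStronglyMeasurable (f n) μ)
    (hg : MemLp g P μ) (hb : ∀ n, ∀ᵐ x ∂μ, ‖f n x‖ ≤ g x)
    (hlim : ∀ᵐ x ∂μ, Tendsto (fun n => f n x) atTop (𝓝 0)) :
    Tendsto (fun n => eLpNorm (f n) P μ) atTop (𝓝 0) := by
  have hp0 : 0 < P.toReal := ENNReal.toReal_pos hP0 hP
  have h1 : Tendsto (fun n => ∫⁻ x, ‖f n x‖ₑ ^ P.toReal ∂μ) atTop (𝓝 (∫⁻ _, 0 ∂μ)) := by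
    refine tendsto_lintegral_of_dominated_convergence' (fun x => ‖g x‖ₑ ^ P.toReal)
      (fun n => (hf n).enorm.pow_const _) (fun n => ?_) ?_ ?_
    · filter_upwards [hb n] with x hx
      have : ‖f n x‖ₑ ≤ ‖g x‖ₑ := by
        rw [enorm_le_iff_norm_le]
        exact hx.trans (le_abs_self _)
      gcongr
    · exact (lintegral_rpow_enorm_lt_top_of_eLpNorm_lt_top hP0 hP hg.2).ne
    · filter_upwards [hlim] with x hx
      have h2 : Tendsto (fun n => ‖f n x‖ₑ ^ P.toReal) atTop (𝓝 (‖(0 : F)‖ₑ ^ P.toReal)) :=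
        (ENNReal.continuous_rpow_const.tendsto _).comp ((continuous_enorm.tendsto _).comp hx)
      simpa [ENNReal.zero_rpow_of_pos hp0] using h2
  have h2 := (ENNReal.continuous_rpow_const (y := 1 / P.toReal)).tendsto _ |>.comp h1
  rw [lintegral_zero, ENNReal.zero_rpow_of_pos (by positivity)] at h2
  refine h2.congr fun n => ?_
  rw [eLpNorm_eq_lintegral_rpow_enorm_toReal hP0 hP]
  rfl

omit [NormedSpace ℝ F] in
theorem eLpNorm_rpow_eq {α : Type*} [MeasurableSpace α] {μ : Measure α} (f : α → F) {s : ℝ}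
    (hs : 0 < s) : eLpNorm f (ENNReal.ofReal s) μ ^ s = ∫⁻ x, ‖f x‖ₑ ^ s ∂μ := by
  rw [eLpNorm_eq_lintegral_rpow_enorm_toReal (by simpa using hs) ENNReal.ofReal_ne_top,
    ENNReal.toReal_ofReal hs.le, ← ENNReal.rpow_mul, one_div_mul_cancel hs.ne', ENNReal.rpow_one]

omit [NormedSpace ℝ F] in
/-- Interpolation of Lebesgue norms. -/
theorem eLpNorm_rpow_le_interpolation {α : Type*} [MeasurableSpace α] {μ : Measure α} {f : α → F}
    (hf : AEStronglyMeasurable f μ) {p q a b : ℝ} (hp : 0 < p) (hq : 0 < q) (ha : 0 ≤ a)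
    (hb : 0 ≤ b) (hab : a + b = 1) :
    eLpNorm f (ENNReal.ofReal (a * p + b * q)) μ ^ (a * p + b * q) ≤
      (eLpNorm f (ENNReal.ofReal p) μ ^ p) ^ a * (eLpNorm f (ENNReal.ofReal q) μ ^ q) ^ b := by
  have hs : 0 < a * p + b * q := by
    rcases ha.eq_or_lt with rfl | ha
    · rw [zero_add] at hab; subst hab; simpa using hq
    · have := mul_pos ha hp
      positivity
  rw [eLpNorm_rpow_eq f hs, eLpNorm_rpow_eq f hp, eLpNorm_rpow_eq f hq]
  refine le_trans (le_of_eq (lintegral_congr fun x => ?_)) (ENNReal.lintegral_mul_norm_pow_le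
    (hf.enorm.pow_const _) (hf.enorm.pow_const _) ha hb hab)
  rw [← ENNReal.rpow_mul, ← ENNReal.rpow_mul, ← ENNReal.rpow_add_of_nonneg _ _ (by positivity)
    (by positivity)]
  congr 1
  ring

end LpTools

end

noncomputable section

/-! ### The Sobolev space: completeness and density of test functions -/

namespace Sobolev

open Filter Topology LpTools

variable {N : ℕ}

theorem inner_gradient (ψ : RN N → ℝ) (x v : RN N) : inner ℝ (gradient ψ x) v = fderiv ℝ ψ x v := by
  rw [gradient, InnerProductSpace.toDual_symm_apply]

theorem norm_gradient (ψ : RN N → ℝ) (x : RN N) : ‖gradient ψ x‖ = ‖fderiv ℝ ψ x‖ := by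
  rw [gradient, LinearIsometryEquiv.norm_map]

theorem continuous_gradient {ψ : RN N → ℝ} (h : ContDiff ℝ 1 ψ) : Continuous (gradient ψ) :=
  (LinearIsometryEquiv.continuous _).comp (h.continuous_fderiv (by simp))

theorem hasCompactSupport_gradient {ψ : RN N → ℝ} (h : HasCompactSupport ψ) :
    HasCompactSupport (gradient ψ) :=
  (h.fderiv (𝕜 := ℝ)).comp_left (g := (InnerProductSpace.toDual ℝ (RN N)).symm) (map_zero _)

theorem isWeakGradient_congr {u u' : RN N → ℝ} {G G' : RN N → RN N} (h : IsWeakGradient u G)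
    (hu : u =ᵐ[volume] u') (hG : G =ᵐ[volume] G') : IsWeakGradient u' G' := by
  intro ψ h1 h2 v
  have e1 : ∫ x, u' x * fderiv ℝ ψ x v = ∫ x, u x * fderiv ℝ ψ x v :=
    integral_congr_ae (by filter_upwards [hu] with x hx; rw [hx])
  have e2 : ∫ x, inner ℝ (G' x) v * ψ x = ∫ x, inner ℝ (G x) v * ψ x :=
    integral_congr_ae (by filter_upwards [hG] with x hx; rw [hx])
  rw [e1, e2, h ψ h1 h2 v]

theorem isWeakGradient_gradient {u : RN N → ℝ} (hu : ContDiff ℝ 1 u) :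
    IsWeakGradient u (gradient u) := by
  intro ψ h1 h2 v
  simp_rw [inner_gradient]
  have hcu : Continuous fun x => fderiv ℝ u x v :=
    (hu.continuous_fderiv (by simp)).clm_apply continuous_const
  have hcψ : Continuous fun x => fderiv ℝ ψ x v :=
    (h1.continuous_fderiv (by simp)).clm_apply continuous_const
  refine integral_mul_fderiv_eq_neg_fderiv_mul_of_integrable ?_ ?_ ?_
    (fun x _ => hu.differentiable (by simp) x) (fun x _ => h1.differentiable (by simp) x)
  · exact (hcu.mul h1.continuous).integrable_of_hasCompactSupport h2.mul_left
  · exact (hu.continuous.mul hcψ).integrable_of_hasCompactSupport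
      (h2.fderiv_apply (𝕜 := ℝ) v).mul_left
  · exact (hu.continuous.mul h1.continuous).integrable_of_hasCompactSupport h2.mul_left

variable {P : ℝ≥0∞}

/-- By Hölder's inequality, pairing with a fixed continuous function of compact support is a bounded
functional on `L^P`. -/
theorem tendsto_integral_inner {F : Type*} [NormedAddCommGroup F] [InnerProductSpace ℝ F]
    (hP1 : 1 ≤ P) {f : ℕ → RN N → F} {f₀ g : RN N → F} (hf : ∀ n, MemLp (f n) P volume)
    (hf₀ : MemLp f₀ P volume) (hg : Continuous g) (hgs : HasCompactSupport g)
    (hlim : Tendsto (fun n => eLpNorm (fun x => f n x - f₀ x) P volume) atTop (𝓝 0)) :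
    Tendsto (fun n => ∫ x, inner ℝ (f n x) (g x)) atTop (𝓝 (∫ x, inner ℝ (f₀ x) (g x))) := by
  have : Fact (1 ≤ P) := ⟨hP1⟩
  have : Fact (1 ≤ ENNReal.conjExponent P) := ⟨ENNReal.HolderConjugate.one_le _ P⟩
  have hgl : MemLp g (ENNReal.conjExponent P) volume := hg.memLp_of_hasCompactSupport hgs
  obtain ⟨T, hT⟩ : ∃ T : Lp F P (volume : Measure (RN N)) →L[ℝ] ℝ,
      ∀ {h : RN N → F} (hh : MemLp h P volume), T hh.toLp = ∫ x, inner ℝ (h x) (g x) := by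
    refine ⟨((innerSL ℝ : F →L[ℝ] F →L[ℝ] ℝ).lpPairing volume P (ENNReal.conjExponent P)).flip
      hgl.toLp, fun {h} hh => ?_⟩
    rw [ContinuousLinearMap.flip_apply, ContinuousLinearMap.lpPairing_eq_integral]
    refine integral_congr_ae ?_
    filter_upwards [hh.coeFn_toLp, hgl.coeFn_toLp] with x h1 h2
    rw [h1, h2]
    rfl
  have h1 : Tendsto (fun n => (hf n).toLp) atTop (𝓝 hf₀.toLp) :=
    (Lp.tendsto_Lp_iff_tendsto_eLpNorm'' _ hf _ hf₀).2 hlim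
  have h2 := (T.continuous.tendsto hf₀.toLp).comp h1
  rw [hT hf₀] at h2
  exact h2.congr fun n => hT (hf n)

/-- Both sides of the defining identity pass to `L^P` limits. Completeness, the chain rule and the
positive part all rest on this. -/
theorem isWeakGradient_of_tendsto (hP1 : 1 ≤ P) {u : ℕ → RN N → ℝ} {G : ℕ → RN N → RN N}
    {u₀ : RN N → ℝ} {G₀ : RN N → RN N} (hw : ∀ n, IsWeakGradient (u n) (G n))
    (hu : ∀ n, MemLp (u n) P volume) (hG : ∀ n, MemLp (G n) P volume) (hu₀ : MemLp u₀ P volume)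
    (hG₀ : MemLp G₀ P volume)
    (hul : Tendsto (fun n => eLpNorm (fun x => u n x - u₀ x) P volume) atTop (𝓝 0))
    (hGl : Tendsto (fun n => eLpNorm (fun x => G n x - G₀ x) P volume) atTop (𝓝 0)) :
    IsWeakGradient u₀ G₀ := by
  intro ψ h1 h2 v
  have hcψ : Continuous fun x => fderiv ℝ ψ x v :=
    (h1.continuous_fderiv (by simp)).clm_apply continuous_const
  have l1 := tendsto_integral_inner hP1 hu hu₀ hcψ (h2.fderiv_apply (𝕜 := ℝ) v) hul
  have l2 := tendsto_integral_inner hP1 hG hG₀ (h1.continuous.smul continuous_const)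
    (h2.smul_right (f' := fun _ => v)) hGl
  have e1 : ∀ f : RN N → ℝ, ∫ x, inner ℝ (f x) (fderiv ℝ ψ x v) = ∫ x, f x * fderiv ℝ ψ x v :=
    fun f => by simp [mul_comm]
  have e2 : ∀ f : RN N → RN N, ∫ x, inner ℝ (f x) (ψ x • v) = ∫ x, inner ℝ (f x) v * ψ x :=
    fun f => by simp [inner_smul_right, mul_comm]
  simp only [e1] at l1
  have l2' : Tendsto (fun n => ∫ x, inner ℝ (G n x) v * ψ x) atTop
      (𝓝 (∫ x, inner ℝ (G₀ x) v * ψ x)) := by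
    rw [← e2]
    refine l2.congr fun n => e2 _
  refine tendsto_nhds_unique l1 ?_
  refine l2'.neg.congr fun n => ?_
  rw [hw n ψ h1 h2 v]

section Space

variable [Fact (1 ≤ P)]

/-- The element of the Sobolev space with given function and weak gradient. -/
def mk {u : RN N → ℝ} {G : RN N → RN N} (hu : MemLp u P volume) (hG : MemLp G P volume)
    (h : IsWeakGradient u G) : sobolevSpace N P :=
  ⟨WithLp.toLp P (hu.toLp, hG.toLp),
    isWeakGradient_congr h hu.coeFn_toLp.symm hG.coeFn_toLp.symm⟩

theorem mk_fst {u : RN N → ℝ} {G : RN N → RN N} (hu : MemLp u P volume) (hG : MemLp G P volume)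
    (h : IsWeakGradient u G) : ((mk hu hG h).1.fst : RN N → ℝ) =ᵐ[volume] u := hu.coeFn_toLp

theorem mk_snd {u : RN N → ℝ} {G : RN N → RN N} (hu : MemLp u P volume) (hG : MemLp G P volume)
    (h : IsWeakGradient u G) : ((mk hu hG h).1.snd : RN N → RN N) =ᵐ[volume] G := hG.coeFn_toLp

theorem isClosed_sobolevSpace : IsClosed (sobolevSpace N P : Set (WithLp P
    (Lp ℝ P (volume : Measure (RN N)) × Lp (RN N) P (volume : Measure (RN N))))) := by
  refine IsSeqClosed.isClosed fun w w₀ hw hlim => ?_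
  have h1 : Tendsto (fun n => (w n).fst) atTop (𝓝 w₀.fst) :=
    ((WithLp.prod_continuous_ofLp P _ _).fst.tendsto w₀).comp hlim
  have h2 : Tendsto (fun n => (w n).snd) atTop (𝓝 w₀.snd) :=
    ((WithLp.prod_continuous_ofLp P _ _).snd.tendsto w₀).comp hlim
  exact isWeakGradient_of_tendsto (Fact.out : 1 ≤ P) hw (fun n => Lp.memLp _)
    (fun n => Lp.memLp _) (Lp.memLp _) (Lp.memLp _)
    ((Lp.tendsto_Lp_iff_tendsto_eLpNorm' _ _).1 h1) ((Lp.tendsto_Lp_iff_tendsto_eLpNorm' _ _).1 h2)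

instance : CompleteSpace (sobolevSpace N P) := isClosed_sobolevSpace.completeSpace_coe

variable (N P) in
/-- The inclusion of the Sobolev space into `L^P`. -/
def fstL : sobolevSpace N P →L[ℝ] Lp ℝ P (volume : Measure (RN N)) :=
  (ContinuousLinearMap.fst ℝ _ _).comp
    ((WithLp.prodContinuousLinearEquiv P ℝ _ _).toContinuousLinearMap.comp
      (sobolevSpace N P).subtypeL)

variable (N P) in
/-- The weak gradient as a bounded operator. -/
def sndL : sobolevSpace N P →L[ℝ] Lp (RN N) P (volume : Measure (RN N)) :=
  (ContinuousLinearMap.snd ℝ _ _).comp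
    ((WithLp.prodContinuousLinearEquiv P ℝ _ _).toContinuousLinearMap.comp
      (sobolevSpace N P).subtypeL)

theorem fstL_apply (u : sobolevSpace N P) : fstL N P u = u.1.fst := rfl

theorem norm_rpow (hP : P ≠ ⊤) (u : sobolevSpace N P) :
    ‖u‖ ^ P.toReal = ‖u.1.fst‖ ^ P.toReal + ‖u.1.snd‖ ^ P.toReal := by
  have hp0 : 0 < P.toReal :=
    ENNReal.toReal_pos (zero_lt_one.trans_le (Fact.out : 1 ≤ P)).ne' hP
  have : ‖u‖ = ‖u.1‖ := rfl
  rw [this, WithLp.prod_norm_eq_add hp0, ← Real.rpow_mul (by positivity),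
    one_div_mul_cancel hp0.ne', Real.rpow_one]

theorem norm_fst_le (hP : P ≠ ⊤) (u : sobolevSpace N P) : ‖u.1.fst‖ ≤ ‖u‖ := by
  have hp0 : 0 < P.toReal :=
    ENNReal.toReal_pos (zero_lt_one.trans_le (Fact.out : 1 ≤ P)).ne' hP
  rw [← Real.rpow_le_rpow_iff (norm_nonneg _) (norm_nonneg _) hp0, norm_rpow hP]
  have : 0 ≤ ‖u.1.snd‖ ^ P.toReal := by positivity
  linarith

theorem norm_snd_le (hP : P ≠ ⊤) (u : sobolevSpace N P) : ‖u.1.snd‖ ≤ ‖u‖ := by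
  have hp0 : 0 < P.toReal :=
    ENNReal.toReal_pos (zero_lt_one.trans_le (Fact.out : 1 ≤ P)).ne' hP
  rw [← Real.rpow_le_rpow_iff (norm_nonneg _) (norm_nonneg _) hp0, norm_rpow hP]
  have : 0 ≤ ‖u.1.fst‖ ^ P.toReal := by positivity
  linarith

end Space

/-! #### Density of test functions -/

-- The derivative falls on the mollifier, and the weak gradient identity moves it to `G`.
open ContinuousLinearMap in
open scoped Convolution in
theorem gradient_convolution {u : RN N → ℝ} {G : RN N → RN N} (h : IsWeakGradient u G)
    (hu : LocallyIntegrable u) (hG : LocallyIntegrable G) {ρ : RN N → ℝ} (hρ : ContDiff ℝ ∞ ρ)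
    (hs : HasCompactSupport ρ) (x : RN N) :
    gradient (ρ ⋆[lsmul ℝ ℝ, volume] u) x = (ρ ⋆[lsmul ℝ ℝ, volume] G) x := by
  refine ext_inner_right ℝ fun v => ?_
  have hd := hs.hasFDerivAt_convolution_right (lsmul ℝ ℝ).flip hu (hρ.of_le (by simp)) x
  rw [convolution_flip] at hd
  rw [inner_gradient, hd.fderiv, convolution_precompR_apply _ hu (hs.fderiv (𝕜 := ℝ))
    (hρ.continuous_fderiv (by simp)), convolution_flip, convolution_lsmul]
  -- For fixed `x` the reflected mollifier is an admissible test function; the reflection accounts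
  -- for the sign.
  have hψ : ContDiff ℝ ∞ fun y => ρ (x - y) := hρ.comp (contDiff_const.sub contDiff_id)
  have hψs : HasCompactSupport fun y => ρ (x - y) :=
    hs.comp_homeomorph (Homeomorph.subLeft x)
  have hψd : ∀ y, fderiv ℝ (fun y => ρ (x - y)) y v = - fderiv ℝ ρ (x - y) v := by
    intro y
    have h1 : HasFDerivAt (fun y => ρ (x - y))
        ((fderiv ℝ ρ (x - y)).comp (-(ContinuousLinearMap.id ℝ (RN N)))) y :=
      ((hρ.differentiable (by simp) _).hasFDerivAt).comp y ((hasFDerivAt_id y).const_sub x)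
    rw [h1.fderiv]
    simp
  have h2 := h _ hψ hψs v
  have e2 : ∫ t, fderiv ℝ ρ t v • u (x - t) = ∫ y, fderiv ℝ ρ (x - y) v * u y := by
    rw [← integral_sub_left_eq_self _ _ x]
    simp
  have hiG : Integrable fun t => ρ t • G (x - t) :=
    (hs.convolutionExists_left (L := lsmul ℝ ℝ) hρ.continuous hG) x
  have e3 : inner ℝ ((ρ ⋆[lsmul ℝ ℝ, volume] G) x) v = ∫ y, inner ℝ (G y) v * ρ (x - y) := by
    rw [convolution_lsmul, real_inner_comm, ← integral_inner hiG,
      ← integral_sub_left_eq_self _ _ x]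
    refine integral_congr_ae (Eventually.of_forall fun y => ?_)
    simp only [sub_sub_cancel]
    rw [inner_smul_right, real_inner_comm, mul_comm]
  rw [e2, e3]
  simp_rw [hψd] at h2
  have e4 : ∫ y, fderiv ℝ ρ (x - y) v * u y = - ∫ y, u y * -(fderiv ℝ ρ (x - y) v) := by
    rw [← integral_neg]
    exact integral_congr_ae (Eventually.of_forall fun y => by simp [mul_comm])
  rw [e4, h2, neg_neg]

end Sobolev

end

noncomputable section

namespace Sobolev

open Filter Topology LpTools

variable {N : ℕ} {P : ℝ≥0∞}

open ContinuousLinearMap in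
open scoped Convolution in
/-- Mollification. -/
theorem exists_smooth_approx (hP1 : 1 ≤ P) (hP : P ≠ ⊤) {u : RN N → ℝ} {G : RN N → RN N}
    (h : IsWeakGradient u G) (hu : MemLp u P volume) (hG : MemLp G P volume) {κ : ℝ}
    (hκ : 0 < κ) : ∃ w : RN N → ℝ, ContDiff ℝ ∞ w ∧
      eLpNorm (fun x => w x - u x) P volume ≤ ENNReal.ofReal κ ∧
      eLpNorm (fun x => gradient w x - G x) P volume ≤ ENNReal.ofReal κ := by
  have : Fact (1 ≤ P) := ⟨hP1⟩
  obtain ⟨r₁, hr₁, ht₁⟩ := exists_eLpNorm_translate_le hP hu.toLp hκ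
  obtain ⟨r₂, hr₂, ht₂⟩ := exists_eLpNorm_translate_le hP hG.toLp hκ
  have hr : 0 < min r₁ r₂ := lt_min hr₁ hr₂
  let φ : ContDiffBump (0 : RN N) := ⟨min r₁ r₂ / 2, min r₁ r₂, by positivity, by linarith⟩
  set ρ := φ.normed volume with hρ
  have hsupp : ∀ t, ρ t ≠ 0 → ‖t‖ < min r₁ r₂ := by
    intro t ht
    have : t ∈ Function.support ρ := ht
    rw [hρ, φ.support_normed_eq] at this
    exact mem_ball_zero_iff.1 this
  have hρd : ContDiff ℝ ∞ ρ := φ.contDiff_normed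
  have hρs : HasCompactSupport ρ := φ.hasCompactSupport_normed
  have hul : LocallyIntegrable hu.toLp := (Lp.memLp _).locallyIntegrable hP1
  have hGl : LocallyIntegrable hG.toLp := (Lp.memLp _).locallyIntegrable hP1
  have h' : IsWeakGradient hu.toLp hG.toLp :=
    isWeakGradient_congr h hu.coeFn_toLp.symm hG.coeFn_toLp.symm
  refine ⟨ρ ⋆[lsmul ℝ ℝ, volume] hu.toLp, hρs.contDiff_convolution_left _ hρd hul, ?_, ?_⟩
  · have := eLpNorm_convolution_sub_le hP1 hP (Lp.stronglyMeasurable hu.toLp) hul hρd.continuous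
      hρs (fun x => φ.nonneg_normed x) φ.integral_normed (fun t ht => ht₁ t
        ((hsupp t ht).trans_le (min_le_left _ _)))
    refine le_trans (le_of_eq (eLpNorm_congr_ae ?_)) this
    filter_upwards [hu.coeFn_toLp] with x hx
    rw [hx]
  · have := eLpNorm_convolution_sub_le hP1 hP (Lp.stronglyMeasurable hG.toLp) hGl hρd.continuous
      hρs (fun x => φ.nonneg_normed x) φ.integral_normed (fun t ht => ht₂ t
        ((hsupp t ht).trans_le (min_le_right _ _)))
    refine le_trans (le_of_eq (eLpNorm_congr_ae ?_)) this
    filter_upwards [hG.coeFn_toLp] with x hx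
    rw [hx, gradient_convolution h' hul hGl hρd hρs]

/-- Truncation by cut-off functions. -/
theorem exists_test_approx_of_smooth (hP1 : 1 ≤ P) (hP : P ≠ ⊤) {w : RN N → ℝ}
    (hw : ContDiff ℝ ∞ w) (hwl : MemLp w P volume) (hgl : MemLp (gradient w) P volume) :
    ∃ ψ : ℕ → RN N → ℝ, (∀ n, ContDiff ℝ ∞ (ψ n)) ∧ (∀ n, HasCompactSupport (ψ n)) ∧
      Tendsto (fun n => eLpNorm (fun x => ψ n x - w x) P volume) atTop (𝓝 0) ∧
      Tendsto (fun n => eLpNorm (fun x => gradient (ψ n) x - gradient w x) P volume)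
        atTop (𝓝 0) := by
  have hP0 : P ≠ 0 := (zero_lt_one.trans_le hP1).ne'
  let χ : ContDiffBump (0 : RN N) := ⟨1, 2, by norm_num, by norm_num⟩
  have hχd : ContDiff ℝ ∞ χ := χ.contDiff
  obtain ⟨C, hC⟩ := ((χ.hasCompactSupport.fderiv (𝕜 := ℝ)).exists_bound_of_continuous
    (hχd.continuous_fderiv (by simp)))
  have hC0 : 0 ≤ C := (norm_nonneg _).trans (hC 0)
  set a : ℕ → ℝ := fun n => ((n : ℝ) + 1)⁻¹ with ha
  have ha0 : ∀ n, 0 < a n := fun n => by positivity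
  have ha1 : ∀ n, a n ≤ 1 := fun n => inv_le_one_of_one_le₀ (by
    linarith [(Nat.cast_nonneg n : (0 : ℝ) ≤ n)])
  have hal : Tendsto a atTop (𝓝 0) := by
    simpa [ha] using tendsto_one_div_add_atTop_nhds_zero_nat (𝕜 := ℝ)
  set χn : ℕ → RN N → ℝ := fun n x => χ (a n • x) with hχn
  have hχnd : ∀ n, ContDiff ℝ ∞ (χn n) := fun n => hχd.comp (contDiff_const_smul _)
  have hχns : ∀ n, HasCompactSupport (χn n) := fun n =>
    χ.hasCompactSupport.comp_smul (ha0 n).ne'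
  have hfd : ∀ n x, fderiv ℝ (χn n) x = a n • fderiv ℝ χ (a n • x) := by
    intro n x
    have h1 : HasFDerivAt (χn n) ((fderiv ℝ χ (a n • x)).comp
        (a n • ContinuousLinearMap.id ℝ (RN N))) x :=
      ((hχd.differentiable (by simp) _).hasFDerivAt).comp x ((hasFDerivAt_id x).const_smul (a n))
    rw [h1.fderiv]
    ext v
    simp
  have hone : ∀ x, ∀ᶠ n in atTop, χn n x = 1 := by
    intro x
    have : Tendsto (fun n => ‖a n • x‖) atTop (𝓝 0) := by
      simpa using (hal.smul_const x).norm
    filter_upwards [this.eventually (ge_mem_nhds zero_lt_one)] with n hn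
    exact χ.one_of_mem_closedBall (by simpa using hn)
  have hψd : ∀ n, ContDiff ℝ ∞ fun x => χn n x * w x := fun n => (hχnd n).mul hw
  have hgrad : ∀ n x, gradient (fun x => χn n x * w x) x =
      χn n x • gradient w x + w x • gradient (χn n) x := by
    intro n x
    refine ext_inner_right ℝ fun v => ?_
    rw [inner_add_left, real_inner_smul_left, real_inner_smul_left, inner_gradient,
      inner_gradient, inner_gradient]
    have := ((hχnd n).differentiable (by simp) x).hasFDerivAt.mul
      (hw.differentiable (by simp) x).hasFDerivAt
    have e : fderiv ℝ (fun x => χn n x * w x) x = _ := this.fderiv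
    rw [e]
    simp
  have hχle : ∀ n x, |χn n x - 1| ≤ 1 := fun n x => by
    have h1 : χn n x ≤ 1 := χ.le_one
    have h2 : 0 ≤ χn n x := χ.nonneg
    rw [abs_le]; constructor <;> linarith
  refine ⟨fun n x => χn n x * w x, hψd, fun n => (hχns n).mul_right, ?_, ?_⟩
  · refine tendsto_eLpNorm_of_dominated hP0 hP (fun n => ?_) hwl.norm (fun n => ?_) ?_
    · exact ((hψd n).continuous.sub hw.continuous).aestronglyMeasurable
    · refine Eventually.of_forall fun x => ?_
      have : χn n x * w x - w x = (χn n x - 1) * w x := by ring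
      rw [this, norm_mul]
      exact mul_le_of_le_one_left (norm_nonneg _) (hχle n x)
    · refine Eventually.of_forall fun x => tendsto_const_nhds.congr' ?_
      filter_upwards [hone x] with n hn
      simp [hn]
  · have hg1 : Continuous (gradient w) := continuous_gradient (hw.of_le (by simp))
    have hg2 : ∀ n, Continuous (gradient fun x => χn n x * w x) := fun n =>
      continuous_gradient ((hψd n).of_le (by simp))
    refine tendsto_eLpNorm_of_dominated hP0 hP (fun n => ((hg2 n).sub hg1).aestronglyMeasurable)
      (hgl.norm.add (hwl.norm.const_mul C)) (fun n => ?_) ?_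
    · refine Eventually.of_forall fun x => ?_
      have : gradient (fun x => χn n x * w x) x - gradient w x =
          (χn n x - 1) • gradient w x + w x • gradient (χn n) x := by
        rw [hgrad]; module
      rw [this]
      refine (norm_add_le _ _).trans ?_
      rw [norm_smul, norm_smul, norm_gradient (χn n), hfd, norm_smul, Real.norm_of_nonneg
        (ha0 n).le]
      refine add_le_add (mul_le_of_le_one_left (norm_nonneg _) (hχle n x)) ?_
      refine (mul_le_mul_of_nonneg_left (?_ : a n * _ ≤ C) (norm_nonneg _)).trans_eq
        (mul_comm _ _)
      calc a n * ‖fderiv ℝ χ (a n • x)‖ ≤ 1 * C := by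
            gcongr
            · exact ha1 n
            · exact hC _
        _ = C := one_mul C
    · refine Eventually.of_forall fun x => ?_
      have h1 : Tendsto (fun n => w x • gradient (χn n) x) atTop (𝓝 0) := by
        rw [tendsto_zero_iff_norm_tendsto_zero]
        have h2 : Tendsto (fun n => ‖w x‖ * (a n * C)) atTop (𝓝 0) := by
          simpa using (hal.mul_const C).const_mul ‖w x‖
        refine squeeze_zero (fun n => norm_nonneg _) (fun n => ?_) h2
        rw [norm_smul, norm_gradient, hfd, norm_smul, Real.norm_of_nonneg (ha0 n).le]
        gcongr
        exact hC _
      refine h1.congr' ?_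
      filter_upwards [hone x] with n hn
      rw [hgrad, hn, one_smul, add_sub_cancel_left]

/-- Density of the test functions in the Sobolev space. -/
theorem exists_test_seq (hP1 : 1 ≤ P) (hP : P ≠ ⊤) {u : RN N → ℝ} {G : RN N → RN N}
    (h : IsWeakGradient u G) (hu : MemLp u P volume) (hG : MemLp G P volume) :
    ∃ ψ : ℕ → RN N → ℝ, (∀ n, ContDiff ℝ ∞ (ψ n)) ∧ (∀ n, HasCompactSupport (ψ n)) ∧
      Tendsto (fun n => eLpNorm (fun x => ψ n x - u x) P volume) atTop (𝓝 0) ∧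
      Tendsto (fun n => eLpNorm (fun x => gradient (ψ n) x - G x) P volume) atTop (𝓝 0) := by
  have key : ∀ n : ℕ, ∃ ψ : RN N → ℝ, ContDiff ℝ ∞ ψ ∧ HasCompactSupport ψ ∧
      eLpNorm (fun x => ψ x - u x) P volume ≤ ENNReal.ofReal (2 / ((n : ℝ) + 1)) ∧
      eLpNorm (fun x => gradient ψ x - G x) P volume ≤ ENNReal.ofReal (2 / ((n : ℝ) + 1)) := by
    intro n
    have hκ : 0 < 1 / ((n : ℝ) + 1) := by positivity
    obtain ⟨w, hw, h1, h2⟩ := exists_smooth_approx hP1 hP h hu hG hκ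
    have hgw : Continuous (gradient w) := continuous_gradient (hw.of_le (by simp))
    have m1 : MemLp (fun x => w x - u x) P volume :=
      ⟨hw.continuous.aestronglyMeasurable.sub hu.1, h1.trans_lt ENNReal.ofReal_lt_top⟩
    have m2 : MemLp (fun x => gradient w x - G x) P volume :=
      ⟨hgw.aestronglyMeasurable.sub hG.1, h2.trans_lt ENNReal.ofReal_lt_top⟩
    have m1' : MemLp w P volume := by
      simpa [Pi.add_def] using m1.add hu
    have m2' : MemLp (gradient w) P volume := by
      simpa [Pi.add_def] using m2.add hG
    obtain ⟨ψ, hψd, hψs, l1, l2⟩ := exists_test_approx_of_smooth hP1 hP hw m1' m2'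
    have hκ' : 0 < ENNReal.ofReal (1 / ((n : ℝ) + 1)) := ENNReal.ofReal_pos.2 hκ
    obtain ⟨k, hk1, hk2⟩ := ((l1.eventually (ge_mem_nhds hκ')).and
      (l2.eventually (ge_mem_nhds hκ'))).exists
    have hgk : Continuous (gradient (ψ k)) := continuous_gradient ((hψd k).of_le (by simp))
    have e : ENNReal.ofReal (2 / ((n : ℝ) + 1)) =
        ENNReal.ofReal (1 / ((n : ℝ) + 1)) + ENNReal.ofReal (1 / ((n : ℝ) + 1)) := by
      rw [← ENNReal.ofReal_add hκ.le hκ.le]; congr 1; ring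
    refine ⟨ψ k, hψd k, hψs k, ?_, ?_⟩
    · have : (fun x => ψ k x - u x) = (fun x => ψ k x - w x) + fun x => w x - u x := by
        funext x; simp
      rw [this, e]
      exact (eLpNorm_add_le ((hψd k).continuous.sub hw.continuous).aestronglyMeasurable m1.1
        hP1).trans (add_le_add hk1 h1)
    · have : (fun x => gradient (ψ k) x - G x) =
          (fun x => gradient (ψ k) x - gradient w x) + fun x => gradient w x - G x := by
        funext x; simp
      rw [this, e]
      exact (eLpNorm_add_le (hgk.sub hgw).aestronglyMeasurable m2.1 hP1).trans
        (add_le_add hk2 h2)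
  choose ψ h1 h2 h3 h4 using key
  have hlim : Tendsto (fun n : ℕ => ENNReal.ofReal (2 / ((n : ℝ) + 1))) atTop (𝓝 0) := by
    have : Tendsto (fun n : ℕ => 2 / ((n : ℝ) + 1)) atTop (𝓝 0) := by
      have := (tendsto_one_div_add_atTop_nhds_zero_nat (𝕜 := ℝ)).const_mul 2
      simpa [div_eq_mul_inv] using this
    simpa using ENNReal.tendsto_ofReal this
  exact ⟨ψ, h1, h2, tendsto_of_tendsto_of_tendsto_of_le_of_le tendsto_const_nhds hlim
    (fun _ => zero_le) h3, tendsto_of_tendsto_of_tendsto_of_le_of_le tendsto_const_nhds hlim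
    (fun _ => zero_le) h4⟩

end Sobolev

end

noncomputable section

namespace Sobolev

open Filter Topology LpTools

variable {N : ℕ} {P : ℝ≥0∞}

/-! ### The Sobolev inequality and the translation estimate -/

theorem exists_ae_subseq {F : Type*} [NormedAddCommGroup F] (hP1 : 1 ≤ P) {f : ℕ → RN N → F}
    {g : RN N → F} (hf : ∀ n, AEStronglyMeasurable (f n) volume)
    (hg : AEStronglyMeasurable g volume)
    (h : Tendsto (fun n => eLpNorm (fun x => f n x - g x) P volume) atTop (𝓝 0)) :
    ∃ ns : ℕ → ℕ, StrictMono ns ∧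
      ∀ᵐ x, Tendsto (fun n => f (ns n) x) atTop (𝓝 (g x)) :=
  (tendstoInMeasure_of_tendsto_eLpNorm (zero_lt_one.trans_le hP1).ne' hf hg h).exists_seq_tendsto_ae

theorem tendsto_eLpNorm_of_sub {F : Type*} [NormedAddCommGroup F] (hP1 : 1 ≤ P) {f : ℕ → RN N → F}
    {g : RN N → F} (hf : ∀ n, AEStronglyMeasurable (f n) volume) (hg : MemLp g P volume)
    (h : Tendsto (fun n => eLpNorm (fun x => f n x - g x) P volume) atTop (𝓝 0)) :
    Tendsto (fun n => eLpNorm (f n) P volume) atTop (𝓝 (eLpNorm g P volume)) := by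
  refine tendsto_of_tendsto_of_tendsto_of_le_of_le
    (g := fun n => eLpNorm g P volume - eLpNorm (fun x => f n x - g x) P volume)
    (h := fun n => eLpNorm g P volume + eLpNorm (fun x => f n x - g x) P volume) ?_ ?_ ?_ ?_
  · have := ENNReal.Tendsto.sub (tendsto_const_nhds (x := eLpNorm g P volume)) h
      (Or.inl hg.2.ne)
    simpa using this
  · simpa using tendsto_const_nhds.add h
  · intro n
    rw [tsub_le_iff_right]
    have e : g = f n - fun x => f n x - g x := by funext x; simp
    calc eLpNorm g P volume = eLpNorm (f n - fun x => f n x - g x) P volume := by rw [← e]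
      _ ≤ _ := eLpNorm_sub_le (hf n) ((hf n).sub hg.1) hP1
  · intro n
    have e : f n = g + fun x => f n x - g x := by funext x; simp
    calc eLpNorm (f n) P volume = eLpNorm (g + fun x => f n x - g x) P volume := by rw [← e]
      _ ≤ _ := eLpNorm_add_le hg.1 ((hf n).sub hg.1) hP1

/-- The Gagliardo–Nirenberg–Sobolev inequality for weakly differentiable functions. -/
theorem exists_sobolev_const {p : ℝ} (hp : 1 ≤ p) (hpN : p < N) : ∃ C : ℝ, 0 ≤ C ∧
    ∀ (u : RN N → ℝ) (G : RN N → RN N), IsWeakGradient u G → MemLp u (ENNReal.ofReal p) volume →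
      MemLp G (ENNReal.ofReal p) volume →
      eLpNorm u (ENNReal.ofReal (N * p / (N - p))) volume ≤
        ENNReal.ofReal C * eLpNorm G (ENNReal.ofReal p) volume := by
  have hp0 : 0 < p := by linarith
  have hN : (0 : ℝ) < N := by linarith
  have hNp : 0 < (N : ℝ) - p := by linarith
  set q : ℝ := N * p / (N - p) with hq
  have hq0 : 0 < q := by positivity
  set C := SNormLESNormFDerivOfEqConst ℝ (volume : Measure (RN N)) p.toNNReal with hC
  refine ⟨C, C.2, fun u G h hu hG => ?_⟩
  have hP1 : 1 ≤ ENNReal.ofReal p := by rwa [ENNReal.one_le_ofReal]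
  obtain ⟨ψ, hψd, hψs, l1, l2⟩ := exists_test_seq hP1 ENNReal.ofReal_ne_top h hu hG
  obtain ⟨ns, hns, hae⟩ := exists_ae_subseq hP1
    (fun n => (hψd n).continuous.aestronglyMeasurable) hu.1 l1
  have l2' := (tendsto_eLpNorm_of_sub hP1 (fun n => (continuous_gradient
    ((hψd n).of_le (by simp))).aestronglyMeasurable) hG l2).comp hns.tendsto_atTop
  have hineq : ∀ n, eLpNorm (ψ n) (ENNReal.ofReal q) volume ≤
      ENNReal.ofReal C * eLpNorm (gradient (ψ n)) (ENNReal.ofReal p) volume := by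
    intro n
    have := eLpNorm_le_eLpNorm_fderiv_of_eq (volume : Measure (RN N)) ((hψd n).of_le (by simp) :
      ContDiff ℝ 1 (ψ n)) (hψs n)
      (p := p.toNNReal) (p' := q.toNNReal) (by simpa using hp) (by
        rw [finrank_euclideanSpace_fin]; exact_mod_cast hN) (by
        rw [finrank_euclideanSpace_fin, Real.coe_toNNReal _ hq0.le, NNReal.coe_inv,
          Real.coe_toNNReal _ hp0.le, hq]
        field_simp)
    have e : eLpNorm (gradient (ψ n)) (ENNReal.ofReal p) volume =
        eLpNorm (fderiv ℝ (ψ n)) (ENNReal.ofReal p) volume :=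
      eLpNorm_congr_norm_ae (Eventually.of_forall fun x => norm_gradient _ x)
    rw [e, ENNReal.ofReal_coe_nnreal]
    exact this
  -- Fatou's lemma along a subsequence of test functions converging almost everywhere, whose
  -- gradient norms converge.
  calc eLpNorm u (ENNReal.ofReal q) volume
      ≤ liminf (fun n => eLpNorm (ψ (ns n)) (ENNReal.ofReal q) volume) atTop :=
        Lp.eLpNorm_lim_le_liminf_eLpNorm
          (fun n => (hψd _).continuous.aestronglyMeasurable) _ hae
    _ ≤ liminf (fun n => ENNReal.ofReal C *
          eLpNorm (gradient (ψ (ns n))) (ENNReal.ofReal p) volume) atTop :=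
        liminf_le_liminf (Eventually.of_forall fun n => hineq (ns n))
    _ = _ := (ENNReal.Tendsto.const_mul l2' (Or.inr ENNReal.ofReal_ne_top)).liminf_eq

theorem measurePreserving_sub_right (t : RN N) :
    MeasurePreserving (fun x : RN N => x - t) volume volume := by
  simpa [sub_eq_add_neg] using measurePreserving_add_right (volume : Measure (RN N)) (-t)

theorem eLpNorm_translate {F : Type*} [NormedAddCommGroup F] {f : RN N → F}
    (hf : AEStronglyMeasurable f volume) (t : RN N) :
    eLpNorm (fun x => f (x - t)) P volume = eLpNorm f P volume :=
  eLpNorm_comp_measurePreserving hf (measurePreserving_sub_right t)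

theorem eLpNorm_translate_sub_le_two {f : RN N → ℝ} (hP1 : 1 ≤ P)
    (hf : AEStronglyMeasurable f volume) (t : RN N) :
    eLpNorm (fun x => f (x - t) - f x) P volume ≤ 2 * eLpNorm f P volume := by
  have hft : AEStronglyMeasurable (fun x => f (x - t)) volume :=
    hf.comp_measurePreserving (measurePreserving_sub_right t)
  refine (eLpNorm_sub_le hft hf hP1).trans_eq ?_
  rw [eLpNorm_translate hf, two_mul]

/-- The difference is the integral of the directional derivative over the segment. It is an average
of translates of the gradient, each with the same norm. -/
theorem eLpNorm_translate_sub_le_of_test (hP1 : 1 ≤ P) (hP : P ≠ ⊤) {ψ : RN N → ℝ}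
    (hψ : ContDiff ℝ 1 ψ) (t : RN N) :
    eLpNorm (fun x => ψ (x - t) - ψ x) P volume ≤ ‖t‖ₑ * eLpNorm (gradient ψ) P volume := by
  have hP0 : P ≠ 0 := (zero_lt_one.trans_le hP1).ne'
  have hp0 : 0 < P.toReal := ENNReal.toReal_pos hP0 hP
  set ν := (volume : Measure ℝ).restrict (Set.Ioc 0 1) with hν
  have : IsProbabilityMeasure ν := ⟨by simp [hν]⟩
  have hg := continuous_gradient hψ
  refine eLpNorm_le_of_enorm_le_lintegral hP1 hP (ν := ν)
    (k := fun x s => ‖t‖ₑ * ‖gradient ψ (x - s • t)‖ₑ) ?_ (fun x => ?_) ?_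
  · have : Continuous fun z : RN N × ℝ => gradient ψ (z.1 - z.2 • t) := by fun_prop
    exact this.enorm.measurable.const_mul _
  · have hd : ∀ s ∈ Set.uIcc (0 : ℝ) 1, HasDerivAt (fun s : ℝ => ψ (x - s • t))
        (- fderiv ℝ ψ (x - s • t) t) s := by
      intro s _
      have h1 : HasDerivAt (fun s : ℝ => x - s • t) (-t) s := by
        simpa using ((hasDerivAt_id s).smul_const t).const_sub x
      have := ((hψ.differentiable (by simp) (x - s • t)).hasFDerivAt).comp_hasDerivAt s h1
      rw [map_neg] at this
      exact this
    have hc : Continuous fun s : ℝ => - fderiv ℝ ψ (x - s • t) t := by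
      have := hψ.continuous_fderiv (by simp)
      fun_prop
    have := intervalIntegral.integral_eq_sub_of_hasDerivAt hd (hc.intervalIntegrable _ _)
    simp only [one_smul, zero_smul, sub_zero] at this
    rw [← this, intervalIntegral.integral_of_le zero_le_one]
    refine (enorm_integral_le_lintegral_enorm _).trans (lintegral_mono fun s => ?_)
    rw [enorm_neg, ← inner_gradient, mul_comm, ← ofReal_norm, ← ofReal_norm, ← ofReal_norm,
      ← ENNReal.ofReal_mul (norm_nonneg _)]
    exact ENNReal.ofReal_le_ofReal (norm_inner_le_norm _ _)
  · refine Eventually.of_forall fun s => ?_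
    have e : ∀ x, (‖t‖ₑ * ‖gradient ψ (x - s • t)‖ₑ) ^ P.toReal =
        ‖t‖ₑ ^ P.toReal * ‖gradient ψ (x - s • t)‖ₑ ^ P.toReal :=
      fun x => ENNReal.mul_rpow_of_nonneg _ _ hp0.le
    simp_rw [e]
    rw [lintegral_const_mul' _ _ (ENNReal.rpow_ne_top_of_nonneg hp0.le (by simp)),
      ENNReal.mul_rpow_of_nonneg _ _ hp0.le]
    gcongr
    rw [eLpNorm_eq_lintegral_rpow_enorm_toReal hP0 hP, ← ENNReal.rpow_mul,
      one_div_mul_cancel hp0.ne', ENNReal.rpow_one]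
    exact le_of_eq (lintegral_sub_right_eq_self (fun x => ‖gradient ψ x‖ₑ ^ P.toReal) (s • t))

/-- The `L^P`-norm of a difference of translates is controlled by the weak gradient. -/
theorem eLpNorm_translate_sub_le (hP1 : 1 ≤ P) (hP : P ≠ ⊤) {u : RN N → ℝ} {G : RN N → RN N}
    (h : IsWeakGradient u G) (hu : MemLp u P volume) (hG : MemLp G P volume) (t : RN N) :
    eLpNorm (fun x => u (x - t) - u x) P volume ≤ ‖t‖ₑ * eLpNorm G P volume := by
  obtain ⟨ψ, hψd, hψs, l1, l2⟩ := exists_test_seq hP1 hP h hu hG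
  have l2' := tendsto_eLpNorm_of_sub hP1 (fun n => (continuous_gradient
    ((hψd n).of_le (by simp))).aestronglyMeasurable) hG l2
  have l3 : Tendsto (fun n => 2 * eLpNorm (fun x => ψ n x - u x) P volume +
      ‖t‖ₑ * eLpNorm (gradient (ψ n)) P volume) atTop (𝓝 (2 * 0 + ‖t‖ₑ * eLpNorm G P volume)) :=
    (ENNReal.Tendsto.const_mul l1 (Or.inr (by simp))).add
      (ENNReal.Tendsto.const_mul l2' (Or.inr (by simp)))
  rw [mul_zero, zero_add] at l3
  refine ge_of_tendsto' l3 fun n => ?_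
  have hm : AEStronglyMeasurable (fun x => ψ n x - u x) volume :=
    (hψd n).continuous.aestronglyMeasurable.sub hu.1
  have hψt : Continuous fun x => ψ n (x - t) - ψ n x :=
    ((hψd n).continuous.comp (continuous_id.sub continuous_const)).sub (hψd n).continuous
  have e : (fun x => u (x - t) - u x) = (fun x => ψ n (x - t) - ψ n x) -
      fun x => (fun x => ψ n x - u x) (x - t) - (fun x => ψ n x - u x) x := by
    funext x; simp only [Pi.sub_apply]; ring
  have hm' : AEStronglyMeasurable
      (fun x => (fun x => ψ n x - u x) (x - t) - (fun x => ψ n x - u x) x) volume :=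
    (hm.comp_measurePreserving (measurePreserving_sub_right t)).sub hm
  rw [e]
  refine (eLpNorm_sub_le hψt.aestronglyMeasurable hm' hP1).trans ?_
  rw [add_comm]
  exact add_le_add (eLpNorm_translate_sub_le_two hP1 hm t)
    (eLpNorm_translate_sub_le_of_test hP1 hP ((hψd n).of_le (by simp)) t)

end Sobolev

end

/-! ### Compact operators into Lebesgue spaces -/

noncomputable section

namespace LpTools

open Filter Topology

theorem exists_clm_of_eLpNorm_le {X F α : Type*} [NormedAddCommGroup X] [NormedSpace ℝ X]
    [NormedAddCommGroup F] [NormedSpace ℝ F] [MeasurableSpace α] {μ : Measure α} {s : ℝ≥0∞}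
    [Fact (1 ≤ s)] {T : X → α → F} {C : ℝ} (hC : 0 ≤ C) (hm : ∀ u, AEStronglyMeasurable (T u) μ)
    (hadd : ∀ u v, T (u + v) =ᵐ[μ] fun x => T u x + T v x)
    (hsmul : ∀ (c : ℝ) u, T (c • u) =ᵐ[μ] fun x => c • T u x)
    (hb : ∀ u, eLpNorm (T u) s μ ≤ ENNReal.ofReal (C * ‖u‖)) :
    ∃ L : X →L[ℝ] Lp F s μ, ∀ u, L u =ᵐ[μ] T u := by
  have hl : ∀ u, MemLp (T u) s μ := fun u => ⟨hm u, (hb u).trans_lt ENNReal.ofReal_lt_top⟩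
  let L₀ : X →ₗ[ℝ] Lp F s μ :=
    { toFun := fun u => (hl u).toLp
      map_add' := fun u v => by
        rw [← MemLp.toLp_add, MemLp.toLp_eq_toLp_iff]
        exact hadd u v
      map_smul' := fun c u => by
        rw [RingHom.id_apply, ← MemLp.toLp_const_smul, MemLp.toLp_eq_toLp_iff]
        exact hsmul c u }
  refine ⟨L₀.mkContinuous C fun u => ?_, fun u => (hl u).coeFn_toLp⟩
  change ‖(hl u).toLp‖ ≤ _
  rw [Lp.norm_toLp]
  exact ENNReal.toReal_le_of_le_ofReal (by positivity) (hb u)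

theorem opNorm_sub_le_of_eLpNorm_le {X F α : Type*} [NormedAddCommGroup X] [NormedSpace ℝ X]
    [NormedAddCommGroup F] [NormedSpace ℝ F] [MeasurableSpace α] {μ : Measure α} {s : ℝ≥0∞}
    [Fact (1 ≤ s)] {L L' : X →L[ℝ] Lp F s μ} {T : X → α → F} (hT : ∀ u, L u =ᵐ[μ] T u) {C : ℝ}
    (hC : 0 ≤ C) (hb : ∀ u, eLpNorm (fun x => T u x - L' u x) s μ ≤ ENNReal.ofReal (C * ‖u‖)) :
    ‖L - L'‖ ≤ C := by
  refine (L - L').opNorm_le_bound hC fun u => ?_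
  rw [Lp.norm_def]
  refine ENNReal.toReal_le_of_le_ofReal (by positivity) (le_trans (le_of_eq ?_) (hb u))
  refine eLpNorm_congr_ae ?_
  filter_upwards [hT u, Lp.coeFn_sub (L u) (L' u)] with x h1 h2
  rw [sub_apply, h2, Pi.sub_apply, h1]

theorem isCompactOperator_of_forall_exists {X Y : Type*} [NormedAddCommGroup X] [NormedSpace ℝ X]
    [NormedAddCommGroup Y] [NormedSpace ℝ Y] [CompleteSpace Y] {L : X →L[ℝ] Y}
    (h : ∀ κ > 0, ∃ L' : X →L[ℝ] Y, IsCompactOperator L' ∧ ‖L - L'‖ < κ) : IsCompactOperator L := by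
  refine (isClosed_setOfPred_isCompactOperator (𝕜₁ := ℝ) (σ₁₂ := RingHom.id ℝ) (M₁ := X)
    (M₂ := Y)).closure_subset (SeminormedAddGroup.mem_closure_iff.2 fun κ hκ => ?_)
  obtain ⟨L', h1, h2⟩ := h κ hκ
  exact ⟨L', h1, by rwa [neg_add_eq_sub, norm_sub_rev]⟩

/-- An `L^s` family of functionals induces a compact operator into `L^s`. -/
theorem isCompactOperator_of_Lp {X α : Type*} [NormedAddCommGroup X] [NormedSpace ℝ X]
    [MeasurableSpace α] {μ : Measure α} {s : ℝ≥0∞} [Fact (1 ≤ s)] (hs : s ≠ ⊤)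
    (Θ : Lp (X →L[ℝ] ℝ) s μ) :
    IsCompactOperator
      ((((ContinuousLinearMap.apply ℝ ℝ : X →L[ℝ] (X →L[ℝ] ℝ) →L[ℝ] ℝ).compLpL₂ (p := s)
        (μ := μ)).flip Θ : X →L[ℝ] Lp ℝ s μ)) := by
  set B := ((ContinuousLinearMap.apply ℝ ℝ : X →L[ℝ] (X →L[ℝ] ℝ) →L[ℝ] ℝ).compLpL₂ (p := s)
        (μ := μ)).flip with hB
  refine Lp.induction hs (motive := fun Θ => IsCompactOperator (B Θ)) ?_ ?_ ?_ Θ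
  · intro c A hA hμ
    -- For an indicator the operator factors through the scalars, hence has rank at most one.
    have e : (B (Lp.simpleFunc.indicatorConst s hA hμ.ne c : Lp (X →L[ℝ] ℝ) s μ) : X → Lp ℝ s μ) =
        (ContinuousLinearMap.toSpanSingleton ℝ (indicatorConstLp s hA hμ.ne (1 : ℝ))) ∘ c := by
      funext u
      rw [hB, ContinuousLinearMap.flip_apply, ContinuousLinearMap.compLpL₂_apply_apply]
      refine Lp.ext ?_
      rw [Lp.simpleFunc.coe_indicatorConst]
      filter_upwards [ContinuousLinearMap.coeFn_compLp (ContinuousLinearMap.apply ℝ ℝ u)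
        (indicatorConstLp s hA hμ.ne c), indicatorConstLp_coeFn (p := s) (hs := hA) (hμs := hμ.ne)
        (c := c), indicatorConstLp_coeFn (p := s) (hs := hA) (hμs := hμ.ne) (c := (1 : ℝ)),
        Lp.coeFn_smul (c u) (indicatorConstLp s hA hμ.ne (1 : ℝ))] with x h1 h2 h3 h4
      rw [h1, h2, Function.comp_apply, ContinuousLinearMap.toSpanSingleton_apply, h4,
        Pi.smul_apply, h3]
      by_cases hx : x ∈ A <;> simp [hx]
    rw [e]
    exact (isCompactOperator_of_locallyCompactSpace_dom c).clm_comp _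
  · intro f g hf hg _ h1 h2
    rw [map_add]
    exact h1.add h2
  · exact (isClosed_setOfPred_isCompactOperator (𝕜₁ := ℝ) (σ₁₂ := RingHom.id ℝ)).preimage B.continuous

theorem exists_compact_of_memLp {X α : Type*} [NormedAddCommGroup X] [NormedSpace ℝ X]
    [MeasurableSpace α] {μ : Measure α} {s : ℝ≥0∞} [Fact (1 ≤ s)] (hs : s ≠ ⊤)
    {Θ : α → X →L[ℝ] ℝ} (hΘ : MemLp Θ s μ) : ∃ L : X →L[ℝ] Lp ℝ s μ,
      IsCompactOperator L ∧ ∀ u, L u =ᵐ[μ] fun x => Θ x u := by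
  refine ⟨_, isCompactOperator_of_Lp hs hΘ.toLp, fun u => ?_⟩
  rw [ContinuousLinearMap.flip_apply, ContinuousLinearMap.compLpL₂_apply_apply]
  filter_upwards [ContinuousLinearMap.coeFn_compLp (ContinuousLinearMap.apply ℝ ℝ u) hΘ.toLp,
    hΘ.coeFn_toLp] with x h1 h2
  rw [h1, h2]
  simp

/-- The weights `a` and `b` solve `a * p + b * q = r` with `a + b = 1`; the bound remains
homogeneous of degree one in `m`. -/
theorem eLpNorm_le_of_interpolation {α F : Type*} [MeasurableSpace α] {μ : Measure α}
    [NormedAddCommGroup F] {f : α → F} (hf : AEStronglyMeasurable f μ) {p q r A B m : ℝ}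
    (hp : 0 < p) (hpr : p ≤ r) (hrq : r < q) (hA : 0 ≤ A) (hB : 0 ≤ B) (hm : 0 ≤ m)
    (h1 : eLpNorm f (ENNReal.ofReal p) μ ≤ ENNReal.ofReal (A * m))
    (h2 : eLpNorm f (ENNReal.ofReal q) μ ≤ ENNReal.ofReal (B * m)) :
    eLpNorm f (ENNReal.ofReal r) μ ≤ ENNReal.ofReal
      ((A ^ (p * ((q - r) / (q - p))) * B ^ (q * ((r - p) / (q - p)))) ^ (1 / r) * m) := by
  have hqp : 0 < q - p := by linarith
  have hr0 : 0 < r := by linarith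
  set a := (q - r) / (q - p) with ha
  set b := (r - p) / (q - p) with hb
  have ha0 : 0 ≤ a := div_nonneg (by linarith) hqp.le
  have hb0 : 0 ≤ b := div_nonneg (by linarith) hqp.le
  have hab : a + b = 1 := by rw [ha, hb]; field_simp; ring
  have hr : a * p + b * q = r := by rw [ha, hb]; field_simp; ring
  have hq0 : 0 < q := by linarith
  have key := eLpNorm_rpow_le_interpolation hf hp hq0 ha0 hb0 hab
  rw [hr] at key
  rw [← ENNReal.rpow_le_rpow_iff hr0]
  refine key.trans ?_
  calc _ ≤ (ENNReal.ofReal (A * m) ^ p) ^ a * (ENNReal.ofReal (B * m) ^ q) ^ b := by gcongr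
    _ = ENNReal.ofReal ((A * m) ^ (p * a) * (B * m) ^ (q * b)) := by
        rw [← ENNReal.rpow_mul, ← ENNReal.rpow_mul, ENNReal.ofReal_rpow_of_nonneg (by positivity)
          (by positivity), ENNReal.ofReal_rpow_of_nonneg (by positivity) (by positivity),
          ENNReal.ofReal_mul (by positivity)]
    _ = _ := by
        rw [ENNReal.ofReal_rpow_of_nonneg (by positivity) hr0.le]
        congr 1
        have e1 : ((A ^ (p * a) * B ^ (q * b)) ^ (1 / r) * m) ^ r =
            (A ^ (p * a) * B ^ (q * b)) * m ^ r := by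
          rw [Real.mul_rpow (by positivity) hm, ← Real.rpow_mul (by positivity),
            one_div_mul_cancel hr0.ne', Real.rpow_one]
        have e2 : m ^ r = m ^ (p * a) * m ^ (q * b) := by
          rw [← Real.rpow_add_of_nonneg hm (by positivity) (by positivity), ← hr]
          ring_nf
        rw [e1, e2, Real.mul_rpow hA hm, Real.mul_rpow hB hm]
        ring

end LpTools

namespace Sobolev

open Filter Topology LpTools

variable {N : ℕ} {p r : ℝ} [Fact (1 ≤ ENNReal.ofReal p)]

/-! ### Embeddings into Lebesgue spaces -/

theorem eLpNorm_fst_le (u : sobolevSpace N (ENNReal.ofReal p)) :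
    eLpNorm u.1.fst (ENNReal.ofReal p) volume ≤ ENNReal.ofReal ‖u‖ := by
  rw [eLpNorm_eq_ofReal_norm]
  exact ENNReal.ofReal_le_ofReal (norm_fst_le ENNReal.ofReal_ne_top u)

theorem eLpNorm_snd_le (u : sobolevSpace N (ENNReal.ofReal p)) :
    eLpNorm u.1.snd (ENNReal.ofReal p) volume ≤ ENNReal.ofReal ‖u‖ := by
  rw [eLpNorm_eq_ofReal_norm]
  exact ENNReal.ofReal_le_ofReal (norm_snd_le ENNReal.ofReal_ne_top u)

theorem exists_critical_embedding_const (hp : 1 ≤ p) (hpN : p < N) : ∃ C : ℝ, 0 ≤ C ∧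
    ∀ u : sobolevSpace N (ENNReal.ofReal p),
      eLpNorm u.1.fst (ENNReal.ofReal (N * p / (N - p))) volume ≤ ENNReal.ofReal (C * ‖u‖) := by
  obtain ⟨C, hC, h⟩ := exists_sobolev_const hp hpN
  refine ⟨C, hC, fun u => (h _ _ u.2 (Lp.memLp _) (Lp.memLp _)).trans ?_⟩
  rw [ENNReal.ofReal_mul hC]
  gcongr
  exact eLpNorm_snd_le u

theorem exists_embedding_const (hp : 1 ≤ p) (hpN : p < N) (hpr : p ≤ r)
    (hr : r < N * p / (N - p)) : ∃ S : ℝ, 0 ≤ S ∧ ∀ u : sobolevSpace N (ENNReal.ofReal p),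
      eLpNorm u.1.fst (ENNReal.ofReal r) volume ≤ ENNReal.ofReal (S * ‖u‖) := by
  obtain ⟨C, hC, h⟩ := exists_critical_embedding_const hp hpN
  refine ⟨_, ?_, fun u => eLpNorm_le_of_interpolation (Lp.aestronglyMeasurable _)
    (by linarith) hpr hr zero_le_one hC (norm_nonneg u) (by simpa using eLpNorm_fst_le u) (h u)⟩
  positivity

open ContinuousLinearMap in
open scoped Convolution in
/-- The values of a mollification, as functionals depending continuously on the point. -/
theorem exists_convolution_functional (hp : 1 < p) {ρ : RN N → ℝ} (hc : Continuous ρ)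
    (hs : HasCompactSupport ρ) : ∃ Θ : RN N → sobolevSpace N (ENNReal.ofReal p) →L[ℝ] ℝ,
      Continuous Θ ∧ ∀ x u, Θ x u = (ρ ⋆[lsmul ℝ ℝ, volume] u.1.fst) x := by
  set P := ENNReal.ofReal p with hP
  set Q := ENNReal.conjExponent P with hQ
  have : Fact (1 ≤ Q) := ⟨ENNReal.HolderConjugate.one_le _ P⟩
  have hQt : Q ≠ ⊤ := by
    rw [hQ, ENNReal.conjExponent]
    refine ENNReal.add_ne_top.2 ⟨ENNReal.one_ne_top, ENNReal.inv_ne_top.2 ?_⟩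
    exact (tsub_pos_of_lt (by rwa [hP, ENNReal.one_lt_ofReal])).ne'
  have : Fact (Q ≠ ⊤) := ⟨hQt⟩
  have hg : MemLp (fun y => ρ (-y)) Q volume :=
    (hc.comp continuous_neg).memLp_of_hasCompactSupport (hs.comp_homeomorph (Homeomorph.neg _))
  have hgc : Continuous fun x : RN N => DomAddAct.mk (-x) +ᵥ hg.toLp :=
    (DomAddAct.continuous_mk.comp continuous_neg).vadd continuous_const
  have hgx : ∀ x : RN N, ((DomAddAct.mk (-x) +ᵥ hg.toLp : Lp ℝ Q volume) : RN N → ℝ) =ᵐ[volume]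
      fun y => ρ (x - y) := by
    intro x
    have h1 := (measurePreserving_add_left (volume : Measure (RN N)) (-x)).quasiMeasurePreserving
      |>.ae_eq_comp hg.coeFn_toLp
    filter_upwards [DomAddAct.vadd_Lp_ae_eq (DomAddAct.mk (-x)) hg.toLp, h1] with y h2 h3
    rw [h2]
    have : (DomAddAct.mk.symm (DomAddAct.mk (-x)) : RN N) +ᵥ y = -x + y := rfl
    rw [this]
    simp only [Function.comp_apply] at h3
    rw [h3]
    congr 1
    abel
  refine ⟨fun x => (((ContinuousLinearMap.mul ℝ ℝ).lpPairing volume P Q).flip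
    (DomAddAct.mk (-x) +ᵥ hg.toLp)).comp (fstL N P), ?_, fun x u => ?_⟩
  · exact ((((ContinuousLinearMap.mul ℝ ℝ).lpPairing volume P Q).flip.continuous.comp
      hgc).clm_comp continuous_const)
  · rw [ContinuousLinearMap.comp_apply, ContinuousLinearMap.flip_apply,
      ContinuousLinearMap.lpPairing_eq_integral, convolution_lsmul_swap]
    refine integral_congr_ae ?_
    filter_upwards [hgx x] with y hy
    rw [hy, fstL_apply]
    simp [mul_comm]

open ContinuousLinearMap in
open scoped Convolution in
/-- The error of mollification is small, uniformly on bounded sets. -/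
theorem exists_mollifier (hp : 1 ≤ p) (hpN : p < N) (hpr : p ≤ r)
    (hr : r < N * p / (N - p)) {κ : ℝ} (hκ : 0 < κ) : ∃ ρ : RN N → ℝ, Continuous ρ ∧
      HasCompactSupport ρ ∧ ∀ u : sobolevSpace N (ENNReal.ofReal p),
        eLpNorm (fun x => (ρ ⋆[lsmul ℝ ℝ, volume] u.1.fst) x - u.1.fst x)
          (ENNReal.ofReal r) volume ≤ ENNReal.ofReal (κ * ‖u‖) := by
  obtain ⟨C, hC, hS⟩ := exists_critical_embedding_const hp hpN
  set q := N * p / (N - p) with hq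
  have hqp : 0 < q - p := by linarith
  have hr0 : 0 < r := by linarith
  have hP1 : 1 ≤ ENNReal.ofReal p := Fact.out
  have hQ1 : 1 ≤ ENNReal.ofReal q := by rw [ENNReal.one_le_ofReal]; linarith
  set a := (q - r) / (q - p) with ha
  have ha0 : 0 < p * a := mul_pos (by linarith) (div_pos (by linarith) hqp)
  set D := (2 * C) ^ (q * ((r - p) / (q - p))) with hD
  -- This factor results from interpolating the `L^p` error `t * ‖u‖` with the bound `2 * C * ‖u‖`
  -- in the critical space. As `r` is subcritical, the exponent of `t` is positive and the factor
  -- tends to zero with `t`.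
  have hcont : Continuous fun t : ℝ => (t ^ (p * a) * D) ^ (1 / r) :=
    (Real.continuous_rpow_const (by positivity)).comp
      ((Real.continuous_rpow_const ha0.le).mul continuous_const)
  have h0 : ((0 : ℝ) ^ (p * a) * D) ^ (1 / r) = 0 := by
    rw [Real.zero_rpow ha0.ne', zero_mul, Real.zero_rpow (by positivity)]
  have hlim := hcont.tendsto 0
  rw [h0] at hlim
  obtain ⟨t, ht0, ht⟩ := ((hlim.eventually (ge_mem_nhds hκ)).filter_mono
    (nhdsWithin_le_nhds (s := Set.Ioi 0))).and self_mem_nhdsWithin |>.exists.imp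
      fun t ht => And.intro ht.2 ht.1
  replace ht0 : 0 < t := ht0
  let φ : ContDiffBump (0 : RN N) := ⟨t / 2, t, by positivity, by linarith⟩
  set ρ := φ.normed volume with hρ
  have hρd : Continuous ρ := φ.continuous_normed
  have hρs : HasCompactSupport ρ := φ.hasCompactSupport_normed
  have hsupp : ∀ s, ρ s ≠ 0 → ‖s‖ < t := by
    intro s hs
    have : s ∈ Function.support ρ := hs
    rw [hρ, φ.support_normed_eq] at this
    exact mem_ball_zero_iff.1 this
  refine ⟨ρ, hρd, hρs, fun u => ?_⟩
  have hul : LocallyIntegrable u.1.fst := (Lp.memLp _).locallyIntegrable hP1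
  have hm : AEStronglyMeasurable (fun x => (ρ ⋆[lsmul ℝ ℝ, volume] u.1.fst) x - u.1.fst x)
      volume :=
    ((hρs.continuous_convolution_left _ hρd hul).aestronglyMeasurable).sub
      (Lp.aestronglyMeasurable _)
  refine (eLpNorm_le_of_interpolation hm (A := t) (B := 2 * C) (by linarith) hpr hr ht0.le
    (by positivity) (norm_nonneg u) ?_ ?_).trans (ENNReal.ofReal_le_ofReal ?_)
  · refine eLpNorm_convolution_sub_le hP1 ENNReal.ofReal_ne_top (Lp.stronglyMeasurable _) hul hρd
      hρs (fun x => φ.nonneg_normed x) φ.integral_normed fun s hs => ?_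
    refine (eLpNorm_translate_sub_le hP1 ENNReal.ofReal_ne_top u.2 (Lp.memLp _) (Lp.memLp _)
      s).trans ?_
    rw [ENNReal.ofReal_mul ht0.le, ← ofReal_norm]
    gcongr
    · exact (hsupp s hs).le
    · exact eLpNorm_snd_le u
  · refine eLpNorm_convolution_sub_le hQ1 ENNReal.ofReal_ne_top (Lp.stronglyMeasurable _) hul hρd
      hρs (fun x => φ.nonneg_normed x) φ.integral_normed fun s hs => ?_
    refine (eLpNorm_translate_sub_le_two hQ1 (Lp.aestronglyMeasurable _) s).trans ?_
    rw [mul_assoc, ENNReal.ofReal_mul (by norm_num)]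
    gcongr
    · simp
    · exact hS u
  · gcongr

theorem exists_cutoff {K : Set (RN N)} (hK : IsCompact K) : ∃ χ : RN N → ℝ, Continuous χ ∧
    HasCompactSupport χ ∧ (∀ x, 0 ≤ χ x ∧ χ x ≤ 1) ∧ ∀ x ∈ K, χ x = 1 := by
  obtain ⟨R, hR0, hKR⟩ := hK.isBounded.subset_closedBall_lt 0 0
  let χ : ContDiffBump (0 : RN N) := ⟨R, R + 1, hR0, by linarith⟩
  exact ⟨χ, χ.continuous, χ.hasCompactSupport, fun x => ⟨χ.nonneg, χ.le_one⟩,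
    fun x hx => χ.one_of_mem_closedBall (hKR hx)⟩

theorem exists_hasCompactSupport_approx {k : RN N → ℝ} (hk : Continuous k) {B : ℝ}
    (hB : ∀ x, |k x| ≤ B) (hk0 : Tendsto k (cocompact _) (𝓝 0)) {κ : ℝ} (hκ : 0 < κ) :
    ∃ k' : RN N → ℝ, Continuous k' ∧ HasCompactSupport k' ∧ (∀ x, |k' x| ≤ B) ∧
      ∀ x, |k x - k' x| ≤ κ := by
  have hev := hk0.abs
  rw [abs_zero] at hev
  obtain ⟨K, hK, hKk⟩ := mem_cocompact.1 (hev.eventually (ge_mem_nhds hκ))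
  obtain ⟨χ, hχc, hχs, hχ01, hχK⟩ := exists_cutoff hK
  refine ⟨fun x => k x * χ x, hk.mul hχc, hχs.mul_left, fun x => ?_, fun x => ?_⟩
  · rw [abs_mul, abs_of_nonneg (hχ01 x).1]
    exact (mul_le_of_le_one_right (abs_nonneg _) (hχ01 x).2).trans (hB x)
  · by_cases hx : x ∈ K
    · simp only [hχK x hx, mul_one, sub_self, abs_zero]
      exact hκ.le
    · have h1 : |k x| ≤ κ := hKk hx
      have h2 : k x - k x * χ x = k x * (1 - χ x) := by ring
      have h3 := (hχ01 x).2
      have h4 := (hχ01 x).1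
      rw [h2, abs_mul, abs_of_nonneg (by linarith : 0 ≤ 1 - χ x)]
      exact (mul_le_of_le_one_right (abs_nonneg _) (by linarith)).trans h1

/-- Decompose the error into `(k - k') u` and `-k' (w - u)`; the tolerances are chosen so that each
costs at most `κ / 4`. -/
theorem eLpNorm_sub_le_of_approx [Fact (1 ≤ ENNReal.ofReal r)] {k k' : RN N → ℝ} (hk : Continuous k)
    (hk' : Continuous k') {B S κ : ℝ} (hκ : 0 ≤ κ) (hB0 : 0 ≤ B) (hS0 : 0 ≤ S)
    (hB : ∀ x, |k' x| ≤ B) (hkk' : ∀ x, |k x - k' x| ≤ κ / (4 * (S + 1)))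
    {u w : RN N → ℝ} (hu : AEStronglyMeasurable u volume) (hw : Continuous w) {m : ℝ} (hm : 0 ≤ m)
    (hS : eLpNorm u (ENNReal.ofReal r) volume ≤ ENNReal.ofReal (S * m))
    (hρ : eLpNorm (fun x => w x - u x) (ENNReal.ofReal r) volume ≤
      ENNReal.ofReal (κ / (4 * (B + 1)) * m)) :
    eLpNorm (fun x => k x * u x - k' x * w x) (ENNReal.ofReal r) volume ≤
      ENNReal.ofReal (κ / 2 * m) := by
  have e : (fun x => k x * u x - k' x * w x) = (fun x => (k x - k' x) * u x) +
      fun x => -k' x * (w x - u x) := by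
    funext x
    simp only [Pi.add_apply]
    ring
  rw [e]
  refine (eLpNorm_add_le ((hk.sub hk').aestronglyMeasurable.mul hu)
    (hk'.neg.aestronglyMeasurable.mul (hw.aestronglyMeasurable.sub hu)) Fact.out).trans ?_
  have h1 : eLpNorm (fun x => (k x - k' x) * u x) (ENNReal.ofReal r) volume ≤
      ENNReal.ofReal (κ / 4 * m) := by
    refine (eLpNorm_le_mul_eLpNorm_of_ae_le_mul (c := κ / (4 * (S + 1))) (g := u)
      (Eventually.of_forall fun x => ?_) _).trans ?_
    · rw [norm_mul]
      exact mul_le_mul_of_nonneg_right (hkk' x) (norm_nonneg _)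
    · refine (mul_le_mul_right hS _).trans ?_
      rw [← ENNReal.ofReal_mul (by positivity)]
      refine ENNReal.ofReal_le_ofReal ?_
      calc κ / (4 * (S + 1)) * (S * m) ≤ κ / (4 * (S + 1)) * ((S + 1) * m) := by
            gcongr; linarith
        _ = _ := by field_simp
  have h2 : eLpNorm (fun x => -k' x * (w x - u x)) (ENNReal.ofReal r) volume ≤
      ENNReal.ofReal (κ / 4 * m) := by
    refine (eLpNorm_le_mul_eLpNorm_of_ae_le_mul (c := B) (g := fun x => w x - u x)
      (Eventually.of_forall fun x => ?_) _).trans ?_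
    · rw [norm_mul, norm_neg]
      exact mul_le_mul_of_nonneg_right (hB x) (norm_nonneg _)
    · refine (mul_le_mul_right hρ _).trans ?_
      rw [← ENNReal.ofReal_mul hB0]
      refine ENNReal.ofReal_le_ofReal ?_
      calc B * (κ / (4 * (B + 1)) * m) ≤ (B + 1) * (κ / (4 * (B + 1)) * m) := by
            gcongr; linarith
        _ = _ := by field_simp
  refine (add_le_add h1 h2).trans_eq ?_
  rw [← ENNReal.ofReal_add (by positivity) (by positivity)]
  congr 1
  ring

/-- The approximating operator is `u ↦ k' * (ρ ⋆ u)`. Its values are functionals of `u` that depend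
continuously on the point and have compact support, hence form an `L^r` family, and
`exists_compact_of_memLp` applies. -/
theorem exists_compact_approx (hp : 1 < p) (hpN : p < N) (hpr : p ≤ r)
    (hr : r < N * p / (N - p)) [Fact (1 ≤ ENNReal.ofReal r)] {k : RN N → ℝ} (hk : Continuous k)
    {B : ℝ} (hB : ∀ x, |k x| ≤ B) (hk0 : Tendsto k (cocompact _) (𝓝 0)) {κ : ℝ} (hκ : 0 < κ) :
    ∃ L' : sobolevSpace N (ENNReal.ofReal p) →L[ℝ] Lp ℝ (ENNReal.ofReal r)
      (volume : Measure (RN N)), IsCompactOperator L' ∧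
        ∀ u, eLpNorm (fun x => k x * u.1.fst x - L' u x) (ENNReal.ofReal r) volume ≤
          ENNReal.ofReal (κ / 2 * ‖u‖) := by
  have hB0 : 0 ≤ B := (abs_nonneg _).trans (hB 0)
  refine (exists_embedding_const (N := N) hp.le hpN hpr hr).elim fun S hS => ?_
  have hS0 := hS.1
  refine (exists_hasCompactSupport_approx hk hB hk0
    (show 0 < κ / (4 * (S + 1)) by positivity)).elim fun k' hk' => ?_
  refine (exists_mollifier (N := N) hp.le hpN hpr hr
    (show 0 < κ / (4 * (B + 1)) by positivity)).elim fun ρ hρ => ?_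
  refine (exists_convolution_functional (N := N) hp hρ.1 hρ.2.1).elim fun Θ hΘ => ?_
  have hF : MemLp (fun x => k' x • Θ x) (ENNReal.ofReal r) volume :=
    Continuous.memLp_of_hasCompactSupport (f := fun x => k' x • Θ x) (hk'.1.smul hΘ.1)
      hk'.2.1.smul_right
  refine (exists_compact_of_memLp ENNReal.ofReal_ne_top hF).imp fun L' hL' => ⟨hL'.1, fun u => ?_⟩
  have e : (fun x => k x * u.1.fst x - L' u x) =ᵐ[volume]
      fun x => k x * u.1.fst x - k' x * Θ x u := by
    filter_upwards [hL'.2 u] with x h1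
    rw [h1, smul_apply, smul_eq_mul]
  rw [eLpNorm_congr_ae e]
  refine eLpNorm_sub_le_of_approx hk hk'.1 hκ.le hB0 hS0 hk'.2.2.1 hk'.2.2.2
    (Lp.aestronglyMeasurable _) (hΘ.1.clm_apply continuous_const) (norm_nonneg u) (hS.2 u) ?_
  simp_rw [hΘ.2]
  exact hρ.2.2 u

/-- Multiplication by a continuous function vanishing at infinity is compact into subcritical
Lebesgue spaces. -/
theorem exists_compact_embedding (hp : 1 < p) (hpN : p < N) (hpr : p ≤ r)
    (hr : r < N * p / (N - p)) [Fact (1 ≤ ENNReal.ofReal r)] {k : RN N → ℝ} (hk : Continuous k)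
    {B : ℝ} (hB : ∀ x, |k x| ≤ B) (hk0 : Tendsto k (cocompact _) (𝓝 0)) :
    ∃ ι : sobolevSpace N (ENNReal.ofReal p) →L[ℝ] Lp ℝ (ENNReal.ofReal r) volume,
      IsCompactOperator ι ∧ ∀ u, ι u =ᵐ[volume] fun x => k x * u.1.fst x := by
  refine (exists_embedding_const (N := N) hp.le hpN hpr hr).elim fun S hS => ?_
  have hS0 := hS.1
  have hB0 : 0 ≤ B := (abs_nonneg _).trans (hB 0)
  have hex : ∃ ι : sobolevSpace N (ENNReal.ofReal p) →L[ℝ] Lp ℝ (ENNReal.ofReal r) volume,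
      ∀ u, ι u =ᵐ[volume] fun x => k x * u.1.fst x := by
    refine exists_clm_of_eLpNorm_le (C := B * S) (by positivity) (fun u =>
      hk.aestronglyMeasurable.mul (Lp.aestronglyMeasurable _)) (fun u v => ?_) (fun c u => ?_)
      (fun u => ?_)
    · filter_upwards [Lp.coeFn_add u.1.fst v.1.fst] with x hx
      have : (u + v).1.fst = u.1.fst + v.1.fst := rfl
      rw [this, hx, Pi.add_apply, mul_add]
    · filter_upwards [Lp.coeFn_smul c u.1.fst] with x hx
      have : (c • u).1.fst = c • u.1.fst := rfl
      rw [this, hx, Pi.smul_apply, smul_eq_mul, smul_eq_mul]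
      ring
    · refine (eLpNorm_le_mul_eLpNorm_of_ae_le_mul (c := B) (g := u.1.fst)
        (Eventually.of_forall fun x => ?_) _).trans ?_
      · rw [norm_mul]
        exact mul_le_mul_of_nonneg_right (hB x) (norm_nonneg _)
      · rw [mul_assoc, ENNReal.ofReal_mul hB0]
        gcongr
        exact hS.2 u
  refine hex.imp fun ι hι => ⟨isCompactOperator_of_forall_exists fun κ hκ => ?_, hι⟩
  exact (exists_compact_approx hp hpN hpr hr hk hB hk0 hκ).imp fun L' h => ⟨h.1,
    (opNorm_sub_le_of_eLpNorm_le hι (half_pos hκ).le h.2).trans_lt (half_lt_self hκ)⟩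

end Sobolev

end

noncomputable section

namespace Sobolev

open Filter Topology LpTools

variable {N : ℕ} {P : ℝ≥0∞}

/-! ### Chain rule and positive part -/

theorem gradient_comp {h : ℝ → ℝ} (hh : ContDiff ℝ 1 h) {ψ : RN N → ℝ} (hψ : ContDiff ℝ 1 ψ)
    (x : RN N) : gradient (fun x => h (ψ x)) x = deriv h (ψ x) • gradient ψ x := by
  refine ext_inner_right ℝ fun v => ?_
  rw [real_inner_smul_left, inner_gradient, inner_gradient]
  have h1 := ((hh.differentiable (by simp) (ψ x)).hasDerivAt).comp_hasFDerivAt x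
    ((hψ.differentiable (by simp) x).hasFDerivAt)
  have e : fderiv ℝ (fun x => h (ψ x)) x = deriv h (ψ x) • fderiv ℝ ψ x := h1.fderiv
  rw [e]
  simp

theorem abs_sub_le_of_deriv_le {h : ℝ → ℝ} (hh : ContDiff ℝ 1 h) {L : ℝ}
    (hL : ∀ t, |deriv h t| ≤ L) (s t : ℝ) : |h s - h t| ≤ L * |s - t| := by
  simpa using convex_univ.norm_image_sub_le_of_norm_deriv_le
    (fun x _ => hh.differentiable (by simp) x) (fun x _ => hL x) (Set.mem_univ t) (Set.mem_univ s)

/-- Approximate by test functions converging almost everywhere. The gradient error splits into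
`h'(ψ_n) (∇ψ_n - G)`, controlled by the Lipschitz constant, and `(h'(ψ_n) - h'(u)) G`, controlled by
dominated convergence. -/
theorem isWeakGradient_comp (hP1 : 1 ≤ P) (hP : P ≠ ⊤) {u : RN N → ℝ} {G : RN N → RN N}
    (hw : IsWeakGradient u G) (hu : MemLp u P volume) (hG : MemLp G P volume) {h : ℝ → ℝ}
    (hh : ContDiff ℝ 1 h) (h0 : h 0 = 0) {L : ℝ} (hL : ∀ t, |deriv h t| ≤ L) :
    IsWeakGradient (fun x => h (u x)) (fun x => deriv h (u x) • G x) := by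
  have hP0 : P ≠ 0 := (zero_lt_one.trans_le hP1).ne'
  have hL0 : 0 ≤ L := (abs_nonneg _).trans (hL 0)
  have hlip := abs_sub_le_of_deriv_le hh hL
  have hd : Continuous (deriv h) := hh.continuous_deriv (by simp)
  obtain ⟨ψ', hψd', hψs', l1', l2'⟩ := exists_test_seq hP1 hP hw hu hG
  obtain ⟨ns, hns, hae⟩ := exists_ae_subseq hP1
    (fun n => (hψd' n).continuous.aestronglyMeasurable) hu.1 l1'
  set ψ := fun n => ψ' (ns n) with hψ
  have hψd : ∀ n, ContDiff ℝ ∞ (ψ n) := fun n => hψd' _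
  have hψs : ∀ n, HasCompactSupport (ψ n) := fun n => hψs' _
  have l1 : Tendsto (fun n => eLpNorm (fun x => ψ n x - u x) P volume) atTop (𝓝 0) :=
    l1'.comp hns.tendsto_atTop
  have l2 : Tendsto (fun n => eLpNorm (fun x => gradient (ψ n) x - G x) P volume) atTop (𝓝 0) :=
    l2'.comp hns.tendsto_atTop
  have hψ1 : ∀ n, ContDiff ℝ 1 (ψ n) := fun n => (hψd n).of_le (by simp)
  have hcomp : ∀ n, ContDiff ℝ 1 fun x => h (ψ n x) := fun n => hh.comp (hψ1 n)
  have hcs : ∀ n, HasCompactSupport fun x => h (ψ n x) := fun n => (hψs n).comp_left h0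
  have hmu : AEStronglyMeasurable (fun x => h (u x)) volume :=
    hh.continuous.comp_aestronglyMeasurable hu.1
  have hmG : AEStronglyMeasurable (fun x => deriv h (u x) • G x) volume :=
    (hd.comp_aestronglyMeasurable hu.1).smul hG.1
  have lu : MemLp (fun x => h (u x)) P volume := by
    refine hu.of_le_mul (c := L) hmu (Eventually.of_forall fun x => ?_)
    simpa [h0] using hlip (u x) 0
  have lG : MemLp (fun x => deriv h (u x) • G x) P volume := by
    refine hG.of_le_mul (c := L) hmG (Eventually.of_forall fun x => ?_)
    rw [norm_smul]
    exact mul_le_mul_of_nonneg_right (hL _) (norm_nonneg _)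
  refine isWeakGradient_of_tendsto hP1 (fun n => isWeakGradient_gradient (hcomp n))
    (fun n => (hcomp n).continuous.memLp_of_hasCompactSupport (hcs n))
    (fun n => (continuous_gradient (hcomp n)).memLp_of_hasCompactSupport
      (hasCompactSupport_gradient (hcs n))) lu lG ?_ ?_
  · have : Tendsto (fun n => ENNReal.ofReal L * eLpNorm (fun x => ψ n x - u x) P volume) atTop
        (𝓝 (ENNReal.ofReal L * 0)) :=
      ENNReal.Tendsto.const_mul l1 (Or.inr ENNReal.ofReal_ne_top)
    rw [mul_zero] at this
    refine tendsto_of_tendsto_of_tendsto_of_le_of_le tendsto_const_nhds this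
      (fun _ => zero_le) fun n => ?_
    exact eLpNorm_le_mul_eLpNorm_of_ae_le_mul (Eventually.of_forall fun x => hlip _ _) _
  · have t1 : Tendsto (fun n => ENNReal.ofReal L * eLpNorm (fun x => gradient (ψ n) x - G x) P
        volume) atTop (𝓝 (ENNReal.ofReal L * 0)) :=
      ENNReal.Tendsto.const_mul l2 (Or.inr ENNReal.ofReal_ne_top)
    have mn : ∀ n, AEStronglyMeasurable (fun x => (deriv h (ψ n x) - deriv h (u x)) • G x)
        volume := fun n => (((hd.comp (hψd n).continuous).aestronglyMeasurable).sub
          (hd.comp_aestronglyMeasurable hu.1)).smul hG.1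
    have t2 : Tendsto (fun n => eLpNorm (fun x => (deriv h (ψ n x) - deriv h (u x)) • G x) P
        volume) atTop (𝓝 0) := by
      refine tendsto_eLpNorm_of_dominated hP0 hP mn (hG.norm.const_mul (2 * L)) (fun n => ?_) ?_
      · refine Eventually.of_forall fun x => ?_
        rw [norm_smul]
        refine mul_le_mul_of_nonneg_right ?_ (norm_nonneg _)
        have := (abs_sub (deriv h (ψ n x)) (deriv h (u x)))
        rw [Real.norm_eq_abs]
        linarith [hL (ψ n x), hL (u x)]
      · filter_upwards [hae] with x hx
        have := ((hd.tendsto (u x)).comp hx).sub_const (deriv h (u x))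
        rw [sub_self] at this
        simpa using this.smul_const (G x)
    have t3 := t1.add t2
    rw [mul_zero, zero_add] at t3
    refine tendsto_of_tendsto_of_tendsto_of_le_of_le tendsto_const_nhds t3
      (fun _ => zero_le) fun n => ?_
    have e : (fun x => gradient (fun x => h (ψ n x)) x - deriv h (u x) • G x) =
        (fun x => deriv h (ψ n x) • (gradient (ψ n) x - G x)) +
          fun x => (deriv h (ψ n x) - deriv h (u x)) • G x := by
      funext x
      rw [gradient_comp hh (hψ1 n), Pi.add_apply]
      module
    rw [e]
    have m1 : AEStronglyMeasurable (fun x => deriv h (ψ n x) • (gradient (ψ n) x - G x)) volume :=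
      ((hd.comp (hψd n).continuous).aestronglyMeasurable).smul
        ((continuous_gradient (hψ1 n)).aestronglyMeasurable.sub hG.1)
    refine (eLpNorm_add_le m1 (mn n) hP1).trans (add_le_add ?_ le_rfl)
    refine eLpNorm_le_mul_eLpNorm_of_ae_le_mul (Eventually.of_forall fun x => ?_) _
    rw [norm_smul]
    exact mul_le_mul_of_nonneg_right (hL _) (norm_nonneg _)

/-- The function is `t` times the smooth transition; its rescalings approximate the positive part.
-/
theorem exists_smooth_ramp : ∃ (h : ℝ → ℝ) (L : ℝ), ContDiff ℝ 1 h ∧ (∀ t, |deriv h t| ≤ L) ∧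
    (∀ t ≤ 0, h t = 0 ∧ deriv h t = 0) ∧ ∀ t, 1 < t → h t = t ∧ deriv h t = 1 := by
  have hs : ContDiff ℝ 1 Real.smoothTransition := Real.smoothTransition.contDiff
  set h : ℝ → ℝ := fun t => t * Real.smoothTransition t with hh
  have hc : ContDiff ℝ 1 h := contDiff_id.mul hs
  have hderiv : ∀ t, deriv h t = Real.smoothTransition t + t * deriv Real.smoothTransition t := by
    intro t
    have := (hasDerivAt_id t).mul (hs.differentiable (by simp) t).hasDerivAt
    have e : deriv h t = _ := this.deriv
    rw [e]
    simp
  have hneg : ∀ t ≤ 0, h t = 0 ∧ deriv h t = 0 := by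
    intro t ht
    have h1 := Real.smoothTransition.zero_of_nonpos ht
    refine ⟨by simp [hh, h1], ?_⟩
    rw [hderiv, h1, zero_add]
    rcases ht.lt_or_eq with ht | rfl
    · have : Real.smoothTransition =ᶠ[𝓝 t] fun _ => 0 := by
        filter_upwards [Iio_mem_nhds ht] with s hs
        exact Real.smoothTransition.zero_of_nonpos (le_of_lt hs)
      rw [this.deriv_eq]
      simp
    · simp
  have hpos : ∀ t, 1 < t → h t = t ∧ deriv h t = 1 := by
    intro t ht
    have h1 := Real.smoothTransition.one_of_one_le ht.le
    refine ⟨by simp [hh, h1], ?_⟩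
    have : Real.smoothTransition =ᶠ[𝓝 t] fun _ => 1 := by
      filter_upwards [Ioi_mem_nhds ht] with s hs
      exact Real.smoothTransition.one_of_one_le (le_of_lt hs)
    rw [hderiv, h1, this.deriv_eq]
    simp
  obtain ⟨C, hC⟩ := (isCompact_Icc (a := (0 : ℝ)) (b := 1)).exists_bound_of_continuousOn
    (hc.continuous_deriv (by simp)).continuousOn
  refine ⟨h, max C 1, hc, fun t => ?_, hneg, hpos⟩
  rcases le_or_gt t 0 with h1 | h1
  · rw [(hneg t h1).2, abs_zero]
    exact le_max_of_le_right zero_le_one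
  · rcases le_or_gt t 1 with h2 | h2
    · exact (hC t ⟨h1.le, h2⟩).trans (le_max_left _ _)
    · rw [(hpos t h2).2, abs_one]
      exact le_max_right _ _

open Classical in
/-- The positive part of a weakly differentiable function. -/
theorem isWeakGradient_posPart (hP1 : 1 ≤ P) (hP : P ≠ ⊤) {u : RN N → ℝ} {G : RN N → RN N}
    (hw : IsWeakGradient u G) (hu : MemLp u P volume) (hG : MemLp G P volume) :
    MemLp (fun x => max (u x) 0) P volume ∧ MemLp (fun x => if 0 < u x then G x else 0) P volume ∧
      IsWeakGradient (fun x => max (u x) 0) (fun x => if 0 < u x then G x else 0) := by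
  have hP0 : P ≠ 0 := (zero_lt_one.trans_le hP1).ne'
  obtain ⟨h, L, hh, hL, hneg, hpos⟩ := exists_smooth_ramp
  have hL0 : 0 ≤ L := (abs_nonneg _).trans (hL 0)
  have h0 : h 0 = 0 := (hneg 0 le_rfl).1
  have hlip := abs_sub_le_of_deriv_le hh hL
  have hd : Continuous (deriv h) := hh.continuous_deriv (by simp)
  set a : ℕ → ℝ := fun n => (n : ℝ) + 1 with ha
  have ha0 : ∀ n, 0 < a n := fun n => by positivity
  -- These functions share one Lipschitz constant. Their derivatives vanish exactly for `t ≤ 0` and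
  -- tend to 1 for `t > 0`, so nothing need be known about the gradient on the zero set of `u`.
  set H : ℕ → ℝ → ℝ := fun n t => h (a n * t) / a n with hH
  have hHd : ∀ n t, deriv (H n) t = deriv h (a n * t) := by
    intro n t
    have h1 := ((hh.differentiable (by simp) (a n * t)).hasDerivAt).comp t
      ((hasDerivAt_id t).const_mul (a n))
    have e : deriv (H n) t = _ := (h1.div_const (a n)).deriv
    rw [e, mul_one, mul_div_cancel_right₀ _ (ha0 n).ne']
  have hHc : ∀ n, ContDiff ℝ 1 (H n) := fun n =>
    (hh.comp (contDiff_const.mul contDiff_id)).div_const _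
  have hHL : ∀ n t, |deriv (H n) t| ≤ L := fun n t => by rw [hHd]; exact hL _
  have hHlip := fun n => abs_sub_le_of_deriv_le (hHc n) (hHL n)
  have hH0 : ∀ n, H n 0 = 0 := fun n => by simp [hH, h0]
  have hHabs : ∀ n t, |H n t| ≤ L * |t| := fun n t => by simpa [hH0] using hHlip n t 0
  have hev : ∀ t > 0, ∀ᶠ n in atTop, 1 < a n * t := by
    intro t ht
    have : Tendsto (fun n => a n * t) atTop atTop :=
      (tendsto_natCast_atTop_atTop.atTop_add tendsto_const_nhds).atTop_mul_const ht
    exact this.eventually_gt_atTop 1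
  have hmu : AEStronglyMeasurable (fun x => max (u x) 0) volume := hu.1.sup
    aestronglyMeasurable_const
  obtain ⟨u', hu'm, hu'⟩ := hu.1
  have hmG : AEStronglyMeasurable (fun x => if 0 < u x then G x else 0) volume := by
    have h1 : AEStronglyMeasurable ({x | 0 < u' x}.indicator G) volume :=
      hG.1.indicator (stronglyMeasurable_const.measurableSet_lt hu'm)
    refine h1.congr ?_
    filter_upwards [hu'] with x hx
    rw [Set.indicator_apply, hx]
    rfl
  have lu : MemLp (fun x => max (u x) 0) P volume := by
    refine hu.mono hmu (Eventually.of_forall fun x => ?_)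
    rw [Real.norm_eq_abs, Real.norm_eq_abs, abs_of_nonneg (le_max_right _ _)]
    exact max_le (le_abs_self _) (abs_nonneg _)
  have lG : MemLp (fun x => if 0 < u x then G x else 0) P volume := by
    refine hG.mono hmG (Eventually.of_forall fun x => ?_)
    split_ifs
    · exact le_rfl
    · simp
  have hmH : ∀ n, AEStronglyMeasurable (fun x => H n (u x)) volume := fun n =>
    (hHc n).continuous.comp_aestronglyMeasurable hu.1
  have hmHG : ∀ n, AEStronglyMeasurable (fun x => deriv (H n) (u x) • G x) volume := fun n =>
    (((hHc n).continuous_deriv (by simp)).comp_aestronglyMeasurable hu.1).smul hG.1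
  refine ⟨lu, lG, isWeakGradient_of_tendsto hP1
    (fun n => isWeakGradient_comp hP1 hP hw hu hG (hHc n) (hH0 n) (hHL n))
    (fun n => hu.of_le_mul (c := L) (hmH n) (Eventually.of_forall fun x => hHabs n _))
    (fun n => hG.of_le_mul (c := L) (hmHG n) (Eventually.of_forall fun x => ?_)) lu lG ?_ ?_⟩
  · rw [norm_smul]
    exact mul_le_mul_of_nonneg_right (hHL n _) (norm_nonneg _)
  · refine tendsto_eLpNorm_of_dominated hP0 hP (fun n => (hmH n).sub hmu)
      (hu.norm.const_mul (L + 1)) (fun n => Eventually.of_forall fun x => ?_)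
      (Eventually.of_forall fun x => ?_)
    · rw [Real.norm_eq_abs, Real.norm_eq_abs]
      have h1 := abs_sub (H n (u x)) (max (u x) 0)
      have h2 : |max (u x) 0| ≤ |u x| := by
        rw [abs_of_nonneg (le_max_right _ _)]
        exact max_le (le_abs_self _) (abs_nonneg _)
      have h3 := hHabs n (u x)
      linarith
    · refine tendsto_const_nhds.congr' ?_
      rcases le_or_gt (u x) 0 with hx | hx
      · refine Eventually.of_forall fun n => ?_
        have : a n * u x ≤ 0 := mul_nonpos_of_nonneg_of_nonpos (ha0 n).le hx
        simp [hH, (hneg _ this).1, max_eq_right hx]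
      · filter_upwards [hev _ hx] with n hn
        simp only [hH, (hpos _ hn).1, max_eq_left hx.le]
        rw [mul_div_cancel_left₀ _ (ha0 n).ne', sub_self]
  · refine tendsto_eLpNorm_of_dominated hP0 hP (fun n => (hmHG n).sub hmG)
      (hG.norm.const_mul (L + 1)) (fun n => Eventually.of_forall fun x => ?_)
      (Eventually.of_forall fun x => ?_)
    · refine (norm_sub_le _ _).trans ?_
      rw [norm_smul, add_mul, one_mul]
      refine add_le_add (mul_le_mul_of_nonneg_right (hHL n _) (norm_nonneg _)) ?_
      split_ifs
      · exact le_rfl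
      · simp
    · refine tendsto_const_nhds.congr' ?_
      rcases le_or_gt (u x) 0 with hx | hx
      · refine Eventually.of_forall fun n => ?_
        have : a n * u x ≤ 0 := mul_nonpos_of_nonneg_of_nonpos (ha0 n).le hx
        simp [hHd, (hneg _ this).2, not_lt.2 hx]
      · filter_upwards [hev _ hx] with n hn
        simp [hHd, (hpos _ hn).2, hx]

end Sobolev

end

noncomputable section

/-! ### Differentiability of integral functionals on Lebesgue spaces -/

-- The mean value inequality on the segment from `u` to `u + w` turns continuity of the directional
-- derivative into Fréchet differentiability.
open Filter Topology in
theorem hasFDerivAt_of_hasLineDerivAt_of_continuous {X : Type*} [NormedAddCommGroup X]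
    [NormedSpace ℝ X] {f : X → ℝ} {d : X → X →L[ℝ] ℝ} (hd : Continuous d)
    (h : ∀ u w, HasLineDerivAt ℝ f (d u w) u w) (u : X) : HasFDerivAt f (d u) u := by
  rw [hasFDerivAt_iff_isLittleO_nhds_zero, Asymptotics.isLittleO_iff]
  intro ε hε
  obtain ⟨δ, hδ, hdu⟩ := Metric.continuousAt_iff.1 (hd.continuousAt (x := u)) ε hε
  filter_upwards [Metric.ball_mem_nhds 0 hδ] with w hw
  rw [mem_ball_zero_iff] at hw
  have hder : ∀ t : ℝ, HasDerivAt (fun t : ℝ => f (u + t • w) - t * d u w)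
      (d (u + t • w) w - d u w) t := by
    intro t
    have h1 : HasDerivAt (fun s : ℝ => f (u + t • w + s • w)) (d (u + t • w) w) (t - t) := by
      rw [sub_self]; exact h (u + t • w) w
    have h2 := h1.comp_sub_const t t
    have h3 : HasDerivAt (fun s : ℝ => f (u + s • w)) (d (u + t • w) w) t := by
      refine h2.congr_of_eventuallyEq (Eventually.of_forall fun s => ?_)
      change f (u + s • w) = f (u + t • w + (s - t) • w)
      congr 1
      module
    have h4 := h3.sub ((hasDerivAt_id t).mul_const (d u w))
    rw [one_mul] at h4
    exact h4
  have hb : ∀ t ∈ Set.Ico (0 : ℝ) 1, ‖d (u + t • w) w - d u w‖ ≤ ε * ‖w‖ := by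
    intro t ht
    rw [← sub_apply]
    refine (ContinuousLinearMap.le_opNorm _ _).trans ?_
    gcongr
    have : dist (u + t • w) u < δ := by
      rw [dist_eq_norm, add_sub_cancel_left, norm_smul, Real.norm_of_nonneg ht.1]
      exact lt_of_le_of_lt (mul_le_of_le_one_left (norm_nonneg _) ht.2.le) hw
    exact (dist_eq_norm (d (u + t • w)) (d u) ▸ (hdu this)).le
  have := norm_image_sub_le_of_norm_deriv_le_segment_01'
    (fun t _ => (hder t).hasDerivWithinAt) hb
  simp only [one_smul, zero_smul, add_zero, zero_mul, sub_zero, one_mul] at this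
  rwa [sub_right_comm]

/-- A Carathéodory integrand of class `C¹` whose derivative has growth of order `s - 1`. -/
structure Nemytskii {α E : Type*} [MeasurableSpace α] [NormedAddCommGroup E] [NormedSpace ℝ E]
    (μ : Measure α) (s C : ℝ) (G : α → E → ℝ) (g : α → E → E →L[ℝ] ℝ) : Prop where
  one_lt : 1 < s
  nonneg : 0 ≤ C
  hasFDerivAt : ∀ x ξ, HasFDerivAt (G x) (g x ξ) ξ
  growth : ∀ x ξ, ‖g x ξ‖ ≤ C * ‖ξ‖ ^ (s - 1)
  zero : ∀ x, G x 0 = 0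
  continuous : ∀ x, Continuous (g x)
  measurable : ∀ z : α → E, AEStronglyMeasurable z μ → AEStronglyMeasurable (fun x => G x (z x)) μ
  measurable_deriv : ∀ z : α → E, AEStronglyMeasurable z μ →
    AEStronglyMeasurable (fun x => g x (z x)) μ

theorem add_rpow_le_two_rpow_mul {a b s : ℝ} (ha : 0 ≤ a) (hb : 0 ≤ b) (hs : 0 ≤ s) :
    (a + b) ^ s ≤ 2 ^ s * (a ^ s + b ^ s) := by
  have h1 : a + b ≤ 2 * max a b := by linarith [le_max_left a b, le_max_right a b]
  have a1 : 0 ≤ a ^ s := by positivity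
  have a2 : 0 ≤ b ^ s := by positivity
  calc (a + b) ^ s ≤ (2 * max a b) ^ s := by gcongr
    _ = 2 ^ s * (max a b) ^ s := Real.mul_rpow (by norm_num) (by positivity)
    _ ≤ _ := by
        gcongr
        rcases max_cases a b with ⟨e, _⟩ | ⟨e, _⟩ <;> rw [e] <;> linarith

namespace Nemytskii

open Filter Topology LpTools

variable {α E : Type*} [MeasurableSpace α] [NormedAddCommGroup E] [NormedSpace ℝ E]
  {μ : Measure α} {s C : ℝ} {G : α → E → ℝ} {g : α → E → E →L[ℝ] ℝ} (h : Nemytskii μ s C G g)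

include h

theorem abs_le (x : α) (ξ : E) : |G x ξ| ≤ C * ‖ξ‖ ^ s := by
  have hs := h.one_lt
  have hC := h.nonneg
  have key := (convex_closedBall (0 : E) ‖ξ‖).norm_image_sub_le_of_norm_hasFDerivWithin_le
    (fun y _ => (h.hasFDerivAt x y).hasFDerivWithinAt) (C := C * ‖ξ‖ ^ (s - 1)) (fun y hy => ?_)
    (Metric.mem_closedBall_self (norm_nonneg ξ)) (show ξ ∈ Metric.closedBall 0 ‖ξ‖ by simp)
  · rw [h.zero, sub_zero, sub_zero, Real.norm_eq_abs] at key
    refine key.trans_eq ?_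
    rcases (norm_nonneg ξ).eq_or_lt with h0 | h0
    · rw [← h0, mul_zero, Real.zero_rpow (by linarith), mul_zero]
    · rw [mul_assoc, ← Real.rpow_add_one h0.ne', sub_add_cancel]
  · refine (h.growth x y).trans ?_
    have : ‖y‖ ≤ ‖ξ‖ := by simpa using hy
    gcongr

theorem integrable {z : α → E} (hz : MemLp z (ENNReal.ofReal s) μ) :
    Integrable (fun x => G x (z x)) μ := by
  have hs := h.one_lt
  have h1 := (hz.integrable_norm_rpow (by simp; linarith) (by simp)).const_mul C
  rw [ENNReal.toReal_ofReal (by linarith)] at h1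
  exact h1.mono' (h.measurable z hz.1) (Eventually.of_forall fun x => h.abs_le x (z x))

theorem holderConjugate : (s / (s - 1)).HolderConjugate s :=
  (Real.HolderConjugate.conjExponent h.one_lt).symm

theorem memLp_deriv {z : α → E} (hz : MemLp z (ENNReal.ofReal s) μ) :
    MemLp (fun x => g x (z x)) (ENNReal.ofReal (s / (s - 1))) μ := by
  have hs := h.one_lt
  have h1 := hz.norm_rpow_div (ENNReal.ofReal (s - 1))
  rw [ENNReal.toReal_ofReal (by linarith), ← ENNReal.ofReal_div_of_pos (by linarith)] at h1
  refine h1.of_le_mul (c := C) (h.measurable_deriv z hz.1) (Eventually.of_forall fun x => ?_)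
  rw [Real.norm_of_nonneg (by positivity)]
  exact h.growth x (z x)

theorem enorm_deriv_sub_le (x : α) (ξ η : E) : ‖g x ξ - g x η‖ₑ ^ (s / (s - 1)) ≤
    ENNReal.ofReal ((2 * C) ^ (s / (s - 1)) * 2 ^ s) * (‖ξ - η‖ₑ ^ s + ‖η‖ₑ ^ s) := by
  have hs := h.one_lt
  have hC := h.nonneg
  have hs1 : 0 < s - 1 := by linarith
  have h1 : ‖g x ξ - g x η‖ ≤ 2 * C * (‖ξ - η‖ + ‖η‖) ^ (s - 1) := by
    have e1 : ‖ξ‖ ≤ ‖ξ - η‖ + ‖η‖ := by simpa using norm_add_le (ξ - η) η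
    have e2 : ‖η‖ ≤ ‖ξ - η‖ + ‖η‖ := by linarith [norm_nonneg (ξ - η)]
    calc ‖g x ξ - g x η‖ ≤ ‖g x ξ‖ + ‖g x η‖ := norm_sub_le _ _
      _ ≤ C * ‖ξ‖ ^ (s - 1) + C * ‖η‖ ^ (s - 1) := add_le_add (h.growth x ξ) (h.growth x η)
      _ ≤ C * (‖ξ - η‖ + ‖η‖) ^ (s - 1) + C * (‖ξ - η‖ + ‖η‖) ^ (s - 1) := by gcongr
      _ = _ := by ring
  have h2 : ‖g x ξ - g x η‖ ^ (s / (s - 1)) ≤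
      (2 * C) ^ (s / (s - 1)) * 2 ^ s * (‖ξ - η‖ ^ s + ‖η‖ ^ s) := by
    calc _ ≤ (2 * C * (‖ξ - η‖ + ‖η‖) ^ (s - 1)) ^ (s / (s - 1)) := by gcongr
      _ = (2 * C) ^ (s / (s - 1)) * (‖ξ - η‖ + ‖η‖) ^ s := by
          rw [Real.mul_rpow (by positivity) (by positivity), ← Real.rpow_mul (by positivity),
            mul_div_cancel₀ _ hs1.ne']
      _ ≤ _ := by
          rw [mul_assoc]
          gcongr
          exact add_rpow_le_two_rpow_mul (norm_nonneg _) (norm_nonneg _) (by linarith)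
  rw [← ofReal_norm, ← ofReal_norm, ← ofReal_norm,
    ENNReal.ofReal_rpow_of_nonneg (norm_nonneg _) (by positivity),
    ENNReal.ofReal_rpow_of_nonneg (norm_nonneg _) (by linarith),
    ENNReal.ofReal_rpow_of_nonneg (norm_nonneg _) (by linarith),
    ← ENNReal.ofReal_add (by positivity) (by positivity), ← ENNReal.ofReal_mul (by positivity)]
  exact ENNReal.ofReal_le_ofReal h2

/-- There is no fixed dominating function. One first subtracts `K * ‖z n - z₀‖ ^ s`, whose integral
tends to zero; the truncated difference is dominated by `K * ‖z₀‖ ^ s`. -/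
theorem tendsto_deriv_of_ae {z : ℕ → α → E} {z₀ : α → E}
    (hz : ∀ n, MemLp (z n) (ENNReal.ofReal s) μ) (hz₀ : MemLp z₀ (ENNReal.ofReal s) μ)
    (hae : ∀ᵐ x ∂μ, Tendsto (fun n => z n x) atTop (𝓝 (z₀ x)))
    (hlim : Tendsto (fun n => eLpNorm (fun x => z n x - z₀ x) (ENNReal.ofReal s) μ) atTop (𝓝 0)) :
    Tendsto (fun n => eLpNorm (fun x => g x (z n x) - g x (z₀ x))
      (ENNReal.ofReal (s / (s - 1))) μ) atTop (𝓝 0) := by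
  have hs := h.one_lt
  have hs1 : 0 < s - 1 := by linarith
  have hs0 : 0 < s := by linarith
  set s' := s / (s - 1) with hs'
  have hs'0 : 0 < s' := by positivity
  set K := ENNReal.ofReal ((2 * C) ^ s' * 2 ^ s) with hK
  set D : ℕ → α → ℝ≥0∞ := fun n x => ‖g x (z n x) - g x (z₀ x)‖ₑ ^ s' with hD
  set a : ℕ → α → ℝ≥0∞ := fun n x => ‖z n x - z₀ x‖ₑ ^ s with ha
  have hDm : ∀ n, AEMeasurable (D n) μ := fun n =>
    (((h.measurable_deriv _ (hz n).1).sub (h.measurable_deriv _ hz₀.1)).enorm).pow_const _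
  have ham : ∀ n, AEMeasurable (a n) μ := fun n => (((hz n).1.sub hz₀.1).enorm).pow_const _
  have hle : ∀ n x, D n x ≤ K * a n x + K * ‖z₀ x‖ₑ ^ s := fun n x => by
    rw [← mul_add]
    exact h.enorm_deriv_sub_le x (z n x) (z₀ x)
  have hal : Tendsto (fun n => ∫⁻ x, a n x ∂μ) atTop (𝓝 0) := by
    have := (ENNReal.continuous_rpow_const (y := s)).tendsto _ |>.comp hlim
    rw [ENNReal.zero_rpow_of_pos hs0] at this
    refine this.congr fun n => ?_
    exact eLpNorm_rpow_eq _ hs0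
  have h1 : Tendsto (fun n => ∫⁻ x, (D n x - K * a n x) ∂μ) atTop (𝓝 (∫⁻ _, 0 ∂μ)) := by
    refine tendsto_lintegral_of_dominated_convergence' (fun x => K * ‖z₀ x‖ₑ ^ s)
      (fun n => (hDm n).sub ((ham n).const_mul K)) (fun n => Eventually.of_forall fun x => ?_) ?_ ?_
    · exact tsub_le_iff_left.2 (hle n x)
    · rw [lintegral_const_mul' _ _ ENNReal.ofReal_ne_top]
      refine ENNReal.mul_ne_top ENNReal.ofReal_ne_top ?_
      rw [← eLpNorm_rpow_eq _ hs0]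
      exact ENNReal.rpow_ne_top_of_nonneg hs0.le hz₀.2.ne
    · filter_upwards [hae] with x hx
      have e1 : Tendsto (fun n => g x (z n x) - g x (z₀ x)) atTop (𝓝 0) := by
        have := (((h.continuous x).tendsto (z₀ x)).comp hx).sub_const (g x (z₀ x))
        simpa using this
      have e2 : Tendsto (fun n => D n x) atTop (𝓝 0) := by
        have e3 := (ENNReal.continuous_rpow_const (y := s')).tendsto _ |>.comp
          (ENNReal.tendsto_ofReal (tendsto_zero_iff_norm_tendsto_zero.1 e1))
        rw [ENNReal.ofReal_zero, ENNReal.zero_rpow_of_pos hs'0] at e3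
        refine e3.congr fun n => ?_
        rw [Function.comp_apply, ofReal_norm]
      exact tendsto_of_tendsto_of_tendsto_of_le_of_le tendsto_const_nhds e2 (fun _ => zero_le)
        fun n => tsub_le_self
  rw [lintegral_zero] at h1
  have h2 : Tendsto (fun n => ∫⁻ x, (D n x - K * a n x) ∂μ + K * ∫⁻ x, a n x ∂μ) atTop
      (𝓝 (0 + K * 0)) :=
    h1.add (ENNReal.Tendsto.const_mul hal (Or.inr ENNReal.ofReal_ne_top))
  rw [mul_zero, add_zero] at h2
  have h3 : Tendsto (fun n => ∫⁻ x, D n x ∂μ) atTop (𝓝 0) := by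
    refine tendsto_of_tendsto_of_tendsto_of_le_of_le tendsto_const_nhds h2 (fun _ => zero_le)
      fun n => ?_
    rw [← lintegral_const_mul' _ _ ENNReal.ofReal_ne_top, ← lintegral_add_right' _
      ((ham n).const_mul K)]
    exact lintegral_mono fun x => le_tsub_add
  have h4 := (ENNReal.continuous_rpow_const (y := s'⁻¹)).tendsto _ |>.comp h3
  rw [ENNReal.zero_rpow_of_pos (by positivity)] at h4
  refine h4.congr fun n => ?_
  rw [Function.comp_apply, ← eLpNorm_rpow_eq _ hs'0, ← ENNReal.rpow_mul,
    mul_inv_cancel₀ hs'0.ne', ENNReal.rpow_one]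

variable [Fact (1 ≤ ENNReal.ofReal s)]

omit [Fact (1 ≤ ENNReal.ofReal s)] in
theorem one_le_conj : Fact (1 ≤ ENNReal.ofReal (s / (s - 1))) :=
  ⟨by rw [ENNReal.one_le_ofReal]; exact h.holderConjugate.lt.le⟩

/-- Every subsequence has a further one converging almost everywhere, to which `tendsto_deriv_of_ae`
applies. -/
theorem continuous_deriv :
    haveI := h.one_le_conj
    Continuous fun z : Lp E (ENNReal.ofReal s) μ => (h.memLp_deriv (Lp.memLp z)).toLp := by
  have := h.one_le_conj
  refine continuous_iff_seqContinuous.2 fun z z₀ hz => ?_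
  refine tendsto_of_subseq_tendsto fun ns hns => ?_
  have h1 := (Lp.tendsto_Lp_iff_tendsto_eLpNorm' _ _).1 (hz.comp hns)
  obtain ⟨ms, hms, hae⟩ := (tendstoInMeasure_of_tendsto_eLpNorm
    (by simpa using (by linarith [h.one_lt] : 0 < s)) (fun n => Lp.aestronglyMeasurable _)
    (Lp.aestronglyMeasurable _) h1).exists_seq_tendsto_ae
  refine ⟨ms, ?_⟩
  refine (Lp.tendsto_Lp_iff_tendsto_eLpNorm'' _ (fun n => h.memLp_deriv (Lp.memLp (z (ns (ms n)))))
    _ (h.memLp_deriv (Lp.memLp z₀))).2 ?_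
  exact h.tendsto_deriv_of_ae (fun n => Lp.memLp _) (Lp.memLp _) hae (h1.comp hms.tendsto_atTop)

theorem hasLineDerivAt (z w : Lp E (ENNReal.ofReal s) μ) :
    HasLineDerivAt ℝ (fun z : Lp E (ENNReal.ofReal s) μ => ∫ x, G x (z x) ∂μ)
      (∫ x, g x (z x) (w x) ∂μ) z w := by
  have hs := h.one_lt
  have hC := h.nonneg
  have hcoe : ∀ t : ℝ, (fun x => G x ((z + t • w : Lp E (ENNReal.ofReal s) μ) x)) =ᵐ[μ]
      fun x => G x (z x + t • w x) := by
    intro t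
    filter_upwards [Lp.coeFn_add z (t • w), Lp.coeFn_smul t w] with x h1 h2
    rw [h1, Pi.add_apply, h2, Pi.smul_apply]
  have hml : ∀ t : ℝ, MemLp (fun x => z x + t • w x) (ENNReal.ofReal s) μ := fun t =>
    (Lp.memLp z).add ((Lp.memLp w).const_smul t)
  have hint : Integrable (fun x => C * (2 ^ s * (‖z x‖ ^ s + ‖w x‖ ^ s))) μ := by
    have e1 := (Lp.memLp z).integrable_norm_rpow (by simp; linarith) (by simp)
    have e2 := (Lp.memLp w).integrable_norm_rpow (by simp; linarith) (by simp)
    rw [ENNReal.toReal_ofReal (by linarith)] at e1 e2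
    exact ((e1.add e2).const_mul _).const_mul _
  have hz0 : AEStronglyMeasurable (fun x => g x (z x + (0 : ℝ) • w x) (w x)) μ :=
    (ContinuousLinearMap.id ℝ (E →L[ℝ] ℝ)).aestronglyMeasurable_comp₂
      (h.measurable_deriv _ (hml 0).1) (Lp.aestronglyMeasurable w)
  have key := hasDerivAt_integral_of_dominated_loc_of_deriv_le (μ := μ) (𝕜 := ℝ)
    (F := fun t x => G x (z x + t • w x)) (F' := fun t x => g x (z x + t • w x) (w x))
    (x₀ := 0) (s := Metric.ball 0 1) (Metric.ball_mem_nhds 0 one_pos)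
    (Eventually.of_forall fun t => h.measurable _ (hml t).1) (h.integrable (hml 0)) hz0
    (bound := fun x => C * (2 ^ s * (‖z x‖ ^ s + ‖w x‖ ^ s))) ?_ hint ?_
  · have k := key.2
    simp only [zero_smul, add_zero] at k
    change HasDerivAt (fun t : ℝ => ∫ x, G x ((z + t • w : Lp E (ENNReal.ofReal s) μ) x) ∂μ) _ 0
    simp_rw [fun t => integral_congr_ae (hcoe t)]
    exact k
  · refine Eventually.of_forall fun x t ht => ?_
    have ht1 : |t| ≤ 1 := by simpa using (Metric.mem_ball.1 ht).le
    have e1 : ‖z x + t • w x‖ ≤ ‖z x‖ + ‖w x‖ := by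
      refine (norm_add_le _ _).trans ?_
      rw [norm_smul]
      gcongr
      exact mul_le_of_le_one_left (norm_nonneg _) ht1
    have e2 : ‖w x‖ ≤ ‖z x‖ + ‖w x‖ := by linarith [norm_nonneg (z x)]
    have e0 : 0 ≤ ‖z x‖ + ‖w x‖ := by positivity
    calc ‖g x (z x + t • w x) (w x)‖ ≤ ‖g x (z x + t • w x)‖ * ‖w x‖ :=
          ContinuousLinearMap.le_opNorm _ _
      _ ≤ C * ‖z x + t • w x‖ ^ (s - 1) * ‖w x‖ := by
          gcongr
          exact h.growth _ _
      _ ≤ C * (‖z x‖ + ‖w x‖) ^ (s - 1) * (‖z x‖ + ‖w x‖) := by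
          gcongr
      _ = C * (‖z x‖ + ‖w x‖) ^ s := by
          rcases e0.eq_or_lt with h0 | h0
          · rw [← h0, mul_zero, Real.zero_rpow (by linarith), mul_zero]
          · rw [mul_assoc, ← Real.rpow_add_one h0.ne', sub_add_cancel]
      _ ≤ _ := by
          gcongr
          exact add_rpow_le_two_rpow_mul (norm_nonneg _) (norm_nonneg _) (by linarith)
  · refine Eventually.of_forall fun x t _ => ?_
    have h1 : HasDerivAt (fun t : ℝ => z x + t • w x) (w x) t := by
      simpa using ((hasDerivAt_id t).smul_const (w x)).const_add (z x)
    exact (h.hasFDerivAt x (z x + t • w x)).comp_hasDerivAt t h1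

theorem exists_hasFDerivAt : ∃ d : Lp E (ENNReal.ofReal s) μ → Lp E (ENNReal.ofReal s) μ →L[ℝ] ℝ,
    Continuous d ∧ (∀ z w, d z w = ∫ x, g x (z x) (w x) ∂μ) ∧
      ∀ z, HasFDerivAt (fun z : Lp E (ENNReal.ofReal s) μ => ∫ x, G x (z x) ∂μ) (d z) z := by
  have := h.one_le_conj
  have hconj := h.holderConjugate.ennrealOfReal
  set B := (ContinuousLinearMap.id ℝ (E →L[ℝ] ℝ)).lpPairing μ (ENNReal.ofReal (s / (s - 1)))
    (ENNReal.ofReal s) with hB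
  set d : Lp E (ENNReal.ofReal s) μ → Lp E (ENNReal.ofReal s) μ →L[ℝ] ℝ :=
    fun z => B (h.memLp_deriv (Lp.memLp z)).toLp with hd
  have hdc : Continuous d := B.continuous.comp h.continuous_deriv
  have hdz : ∀ z w, d z w = ∫ x, g x (z x) (w x) ∂μ := by
    intro z w
    rw [hd, hB, ContinuousLinearMap.lpPairing_eq_integral]
    refine integral_congr_ae ?_
    filter_upwards [(h.memLp_deriv (Lp.memLp z)).coeFn_toLp] with x hx
    rw [hx]
    rfl
  refine ⟨d, hdc, hdz, hasFDerivAt_of_hasLineDerivAt_of_continuous hdc fun z w => ?_⟩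
  rw [hdz]
  exact h.hasLineDerivAt z w

end Nemytskii

end

noncomputable section

/-! ### Weighted integrals of powers of the norm -/

section PowerGap

variable {E : Type*} [NormedAddCommGroup E] [InnerProductSpace ℝ E] {p : ℝ}

theorem norm_midpoint_rpow_le (hp : 1 < p) (a b : E) :
    ‖(1 / 2 : ℝ) • (a + b)‖ ^ p ≤ ‖a‖ ^ p / 2 + ‖b‖ ^ p / 2 := by
  have h1 : ‖(1 / 2 : ℝ) • (a + b)‖ ≤ 1 / 2 * ‖a‖ + 1 / 2 * ‖b‖ := by
    rw [norm_smul, ← mul_add]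
    norm_num
    exact norm_add_le a b
  have h2 := (convexOn_rpow hp.le).2 (norm_nonneg a) (norm_nonneg b)
    (by norm_num : (0 : ℝ) ≤ 1 / 2) (by norm_num : (0 : ℝ) ≤ 1 / 2) (by norm_num)
  simp only [smul_eq_mul] at h2
  calc _ ≤ (1 / 2 * ‖a‖ + 1 / 2 * ‖b‖) ^ p := by gcongr
    _ ≤ _ := h2
    _ = _ := by ring

/-- For equal norms the strict convexity of the norm is used, for different norms that of the power.
-/
theorem norm_midpoint_rpow_lt (hp : 1 < p) {a b : E} (hab : a ≠ b) :
    ‖(1 / 2 : ℝ) • (a + b)‖ ^ p < ‖a‖ ^ p / 2 + ‖b‖ ^ p / 2 := by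
  by_cases h : ‖a‖ = ‖b‖
  · have h1 : ‖(1 / 2 : ℝ) • (a + b)‖ < ‖a‖ := (norm_midpoint_lt_iff h).2 hab
    calc _ < ‖a‖ ^ p := Real.rpow_lt_rpow (norm_nonneg _) h1 (by linarith)
      _ = _ := by rw [← h]; ring
  · have h1 : ‖(1 / 2 : ℝ) • (a + b)‖ ≤ 1 / 2 * ‖a‖ + 1 / 2 * ‖b‖ := by
      rw [norm_smul, ← mul_add]
      norm_num
      exact norm_add_le a b
    have h2 := (strictConvexOn_rpow hp).2 (norm_nonneg a) (norm_nonneg b) h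
      (by norm_num : (0 : ℝ) < 1 / 2) (by norm_num : (0 : ℝ) < 1 / 2) (by norm_num)
    simp only [smul_eq_mul] at h2
    calc _ ≤ (1 / 2 * ‖a‖ + 1 / 2 * ‖b‖) ^ p := by gcongr
      _ < _ := h2
      _ = _ := by ring

/-- Both sides are homogeneous of degree `p`, so one may normalize `‖a‖ ^ p + ‖b‖ ^ p = 1`. On the
compact set where moreover `‖a - b‖ ^ p ≥ η`, the midpoint gap has a positive minimum. This treats
all `p > 1` at once, without Clarkson's inequalities. -/
theorem exists_norm_sub_rpow_le [FiniteDimensional ℝ E] (hp : 1 < p) {η : ℝ} (hη : 0 < η) :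
    ∃ K, 0 ≤ K ∧ ∀ a b : E, ‖a - b‖ ^ p ≤ η * (‖a‖ ^ p + ‖b‖ ^ p) +
      K * (‖a‖ ^ p / 2 + ‖b‖ ^ p / 2 - ‖(1 / 2 : ℝ) • (a + b)‖ ^ p) := by
  have hp0 : 0 < p := by linarith
  set gap : E × E → ℝ := fun z => ‖z.1‖ ^ p / 2 + ‖z.2‖ ^ p / 2 - ‖(1 / 2 : ℝ) • (z.1 + z.2)‖ ^ p
    with hgap
  have hc : ∀ f : E × E → E, Continuous f → Continuous fun z => ‖f z‖ ^ p := fun f hf =>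
    hf.norm.rpow_const fun _ => Or.inr hp0.le
  have hgc : Continuous gap := (((hc _ continuous_fst).div_const 2).add
    ((hc _ continuous_snd).div_const 2)).sub (hc _ (by fun_prop))
  set S : Set (E × E) := {z | ‖z.1‖ ^ p + ‖z.2‖ ^ p = 1 ∧ η ≤ ‖z.1 - z.2‖ ^ p} with hS
  have hSc : IsCompact S := by
    refine (isCompact_closedBall (0 : E × E) 1).of_isClosed_subset ?_ ?_
    · exact (isClosed_eq ((hc _ continuous_fst).add (hc _ continuous_snd)) continuous_const).inter
        (isClosed_le continuous_const (hc _ (by fun_prop)))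
    · rintro ⟨a, b⟩ ⟨h, -⟩
      have h1 : ∀ t : ℝ, 0 ≤ t → t ^ p ≤ 1 → t ≤ 1 := fun t ht h => by
        rw [← Real.one_rpow p] at h
        exact (Real.rpow_le_rpow_iff ht zero_le_one hp0).1 h
      have e1 : 0 ≤ ‖a‖ ^ p := by positivity
      have e2 : 0 ≤ ‖b‖ ^ p := by positivity
      simp only at h
      rw [mem_closedBall_zero_iff, Prod.norm_def]
      exact max_le (h1 _ (norm_nonneg _) (by linarith)) (h1 _ (norm_nonneg _) (by linarith))
  have hgap0 : ∀ z, 0 ≤ gap z := fun z => sub_nonneg.2 (norm_midpoint_rpow_le hp z.1 z.2)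
  obtain ⟨κ, hκ, hmin⟩ : ∃ κ > 0, ∀ z ∈ S, κ ≤ gap z := by
    rcases S.eq_empty_or_nonempty with h | h
    · exact ⟨1, one_pos, by simp [h]⟩
    · obtain ⟨z, hz, hmin⟩ := hSc.exists_isMinOn h hgc.continuousOn
      refine ⟨gap z, ?_, fun y hy => hmin hy⟩
      refine sub_pos.2 (norm_midpoint_rpow_lt hp fun e => ?_)
      have := hz.2
      rw [e, sub_self, norm_zero, Real.zero_rpow hp0.ne'] at this
      linarith
  -- With `t` the sum of the two powers, `‖a - b‖ ^ p` never exceeds `2 ^ p * t`, while the gap is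
  -- at least `κ * t` whenever the first term does not suffice.
  refine ⟨2 ^ p / κ, by positivity, fun a b => ?_⟩
  set t := ‖a‖ ^ p + ‖b‖ ^ p with ht
  have e1 : 0 ≤ ‖a‖ ^ p := by positivity
  have e2 : 0 ≤ ‖b‖ ^ p := by positivity
  have hK : 0 ≤ 2 ^ p / κ * gap (a, b) := mul_nonneg (by positivity) (hgap0 _)
  by_cases hsmall : ‖a - b‖ ^ p ≤ η * t
  · exact hsmall.trans (le_add_of_nonneg_right hK)
  push Not at hsmall
  have ht0 : 0 < t := by
    rcases (add_nonneg e1 e2).eq_or_lt with h | h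
    · exfalso
      have h3 : ‖a‖ ^ p = 0 := by linarith
      have h4 : ‖b‖ ^ p = 0 := by linarith
      rw [Real.rpow_eq_zero (norm_nonneg _) hp0.ne', norm_eq_zero] at h3 h4
      rw [ht, h3, h4] at hsmall
      simp [Real.zero_rpow hp0.ne'] at hsmall
    · exact h
  set l := (t ^ (1 / p))⁻¹ with hl
  have hl0 : 0 < l := by positivity
  have hlp : l ^ p = t⁻¹ := by
    rw [hl, Real.inv_rpow (by positivity), ← Real.rpow_mul ht0.le, one_div_mul_cancel hp0.ne',
      Real.rpow_one]
  have hsc : ∀ x : E, ‖l • x‖ ^ p = t⁻¹ * ‖x‖ ^ p := fun x => by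
    rw [norm_smul, Real.mul_rpow (norm_nonneg _) (norm_nonneg _), Real.norm_of_nonneg hl0.le, hlp]
  have hmem : (l • a, l • b) ∈ S := by
    refine ⟨?_, ?_⟩
    · change ‖l • a‖ ^ p + ‖l • b‖ ^ p = 1
      rw [hsc, hsc, ← mul_add, inv_mul_cancel₀ ht0.ne']
    · change η ≤ ‖l • a - l • b‖ ^ p
      rw [← smul_sub, hsc, inv_mul_eq_div, le_div_iff₀ ht0]
      exact hsmall.le
  have hg : gap (l • a, l • b) = t⁻¹ * gap (a, b) := by
    simp only [hgap]
    rw [← smul_add, smul_comm, hsc, hsc, hsc]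
    ring
  have h5 : κ * t ≤ gap (a, b) := by
    have := hmin _ hmem
    rwa [hg, inv_mul_eq_div, le_div_iff₀ ht0] at this
  have h6 : ‖a - b‖ ^ p ≤ 2 ^ p * t :=
    (Real.rpow_le_rpow (norm_nonneg _) (norm_sub_le a b) hp0.le).trans
      (add_rpow_le_two_rpow_mul (norm_nonneg _) (norm_nonneg _) hp0.le)
  calc ‖a - b‖ ^ p ≤ 2 ^ p * t := h6
    _ = 2 ^ p / κ * (κ * t) := by field_simp
    _ ≤ 2 ^ p / κ * gap (a, b) := by gcongr
    _ ≤ _ := le_add_of_nonneg_left (by positivity)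

end PowerGap

/-- A bounded nonnegative measurable weight. -/
structure BddWeight {α : Type*} [MeasurableSpace α] (μ : Measure α) (w : α → ℝ) (B : ℝ) : Prop where
  measurable : AEStronglyMeasurable w μ
  nonneg : ∀ x, 0 ≤ w x
  le : ∀ x, w x ≤ B

/-- The weighted power integral `∫ w ‖z‖^p`. -/
def powInt {α E : Type*} [MeasurableSpace α] [NormedAddCommGroup E] (μ : Measure α) (w : α → ℝ)
    (p : ℝ) (z : Lp E (ENNReal.ofReal p) μ) : ℝ := ∫ x, w x * ‖z x‖ ^ p ∂μ

namespace BddWeight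

variable {α E : Type*} [MeasurableSpace α] [NormedAddCommGroup E] [InnerProductSpace ℝ E]
  {μ : Measure α} {w : α → ℝ} {B p : ℝ} (h : BddWeight μ w B)

theorem one : BddWeight μ (fun _ => (1 : ℝ)) 1 :=
  ⟨aestronglyMeasurable_const, fun _ => zero_le_one, fun _ => le_rfl⟩

include h

theorem nemytskii (hB : 0 ≤ B) (hp : 1 < p) : Nemytskii μ p (B * p) (fun x (ξ : E) => w x * ‖ξ‖ ^ p)
    (fun x (ξ : E) => w x • ((p * ‖ξ‖ ^ (p - 2)) • innerSL ℝ ξ)) := by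
  have hp0 : 0 < p := by linarith
  have hc : Continuous fun ξ : E => (p * ‖ξ‖ ^ (p - 2)) • innerSL ℝ ξ := by
    have := (contDiff_norm_rpow (E := E) hp).continuous_fderiv one_ne_zero
    exact this.congr fun ξ => (hasFDerivAt_norm_rpow ξ hp).fderiv
  refine ⟨hp, by positivity, fun x ξ => (hasFDerivAt_norm_rpow ξ hp).const_mul _, fun x ξ => ?_,
    fun x => by simp [Real.zero_rpow hp0.ne'], fun x => (continuous_const_smul (w x)).comp hc, fun z hz => ?_,
    fun z hz => h.measurable.smul (hc.comp_aestronglyMeasurable hz)⟩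
  · rw [norm_smul, norm_smul, innerSL_apply_norm, Real.norm_of_nonneg (h.nonneg x),
      Real.norm_of_nonneg (by positivity)]
    have h1 : p * ‖ξ‖ ^ (p - 2) * ‖ξ‖ ≤ p * ‖ξ‖ ^ (p - 1) := by
      rcases (norm_nonneg ξ).eq_or_lt with h0 | h0
      · rw [← h0, mul_zero]; positivity
      · rw [mul_assoc, ← Real.rpow_add_one h0.ne']
        refine le_of_eq ?_
        congr 2
        ring
    calc w x * (p * ‖ξ‖ ^ (p - 2) * ‖ξ‖) ≤ B * (p * ‖ξ‖ ^ (p - 1)) :=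
          mul_le_mul (h.le x) h1 (by positivity) hB
      _ = _ := by ring
  · exact h.measurable.mul
      ((hz.norm.aemeasurable.pow_const _).aestronglyMeasurable)

theorem integrable (hp : 1 < p) (z : Lp E (ENNReal.ofReal p) μ) :
    Integrable (fun x => w x * ‖z x‖ ^ p) μ := by
  have h' : BddWeight μ w (max B 0) := ⟨h.measurable, h.nonneg, fun x => le_max_of_le_left (h.le x)⟩
  exact (h'.nemytskii (E := E) (le_max_right _ _) hp).integrable (Lp.memLp z)

variable [Fact (1 ≤ ENNReal.ofReal p)]

theorem exists_hasFDerivAt (hp : 1 < p) (z : Lp E (ENNReal.ofReal p) μ) :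
    ∃ d : Lp E (ENNReal.ofReal p) μ →L[ℝ] ℝ, HasFDerivAt (powInt μ w p) d z := by
  have h' : BddWeight μ w (max B 0) := ⟨h.measurable, h.nonneg, fun x => le_max_of_le_left (h.le x)⟩
  exact ((h'.nemytskii (E := E) (le_max_right _ _) hp).exists_hasFDerivAt).elim
    fun d hd => ⟨d z, hd.2.2 z⟩

omit [Fact (1 ≤ ENNReal.ofReal p)] in
theorem powInt_nonneg (z : Lp E (ENNReal.ofReal p) μ) : 0 ≤ powInt μ w p z :=
  integral_nonneg fun x => mul_nonneg (h.nonneg x) (by positivity)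

omit h [InnerProductSpace ℝ E] in
theorem powInt_smul [NormedSpace ℝ E] (c : ℝ) (z : Lp E (ENNReal.ofReal p) μ) :
    powInt μ w p (c • z) = |c| ^ p * powInt μ w p z := by
  rw [powInt, powInt, ← integral_const_mul]
  refine integral_congr_ae ?_
  filter_upwards [Lp.coeFn_smul c z] with x hx
  rw [hx, Pi.smul_apply, norm_smul, Real.mul_rpow (norm_nonneg _) (norm_nonneg _),
    Real.norm_eq_abs]
  ring

theorem convexOn (hp : 1 < p) :
    ConvexOn ℝ Set.univ (powInt μ w p : Lp E (ENNReal.ofReal p) μ → ℝ) := by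
  refine ⟨convex_univ, fun y _ z _ a b ha hb hab => ?_⟩
  simp only [smul_eq_mul]
  rw [powInt, powInt, powInt, ← integral_const_mul, ← integral_const_mul,
    ← integral_add ((h.integrable hp y).const_mul _) ((h.integrable hp z).const_mul _)]
  refine integral_mono_ae (h.integrable hp _)
    (((h.integrable hp y).const_mul _).add ((h.integrable hp z).const_mul _)) ?_
  filter_upwards [Lp.coeFn_add (a • y) (b • z), Lp.coeFn_smul a y, Lp.coeFn_smul b z] with x h1 h2 h3
  change w x * ‖(a • y + b • z) x‖ ^ p ≤ a * (w x * ‖y x‖ ^ p) + b * (w x * ‖z x‖ ^ p)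
  rw [h1, Pi.add_apply, h2, h3, Pi.smul_apply, Pi.smul_apply]
  have e1 : ‖a • y x + b • z x‖ ≤ a * ‖y x‖ + b * ‖z x‖ := by
    refine (norm_add_le _ _).trans_eq ?_
    rw [norm_smul, norm_smul, Real.norm_of_nonneg ha, Real.norm_of_nonneg hb]
  have e2 := (convexOn_rpow hp.le).2 (norm_nonneg (y x)) (norm_nonneg (z x)) ha hb hab
  simp only [smul_eq_mul] at e2
  have e3 : ‖a • y x + b • z x‖ ^ p ≤ a * ‖y x‖ ^ p + b * ‖z x‖ ^ p :=
    (Real.rpow_le_rpow (norm_nonneg _) e1 (by linarith)).trans e2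
  calc _ ≤ w x * (a * ‖y x‖ ^ p + b * ‖z x‖ ^ p) := mul_le_mul_of_nonneg_left e3 (h.nonneg x)
    _ = _ := by ring

omit h [InnerProductSpace ℝ E] in
theorem norm_rpow_eq (hp : 1 < p) (z : Lp E (ENNReal.ofReal p) μ) :
    ‖z‖ ^ p = powInt μ (fun _ => 1) p z := by
  have hp0 : 0 < p := by linarith
  rw [powInt, Lp.norm_def, MemLp.eLpNorm_eq_integral_rpow_norm (by simpa using hp0) (by simp)
    (Lp.memLp z), ENNReal.toReal_ofReal hp0.le, ENNReal.toReal_ofReal (by positivity),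
    ← Real.rpow_mul (by positivity), inv_mul_cancel₀ hp0.ne', Real.rpow_one]
  simp

theorem mul_norm_rpow_le (hp : 1 < p) {c : ℝ} (hc : ∀ x, c ≤ w x)
    (z : Lp E (ENNReal.ofReal p) μ) : c * ‖z‖ ^ p ≤ powInt μ w p z := by
  rw [norm_rpow_eq hp, powInt, powInt, ← integral_const_mul]
  refine integral_mono ((one.integrable hp z).const_mul c) (h.integrable hp z) fun x => ?_
  have : 0 ≤ ‖z x‖ ^ p := by positivity
  simpa using mul_le_mul_of_nonneg_right (hc x) this

/-- Integrate the pointwise inequality; the constant is divided by the lower bound `c` of the weight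
since the unweighted gap is at most the weighted one over `c`. -/
theorem exists_gap [FiniteDimensional ℝ E] (hp : 1 < p) {c : ℝ} (hc0 : 0 < c) (hc : ∀ x, c ≤ w x)
    {η : ℝ} (hη : 0 < η) : ∃ K, 0 ≤ K ∧ ∀ y z : Lp E (ENNReal.ofReal p) μ,
      ‖y - z‖ ^ p ≤ η * (‖y‖ ^ p + ‖z‖ ^ p) +
        K * (powInt μ w p y / 2 + powInt μ w p z / 2 - powInt μ w p ((1 / 2 : ℝ) • (y + z))) := by
  obtain ⟨K, hK, hgap⟩ := exists_norm_sub_rpow_le (E := E) hp hη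
  refine ⟨K / c, by positivity, fun y z => ?_⟩
  have i := fun z : Lp E (ENNReal.ofReal p) μ => one.integrable hp z
  have j := fun z : Lp E (ENNReal.ofReal p) μ => h.integrable hp z
  have e := (((i y).add (i z)).const_mul η).add
    ((((j y).div_const 2).add ((j z).div_const 2) |>.sub (j ((1 / 2 : ℝ) • (y + z)))).const_mul
      (K / c))
  have key : powInt μ (fun _ => 1) p (y - z) ≤ ∫ x, (η * (1 * ‖y x‖ ^ p + 1 * ‖z x‖ ^ p) +
      K / c * (w x * ‖y x‖ ^ p / 2 + w x * ‖z x‖ ^ p / 2 -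
        w x * ‖((1 / 2 : ℝ) • (y + z) : Lp E (ENNReal.ofReal p) μ) x‖ ^ p)) ∂μ := by
    refine integral_mono_ae (i _) e ?_
    filter_upwards [Lp.coeFn_sub y z, Lp.coeFn_add y z, Lp.coeFn_smul (1 / 2 : ℝ) (y + z)]
      with x h1 h2 h3
    rw [h1, h3, Pi.sub_apply, Pi.smul_apply, h2, Pi.add_apply]
    have e1 := hgap (y x) (z x)
    have e2 : 0 ≤ ‖y x‖ ^ p / 2 + ‖z x‖ ^ p / 2 - ‖(1 / 2 : ℝ) • (y x + z x)‖ ^ p :=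
      sub_nonneg.2 (norm_midpoint_rpow_le hp _ _)
    set g := ‖y x‖ ^ p / 2 + ‖z x‖ ^ p / 2 - ‖(1 / 2 : ℝ) • (y x + z x)‖ ^ p with hg
    have e3 : K * g ≤ K / c * (w x * g) := by
      rw [div_mul_eq_mul_div, le_div_iff₀ hc0]
      calc K * g * c = K * (c * g) := by ring
        _ ≤ K * (w x * g) := by gcongr; exact hc x
    have e4 : w x * ‖y x‖ ^ p / 2 + w x * ‖z x‖ ^ p / 2 - w x * ‖(1 / 2 : ℝ) • (y x + z x)‖ ^ p =
        w x * g := by rw [hg]; ring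
    rw [e4]
    linarith
  rw [norm_rpow_eq hp, norm_rpow_eq hp, norm_rpow_eq hp]
  refine key.trans_eq ?_
  rw [integral_add, integral_const_mul, integral_const_mul, integral_sub, integral_add,
    integral_add, integral_div, integral_div]
  · rfl
  · exact (j y).div_const 2
  · exact (j z).div_const 2
  · exact i y
  · exact i z
  · exact ((j y).div_const 2).add ((j z).div_const 2)
  · exact j _
  · exact ((i y).add (i z)).const_mul η
  · exact (((j y).div_const 2).add ((j z).div_const 2) |>.sub (j ((1 / 2 : ℝ) • (y + z)))).const_mul _

end BddWeight

end

noncomputable section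

/-! ### The convex part of the functional -/

section Penalization

theorem hasDerivAt_max_zero_rpow {β : ℝ} (hβ : 1 < β) (t : ℝ) :
    ∃ d, HasDerivAt (fun t : ℝ => (max t 0) ^ β) d t := by
  rcases lt_trichotomy t 0 with h | h | h
  · refine ⟨0, (hasDerivAt_const t ((0 : ℝ) ^ β)).congr_of_eventuallyEq ?_⟩
    filter_upwards [eventually_lt_nhds h] with s hs
    rw [max_eq_right hs.le]
  · subst h
    refine ⟨0, ?_⟩
    have h1 := hasFDerivAt_norm_rpow (0 : ℝ) hβ
    rw [map_zero, smul_zero] at h1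
    rw [hasDerivAt_iff_isLittleO_nhds_zero]
    rw [hasFDerivAt_iff_isLittleO_nhds_zero] at h1
    have h0 : (0 : ℝ) ^ β = 0 := Real.zero_rpow (by linarith)
    refine Asymptotics.IsBigO.trans_isLittleO (Asymptotics.IsBigO.of_bound 1
      (Filter.Eventually.of_forall fun s => ?_)) h1
    simp only [zero_add, norm_zero, max_self, h0, sub_zero, smul_zero, zero_apply, one_mul]
    have e1 : 0 ≤ max s 0 := le_max_right _ _
    rw [Real.norm_of_nonneg (by positivity), Real.norm_of_nonneg (by positivity)]
    refine Real.rpow_le_rpow e1 ?_ (by linarith)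
    exact max_le (le_abs_self s) (abs_nonneg s)
  · refine ⟨_, (Real.hasDerivAt_rpow_const (p := β) (Or.inl h.ne')).congr_of_eventuallyEq ?_⟩
    filter_upwards [eventually_gt_nhds h] with s hs
    rw [max_eq_left hs.le]

theorem convexOn_max_zero_rpow {β : ℝ} (hβ : 1 < β) :
    ConvexOn ℝ Set.univ fun t : ℝ => (max (t - 1) 0) ^ β := by
  refine ⟨convex_univ, fun x _ y _ a b ha hb hab => ?_⟩
  have h := (convexOn_rpow hβ.le).2 (le_max_right (x - 1) 0) (le_max_right (y - 1) 0) ha hb hab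
  simp only [smul_eq_mul] at h ⊢
  refine (Real.rpow_le_rpow (le_max_right _ _) ?_ (by linarith)).trans h
  refine max_le ?_ (add_nonneg (mul_nonneg ha (le_max_right _ _)) (mul_nonneg hb (le_max_right _ _)))
  have h1 := mul_le_mul_of_nonneg_left (le_max_left (x - 1) 0) ha
  have h2 := mul_le_mul_of_nonneg_left (le_max_left (y - 1) 0) hb
  calc a * x + b * y - 1 = a * (x - 1) + b * (y - 1) + (a + b - 1) := by ring
    _ = a * (x - 1) + b * (y - 1) := by rw [hab]; ring
    _ ≤ _ := add_le_add h1 h2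

theorem max_zero_rpow_mono {β : ℝ} (hβ : 1 < β) :
    Monotone fun t : ℝ => (max (t - 1) 0) ^ β := fun _ _ h =>
  Real.rpow_le_rpow (le_max_right _ _) (max_le_max (by linarith) le_rfl) (by linarith)

/-- The slope of `(1 + s) ^ a` at `s = 0` is `a < r`. An explicit `s` comes from `(1 + s) ^ a ≤ exp
(a * s)` and `exp (a * s) * (1 - a * s) ≤ 1`. -/
theorem exists_one_add_rpow_lt {a r : ℝ} (ha : 0 < a) (har : a < r) :
    ∃ s > 0, (1 + s) ^ a < 1 + s * r := by
  have hr : 0 < r := ha.trans har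
  -- Chosen so that `a * r * s = (r - a) / 2`, which makes `(1 + s * r) * (1 - a * s)` exceed 1.
  set s := (r - a) / (2 * (a * r)) with hs
  have hs0 : 0 < s := div_pos (by linarith) (by positivity)
  refine ⟨s, hs0, ?_⟩
  have h1 : a * s = (r - a) / (2 * r) := by rw [hs]; field_simp
  have h2 : a * s < 1 := by
    rw [h1, div_lt_one (by positivity)]; linarith
  have h3 : (1 + s) ^ a ≤ Real.exp (a * s) := by
    rw [mul_comm, Real.exp_mul]
    refine Real.rpow_le_rpow (by positivity) ?_ ha.le
    linarith [Real.add_one_le_exp s]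
  have h4 : Real.exp (a * s) * (1 - a * s) ≤ 1 := by
    have := Real.one_sub_le_exp_neg (a * s)
    calc _ ≤ Real.exp (a * s) * Real.exp (-(a * s)) := by gcongr
      _ = 1 := by rw [← Real.exp_add]; simp
  have h5 : 1 < (1 + s * r) * (1 - a * s) := by
    have : a * r * s = (r - a) / 2 := by rw [hs]; field_simp
    have e : (1 + s * r) * (1 - a * s) = 1 + s * (r - a) - s * (a * r * s) := by ring
    rw [e, this]
    have : 0 < s * (r - a) := mul_pos hs0 (by linarith)
    linarith
  exact h3.trans_lt (lt_of_mul_lt_mul_right (h4.trans_lt h5) (by linarith))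

/-- One has `(l t - 1)_+ ≤ l (t - 1)_+ + (l - 1)`. Since `l` is below `θ ^ (1 / β)`, the additive
term is absorbed as soon as `(t - 1)_+` exceeds `Y`, and contributes only a constant otherwise. -/
theorem exists_max_zero_rpow_scaling {β l θ : ℝ} (hβ : 1 < β) (hl : 1 ≤ l) (hlθ : l ^ β < θ) :
    ∃ K, 0 ≤ K ∧ ∀ t, (max (l * t - 1) 0) ^ β ≤ θ * (max (t - 1) 0) ^ β + K := by
  have hβ0 : 0 < β := by linarith
  have hθ : 0 < θ := lt_of_le_of_lt (by positivity) hlθ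
  set l' := θ ^ (1 / β) with hl'
  have hl'θ : l' ^ β = θ := by
    rw [hl', ← Real.rpow_mul hθ.le, one_div_mul_cancel hβ0.ne', Real.rpow_one]
  have hll : l < l' := by
    rw [← hl'θ] at hlθ
    exact (Real.rpow_lt_rpow_iff (by linarith) (by positivity) hβ0).1 hlθ
  set Y := (l - 1) / (l' - l) with hY
  have hY0 : 0 ≤ Y := div_nonneg (by linarith) (by linarith)
  refine ⟨(l * Y + (l - 1)) ^ β, Real.rpow_nonneg (by nlinarith) _, fun t => ?_⟩
  set y := max (t - 1) 0 with hy
  have hy0 : 0 ≤ y := le_max_right _ _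
  have h1 : max (l * t - 1) 0 ≤ l * y + (l - 1) := by
    refine max_le ?_ (by nlinarith)
    have := mul_le_mul_of_nonneg_left (le_max_left (t - 1) 0) (by linarith : 0 ≤ l)
    linarith
  have h2 : 0 ≤ θ * y ^ β := by positivity
  refine (Real.rpow_le_rpow (le_max_right _ _) h1 hβ0.le).trans ?_
  have hl0 : 0 ≤ l * y + (l - 1) := by nlinarith
  rcases le_total y Y with h | h
  · have : (l * y + (l - 1)) ^ β ≤ (l * Y + (l - 1)) ^ β :=
      Real.rpow_le_rpow hl0 (by nlinarith) hβ0.le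
    linarith
  · have h3 : l * y + (l - 1) ≤ l' * y := by
      rw [hY, div_le_iff₀ (by linarith)] at h
      linarith
    have h4 : 0 ≤ (l * Y + (l - 1)) ^ β := Real.rpow_nonneg (by nlinarith) _
    calc _ ≤ (l' * y) ^ β := Real.rpow_le_rpow hl0 h3 hβ0.le
      _ = θ * y ^ β := by rw [Real.mul_rpow (by linarith) hy0, hl'θ]
      _ ≤ _ := le_add_of_nonneg_right h4

end Penalization

theorem ConvexOn.midpoint_gap_nonneg {X : Type*} [AddCommGroup X] [Module ℝ X] {f : X → ℝ}
    (hf : ConvexOn ℝ Set.univ f) (u v : X) : 0 ≤ f u / 2 + f v / 2 - f ((1 / 2 : ℝ) • (u + v)) := by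
  have h := hf.2 (Set.mem_univ u) (Set.mem_univ v)
    (by norm_num : (0 : ℝ) ≤ 1 / 2) (by norm_num : (0 : ℝ) ≤ 1 / 2) (by norm_num)
  rw [← smul_add] at h
  simp only [smul_eq_mul] at h
  linarith

/-- The convex functional `(1/p) (∫ |A u|^p + V |B u|^p) + (1/(pβ)) (∫ ξ |B u|^p - 1)_+^β`. -/
def energy {α E X : Type*} [MeasurableSpace α] [NormedAddCommGroup E] (μ : Measure α) (p β : ℝ)
    (V ξ : α → ℝ) (A : X → Lp E (ENNReal.ofReal p) μ) (B : X → Lp ℝ (ENNReal.ofReal p) μ)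
    (u : X) : ℝ :=
  1 / p * (powInt μ (fun _ => 1) p (A u) + powInt μ V p (B u)) +
    1 / (p * β) * (max (powInt μ ξ p (B u) - 1) 0) ^ β

section Energy

open BddWeight

variable {α E X : Type*} [MeasurableSpace α] [NormedAddCommGroup E] [InnerProductSpace ℝ E]
  [NormedAddCommGroup X] [NormedSpace ℝ X] {μ : Measure α} {p β : ℝ} [Fact (1 ≤ ENNReal.ofReal p)]
  {V ξ : α → ℝ} {bV bξ : ℝ} {A : X →L[ℝ] Lp E (ENNReal.ofReal p) μ}
  {B : X →L[ℝ] Lp ℝ (ENNReal.ofReal p) μ}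

theorem exists_hasFDerivAt_energy (hp : 1 < p) (hβ : 1 < β) (hV : BddWeight μ V bV)
    (hξ : BddWeight μ ξ bξ) (u : X) :
    ∃ l : X →L[ℝ] ℝ, HasFDerivAt (energy μ p β V ξ A B) l u := by
  refine ((one (μ := μ)).exists_hasFDerivAt hp (A u)).elim fun d₁ h₁ => ?_
  refine (hV.exists_hasFDerivAt hp (B u)).elim fun d₂ h₂ => ?_
  refine (hξ.exists_hasFDerivAt hp (B u)).elim fun d₃ h₃ => ?_
  refine (hasDerivAt_max_zero_rpow hβ (powInt μ ξ p (B u) - 1)).elim fun d hd => ?_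
  have k₁ : HasFDerivAt (fun u => powInt μ (fun _ => 1) p (A u)) (d₁.comp A) u :=
    h₁.comp u A.hasFDerivAt
  have k₂ : HasFDerivAt (fun u => powInt μ V p (B u)) (d₂.comp B) u := h₂.comp u B.hasFDerivAt
  have k₃ : HasFDerivAt (fun u => powInt μ ξ p (B u)) (d₃.comp B) u := h₃.comp u B.hasFDerivAt
  exact ⟨_, ((k₁.add k₂).const_mul (1 / p)).add
    ((hd.comp_hasFDerivAt u (k₃.sub_const 1)).const_mul (1 / (p * β)))⟩

theorem energy_smul (c : ℝ) (u : X) : energy μ p β V ξ A B (c • u) =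
    |c| ^ p * (1 / p * (powInt μ (fun _ => 1) p (A u) + powInt μ V p (B u))) +
      1 / (p * β) * (max (|c| ^ p * powInt μ ξ p (B u) - 1) 0) ^ β := by
  rw [energy, map_smul, map_smul, powInt_smul, powInt_smul, powInt_smul]
  ring

theorem energy_neg (u : X) : energy μ p β V ξ A B (-u) = energy μ p β V ξ A B u := by
  rw [← neg_one_smul ℝ u, energy_smul, abs_neg, abs_one, Real.one_rpow, one_mul, one_mul, energy]

theorem convexOn_powInt_comp {F : Type*} [NormedAddCommGroup F] [InnerProductSpace ℝ F]
    {w : α → ℝ} {b : ℝ} (hp : 1 < p) (hw : BddWeight μ w b)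
    (L : X →L[ℝ] Lp F (ENNReal.ofReal p) μ) :
    ConvexOn ℝ Set.univ fun u => powInt μ w p (L u) :=
  (hw.convexOn hp).comp_linearMap (L : X →ₗ[ℝ] Lp F (ENNReal.ofReal p) μ)

/-- A nondecreasing convex function composed with a convex one. -/
theorem convexOn_penalty (hp : 1 < p) (hβ : 1 < β) (hξ : BddWeight μ ξ bξ) :
    ConvexOn ℝ Set.univ fun u : X => (max (powInt μ ξ p (B u) - 1) 0) ^ β := by
  have h := convexOn_powInt_comp hp hξ B
  refine ⟨convex_univ, fun x _ y _ a b ha hb hab => ?_⟩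
  exact (max_zero_rpow_mono hβ (h.2 (Set.mem_univ x) (Set.mem_univ y) ha hb hab)).trans
    ((convexOn_max_zero_rpow hβ).2 (Set.mem_univ _) (Set.mem_univ _) ha hb hab)

theorem convexOn_energy (hp : 1 < p) (hβ : 1 < β) (hV : BddWeight μ V bV)
    (hξ : BddWeight μ ξ bξ) : ConvexOn ℝ Set.univ (energy μ p β V ξ A B) :=
  (((convexOn_powInt_comp hp one A).add (convexOn_powInt_comp hp hV B)).smul
    (show (0 : ℝ) ≤ 1 / p by positivity)).add
    ((convexOn_penalty hp hβ hξ).smul (show (0 : ℝ) ≤ 1 / (p * β) by positivity))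

theorem le_energy (hp : 1 < p) {c : ℝ} (hV : BddWeight μ V bV) (hc : ∀ x, c ≤ V x)
    (hn : ∀ u, ‖u‖ ^ p = ‖B u‖ ^ p + ‖A u‖ ^ p) (u : X) :
    min 1 c * ‖u‖ ^ p ≤ powInt μ (fun _ => 1) p (A u) + powInt μ V p (B u) := by
  have h1 := hV.mul_norm_rpow_le hp hc (B u)
  have h2 : 0 ≤ ‖B u‖ ^ p := by positivity
  have h3 : 0 ≤ ‖A u‖ ^ p := by positivity
  rw [← norm_rpow_eq hp, hn, mul_add]
  have h4 := mul_le_mul_of_nonneg_right (min_le_left 1 c) h3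
  have h5 := mul_le_mul_of_nonneg_right (min_le_right 1 c) h2
  linarith

/-- The two `p`-integrals supply the quantitative gap. The penalty is only convex, but its midpoint
gap is nonnegative and can be discarded. -/
theorem uniformlyConvex_energy [FiniteDimensional ℝ E] (hp : 1 < p) (hβ : 1 < β) {c : ℝ}
    (hc0 : 0 < c) (hV : BddWeight μ V bV) (hc : ∀ x, c ≤ V x) (hξ : BddWeight μ ξ bξ)
    (hn : ∀ u, ‖u‖ ^ p = ‖B u‖ ^ p + ‖A u‖ ^ p) :
    ConvexSplit.UniformlyConvex p (energy μ p β V ξ A B) where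
  one_lt := hp
  continuous := continuous_iff_continuousAt.2 fun u =>
    (exists_hasFDerivAt_energy hp hβ hV hξ u).elim fun _ h => h.continuousAt
  convex := convexOn_energy hp hβ hV hξ
  even := energy_neg
  gap := by
    intro η hη
    obtain ⟨K₁, hK₁, h₁⟩ := (one (μ := μ)).exists_gap (E := E) hp one_pos (fun _ => le_rfl) hη
    obtain ⟨K₂, hK₂, h₂⟩ := hV.exists_gap (E := ℝ) hp hc0 hc hη
    refine ⟨(K₁ + K₂) * p, by positivity, fun u v => ?_⟩
    have a₁ := h₁ (A u) (A v)
    have a₂ := h₂ (B u) (B v)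
    rw [← map_sub, ← map_add, ← map_smul] at a₁ a₂
    have g₁ := (convexOn_powInt_comp hp one A).midpoint_gap_nonneg u v
    have g₂ := (convexOn_powInt_comp hp hV B).midpoint_gap_nonneg u v
    have g₃ := (convexOn_penalty (B := B) hp hβ hξ).midpoint_gap_nonneg u v
    rw [hn, hn, hn]
    simp only [energy]
    set x₁ := powInt μ (fun _ => 1) p (A u) / 2 + powInt μ (fun _ => 1) p (A v) / 2 -
      powInt μ (fun _ => 1) p (A ((1 / 2 : ℝ) • (u + v))) with hx₁
    set x₂ := powInt μ V p (B u) / 2 + powInt μ V p (B v) / 2 -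
      powInt μ V p (B ((1 / 2 : ℝ) • (u + v))) with hx₂
    set x₃ := (max (powInt μ ξ p (B u) - 1) 0) ^ β / 2 + (max (powInt μ ξ p (B v) - 1) 0) ^ β / 2 -
      (max (powInt μ ξ p (B ((1 / 2 : ℝ) • (u + v))) - 1) 0) ^ β with hx₃
    have e : (1 / p * (powInt μ (fun _ => 1) p (A u) + powInt μ V p (B u)) +
        1 / (p * β) * (max (powInt μ ξ p (B u) - 1) 0) ^ β) / 2 +
        (1 / p * (powInt μ (fun _ => 1) p (A v) + powInt μ V p (B v)) +
        1 / (p * β) * (max (powInt μ ξ p (B v) - 1) 0) ^ β) / 2 -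
        (1 / p * (powInt μ (fun _ => 1) p (A ((1 / 2 : ℝ) • (u + v))) +
          powInt μ V p (B ((1 / 2 : ℝ) • (u + v)))) +
        1 / (p * β) * (max (powInt μ ξ p (B ((1 / 2 : ℝ) • (u + v))) - 1) 0) ^ β) =
        1 / p * (x₁ + x₂) + 1 / (p * β) * x₃ := by
      rw [hx₁, hx₂, hx₃]; ring
    rw [e]
    have e2 : (K₁ + K₂) * p * (1 / p * (x₁ + x₂) + 1 / (p * β) * x₃) =
        (K₁ + K₂) * (x₁ + x₂) + (K₁ + K₂) * (1 / β * x₃) := by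
      field_simp
    rw [e2]
    have e3 : 0 ≤ (K₁ + K₂) * (1 / β * x₃) :=
      mul_nonneg (by positivity) (mul_nonneg (by positivity) g₃)
    have e4 := mul_nonneg hK₁ g₂
    have e5 := mul_nonneg hK₂ g₁
    linarith
  coercive := by
    refine ⟨1 / p * min 1 c, by positivity, fun u => ?_⟩
    have h1 := le_energy (A := A) (B := B) hp hV hc hn u
    have h2 : 0 ≤ 1 / (p * β) * (max (powInt μ ξ p (B u) - 1) 0) ^ β := by
      have : 0 ≤ max (powInt μ ξ p (B u) - 1) 0 := le_max_right _ _
      positivity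
    rw [mul_assoc, energy]
    have h3 : (0 : ℝ) ≤ 1 / p := by positivity
    linarith [mul_le_mul_of_nonneg_left h1 h3]

/-- Since `p * β < r`, some `s` satisfies `(1 + s) ^ (p * β) < 1 + s * r`, which controls the scaled
penalty up to a constant. Then also `(1 + s) ^ p < 1 + s * r`, which leaves a positive multiple of
the coercive part. -/
theorem energy_scaling (hp : 1 < p) (hβ : 1 < β) {c r : ℝ} (hr : p * β < r)
    (hc0 : 0 < c) (hV : BddWeight μ V bV) (hc : ∀ x, c ≤ V x)
    (hn : ∀ u, ‖u‖ ^ p = ‖B u‖ ^ p + ‖A u‖ ^ p) : ∃ s > 0, ∃ c' > 0, ∃ K, ∀ u,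
      c' * ‖u‖ ^ p - K ≤
        (1 + s * r) * energy μ p β V ξ A B u - energy μ p β V ξ A B ((1 + s) • u) := by
  obtain ⟨s, hs, hsr⟩ := exists_one_add_rpow_lt (a := p * β) (by positivity) hr
  have hl : (1 + s) ^ p < 1 + s * r := by
    refine lt_of_le_of_lt (Real.rpow_le_rpow_of_exponent_le (by linarith) ?_) hsr
    nlinarith
  rw [Real.rpow_mul (by positivity)] at hsr
  obtain ⟨K, hK, hsc⟩ := exists_max_zero_rpow_scaling hβ
    (Real.one_le_rpow (by linarith) (by linarith) : 1 ≤ (1 + s) ^ p) hsr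
  refine ⟨s, hs, (1 + s * r - (1 + s) ^ p) * (1 / p * min 1 c),
    mul_pos (by linarith) (by positivity), 1 / (p * β) * K, fun u => ?_⟩
  have h1 := le_energy (A := A) (B := B) hp hV hc hn u
  have h2 := hsc (powInt μ ξ p (B u))
  rw [energy_smul, abs_of_pos (by linarith : 0 < 1 + s), energy]
  set Q := powInt μ (fun _ => 1) p (A u) + powInt μ V p (B u)
  have h3 : 0 ≤ (1 + s * r - (1 + s) ^ p) * (1 / p) := mul_nonneg (by linarith) (by positivity)
  have h4 := mul_le_mul_of_nonneg_left h1 h3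
  have h5 := mul_le_mul_of_nonneg_left h2 (show (0 : ℝ) ≤ 1 / (p * β) by positivity)
  linarith

end Energy

end

noncomputable section

/-! ### Truncated powers -/

/-- An even continuous cut-off with values in `[0, 1]`, equal to `1` on `[-1, 1]` and vanishing
outside `[-2, 2]`. -/
structure IsTruncation (φ : ℝ → ℝ) : Prop where
  continuous : Continuous φ
  even : ∀ s, φ (-s) = φ s
  nonneg : ∀ s, 0 ≤ φ s
  le_one : ∀ s, φ s ≤ 1
  one : ∀ s, |s| ≤ 1 → φ s = 1
  zero : ∀ s, 2 ≤ |s| → φ s = 0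

namespace IsTruncation

/-- The primitive `∫₀ˢ φ` of a cut-off. -/
def prim (φ : ℝ → ℝ) (s : ℝ) : ℝ := ∫ τ in (0 : ℝ)..s, φ τ

/-- The truncated power `|s|^r |∫₀ˢ φ|^κ`. -/
def pow (φ : ℝ → ℝ) (r κ s : ℝ) : ℝ := |s| ^ r * |prim φ s| ^ κ

/-- The derivative of `IsTruncation.pow`. -/
def powDeriv (φ : ℝ → ℝ) (r κ s : ℝ) : ℝ :=
  r * |s| ^ (r - 2) * s * |prim φ s| ^ κ +
    |s| ^ r * (κ * |prim φ s| ^ (κ - 2) * prim φ s * φ s)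

variable {φ : ℝ → ℝ} (h : IsTruncation φ)

theorem prim_zero : prim φ 0 = 0 := intervalIntegral.integral_same

include h

theorem hasDerivAt_prim (s : ℝ) : HasDerivAt (prim φ) (φ s) s :=
  intervalIntegral.integral_hasDerivAt_right (h.continuous.intervalIntegrable _ _)
    h.continuous.aestronglyMeasurable.stronglyMeasurableAtFilter h.continuous.continuousAt

theorem continuous_prim : Continuous (prim φ) :=
  continuous_iff_continuousAt.2 fun s => (h.hasDerivAt_prim s).continuousAt

theorem monotone_prim : Monotone (prim φ) :=
  monotone_of_deriv_nonneg (fun s => (h.hasDerivAt_prim s).differentiableAt) fun s => by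
    rw [(h.hasDerivAt_prim s).deriv]; exact h.nonneg s

theorem prim_neg (s : ℝ) : prim φ (-s) = - prim φ s := by
  have h1 := intervalIntegral.integral_comp_neg (a := 0) (b := s) φ
  simp only [h.even, neg_zero] at h1
  rw [prim, prim, h1, intervalIntegral.integral_symm]

theorem prim_eq_self {s : ℝ} (hs : |s| ≤ 1) : prim φ s = s := by
  have : prim φ s = ∫ _ in (0 : ℝ)..s, (1 : ℝ) := by
    refine intervalIntegral.integral_congr fun τ hτ => h.one τ ?_
    have := Set.abs_sub_left_of_mem_uIcc hτ
    rw [sub_zero, sub_zero] at this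
    exact this.trans hs
  rw [this]
  simp

theorem prim_nonneg {s : ℝ} (hs : 0 ≤ s) : 0 ≤ prim φ s := by
  rw [← prim_zero (φ := φ)]
  exact h.monotone_prim hs

theorem abs_prim (s : ℝ) : |prim φ s| = prim φ |s| := by
  rcases le_total 0 s with hs | hs
  · rw [abs_of_nonneg hs, abs_of_nonneg (h.prim_nonneg hs)]
  · rw [abs_of_nonpos hs, h.prim_neg, abs_of_nonpos]
    have := h.prim_nonneg (neg_nonneg.2 hs)
    rw [h.prim_neg] at this
    linarith

/-- The primitive is monotone and is the identity on `[-1, 1]`. -/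
theorem min_le_abs_prim (s : ℝ) : min |s| 1 ≤ |prim φ s| := by
  rw [h.abs_prim]
  have h0 : 0 ≤ min |s| 1 := le_min (abs_nonneg s) zero_le_one
  rw [← h.prim_eq_self (s := min |s| 1) (by rw [abs_of_nonneg h0]; exact min_le_right _ _)]
  exact h.monotone_prim (min_le_left _ _)

theorem prim_ne_zero {s : ℝ} (hs : s ≠ 0) : prim φ s ≠ 0 := by
  have h1 := h.min_le_abs_prim s
  have h2 : 0 < min |s| 1 := lt_min (abs_pos.2 hs) one_pos
  exact abs_pos.1 (h2.trans_le h1)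

theorem mul_prim_nonneg (s : ℝ) : 0 ≤ s * prim φ s := by
  rcases le_total 0 s with hs | hs
  · exact mul_nonneg hs (h.prim_nonneg hs)
  · refine mul_nonneg_of_nonpos_of_nonpos hs ?_
    have := h.prim_nonneg (neg_nonneg.2 hs)
    rw [h.prim_neg] at this
    linarith

theorem abs_prim_le_two (s : ℝ) : |prim φ s| ≤ 2 := by
  have h2 : prim φ 2 ≤ 2 := by
    have := intervalIntegral.norm_integral_le_of_norm_le_const (a := 0) (b := 2) (f := φ) (C := 1)
      fun τ _ => by rw [Real.norm_of_nonneg (h.nonneg τ)]; exact h.le_one τ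
    simp only [sub_zero, one_mul, abs_two] at this
    exact (le_abs_self _).trans this
  rw [h.abs_prim]
  rcases le_total |s| 2 with hs | hs
  · exact (h.monotone_prim hs).trans h2
  · have h3 : ∫ τ in (2 : ℝ)..|s|, φ τ = 0 := by
      rw [← intervalIntegral.integral_zero (a := (2 : ℝ)) (b := |s|)]
      refine intervalIntegral.integral_congr fun τ hτ => h.zero τ ?_
      rw [Set.uIcc_of_le hs] at hτ
      exact hτ.1.trans (le_abs_self τ)
    rw [prim, ← intervalIntegral.integral_add_adjacent_intervals
      (h.continuous.intervalIntegrable 0 2) (h.continuous.intervalIntegrable 2 |s|), h3, add_zero]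
    exact h2

variable {r κ : ℝ} (hr : 1 < r) (hκ : 0 < κ)

theorem pow_neg (s : ℝ) : pow φ r κ (-s) = pow φ r κ s := by
  rw [pow, pow, h.prim_neg, abs_neg, abs_neg]

theorem powDeriv_neg (s : ℝ) : powDeriv φ r κ (-s) = - powDeriv φ r κ s := by
  rw [powDeriv, powDeriv, h.prim_neg, abs_neg, abs_neg, h.even]
  ring

include hκ in
theorem pow_le (s : ℝ) : pow φ r κ s ≤ 2 ^ κ * |s| ^ r := by
  rw [pow, mul_comm]
  have := h.abs_prim_le_two s
  gcongr

include hr in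
theorem powDeriv_zero : powDeriv φ r κ 0 = 0 := by
  rw [powDeriv, abs_zero, Real.zero_rpow (by linarith : r ≠ 0)]
  ring

-- The delicate factor is `|prim|^(κ - 1)` in the second term, possibly singular for `κ < 1`. There
-- `φ s` vanishes unless `|s| < 2`, and in that range `|s| ≤ 2 * |prim φ s|`, so one power of `|s|`
-- compensates.
include hr hκ in
theorem abs_powDeriv_le (s : ℝ) :
    |powDeriv φ r κ s| ≤ (r + 2 * κ) * 2 ^ κ * |s| ^ (r - 1) := by
  rcases eq_or_ne s 0 with rfl | hs
  · rw [h.powDeriv_zero hr, abs_zero]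
    positivity
  have hs0 : 0 < |s| := abs_pos.2 hs
  have hm0 : 0 < |prim φ s| := abs_pos.2 (h.prim_ne_zero hs)
  have hm : |prim φ s| ^ κ ≤ 2 ^ κ := by
    have := h.abs_prim_le_two s
    gcongr
  have e1 : |r * |s| ^ (r - 2) * s * |prim φ s| ^ κ| ≤ r * 2 ^ κ * |s| ^ (r - 1) := by
    rw [abs_mul, abs_mul, abs_mul, abs_of_pos (by linarith : 0 < r),
      abs_of_nonneg (by positivity : 0 ≤ |s| ^ (r - 2)),
      abs_of_nonneg (by positivity : 0 ≤ |prim φ s| ^ κ), mul_assoc r,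
      ← Real.rpow_add_one hs0.ne', show r - 2 + 1 = r - 1 by ring]
    calc _ ≤ r * |s| ^ (r - 1) * 2 ^ κ := by gcongr
      _ = _ := by ring
  have e2 : |(|s| ^ r * (κ * |prim φ s| ^ (κ - 2) * prim φ s * φ s))| ≤
      2 * κ * 2 ^ κ * |s| ^ (r - 1) := by
    by_cases hz : 2 ≤ |s|
    · rw [h.zero s hz, mul_zero, mul_zero, abs_zero]
      positivity
    push Not at hz
    have e3 : |s| ≤ 2 * |prim φ s| := by
      have := h.min_le_abs_prim s
      rcases min_cases |s| 1 with ⟨e, _⟩ | ⟨e, _⟩ <;> rw [e] at this <;> linarith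
    rw [abs_mul, abs_mul, abs_mul, abs_mul, abs_of_pos hκ,
      abs_of_nonneg (by positivity : 0 ≤ |s| ^ r),
      abs_of_nonneg (by positivity : 0 ≤ |prim φ s| ^ (κ - 2)), abs_of_nonneg (h.nonneg s),
      mul_assoc κ, ← Real.rpow_add_one hm0.ne', show κ - 2 + 1 = κ - 1 by ring]
    have e4 : |s| ^ r = |s| ^ (r - 1) * |s| := by
      rw [← Real.rpow_add_one hs0.ne', sub_add_cancel]
    have e5 : |prim φ s| ^ (κ - 1) * |prim φ s| = |prim φ s| ^ κ := by
      rw [← Real.rpow_add_one hm0.ne', sub_add_cancel]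
    calc |s| ^ r * (κ * |prim φ s| ^ (κ - 1) * φ s)
        ≤ |s| ^ r * (κ * |prim φ s| ^ (κ - 1) * 1) := by
          gcongr
          exact h.le_one s
      _ = κ * |s| ^ (r - 1) * (|prim φ s| ^ (κ - 1) * |s|) := by rw [e4]; ring
      _ ≤ κ * |s| ^ (r - 1) * (|prim φ s| ^ (κ - 1) * (2 * |prim φ s|)) := by gcongr
      _ = 2 * κ * |s| ^ (r - 1) * |prim φ s| ^ κ := by rw [← e5]; ring
      _ ≤ 2 * κ * |s| ^ (r - 1) * 2 ^ κ := by gcongr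
      _ = _ := by ring
  calc _ ≤ _ := abs_add_le _ _
    _ ≤ _ := add_le_add e1 e2
    _ = _ := by ring

-- The factor `|s| ^ r` alone produces `r` times the power. Differentiating the other factor adds a
-- nonnegative term, because `φ ≥ 0` and `s` and its primitive have the same sign.
include hκ in
theorem mul_pow_le (s : ℝ) : r * pow φ r κ s ≤ powDeriv φ r κ s * s := by
  rcases eq_or_ne s 0 with rfl | hs
  · rw [mul_zero, pow, prim_zero, abs_zero, Real.zero_rpow hκ.ne', mul_zero, mul_zero]
  have hs0 : 0 < |s| := abs_pos.2 hs
  have e1 : |s| ^ (r - 2) * s * s = |s| ^ r := by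
    rw [mul_assoc, ← abs_mul_abs_self, ← mul_assoc, ← Real.rpow_add_one hs0.ne',
      ← Real.rpow_add_one hs0.ne']
    congr 1
    ring
  have e2 : 0 ≤ |s| ^ r * (κ * |prim φ s| ^ (κ - 2) * φ s) * (s * prim φ s) := by
    have := h.nonneg s
    have := h.mul_prim_nonneg s
    positivity
  calc r * pow φ r κ s = r * (|s| ^ (r - 2) * s * s) * |prim φ s| ^ κ := by rw [e1, pow]; ring
    _ ≤ r * (|s| ^ (r - 2) * s * s) * |prim φ s| ^ κ +
        |s| ^ r * (κ * |prim φ s| ^ (κ - 2) * φ s) * (s * prim φ s) := le_add_of_nonneg_right e2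
    _ = _ := by rw [powDeriv]; ring

-- At the origin the function is `O(|s| ^ r)` with `r > 1`; elsewhere the primitive is nonzero and
-- the product rule applies.
include hr hκ in
theorem hasDerivAt_pow (s : ℝ) : HasDerivAt (pow φ r κ) (powDeriv φ r κ s) s := by
  rcases eq_or_ne s 0 with rfl | hs
  · rw [h.powDeriv_zero hr]
    have h1 := hasFDerivAt_norm_rpow (0 : ℝ) hr
    rw [map_zero, smul_zero] at h1
    rw [hasDerivAt_iff_isLittleO_nhds_zero]
    rw [hasFDerivAt_iff_isLittleO_nhds_zero] at h1
    refine Asymptotics.IsBigO.trans_isLittleO (Asymptotics.IsBigO.of_bound (2 ^ κ)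
      (Filter.Eventually.of_forall fun s => ?_)) h1
    have h0 : pow φ r κ 0 = 0 := by
      rw [pow, prim_zero, abs_zero, Real.zero_rpow hκ.ne', mul_zero]
    simp only [zero_add, norm_zero, h0, sub_zero, smul_zero, zero_apply,
      Real.zero_rpow (by linarith : r ≠ 0)]
    have e0 : 0 ≤ pow φ r κ s := by rw [pow]; positivity
    rw [Real.norm_of_nonneg e0, Real.norm_of_nonneg (by positivity), Real.norm_eq_abs]
    exact h.pow_le hκ s
  · have hm := h.prim_ne_zero hs
    have h1 := hasDerivAt_abs_rpow s hr
    have h2 : HasDerivAt (fun s => |prim φ s|) (SignType.sign (prim φ s) * φ s) s :=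
      (hasDerivAt_abs hm).comp s (h.hasDerivAt_prim s)
    have h3 := h2.rpow_const (p := κ) (Or.inl (abs_ne_zero.2 hm))
    refine (h1.mul h3).congr_deriv ?_
    rw [powDeriv]
    congr 2
    have e : |prim φ s| ^ (κ - 1) * SignType.sign (prim φ s) = |prim φ s| ^ (κ - 2) * prim φ s := by
      rw [show κ - 1 = κ - 2 + 1 by ring, Real.rpow_add_one (abs_ne_zero.2 hm), mul_assoc,
        mul_comm |prim φ s|, sign_mul_abs]
    calc _ = κ * φ s * (|prim φ s| ^ (κ - 1) * SignType.sign (prim φ s)) := by ring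
      _ = _ := by rw [e]; ring

include hr hκ in
theorem continuous_powDeriv : Continuous (powDeriv φ r κ) := by
  refine continuous_iff_continuousAt.2 fun s => ?_
  rcases eq_or_ne s 0 with rfl | hs
  · rw [ContinuousAt, h.powDeriv_zero hr]
    refine squeeze_zero_norm (fun s => h.abs_powDeriv_le hr hκ s) ?_
    have : Continuous fun s : ℝ => (r + 2 * κ) * 2 ^ κ * |s| ^ (r - 1) :=
      continuous_const.mul (continuous_abs.rpow_const fun _ => Or.inr (by linarith))
    have := this.tendsto 0
    rwa [abs_zero, Real.zero_rpow (by linarith), mul_zero] at this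
  · have hm := h.prim_ne_zero hs
    have c1 : ∀ e : ℝ, ContinuousAt (fun s : ℝ => |s| ^ e) s := fun e =>
      continuous_abs.continuousAt.rpow_const (Or.inl (abs_ne_zero.2 hs))
    have c2 : ∀ e : ℝ, ContinuousAt (fun s : ℝ => |prim φ s| ^ e) s := fun e =>
      h.continuous_prim.abs.continuousAt.rpow_const (Or.inl (abs_ne_zero.2 hm))
    exact (((continuousAt_const.mul (c1 _)).mul continuousAt_id).mul (c2 _)).add
      ((c1 _).mul (((continuousAt_const.mul (c2 _)).mul h.continuous_prim.continuousAt).mul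
        h.continuous.continuousAt))

end IsTruncation

end

noncomputable section

theorem Nemytskii.of_hasDerivAt {α : Type*} [MeasurableSpace α] [TopologicalSpace α]
    [OpensMeasurableSpace α] [SecondCountableTopology α] [TopologicalSpace.PseudoMetrizableSpace α]
    {μ : Measure α} {s C : ℝ} {G g : α → ℝ → ℝ}
    (hs : 1 < s) (hC : 0 ≤ C) (hd : ∀ x t, HasDerivAt (G x) (g x t) t)
    (hg : ∀ x t, |g x t| ≤ C * |t| ^ (s - 1)) (h0 : ∀ x, G x 0 = 0)
    (hG : Continuous fun z : α × ℝ => G z.1 z.2) (hgc : Continuous fun z : α × ℝ => g z.1 z.2) :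
    Nemytskii μ s C G fun x t => ContinuousLinearMap.toSpanSingleton ℝ (g x t) := by
  have hL : Continuous fun c : ℝ => ContinuousLinearMap.toSpanSingleton ℝ c :=
    (ContinuousLinearMap.toSpanSingletonLIE ℝ ℝ).continuous
  have hz : ∀ z : α → ℝ, AEStronglyMeasurable z μ → AEStronglyMeasurable (fun x => (x, z x)) μ :=
    fun z hz => aestronglyMeasurable_id.prodMk hz
  refine ⟨hs, hC, fun x t => (hd x t).hasFDerivAt, fun x t => ?_, h0, fun x => hL.comp
    (hgc.comp (Continuous.prodMk_right x)), fun z h => hG.comp_aestronglyMeasurable (hz z h),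
    fun z h => hL.comp_aestronglyMeasurable (hgc.comp_aestronglyMeasurable (hz z h))⟩
  rw [ContinuousLinearMap.norm_toSpanSingleton]
  exact hg x t

/-! ### The truncated nonlinearity -/

namespace PLaplaceData

open IsTruncation Filter Topology

variable {N : ℕ} (D : PLaplaceData N)

theorem p_lt_r : D.p < D.r := (le_max_left _ _).trans_lt D.lt_r

theorem one_lt_r : 1 < D.r := D.one_lt_p.trans D.p_lt_r

theorem r_lt_pStar : D.r < D.pStar := D.r_lt_q.trans D.q_lt

theorem q_pos : 0 < D.q := by linarith [D.one_lt_r, D.r_lt_q]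

theorem pStar_pos : 0 < D.pStar := by linarith [D.one_lt_r, D.r_lt_pStar]

instance : Fact (1 ≤ ENNReal.ofReal D.r) :=
  ⟨by rw [ENNReal.one_le_ofReal]; exact D.one_lt_r.le⟩

theorem isTruncation : IsTruncation D.φ := by
  have h01 : ∀ s, 0 ≤ D.φ s ∧ D.φ s ≤ 1 := by
    have key : ∀ s, 0 ≤ s → 0 ≤ D.φ s ∧ D.φ s ≤ 1 := by
      intro s hs
      have e1 : D.φ 1 = 1 := D.φ_one 1 (by simp)
      have e2 : D.φ 2 = 0 := D.φ_zero 2 (by simp)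
      rcases le_total s 1 with h | h
      · rw [D.φ_one s (by rwa [abs_of_nonneg hs])]
        exact ⟨zero_le_one, le_rfl⟩
      rcases le_total s 2 with h' | h'
      · refine ⟨?_, ?_⟩
        · rw [← e2]; exact D.φ_anti ⟨h, h'⟩ ⟨by norm_num, le_rfl⟩ h'
        · rw [← e1]; exact D.φ_anti ⟨le_rfl, by norm_num⟩ ⟨h, h'⟩ h
      · rw [D.φ_zero s (by rwa [abs_of_nonneg hs])]
        exact ⟨le_rfl, zero_le_one⟩
    intro s
    rcases le_total 0 s with h | h
    · exact key s h
    · rw [← D.φ_even]; exact key _ (neg_nonneg.2 h)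
  exact ⟨D.φ_smooth.continuous, D.φ_even, fun s => (h01 s).1, fun s => (h01 s).2, D.φ_one, D.φ_zero⟩

/-- The factor `σ e^{dist(σx, M)}`. -/
def scale (σ : ℝ) (x : RN N) : ℝ := σ * Real.exp (Metric.infDist (σ • x) D.M)

theorem continuous_scale (σ : ℝ) : Continuous (D.scale σ) :=
  continuous_const.mul (Real.continuous_exp.comp
    ((Metric.continuous_infDist_pt D.M).comp (continuous_const_smul σ)))

variable {σ : ℝ} (hσ : 0 < σ)

include hσ in
theorem scale_pos (x : RN N) : 0 < D.scale σ x := by rw [scale]; positivity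

include hσ in
theorem le_scale (x : RN N) : σ ≤ D.scale σ x :=
  le_mul_of_one_le_right hσ.le (Real.one_le_exp Metric.infDist_nonneg)

-- The distance to the bounded set `M` grows linearly. This divergence of the scale is the source of
-- compactness at infinity.
include hσ in
theorem tendsto_scale (hN : D.M.Nonempty) (hb : Bornology.IsBounded D.M) :
    Tendsto (D.scale σ) (cocompact (RN N)) atTop := by
  obtain ⟨R, hR⟩ := hb.subset_closedBall 0
  refine (Real.tendsto_exp_atTop.comp ?_).const_mul_atTop hσ
  have h1 : Tendsto (fun x : RN N => σ * ‖x‖ + -R) (cocompact (RN N)) atTop :=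
    tendsto_atTop_add_const_right _ _ (tendsto_norm_cocompact_atTop.const_mul_atTop hσ)
  refine tendsto_atTop_mono (fun x => ?_) h1
  refine (Metric.le_infDist hN).2 fun y hy => ?_
  have h2 : ‖y‖ ≤ R := by simpa using hR hy
  have h3 := norm_sub_norm_le (σ • x) y
  rw [norm_smul, Real.norm_of_nonneg hσ.le] at h3
  rw [dist_eq_norm]
  linarith

-- The substitution `τ ↦ scale * τ` concentrates the whole dependence on `x` in the number `scale σ
-- x`.
include hσ in
theorem m_eq (x : RN N) (t : ℝ) : D.m σ x t = (D.scale σ x)⁻¹ * prim D.φ (D.scale σ x * t) := by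
  have h := intervalIntegral.integral_comp_mul_left (a := 0) (b := t) D.φ (D.scale_pos hσ x).ne'
  rw [mul_zero] at h
  exact h

/-- The rescaled truncated power `a^{-(r + κ)} |a t|^r |∫₀^{at} φ|^κ`. -/
def term (κ a t : ℝ) : ℝ := a ^ (-(D.r + κ)) * pow D.φ D.r κ (a * t)

/-- The derivative in `t` of `term`. -/
def termDeriv (κ a t : ℝ) : ℝ := a ^ (-(D.r + κ)) * (powDeriv D.φ D.r κ (a * t) * a)

theorem rpow_mul_abs_prim {κ a t : ℝ} (ha : 0 < a) :
    |t| ^ D.r * |a⁻¹ * prim D.φ (a * t)| ^ κ = D.term κ a t := by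
  rw [term, pow, abs_mul, abs_mul, abs_of_pos ha, abs_of_pos (inv_pos.2 ha),
    Real.mul_rpow ha.le (abs_nonneg _), Real.mul_rpow (by positivity) (abs_nonneg _),
    Real.rpow_neg ha.le, Real.rpow_add ha, Real.inv_rpow ha.le]
  have := (Real.rpow_pos_of_pos ha D.r).ne'
  have := (Real.rpow_pos_of_pos ha κ).ne'
  field_simp

theorem hasDerivAt_term {κ a : ℝ} (hκ : 0 < κ) (t : ℝ) :
    HasDerivAt (D.term κ a) (D.termDeriv κ a t) t := by
  have h1 : HasDerivAt (fun t => a * t) a t := by simpa using (hasDerivAt_id t).const_mul a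
  exact ((D.isTruncation.hasDerivAt_pow D.one_lt_r hκ (a * t)).comp t h1).const_mul _

/-- Of the powers of `a`, the chain rule and the bound for the truncated power use up `a ^ r`; the
remaining factor `a ^ (-κ)` gives decay as `a` grows. -/
theorem abs_termDeriv_le {κ a : ℝ} (hκ : 0 < κ) (ha : 0 < a) (t : ℝ) :
    |D.termDeriv κ a t| ≤ (D.r + 2 * κ) * 2 ^ κ * a ^ (-κ) * |t| ^ (D.r - 1) := by
  rw [termDeriv, abs_mul, abs_mul, abs_of_pos ha, abs_of_pos (Real.rpow_pos_of_pos ha _)]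
  have h := D.isTruncation.abs_powDeriv_le D.one_lt_r hκ (a * t)
  rw [abs_mul, abs_of_pos ha, Real.mul_rpow ha.le (abs_nonneg t)] at h
  have e : a ^ (-(D.r + κ)) * (a ^ (D.r - 1) * a) = a ^ (-κ) := by
    rw [← Real.rpow_add_one ha.ne', ← Real.rpow_add ha]
    congr 1
    ring
  calc _ ≤ a ^ (-(D.r + κ)) *
        ((D.r + 2 * κ) * 2 ^ κ * (a ^ (D.r - 1) * |t| ^ (D.r - 1)) * a) := by gcongr
    _ = (D.r + 2 * κ) * 2 ^ κ * (a ^ (-(D.r + κ)) * (a ^ (D.r - 1) * a)) * |t| ^ (D.r - 1) := by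
        ring
    _ = _ := by rw [e]

theorem mul_term_le {κ a : ℝ} (hκ : 0 < κ) (ha : 0 < a) (t : ℝ) :
    D.r * D.term κ a t ≤ D.termDeriv κ a t * t := by
  have h := D.isTruncation.mul_pow_le (r := D.r) hκ (a * t)
  have h0 : 0 ≤ a ^ (-(D.r + κ)) := by positivity
  calc D.r * D.term κ a t = a ^ (-(D.r + κ)) * (D.r * pow D.φ D.r κ (a * t)) := by rw [term]; ring
    _ ≤ a ^ (-(D.r + κ)) * (powDeriv D.φ D.r κ (a * t) * (a * t)) := by gcongr
    _ = _ := by rw [termDeriv]; ring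

theorem term_neg (κ a t : ℝ) : D.term κ a (-t) = D.term κ a t := by
  rw [term, mul_neg, D.isTruncation.pow_neg, term]

theorem termDeriv_neg (κ a t : ℝ) : D.termDeriv κ a (-t) = - D.termDeriv κ a t := by
  rw [termDeriv, mul_neg, D.isTruncation.powDeriv_neg, termDeriv]
  ring

theorem term_nonneg {κ a : ℝ} (ha : 0 < a) (t : ℝ) : 0 ≤ D.term κ a t := by
  rw [term, pow]; positivity

/-- The derivative in `t` of `F`. -/
def f (σ : ℝ) (x : RN N) (t : ℝ) : ℝ :=
  1 / D.pStar * D.termDeriv (D.pStar - D.r) (D.scale σ x) t +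
    D.μ / D.q * D.termDeriv (D.q - D.r) (D.scale σ x) t

theorem exponents_pos : 0 < D.pStar - D.r ∧ 0 < D.q - D.r :=
  ⟨sub_pos.2 D.r_lt_pStar, sub_pos.2 D.r_lt_q⟩

theorem coeffs_pos : 0 < 1 / D.pStar ∧ 0 < D.μ / D.q :=
  ⟨one_div_pos.2 D.pStar_pos, div_pos D.μ_pos D.q_pos⟩

include hσ in
theorem F_eq (x : RN N) (t : ℝ) : D.F σ x t =
    1 / D.pStar * D.term (D.pStar - D.r) (D.scale σ x) t +
      D.μ / D.q * D.term (D.q - D.r) (D.scale σ x) t := by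
  rw [F, D.m_eq hσ, mul_assoc, mul_assoc, D.rpow_mul_abs_prim (D.scale_pos hσ x),
    D.rpow_mul_abs_prim (D.scale_pos hσ x)]

include hσ in
theorem hasDerivAt_F (x : RN N) (t : ℝ) : HasDerivAt (D.F σ x) (D.f σ x t) t := by
  rw [show D.F σ x = _ from funext (D.F_eq hσ x)]
  exact ((D.hasDerivAt_term D.exponents_pos.1 t).const_mul _).add
    ((D.hasDerivAt_term D.exponents_pos.2 t).const_mul _)

include hσ in
theorem F_neg (x : RN N) (t : ℝ) : D.F σ x (-t) = D.F σ x t := by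
  rw [D.F_eq hσ, D.F_eq hσ, term_neg, term_neg]

theorem f_neg (x : RN N) (t : ℝ) : D.f σ x (-t) = - D.f σ x t := by
  rw [f, f, termDeriv_neg, termDeriv_neg]
  ring

include hσ in
theorem mul_F_le (x : RN N) (t : ℝ) : D.r * D.F σ x t ≤ D.f σ x t * t := by
  have h1 := D.mul_term_le D.exponents_pos.1 (D.scale_pos hσ x) t
  have h2 := D.mul_term_le D.exponents_pos.2 (D.scale_pos hσ x) t
  have h3 := mul_le_mul_of_nonneg_left h1 D.coeffs_pos.1.le
  have h4 := mul_le_mul_of_nonneg_left h2 D.coeffs_pos.2.le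
  rw [D.F_eq hσ, f]
  linarith

include hσ in
theorem F_nonneg (x : RN N) (t : ℝ) : 0 ≤ D.F σ x t := by
  rw [D.F_eq hσ]
  have h1 := D.term_nonneg (κ := D.pStar - D.r) (D.scale_pos hσ x) t
  have h2 := D.term_nonneg (κ := D.q - D.r) (D.scale_pos hσ x) t
  have := D.coeffs_pos
  exact add_nonneg (mul_nonneg this.1.le h1) (mul_nonneg this.2.le h2)

include hσ in
theorem f_mul_nonneg (x : RN N) (t : ℝ) : 0 ≤ D.f σ x t * t :=
  (mul_nonneg (by linarith [D.one_lt_r]) (D.F_nonneg hσ x t)).trans (D.mul_F_le hσ x t)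

/-- The weight through which the nonlinearity decays at infinity. -/
def decay (σ : ℝ) (x : RN N) : ℝ :=
  (D.scale σ x ^ (-(D.pStar - D.r)) + D.scale σ x ^ (-(D.q - D.r))) ^ (1 / D.r)

/-- The growth constant of the nonlinearity. -/
def growthConst : ℝ :=
  1 / D.pStar * ((D.r + 2 * (D.pStar - D.r)) * 2 ^ (D.pStar - D.r)) +
    D.μ / D.q * ((D.r + 2 * (D.q - D.r)) * 2 ^ (D.q - D.r))

theorem growthConst_nonneg : 0 ≤ D.growthConst := by
  have h1 := D.exponents_pos
  have h2 := D.coeffs_pos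
  have h3 := D.one_lt_r
  rw [growthConst]
  exact add_nonneg (mul_nonneg h2.1.le (mul_nonneg (by linarith) (by positivity)))
    (mul_nonneg h2.2.le (mul_nonneg (by linarith) (by positivity)))

include hσ in
theorem decay_pos (x : RN N) : 0 < D.decay σ x := by
  have := D.scale_pos hσ x
  rw [decay]; positivity

include hσ in
theorem continuous_decay : Continuous (D.decay σ) := by
  have h : ∀ κ : ℝ, Continuous fun x => D.scale σ x ^ κ := fun κ =>
    (D.continuous_scale σ).rpow_const fun x => Or.inl (D.scale_pos hσ x).ne'
  exact ((h _).add (h _)).rpow_const fun x => Or.inl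
    (add_pos (Real.rpow_pos_of_pos (D.scale_pos hσ x) _)
      (Real.rpow_pos_of_pos (D.scale_pos hσ x) _)).ne'

include hσ in
theorem decay_le (x : RN N) :
    D.decay σ x ≤ (σ ^ (-(D.pStar - D.r)) + σ ^ (-(D.q - D.r))) ^ (1 / D.r) := by
  have h := D.exponents_pos
  have h1 := D.scale_pos hσ x
  have h2 := D.one_lt_r
  have e : ∀ κ : ℝ, 0 < κ → D.scale σ x ^ (-κ) ≤ σ ^ (-κ) := fun κ hκ =>
    Real.rpow_le_rpow_of_nonpos hσ (D.le_scale hσ x) (by linarith)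
  exact Real.rpow_le_rpow (by positivity) (add_le_add (e _ h.1) (e _ h.2)) (by positivity)

include hσ in
theorem tendsto_decay (hN : D.M.Nonempty) (hb : Bornology.IsBounded D.M) :
    Tendsto (D.decay σ) (cocompact (RN N)) (𝓝 0) := by
  have h := D.tendsto_scale hσ hN hb
  have h2 := D.one_lt_r
  have e : ∀ κ : ℝ, 0 < κ → Tendsto (fun x => D.scale σ x ^ (-κ)) (cocompact (RN N)) (𝓝 0) :=
    fun κ hκ => (tendsto_rpow_neg_atTop hκ).comp h
  have h3 := ((e _ D.exponents_pos.1).add (e _ D.exponents_pos.2)).rpow_const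
    (p := 1 / D.r) (Or.inr (by positivity))
  rw [add_zero, Real.zero_rpow (by positivity)] at h3
  exact h3

-- The two terms decay like `scale ^ (-κ)` with `κ = p^* - r` and `κ = q - r`, and `decay ^ r` is
-- the sum of these powers.
include hσ in
theorem abs_f_le (x : RN N) (t : ℝ) :
    |D.f σ x t| ≤ D.growthConst * D.decay σ x ^ D.r * |t| ^ (D.r - 1) := by
  have h := D.exponents_pos
  have hc := D.coeffs_pos
  have ha := D.scale_pos hσ x
  have hr := D.one_lt_r
  have h1 := D.abs_termDeriv_le h.1 ha t
  have h2 := D.abs_termDeriv_le h.2 ha t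
  have e : D.decay σ x ^ D.r = D.scale σ x ^ (-(D.pStar - D.r)) + D.scale σ x ^ (-(D.q - D.r)) := by
    rw [decay, ← Real.rpow_mul (by positivity), one_div_mul_cancel (by linarith), Real.rpow_one]
  set A := D.scale σ x ^ (-(D.pStar - D.r)) with hA
  set B := D.scale σ x ^ (-(D.q - D.r)) with hB
  have hA0 : 0 ≤ A := by positivity
  have hB0 : 0 ≤ B := by positivity
  set C₁ := (D.r + 2 * (D.pStar - D.r)) * 2 ^ (D.pStar - D.r) with hC₁
  set C₂ := (D.r + 2 * (D.q - D.r)) * 2 ^ (D.q - D.r) with hC₂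
  have hC₁0 : 0 ≤ C₁ := mul_nonneg (by linarith) (by positivity)
  have hC₂0 : 0 ≤ C₂ := mul_nonneg (by linarith) (by positivity)
  have ht : 0 ≤ |t| ^ (D.r - 1) := by positivity
  rw [e, growthConst, f]
  calc _ ≤ 1 / D.pStar * (C₁ * A * |t| ^ (D.r - 1)) + D.μ / D.q * (C₂ * B * |t| ^ (D.r - 1)) := by
        refine (abs_add_le _ _).trans (add_le_add ?_ ?_)
        · rw [abs_mul, abs_of_pos hc.1]
          exact mul_le_mul_of_nonneg_left h1 hc.1.le
        · rw [abs_mul, abs_of_pos hc.2]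
          exact mul_le_mul_of_nonneg_left h2 hc.2.le
    _ ≤ 1 / D.pStar * (C₁ * (A + B) * |t| ^ (D.r - 1)) +
        D.μ / D.q * (C₂ * (A + B) * |t| ^ (D.r - 1)) := by
        have := hc.1.le
        have := hc.2.le
        gcongr
        · linarith
        · linarith
    _ = _ := by ring

include hσ in
theorem continuous_F : Continuous fun z : RN N × ℝ => D.F σ z.1 z.2 := by
  simp_rw [D.F_eq hσ]
  have ha : Continuous fun z : RN N × ℝ => D.scale σ z.1 := (D.continuous_scale σ).comp continuous_fst
  have h : ∀ κ, 0 < κ → Continuous fun z : RN N × ℝ => D.term κ (D.scale σ z.1) z.2 := fun κ hκ =>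
    (ha.rpow_const fun z => Or.inl (D.scale_pos hσ z.1).ne').mul
      ((continuous_iff_continuousAt.2 fun s =>
        (D.isTruncation.hasDerivAt_pow D.one_lt_r hκ s).continuousAt).comp (ha.mul continuous_snd))
  exact (continuous_const.mul (h _ D.exponents_pos.1)).add
    (continuous_const.mul (h _ D.exponents_pos.2))

include hσ in
theorem continuous_f : Continuous fun z : RN N × ℝ => D.f σ z.1 z.2 := by
  simp_rw [f]
  have ha : Continuous fun z : RN N × ℝ => D.scale σ z.1 := (D.continuous_scale σ).comp continuous_fst
  have h : ∀ κ, 0 < κ → Continuous fun z : RN N × ℝ => D.termDeriv κ (D.scale σ z.1) z.2 :=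
    fun κ hκ => (ha.rpow_const fun z => Or.inl (D.scale_pos hσ z.1).ne').mul
      (((D.isTruncation.continuous_powDeriv D.one_lt_r hκ).comp (ha.mul continuous_snd)).mul ha)
  exact (continuous_const.mul (h _ D.exponents_pos.1)).add
    (continuous_const.mul (h _ D.exponents_pos.2))

-- Writing `s = decay * t` moves the weight into the argument: the factors `decay ^ r`, `decay ^
-- (-(r - 1))` and `decay ^ (-1)` cancel, and the growth in `s` is uniform in `x`. Thus `Φ` becomes
-- a smooth functional on `L^r` evaluated at `decay * u`.
include hσ in
theorem nemytskii : Nemytskii volume D.r D.growthConst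
    (fun x s => D.F σ x (s / D.decay σ x))
    (fun x s => ContinuousLinearMap.toSpanSingleton ℝ (D.f σ x (s / D.decay σ x) / D.decay σ x)) := by
  have hdiv : Continuous fun z : RN N × ℝ => (z.1, z.2 / D.decay σ z.1) :=
    continuous_fst.prodMk (continuous_snd.div ((D.continuous_decay hσ).comp continuous_fst)
      fun z => (D.decay_pos hσ z.1).ne')
  refine Nemytskii.of_hasDerivAt (g := fun x s => D.f σ x (s / D.decay σ x) / D.decay σ x)
    D.one_lt_r D.growthConst_nonneg (fun x s => ?_) (fun x s => ?_)
    (fun x => ?_) ((D.continuous_F hσ).comp hdiv) (((D.continuous_f hσ).comp hdiv).div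
      ((D.continuous_decay hσ).comp continuous_fst) fun z => (D.decay_pos hσ z.1).ne')
  · have h1 : HasDerivAt (fun s => s / D.decay σ x) (1 / D.decay σ x) s :=
      (hasDerivAt_id s).div_const _
    exact ((D.hasDerivAt_F hσ x (s / D.decay σ x)).comp s h1).congr_deriv (mul_one_div _ _)
  · have hk := D.decay_pos hσ x
    rw [abs_div, abs_of_pos hk, div_le_iff₀ hk]
    have h1 := D.abs_f_le hσ x (s / D.decay σ x)
    rw [abs_div, abs_of_pos hk, Real.div_rpow (abs_nonneg _) hk.le] at h1
    refine h1.trans_eq ?_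
    have e : D.decay σ x ^ D.r = D.decay σ x ^ (D.r - 1) * D.decay σ x := by
      rw [← Real.rpow_add_one hk.ne', sub_add_cancel]
    have := (Real.rpow_pos_of_pos hk (D.r - 1)).ne'
    rw [e]
    field_simp
  · have h1 := D.mul_F_le hσ x 0
    have h2 := D.F_nonneg hσ x 0
    have h3 := D.one_lt_r
    rw [mul_zero] at h1
    rw [zero_div]
    nlinarith

end PLaplaceData

end

noncomputable section

/-! ### The functional as a difference -/

theorem Nemytskii.integrable_deriv_apply {α E : Type*} [MeasurableSpace α] [NormedAddCommGroup E]
    [NormedSpace ℝ E] {μ : Measure α} {s C : ℝ} {G : α → E → ℝ} {g : α → E → E →L[ℝ] ℝ}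
    (h : Nemytskii μ s C G g) {z w : α → E} (hz : MemLp z (ENNReal.ofReal s) μ)
    (hw : MemLp w (ENNReal.ofReal s) μ) : Integrable (fun x => g x (z x) (w x)) μ := by
  have hconj := h.holderConjugate.ennrealOfReal
  have h1 := (h.memLp_deriv hz).norm.integrable_mul hw.norm
  refine h1.mono' ((ContinuousLinearMap.id ℝ (E →L[ℝ] ℝ)).aestronglyMeasurable_comp₂
    (h.measurable_deriv _ hz.1) hw.1) (Filter.Eventually.of_forall fun x => ?_)
  exact ContinuousLinearMap.le_opNorm _ _

/-- By the chain rule the derivative of the composition with `ι` is `d (ι u)` composed with `ι`, so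
it depends on `u` through `ι u` only. -/
theorem ConvexSplit.exists_split {α X : Type*} [MeasurableSpace α] [NormedAddCommGroup X]
    [NormedSpace ℝ X] {μ : Measure α} {p r C : ℝ} [Fact (1 ≤ ENNReal.ofReal r)] {J : X → ℝ}
    {G : α → ℝ → ℝ} {g : α → ℝ → ℝ →L[ℝ] ℝ} (h : Nemytskii μ r C G g) (uc : UniformlyConvex p J)
    {ι : X →L[ℝ] Lp ℝ (ENNReal.ofReal r) μ} (hι : IsCompactOperator ι)
    (heven : ∀ x s, G x (-s) = G x s) (hodd : ∀ x s, g x (-s) = - g x s)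
    (hsup : ∀ x s, r * G x s ≤ g x s s)
    (hsc : ∃ s > 0, ∃ c > 0, ∃ K, ∀ u, c * ‖u‖ ^ p - K ≤ (1 + s * r) * J u - J ((1 + s) • u)) :
    ∃ (dΦ : X → X →L[ℝ] ℝ) (Ψ : Lp ℝ (ENNReal.ofReal r) μ → X →L[ℝ] ℝ),
      Split p r J (fun u => ∫ x, G x (ι u x) ∂μ) dΦ ι Ψ ∧
        ∀ u w, dΦ u w = ∫ x, g x (ι u x) (ι w x) ∂μ := by
  refine h.exists_hasFDerivAt.elim fun d ⟨hdc, hd, hdd⟩ => ?_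
  have hneg : ∀ z : Lp ℝ (ENNReal.ofReal r) μ, ∀ᵐ x ∂μ, (-z : Lp ℝ (ENNReal.ofReal r) μ) x = -z x :=
    fun z => Lp.coeFn_neg z
  refine ⟨fun u => (d (ι u)).comp ι, fun z => (d z).comp ι, ⟨uc, fun u => ?_, fun u => ?_,
    fun u => ?_, hι, hdc.clm_comp continuous_const, fun u => rfl, fun u => ?_,
    by linarith [h.one_lt], hsc⟩, fun u w => hd _ _⟩
  · exact (hdd (ι u)).comp u ι.hasFDerivAt
  · refine integral_congr_ae ?_
    rw [map_neg]
    filter_upwards [hneg (ι u)] with x hx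
    rw [hx, heven]
  · ext w
    change d (ι (-u)) (ι w) = - d (ι u) (ι w)
    rw [map_neg, hd, hd, ← integral_neg]
    refine integral_congr_ae ?_
    filter_upwards [hneg (ι u)] with x hx
    rw [hx, hodd]
    rfl
  · change r * ∫ x, G x (ι u x) ∂μ ≤ d (ι u) (ι u)
    rw [hd, ← integral_const_mul]
    exact integral_mono ((h.integrable (Lp.memLp _)).const_mul _)
      (h.integrable_deriv_apply (Lp.memLp _) (Lp.memLp _)) fun x => hsup x _

namespace PLaplaceData

open Filter Topology

variable {N : ℕ} (D : PLaplaceData N) {ε : ℝ}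

theorem bddWeight_V (hV : D.V1) : ∃ c b : ℝ, 0 < c ∧ (∀ x, c ≤ D.V (ε • x)) ∧
    BddWeight (volume : Measure (RN N)) (fun x => D.V (ε • x)) b := by
  obtain ⟨hc, a, b, ha, -, hab⟩ := hV
  exact ⟨a, b, ha, fun x => (hab _).1,
    (hc.continuous.comp (continuous_const_smul ε)).aestronglyMeasurable,
    fun x => ha.le.trans (hab _).1, fun x => (hab _).2⟩

theorem isOpen_dilated (hM : IsOpen D.M) (ε : ℝ) : IsOpen (D.dilated ε) :=
  hM.preimage (continuous_const_smul ε)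

theorem bddWeight_ξ (hM : IsOpen D.M) (hε : 0 < ε) :
    BddWeight (volume : Measure (RN N)) (D.ξ ε) (ε ^ (-D.γ)) := by
  classical
  have h0 : 0 ≤ ε ^ (-D.γ) := by positivity
  refine ⟨Measurable.aestronglyMeasurable (Measurable.ite (D.isOpen_dilated hM ε).measurableSet
    measurable_const (continuous_const.mul (D.ζ_C1.continuous.comp
      (Metric.continuous_infDist_pt _))).measurable), fun x => ?_, fun x => ?_⟩ <;>
  rw [ξ] <;> split_ifs
  · exact le_rfl
  · exact mul_nonneg h0 (D.ζ_mem _).1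
  · exact h0
  · exact mul_le_of_le_one_right h0 (D.ζ_mem _).2

/-- The convex part of `I_ε`. -/
def J (ε : ℝ) : D.W → ℝ :=
  energy volume D.p D.β (fun x => D.V (ε • x)) (D.ξ ε) (Sobolev.sndL N (ENNReal.ofReal D.p))
    (Sobolev.fstL N (ENNReal.ofReal D.p))

theorem norm_rpow_W (u : D.W) : ‖u‖ ^ D.p =
    ‖Sobolev.fstL N (ENNReal.ofReal D.p) u‖ ^ D.p +
      ‖Sobolev.sndL N (ENNReal.ofReal D.p) u‖ ^ D.p := by
  have h := Sobolev.norm_rpow ENNReal.ofReal_ne_top u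
  rwa [ENNReal.toReal_ofReal (by linarith [D.one_lt_p])] at h

theorem I_eq (hV : D.V1) (u : D.W) : D.I ε u = D.J ε u - ∫ x, D.F ε x (D.val u x) := by
  obtain ⟨c, b, -, -, hb⟩ := D.bddWeight_V (ε := ε) hV
  have h1 := BddWeight.one.integrable D.one_lt_p (Sobolev.sndL N (ENNReal.ofReal D.p) u)
  have h2 := hb.integrable D.one_lt_p (Sobolev.fstL N (ENNReal.ofReal D.p) u)
  have h3 := integral_add h1 h2
  simp only [one_mul] at h3
  rw [I, J, energy, powInt, powInt, powInt, penalty]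
  simp only [one_mul]
  rw [← h3]
  rfl

theorem uniformlyConvex_J (hV : D.V1) (hM : IsOpen D.M) (hε : 0 < ε) :
    ConvexSplit.UniformlyConvex D.p (D.J ε) := by
  obtain ⟨c, b, hc, hcV, hb⟩ := D.bddWeight_V (ε := ε) hV
  exact uniformlyConvex_energy D.one_lt_p D.one_lt_β hc hb hcV (D.bddWeight_ξ hM hε) D.norm_rpow_W

theorem exists_hasFDerivAt_J (hV : D.V1) (hM : IsOpen D.M) (hε : 0 < ε) (u : D.W) :
    ∃ l : D.W →L[ℝ] ℝ, HasFDerivAt (D.J ε) l u := by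
  obtain ⟨c, b, hc, hcV, hb⟩ := D.bddWeight_V (ε := ε) hV
  exact exists_hasFDerivAt_energy D.one_lt_p D.one_lt_β hb (D.bddWeight_ξ hM hε) u

theorem J_scaling (hV : D.V1) : ∃ s > 0, ∃ c > 0, ∃ K, ∀ u : D.W,
    c * ‖u‖ ^ D.p - K ≤ (1 + s * D.r) * D.J ε u - D.J ε ((1 + s) • u) := by
  obtain ⟨c, b, hc, hcV, hb⟩ := D.bddWeight_V (ε := ε) hV
  have hp := D.one_lt_p
  have h := D.β_lt
  rw [lt_div_iff₀ (by linarith), mul_comm] at h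
  exact energy_scaling hp D.one_lt_β h hc hb hcV D.norm_rpow_W

theorem exists_weighted_embedding (hM : IsSmoothBoundedDomain D.M) (hε : 0 < ε) :
    ∃ ι : D.W →L[ℝ] Lp ℝ (ENNReal.ofReal D.r) (volume : Measure (RN N)), IsCompactOperator ι ∧
      ∀ u : D.W, ∀ᵐ x, ι u x / D.decay ε x = D.val u x := by
  refine (Sobolev.exists_compact_embedding (N := N) D.one_lt_p D.p_lt_N D.p_lt_r.le D.r_lt_pStar
    (D.continuous_decay hε) (fun x => by
      rw [abs_of_pos (D.decay_pos hε x)]; exact D.decay_le hε x)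
    (D.tendsto_decay hε hM.isConnected.nonempty hM.isBounded)).imp fun ι hι =>
      ⟨hι.1, fun u => (hι.2 u).mono fun x hx => ?_⟩
  rw [hx, mul_div_cancel_left₀ _ (D.decay_pos hε x).ne']
  rfl

theorem integral_F_eq {z v : RN N → ℝ} (h : ∀ᵐ x, z x / D.decay ε x = v x) :
    ∫ x, D.F ε x (z x / D.decay ε x) = ∫ x, D.F ε x (v x) :=
  integral_congr_ae (h.mono fun x hx => by
    change D.F ε x (z x / D.decay ε x) = D.F ε x (v x)
    rw [hx])

theorem integral_f_eq {z v z' v' : RN N → ℝ} (h : ∀ᵐ x, z x / D.decay ε x = v x)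
    (h' : ∀ᵐ x, z' x / D.decay ε x = v' x) :
    ∫ x, ContinuousLinearMap.toSpanSingleton ℝ (D.f ε x (z x / D.decay ε x) / D.decay ε x) (z' x) =
      ∫ x, D.f ε x (v x) * v' x := by
  refine integral_congr_ae (h.mp (h'.mono fun x h1 h2 => ?_))
  change z' x • (D.f ε x (z x / D.decay ε x) / D.decay ε x) = D.f ε x (v x) * v' x
  rw [smul_eq_mul, ← h1, ← h2]
  ring

theorem exists_split_weighted (hV : D.V1) (hM : IsOpen D.M) (hε : 0 < ε)
    {ι : D.W →L[ℝ] Lp ℝ (ENNReal.ofReal D.r) (volume : Measure (RN N))} (hι : IsCompactOperator ι) :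
    ∃ (dΦ : D.W → D.W →L[ℝ] ℝ)
      (Ψ : Lp ℝ (ENNReal.ofReal D.r) (volume : Measure (RN N)) → D.W →L[ℝ] ℝ),
      ConvexSplit.Split D.p D.r (D.J ε) (fun u => ∫ x, D.F ε x (ι u x / D.decay ε x)) dΦ ι Ψ ∧
        ∀ u w, dΦ u w = ∫ x, ContinuousLinearMap.toSpanSingleton ℝ
          (D.f ε x (ι u x / D.decay ε x) / D.decay ε x) (ι w x) := by
  refine ConvexSplit.exists_split (D.nemytskii hε) (D.uniformlyConvex_J hV hM hε) hι
    (fun x s => ?_) (fun x s => ?_) (fun x s => ?_) (D.J_scaling hV)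
  · rw [neg_div, D.F_neg hε]
  · rw [neg_div, D.f_neg, neg_div]
    ext
    simp
  · rw [ContinuousLinearMap.toSpanSingleton_apply, smul_eq_mul]
    refine (D.mul_F_le hε x _).trans_eq ?_
    ring

theorem exists_split (hV : D.V1) (hM : IsSmoothBoundedDomain D.M) (hε : 0 < ε) :
    ∃ (ι : D.W →L[ℝ] Lp ℝ (ENNReal.ofReal D.r) (volume : Measure (RN N))) (dΦ : D.W → D.W →L[ℝ] ℝ)
      (Ψ : Lp ℝ (ENNReal.ofReal D.r) (volume : Measure (RN N)) → D.W →L[ℝ] ℝ),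
      ConvexSplit.Split D.p D.r (D.J ε) (fun u => ∫ x, D.F ε x (D.val u x)) dΦ ι Ψ ∧
        ∀ u w, dΦ u w = ∫ x, D.f ε x (D.val u x) * D.val w x := by
  refine (D.exists_weighted_embedding hM hε).imp fun ι hι => ?_
  refine (D.exists_split_weighted hV hM.isOpen hε hι.1).imp fun dΦ h => h.imp fun Ψ h => ?_
  rw [show (fun u : D.W => ∫ x, D.F ε x (D.val u x)) =
    fun u => ∫ x, D.F ε x (ι u x / D.decay ε x) from funext fun u => (D.integral_F_eq (hι.2 u)).symm]
  exact ⟨h.1, fun u w => (h.2 u w).trans (D.integral_f_eq (hι.2 u) (hι.2 w))⟩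

end PLaplaceData

end

noncomputable section

/-! ### Invariance of the neighbourhoods of the cone -/

theorem integral_rpow_sub_one_mul_le {α : Type*} [MeasurableSpace α] {μ : Measure α} {r A B : ℝ}
    (hr : 1 < r) {a b : α → ℝ} (ha0 : ∀ x, 0 ≤ a x) (hb0 : ∀ x, 0 ≤ b x)
    (ha : MemLp a (ENNReal.ofReal r) μ) (hb : MemLp b (ENNReal.ofReal r) μ) (hA0 : 0 ≤ A)
    (hB0 : 0 ≤ B) (hA : ∫ x, a x ^ r ∂μ ≤ A ^ r) (hB : ∫ x, b x ^ r ∂μ ≤ B ^ r) :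
    Integrable (fun x => a x ^ (r - 1) * b x) μ ∧
      ∫ x, a x ^ (r - 1) * b x ∂μ ≤ A ^ (r - 1) * B := by
  have hr1 : 0 < r - 1 := by linarith
  have hconj : (r / (r - 1)).HolderConjugate r := (Real.HolderConjugate.conjExponent hr).symm
  have h1 := ha.norm_rpow_div (ENNReal.ofReal (r - 1))
  rw [ENNReal.toReal_ofReal hr1.le, ← ENNReal.ofReal_div_of_pos hr1] at h1
  simp_rw [fun x => Real.norm_of_nonneg (ha0 x)] at h1
  have := hconj.ennrealOfReal
  refine ⟨h1.integrable_mul hb, ?_⟩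
  refine (integral_mul_le_Lp_mul_Lq_of_nonneg hconj
    (Filter.Eventually.of_forall fun x => Real.rpow_nonneg (ha0 x) _)
    (Filter.Eventually.of_forall hb0) h1 hb).trans ?_
  have e1 : ∀ x, (a x ^ (r - 1)) ^ (r / (r - 1)) = a x ^ r := fun x => by
    rw [← Real.rpow_mul (ha0 x), mul_div_cancel₀ _ hr1.ne']
  simp_rw [e1]
  have e2 : A ^ (r - 1) = (A ^ r) ^ (1 / (r / (r - 1))) := by
    rw [← Real.rpow_mul hA0]
    congr 1
    field_simp
  have e3 : B = (B ^ r) ^ (1 / r) := by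
    rw [← Real.rpow_mul hB0, mul_one_div_cancel (by linarith), Real.rpow_one]
  have i1 : 0 ≤ ∫ x, a x ^ r ∂μ := integral_nonneg fun x => Real.rpow_nonneg (ha0 x) _
  have i2 : 0 ≤ ∫ x, b x ^ r ∂μ := integral_nonneg fun x => Real.rpow_nonneg (hb0 x) _
  calc _ ≤ (A ^ r) ^ (1 / (r / (r - 1))) * (B ^ r) ^ (1 / r) := by gcongr
    _ = _ := by rw [← e2, ← e3]

/-- Almost everywhere one of `y` and `z - y` vanishes, so the powers add without error. -/
theorem BddWeight.powInt_split {α E : Type*} [MeasurableSpace α] [NormedAddCommGroup E]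
    [InnerProductSpace ℝ E] {μ : Measure α} {w : α → ℝ} {b p : ℝ} (h : BddWeight μ w b)
    (hp : 1 < p) {y z : Lp E (ENNReal.ofReal p) μ} (hyz : ∀ᵐ x ∂μ, y x = z x ∨ y x = 0) :
    powInt μ w p z = powInt μ w p y + powInt μ w p (z - y) := by
  rw [powInt, powInt, powInt, ← integral_add (h.integrable hp y) (h.integrable hp _)]
  refine integral_congr_ae ?_
  filter_upwards [hyz, Lp.coeFn_sub z y] with x hx h2
  rw [h2, Pi.sub_apply]
  have h0 : (0 : ℝ) ^ p = 0 := Real.zero_rpow (by linarith)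
  rcases hx with e | e <;> rw [e] <;> simp [h0]

/-- The `p`-integrals of `u` split exactly into those of `w` and `u - w`, and the penalty is
monotone. What is lost in passing to `w` is at least the coercive part of `u - w`. -/
theorem energy_add_le_of_split {α E X : Type*} [MeasurableSpace α] [NormedAddCommGroup E]
    [InnerProductSpace ℝ E] [NormedAddCommGroup X] [NormedSpace ℝ X] {μ : Measure α} {p β : ℝ}
    [Fact (1 ≤ ENNReal.ofReal p)] {V ξ : α → ℝ} {bV bξ : ℝ}
    {A : X →L[ℝ] Lp E (ENNReal.ofReal p) μ} {B : X →L[ℝ] Lp ℝ (ENNReal.ofReal p) μ}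
    (hp : 1 < p) (hβ : 1 < β) {c : ℝ} (hV : BddWeight μ V bV) (hc : ∀ x, c ≤ V x)
    (hξ : BddWeight μ ξ bξ) (hn : ∀ u, ‖u‖ ^ p = ‖B u‖ ^ p + ‖A u‖ ^ p) {u w : X}
    (hA : ∀ᵐ x ∂μ, A w x = A u x ∨ A w x = 0) (hB : ∀ᵐ x ∂μ, B w x = B u x ∨ B w x = 0) :
    energy μ p β V ξ A B w + 1 / p * min 1 c * ‖u - w‖ ^ p ≤ energy μ p β V ξ A B u := by
  have h1 := le_energy (A := A) (B := B) hp hV hc hn (u - w)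
  have e1 := (BddWeight.one (μ := μ)).powInt_split hp hA
  have e2 := hV.powInt_split hp hB
  have e3 := hξ.powInt_split hp hB
  rw [← map_sub] at e1 e2 e3
  have h3 := max_zero_rpow_mono hβ (e3.symm ▸ le_add_of_nonneg_right (hξ.powInt_nonneg _) :
    powInt μ ξ p (B w) ≤ powInt μ ξ p (B u))
  rw [energy, energy, e1, e2]
  have h4 := mul_le_mul_of_nonneg_left h1 (show (0 : ℝ) ≤ 1 / p by positivity)
  have h5 := mul_le_mul_of_nonneg_left h3 (show (0 : ℝ) ≤ 1 / (p * β) by positivity)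
  simp only at h5
  linarith

namespace PLaplaceData

open Filter Topology

variable {N : ℕ} (D : PLaplaceData N) {ε : ℝ}

theorem val_sub (u v : D.W) : ∀ᵐ x, D.val (u - v) x = D.val u x - D.val v x :=
  Lp.coeFn_sub u.1.fst v.1.fst

theorem val_add (u v : D.W) : ∀ᵐ x, D.val (u + v) x = D.val u x + D.val v x :=
  Lp.coeFn_add u.1.fst v.1.fst

theorem val_neg (u : D.W) : ∀ᵐ x, D.val (-u) x = - D.val u x := Lp.coeFn_neg u.1.fst

theorem val_smul (c : ℝ) (u : D.W) : ∀ᵐ x, D.val (c • u) x = c * D.val u x :=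
  Lp.coeFn_smul c u.1.fst

theorem zero_mem_P : (0 : D.W) ∈ D.P :=
  (Lp.coeFn_zero ℝ (ENNReal.ofReal D.p) (volume : Measure (RN N))).mono fun x hx => by
    change 0 ≤ (0 : Lp ℝ (ENNReal.ofReal D.p) (volume : Measure (RN N))) x
    rw [hx]; exact le_rfl

theorem convex_P : Convex ℝ D.P := by
  intro u hu v hv a b ha hb _
  have hu' : ∀ᵐ x, 0 ≤ D.val u x := hu
  have hv' : ∀ᵐ x, 0 ≤ D.val v x := hv
  change ∀ᵐ x, 0 ≤ D.val (a • u + b • v) x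
  filter_upwards [hu', hv', D.val_add (a • u) (b • v), D.val_smul a u, D.val_smul b v]
    with x h1 h2 h3 h4 h5
  rw [h3, h4, h5]
  positivity

theorem exists_posPart (v : D.W) : ∃ w ∈ D.P, (∀ᵐ x, D.val w x = max (D.val v x) 0) ∧
    ∀ᵐ x, D.grad w x = D.grad v x ∨ D.grad w x = 0 := by
  classical
  have h := Sobolev.isWeakGradient_posPart (Fact.out : 1 ≤ ENNReal.ofReal D.p)
    ENNReal.ofReal_ne_top v.2 (Lp.memLp v.1.fst) (Lp.memLp v.1.snd)
  have h1 := Sobolev.mk_fst h.1 h.2.1 h.2.2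
  refine ⟨Sobolev.mk h.1 h.2.1 h.2.2, h1.mono fun x hx => ?_, h1,
    (Sobolev.mk_snd h.1 h.2.1 h.2.2).mono fun x hx => ?_⟩
  · exact (le_max_right _ _).trans_eq hx.symm
  · by_cases hv : 0 < v.1.fst x
    · exact Or.inl (hx.trans (if_pos hv))
    · exact Or.inr (hx.trans (if_neg hv))

theorem exists_embedding : ∃ S : ℝ, 0 < S ∧ ∀ u : D.W,
    MemLp (D.val u) (ENNReal.ofReal D.r) volume ∧ ∫ x, |D.val u x| ^ D.r ≤ (S * ‖u‖) ^ D.r := by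
  have hr := D.one_lt_r
  refine (Sobolev.exists_embedding_const (N := N) D.one_lt_p.le D.p_lt_N D.p_lt_r.le
    D.r_lt_pStar).elim fun S hS => ⟨S + 1, by linarith [hS.1], fun u => ?_⟩
  have hS0 := hS.1
  have h1 : MemLp (D.val u) (ENNReal.ofReal D.r) volume :=
    ⟨Lp.aestronglyMeasurable u.1.fst, (hS.2 u).trans_lt ENNReal.ofReal_lt_top⟩
  refine ⟨h1, ?_⟩
  have h2 : eLpNorm (D.val u) (ENNReal.ofReal D.r) volume ≤ ENNReal.ofReal (S * ‖u‖) := hS.2 u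
  rw [h1.eLpNorm_eq_integral_rpow_norm (by simpa using (by linarith : 0 < D.r)) (by simp),
    ENNReal.toReal_ofReal (by linarith), ENNReal.ofReal_le_ofReal_iff (by positivity)] at h2
  have i0 : 0 ≤ ∫ x, |D.val u x| ^ D.r := integral_nonneg fun x => by positivity
  calc ∫ x, |D.val u x| ^ D.r = ((∫ x, ‖D.val u x‖ ^ D.r) ^ D.r⁻¹) ^ D.r := by
        simp_rw [Real.norm_eq_abs]
        rw [← Real.rpow_mul i0, inv_mul_cancel₀ (by linarith), Real.rpow_one]
    _ ≤ (S * ‖u‖) ^ D.r := by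
        refine Real.rpow_le_rpow (Real.rpow_nonneg ?_ _) h2 (by linarith)
        exact integral_nonneg fun x => by positivity
    _ ≤ _ := by
        have := norm_nonneg u
        gcongr
        linarith

theorem memLp_negPart {S : ℝ} (hS : ∀ u : D.W, MemLp (D.val u) (ENNReal.ofReal D.r) volume ∧
    ∫ x, |D.val u x| ^ D.r ≤ (S * ‖u‖) ^ D.r) (u : D.W) :
    MemLp (fun x => max (-D.val u x) 0) (ENNReal.ofReal D.r) volume :=
  (hS u).1.neg.pos_part

theorem integrable_rpow_of_memLp {g : RN N → ℝ} (hg : MemLp g (ENNReal.ofReal D.r) volume) :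
    Integrable fun x => |g x| ^ D.r := by
  have hr := D.one_lt_r
  have h := hg.integrable_norm_rpow (by simp; linarith) (by simp)
  rwa [ENNReal.toReal_ofReal (by linarith)] at h

/-- For nonnegative `w` the negative part of `u` is at most `|u - w|` pointwise. Apply the embedding
to `u - w` with `w` almost nearest, and let the error `e` tend to zero. -/
theorem integral_negPart_le {S : ℝ} (hS0 : 0 < S)
    (hS : ∀ u : D.W, MemLp (D.val u) (ENNReal.ofReal D.r) volume ∧
      ∫ x, |D.val u x| ^ D.r ≤ (S * ‖u‖) ^ D.r) (u : D.W) :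
    ∫ x, (max (-D.val u x) 0) ^ D.r ≤ (S * Metric.infDist u D.P) ^ D.r := by
  have hr := D.one_lt_r
  have hlim : Tendsto (fun e : ℝ => (S * (Metric.infDist u D.P + e)) ^ D.r) (𝓝[>] 0)
      (𝓝 ((S * (Metric.infDist u D.P + 0)) ^ D.r)) := by
    refine Tendsto.mono_left ?_ nhdsWithin_le_nhds
    exact (Continuous.rpow_const (by fun_prop) fun _ => Or.inr (by linarith)).tendsto 0
  rw [add_zero] at hlim
  refine ge_of_tendsto hlim (eventually_nhdsWithin_of_forall fun e he => ?_)
  obtain ⟨w, hw, hd⟩ := (Metric.infDist_lt_iff ⟨0, D.zero_mem_P⟩).1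
    (lt_add_of_pos_right (Metric.infDist u D.P) he)
  rw [dist_eq_norm] at hd
  have hw' : ∀ᵐ x, 0 ≤ D.val w x := hw
  calc ∫ x, (max (-D.val u x) 0) ^ D.r ≤ ∫ x, |D.val (u - w) x| ^ D.r := by
        refine integral_mono_of_nonneg (Eventually.of_forall fun x => ?_)
          (D.integrable_rpow_of_memLp (hS (u - w)).1) ?_
        · have : 0 ≤ max (-D.val u x) 0 := le_max_right _ _
          change 0 ≤ (max (-D.val u x) 0) ^ D.r
          positivity
        · filter_upwards [hw', D.val_sub u w] with x h1 h2
          rw [h2]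
          refine Real.rpow_le_rpow (le_max_right _ _) (max_le ?_ (abs_nonneg _)) (by linarith)
          linarith [neg_abs_le (D.val u x - D.val w x)]
    _ ≤ (S * ‖u - w‖) ^ D.r := (hS (u - w)).2
    _ ≤ _ := Real.rpow_le_rpow (by positivity)
        (mul_le_mul_of_nonneg_left hd.le hS0.le) (by linarith)

theorem exists_abs_f_le (hε : 0 < ε) :
    ∃ C, 0 ≤ C ∧ ∀ x t, |D.f ε x t| ≤ C * |t| ^ (D.r - 1) := by
  have hr := D.one_lt_r
  set B := (ε ^ (-(D.pStar - D.r)) + ε ^ (-(D.q - D.r))) ^ (1 / D.r) with hB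
  have hB0 : 0 ≤ B := by positivity
  have hG := D.growthConst_nonneg
  refine ⟨D.growthConst * B ^ D.r, by positivity, fun x t => (D.abs_f_le hε x t).trans ?_⟩
  have := (D.decay_pos hε x).le
  have := D.decay_le hε x
  gcongr

theorem J_add_le_of_split (hV : D.V1) (hM : IsOpen D.M) (hε : 0 < ε) : ∃ c > 0, ∀ u w : D.W,
    (∀ᵐ x, D.grad w x = D.grad u x ∨ D.grad w x = 0) →
    (∀ᵐ x, D.val w x = D.val u x ∨ D.val w x = 0) →
    D.J ε w + c * ‖u - w‖ ^ D.p ≤ D.J ε u := by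
  obtain ⟨c, b, hc, hcV, hb⟩ := D.bddWeight_V (ε := ε) hV
  have hp := D.one_lt_p
  exact ⟨1 / D.p * min 1 c, by positivity, fun u w h1 h2 =>
    energy_add_le_of_split hp D.one_lt_β hb hcV (D.bddWeight_ξ hM hε) D.norm_rpow_W h1 h2⟩

/-- A function that is not integrable has integral zero by convention, so integrability of the
nonnegative majorant suffices. -/
theorem integral_le_of_le {α : Type*} [MeasurableSpace α] {μ : Measure α} {g h : α → ℝ}
    (hh : Integrable h μ) (h0 : ∀ x, 0 ≤ h x) (hgh : ∀ᵐ x ∂μ, g x ≤ h x) :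
    ∫ x, g x ∂μ ≤ ∫ x, h x ∂μ := by
  by_cases hg : Integrable g μ
  · exact integral_mono_ae hg hh hgh
  · rw [integral_undef hg]
    exact integral_nonneg h0

theorem exists_threshold {K r p : ℝ} (hK : 0 ≤ K) (hpr : p < r) {c : ℝ} (hc : 0 < c) :
    ∃ δ₀ > 0, ∀ δ, 0 < δ → δ < δ₀ → K * δ ^ r < c * δ ^ p := by
  refine ⟨(c / (K + 1)) ^ (1 / (r - p)), by positivity, fun δ hδ hlt => ?_⟩
  have hrp : 0 < r - p := by linarith
  have h1 : δ ^ (r - p) < c / (K + 1) := by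
    have := Real.rpow_lt_rpow hδ.le hlt hrp
    rwa [← Real.rpow_mul (by positivity), one_div_mul_cancel hrp.ne', Real.rpow_one] at this
  have h2 : δ ^ r = δ ^ (r - p) * δ ^ p := by
    rw [← Real.rpow_add hδ]; congr 1; ring
  have h3 : 0 < δ ^ p := by positivity
  have h4 : 0 < δ ^ (r - p) := by positivity
  rw [lt_div_iff₀ (by positivity)] at h1
  rw [h2, ← mul_assoc]
  refine mul_lt_mul_of_pos_right ?_ h3
  linarith

/-- Compare the minimizer `v` with its positive part `w`. The energy drops by at least `c * ‖v - w‖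
^ p`, whereas the linear term can compensate by at most a multiple of `dist(u, P) ^ (r - 1) * ‖v -
w‖`. Since `p < r`, for small `δ` this forces `‖v - w‖ < δ`. -/
theorem exists_infDist_lt_of_minimizer (hV : D.V1) (hM : IsOpen D.M) (hε : 0 < ε)
    {dΦ : D.W → D.W →L[ℝ] ℝ} (hd : ∀ u w, dΦ u w = ∫ x, D.f ε x (D.val u x) * D.val w x) :
    ∃ δ₀ > 0, ∀ δ, 0 < δ → δ < δ₀ → ∀ u v : D.W,
      (∀ w : D.W, D.J ε v - dΦ u v ≤ D.J ε w - dΦ u w) →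
      Metric.infDist u D.P < δ → Metric.infDist v D.P < δ := by
  obtain ⟨S, hS0, hS⟩ := D.exists_embedding
  obtain ⟨C, hC0, hC⟩ := D.exists_abs_f_le hε
  obtain ⟨c, hc, hJ⟩ := D.J_add_le_of_split hV hM hε
  have hr := D.one_lt_r
  have hp := D.one_lt_p
  have hrp := D.p_lt_r
  obtain ⟨δ₀, hδ₀, hth⟩ := exists_threshold (K := C * S ^ (D.r - 1) * S) (by positivity)
    (by linarith : D.p - 1 < D.r - 1) hc
  refine ⟨δ₀, hδ₀, fun δ hδ hlt u v hmin hu => ?_⟩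
  obtain ⟨w, hwP, hw, hgw⟩ := D.exists_posPart v
  have h1 := hJ v w hgw (hw.mono fun x hx => by
    rcases le_total (D.val v x) 0 with h | h
    · exact Or.inr (by rw [hx, max_eq_right h])
    · exact Or.inl (by rw [hx, max_eq_left h]))
  have h2 := hmin w
  -- Here `v - w ≤ 0` and `f` has the sign of `u`, so the integrand is nonpositive where `u ≥ 0` and
  -- only the negative part of `u` contributes. Hölder's inequality then brings in the distance of
  -- `u` to the cone.
  have h3 : dΦ u (v - w) ≤ C * ((S * Metric.infDist u D.P) ^ (D.r - 1) * (S * ‖v - w‖)) := by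
    have hb : MemLp (fun x => |D.val (v - w) x|) (ENNReal.ofReal D.r) volume :=
      (hS (v - w)).1.norm
    obtain ⟨i1, i2⟩ := integral_rpow_sub_one_mul_le hr (a := fun x => max (-D.val u x) 0)
      (fun x => le_max_right _ _) (fun x => abs_nonneg _) (D.memLp_negPart hS u) hb
      (mul_nonneg hS0.le Metric.infDist_nonneg) (by positivity) (D.integral_negPart_le hS0 hS u)
      (hS (v - w)).2
    rw [hd]
    refine (integral_le_of_le (i1.const_mul C) (fun x => ?_) ?_).trans
      ((integral_const_mul C _).trans_le (mul_le_mul_of_nonneg_left i2 hC0))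
    · have : 0 ≤ max (-D.val u x) 0 := le_max_right _ _
      positivity
    · filter_upwards [hw, D.val_sub v w] with x e1 e2
      have hneg : D.val (v - w) x ≤ 0 := by
        rw [e2, e1]; linarith [le_max_left (D.val v x) 0]
      rcases le_or_gt 0 (D.val u x) with h | h
      · have hf : 0 ≤ D.f ε x (D.val u x) := by
          rcases h.eq_or_lt with h0 | h0
          · have := hC x (D.val u x)
            rw [← h0, abs_zero, Real.zero_rpow (by linarith), mul_zero] at this
            rw [← h0, abs_nonpos_iff.1 this]
          · exact nonneg_of_mul_nonneg_left (D.f_mul_nonneg hε x _) h0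
        refine (mul_nonpos_of_nonneg_of_nonpos hf hneg).trans ?_
        have : 0 ≤ max (-D.val u x) 0 := le_max_right _ _
        positivity
      · have h5 := hC x (D.val u x)
        have h6 : |D.val u x| = max (-D.val u x) 0 := by
          rw [abs_of_neg h, max_eq_left (by linarith)]
        rw [h6] at h5
        calc _ ≤ |D.f ε x (D.val u x) * D.val (v - w) x| := le_abs_self _
          _ = |D.f ε x (D.val u x)| * |D.val (v - w) x| := abs_mul _ _
          _ ≤ C * (max (-D.val u x) 0) ^ (D.r - 1) * |D.val (v - w) x| := by gcongr
          _ = _ := mul_assoc _ _ _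
  rw [map_sub] at h3
  set y := ‖v - w‖ with hy
  have hy0 : 0 ≤ y := norm_nonneg _
  have hyd : Metric.infDist v D.P ≤ y := by
    rw [hy, ← dist_eq_norm]; exact Metric.infDist_le_dist_of_mem hwP
  refine hyd.trans_lt ?_
  -- If `‖v - w‖ ≥ δ`, dividing by this norm gives `c * δ ^ (p - 1)` at most a constant times `δ ^
  -- (r - 1)`, against the choice of `δ₀`.
  by_contra! hge
  have hypos : 0 < y := hδ.trans_le hge
  have h4 : c * y ^ D.p ≤ C * S ^ (D.r - 1) * S * δ ^ (D.r - 1) * y := by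
    calc c * y ^ D.p ≤ C * ((S * Metric.infDist u D.P) ^ (D.r - 1) * (S * y)) := by linarith
      _ ≤ C * ((S * δ) ^ (D.r - 1) * (S * y)) := by
          have := Metric.infDist_nonneg (x := u) (s := D.P)
          gcongr
      _ = _ := by rw [Real.mul_rpow hS0.le hδ.le]; ring
  have h5 : c * δ ^ (D.p - 1) * y ≤ c * y ^ D.p := by
    have : y ^ D.p = y ^ (D.p - 1) * y := by
      rw [← Real.rpow_add_one hypos.ne', sub_add_cancel]
    rw [this, ← mul_assoc]
    gcongr
  have h6 := hth δ hδ hlt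
  have h7 := mul_lt_mul_of_pos_right h6 hypos
  linarith

/-- The positive part of `u` is the negative part of `-u`, so `integral_negPart_le` applies to each
half. -/
theorem integral_abs_rpow_le {S : ℝ} (hS0 : 0 < S)
    (hS : ∀ u : D.W, MemLp (D.val u) (ENNReal.ofReal D.r) volume ∧
      ∫ x, |D.val u x| ^ D.r ≤ (S * ‖u‖) ^ D.r) (u : D.W) : ∫ x, |D.val u x| ^ D.r ≤
      (S * Metric.infDist u D.P) ^ D.r + (S * Metric.infDist (-u) D.P) ^ D.r := by
  have e1 := D.integral_negPart_le hS0 hS u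
  have e2 := D.integral_negPart_le hS0 hS (-u)
  have i1 := D.integrable_rpow_of_memLp (D.memLp_negPart hS u)
  have i2 := D.integrable_rpow_of_memLp (D.memLp_negPart hS (-u))
  have habs : ∀ v : D.W, ∀ x, |max (-D.val v x) 0| = max (-D.val v x) 0 := fun v x =>
    abs_of_nonneg (le_max_right _ _)
  simp_rw [habs] at i1 i2
  calc ∫ x, |D.val u x| ^ D.r
      ≤ ∫ x, ((max (-D.val u x) 0) ^ D.r + (max (-D.val (-u) x) 0) ^ D.r) := by
        refine integral_mono_ae (D.integrable_rpow_of_memLp (hS u).1) (i1.add i2) ?_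
        filter_upwards [D.val_neg u] with x hx
        change |D.val u x| ^ D.r ≤ (max (-D.val u x) 0) ^ D.r + (max (-D.val (-u) x) 0) ^ D.r
        rw [hx, neg_neg]
        have a1 : 0 ≤ max (-D.val u x) 0 := le_max_right _ _
        have a2 : 0 ≤ max (D.val u x) 0 := le_max_right _ _
        rcases le_total (D.val u x) 0 with h | h
        · rw [abs_of_nonpos h, max_eq_left (by linarith : 0 ≤ -D.val u x)]
          exact le_add_of_nonneg_right (by positivity)
        · rw [abs_of_nonneg h, max_eq_left h]
          exact le_add_of_nonneg_left (by positivity)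
    _ = _ := integral_add i1 i2
    _ ≤ _ := by linarith

theorem F_le_of_abs_f_le (hε : 0 < ε) {C : ℝ} (hC : ∀ x t, |D.f ε x t| ≤ C * |t| ^ (D.r - 1))
    (x : RN N) (t : ℝ) : D.F ε x t ≤ C * |t| ^ D.r := by
  have hr := D.one_lt_r
  have e1 := D.mul_F_le hε x t
  have e2 := D.F_nonneg hε x t
  have e3 : D.f ε x t * t ≤ C * |t| ^ D.r := by
    rcases eq_or_ne t 0 with h0 | h0
    · rw [h0, mul_zero, abs_zero, Real.zero_rpow (by linarith), mul_zero]
    · calc D.f ε x t * t ≤ |D.f ε x t| * |t| := (le_abs_self _).trans_eq (abs_mul _ _)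
        _ ≤ C * |t| ^ (D.r - 1) * |t| := by gcongr; exact hC x t
        _ = _ := by rw [mul_assoc, ← Real.rpow_add_one (abs_ne_zero.2 h0), sub_add_cancel]
  nlinarith

/-- As `0` belongs to the cone, the norm is at least `δ` and the energy at least `c * δ ^ p`. Both
parts of `u` are within `S * δ` of zero in `L^r`, so the nonlinear term is of the smaller order `δ ^
r`. -/
theorem exists_pos_on_boundary (hV : D.V1) (hM : IsOpen D.M) (hε : 0 < ε) :
    ∃ δ₀ > 0, ∀ δ, 0 < δ → δ < δ₀ → ∃ κ > 0, ∀ u : D.W,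
      Metric.infDist u D.P = δ → Metric.infDist (-u) D.P = δ →
      κ ≤ D.J ε u - ∫ x, D.F ε x (D.val u x) := by
  obtain ⟨S, hS0, hS⟩ := D.exists_embedding
  obtain ⟨C, hC0, hC⟩ := D.exists_abs_f_le hε
  obtain ⟨c, hc, hJ⟩ := (D.uniformlyConvex_J hV hM hε).coercive
  have hr := D.one_lt_r
  have hp := D.one_lt_p
  obtain ⟨δ₀, hδ₀, hth⟩ := exists_threshold (K := C * (2 * S ^ D.r)) (by positivity) D.p_lt_r hc
  refine ⟨δ₀, hδ₀, fun δ hδ hlt => ⟨c * δ ^ D.p - C * (2 * S ^ D.r) * δ ^ D.r,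
    sub_pos.2 (hth δ hδ hlt), fun u h1 h2 => ?_⟩⟩
  have h3 : δ ≤ ‖u‖ := by
    rw [← h1, ← dist_zero_right]
    exact Metric.infDist_le_dist_of_mem D.zero_mem_P
  have h4 : c * δ ^ D.p ≤ D.J ε u := le_trans (by gcongr) (hJ u)
  have h5 := D.integral_abs_rpow_le hS0 hS u
  rw [h1, h2] at h5
  have h6 : ∫ x, D.F ε x (D.val u x) ≤ C * ∫ x, |D.val u x| ^ D.r := by
    rw [← integral_const_mul]
    exact integral_le_of_le ((D.integrable_rpow_of_memLp (hS u).1).const_mul C)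
      (fun x => by positivity) (Eventually.of_forall fun x => D.F_le_of_abs_f_le hε hC x _)
  have h7 := mul_le_mul_of_nonneg_left h5 hC0
  rw [Real.mul_rpow hS0.le hδ.le] at h7
  linarith

end PLaplaceData

end

noncomputable section

/-! ### Finite-dimensional test spaces -/

/-- Beyond `Y` the term of higher order exceeds `(A + 1) * x ^ p`, which leaves `-x ^ p` to beat the
constant `C`. -/
theorem exists_rpow_bound {A B C p r : ℝ} (hA : 0 ≤ A) (hB : 0 < B) (hp : 0 < p) (hpr : p < r) :
    ∃ m X : ℝ, ∀ x, 0 ≤ x → A * x ^ p - B * x ^ r + C ≤ m ∧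
      (X ≤ x → A * x ^ p - B * x ^ r + C < 0) := by
  have hrp : 0 < r - p := by linarith
  set Y := ((A + 1) / B) ^ (1 / (r - p)) with hY
  have hY0 : 0 < Y := by positivity
  have key : ∀ x, Y ≤ x → A * x ^ p - B * x ^ r ≤ - x ^ p := by
    intro x hx
    have hx0 : 0 < x := hY0.trans_le hx
    have h1 : (A + 1) / B ≤ x ^ (r - p) := by
      have := Real.rpow_le_rpow hY0.le hx hrp.le
      rwa [hY, ← Real.rpow_mul (by positivity), one_div_mul_cancel hrp.ne', Real.rpow_one] at this
    have h2 : x ^ r = x ^ (r - p) * x ^ p := by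
      rw [← Real.rpow_add hx0]; congr 1; ring
    rw [div_le_iff₀ hB] at h1
    have h3 : 0 ≤ x ^ p := by positivity
    rw [h2]
    nlinarith [mul_le_mul_of_nonneg_right h1 h3]
  refine ⟨A * Y ^ p + C, max Y ((|C| + 1) ^ (1 / p)), fun x hx => ⟨?_, fun h => ?_⟩⟩
  · rcases le_total Y x with h | h
    · have h1 := key x h
      have h2 : 0 ≤ x ^ p := by positivity
      have h3 : 0 ≤ A * Y ^ p := by positivity
      linarith
    · have h1 : A * x ^ p ≤ A * Y ^ p := by gcongr
      have h2 : 0 ≤ B * x ^ r := by positivity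
      linarith
  · have h1 := key x ((le_max_left _ _).trans h)
    have h2 := Real.rpow_le_rpow (by positivity) ((le_max_right _ _).trans h) hp.le
    rw [← Real.rpow_mul (by positivity), one_div_mul_cancel hp.ne', Real.rpow_one] at h2
    linarith [le_abs_self C]

section Bumps

variable {E : Type*} [NormedAddCommGroup E] [NormedSpace ℝ E] [FiniteDimensional ℝ E]

/-- Each bump is supported in the ball away from the other centres, so evaluation at the centres
recovers the coefficients of a linear combination. -/
theorem exists_bumps [Nontrivial E] {ρ : ℝ} (hρ : 0 < ρ) (n : ℕ) :
    ∃ (e : Fin n → E → ℝ) (c : Fin n → E), (∀ i, ContDiff ℝ ∞ (e i)) ∧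
      (∀ i, HasCompactSupport (e i)) ∧ (∀ i x, ρ ≤ ‖x‖ → e i x = 0) ∧
      ∀ i k, e i (c k) = if i = k then 1 else 0 := by
  have hinf : (Metric.ball (0 : E) ρ).Infinite := infinite_of_mem_nhds 0 (Metric.ball_mem_nhds 0 hρ)
  set c : Fin n → E := fun i => hinf.natEmbedding _ i with hc
  have hcinj : Function.Injective c := fun i k h =>
    Fin.val_injective ((hinf.natEmbedding _).injective (Subtype.val_injective h))
  have hex : ∀ i, ∃ f : E → ℝ, tsupport f ⊆ Metric.ball 0 ρ \ (c '' {i}ᶜ) ∧ HasCompactSupport f ∧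
      ContDiff ℝ ∞ f ∧ f (c i) = 1 := by
    intro i
    have hopen : IsOpen (Metric.ball (0 : E) ρ \ (c '' {i}ᶜ)) :=
      Metric.isOpen_ball.sdiff (Set.toFinite _).isClosed
    have hmem : c i ∈ Metric.ball (0 : E) ρ \ (c '' {i}ᶜ) := by
      refine ⟨(hinf.natEmbedding _ i).2, ?_⟩
      rintro ⟨k, hk, h⟩
      exact hk (hcinj h)
    obtain ⟨f, h1, h2, h3, -, h5⟩ := exists_contDiff_tsupport_subset (n := ⊤) (hopen.mem_nhds hmem)
    exact ⟨f, h1, h2, h3, h5⟩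
  choose e h1 h2 h3 h4 using hex
  refine ⟨e, c, h3, h2, fun i x hx => ?_, fun i k => ?_⟩
  · refine image_eq_zero_of_notMem_tsupport fun h => ?_
    have := (h1 i h).1
    rw [mem_ball_zero_iff] at this
    linarith
  · split_ifs with h
    · rw [← h, h4]
    · exact image_eq_zero_of_notMem_tsupport fun hk => (h1 i hk).2 ⟨k, fun h' => h h'.symm, rfl⟩

/-- The map from coefficients to `L^r` is linear and injective on a finite-dimensional space, hence
bounded below. -/
theorem exists_mul_norm_rpow_le_integral [MeasurableSpace E] [BorelSpace E] {μ : Measure E}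
    [μ.IsOpenPosMeasure] [IsFiniteMeasureOnCompacts μ] {n : ℕ} {r : ℝ} (hr : 1 < r)
    {e : Fin n → E → ℝ} {c : Fin n → E} (h1 : ∀ i, Continuous (e i))
    (h2 : ∀ i, HasCompactSupport (e i)) (h3 : ∀ i k, e i (c k) = if i = k then 1 else 0) :
    ∃ κ > 0, ∀ a : Fin n → ℝ, κ * ‖a‖ ^ r ≤ ∫ x, |∑ i, a i * e i x| ^ r ∂μ := by
  have : Fact (1 ≤ ENNReal.ofReal r) := ⟨by rw [ENNReal.one_le_ofReal]; exact hr.le⟩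
  have hm : ∀ i, MemLp (e i) (ENNReal.ofReal r) μ := fun i => (h1 i).memLp_of_hasCompactSupport (h2 i)
  set T : (Fin n → ℝ) →ₗ[ℝ] Lp ℝ (ENNReal.ofReal r) μ :=
    ∑ i, (LinearMap.proj i).smulRight ((hm i).toLp) with hT
  have hTa : ∀ a, T a = ∑ i, a i • (hm i).toLp := fun a => by
    simp [hT, LinearMap.sum_apply]
  have hTe : ∀ a, T a =ᵐ[μ] fun x => ∑ i, a i * e i x := fun a => by
    rw [hTa]
    refine (Lp.coeFn_finsetSum _ _).trans ?_
    have : ∀ᵐ x ∂μ, ∀ i, (a i • (hm i).toLp : Lp ℝ (ENNReal.ofReal r) μ) x = a i * e i x := by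
      refine ae_all_iff.2 fun i => ?_
      filter_upwards [Lp.coeFn_smul (a i) (hm i).toLp, (hm i).coeFn_toLp] with x e1 e2
      rw [e1, Pi.smul_apply, e2, smul_eq_mul]
    filter_upwards [this] with x hx
    simp [hx]
  have hker : LinearMap.ker T = ⊥ := by
    refine LinearMap.ker_eq_bot'.2 fun a ha => ?_
    have h4 : (fun x => ∑ i, a i * e i x) =ᵐ[μ] fun _ => 0 := by
      refine (hTe a).symm.trans ?_
      rw [ha]
      exact Lp.coeFn_zero _ _ _
    have h5 := (Continuous.ae_eq_iff_eq μ
      (continuous_finsetSum _ fun i _ => continuous_const.mul (h1 i)) continuous_const).1 h4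
    ext k
    have := congrFun h5 (c k)
    simpa [h3] using this
  obtain ⟨K, hK, hanti⟩ := T.exists_antilipschitzWith hker
  refine ⟨((K : ℝ) ^ r)⁻¹, by positivity, fun a => ?_⟩
  have h6 : ‖a‖ ≤ K * ‖T a‖ := by
    have := hanti.le_mul_dist a 0
    simpa using this
  have h7 : ‖T a‖ ^ r = ∫ x, |∑ i, a i * e i x| ^ r ∂μ := by
    rw [BddWeight.norm_rpow_eq hr, powInt]
    refine integral_congr_ae ((hTe a).mono fun x hx => ?_)
    simp only [hx, one_mul, Real.norm_eq_abs]
  rw [← h7, inv_mul_le_iff₀ (by positivity), ← Real.mul_rpow (by positivity) (norm_nonneg _)]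
  gcongr

end Bumps

namespace Sobolev

/-- Lebesgue measure is translation invariant, so the norm of the translate does not depend on `y`.
-/
theorem exists_translate_bound {N : ℕ} {p : ℝ} [Fact (1 ≤ ENNReal.ofReal p)] (hp : 1 < p)
    {e : RN N → ℝ} (he : ContDiff ℝ ∞ e) (hc : HasCompactSupport e) : ∃ K, 0 ≤ K ∧ ∀ y,
      ∃ u : sobolevSpace N (ENNReal.ofReal p), u.1.fst =ᵐ[volume] (fun x => e (x - y)) ∧ ‖u‖ ≤ K := by
  have hp0 : 0 < p := by linarith
  have he1 : ContDiff ℝ 1 e := he.of_le (by simp)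
  have m1 : MemLp e (ENNReal.ofReal p) volume := he.continuous.memLp_of_hasCompactSupport hc
  have m2 : MemLp (gradient e) (ENNReal.ofReal p) volume :=
    (continuous_gradient he1).memLp_of_hasCompactSupport (hasCompactSupport_gradient hc)
  set A := (eLpNorm e (ENNReal.ofReal p) volume).toReal with hA
  set B := (eLpNorm (gradient e) (ENNReal.ofReal p) volume).toReal with hB
  refine ⟨(A ^ p + B ^ p) ^ (1 / p), by positivity, fun y => ?_⟩
  have hg : gradient (fun x => e (x - y)) = fun x => gradient e (x - y) := by
    funext x
    rw [gradient, gradient, fderiv_comp_sub]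
  have hsub : ContDiff ℝ 1 fun x => e (x - y) := he1.comp (contDiff_id.sub contDiff_const)
  have m1' := m1.comp_measurePreserving (measurePreserving_sub_right y)
  have m2' := m2.comp_measurePreserving (measurePreserving_sub_right y)
  have hw := isWeakGradient_gradient hsub
  rw [hg] at hw
  refine ⟨mk m1' m2' hw, mk_fst m1' m2' hw, ?_⟩
  have h1 := norm_rpow ENNReal.ofReal_ne_top (mk m1' m2' hw)
  rw [ENNReal.toReal_ofReal hp0.le] at h1
  have h2 : ‖(mk m1' m2' hw).1.fst‖ = A := by
    rw [Lp.norm_def, eLpNorm_congr_ae (mk_fst m1' m2' hw)]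
    exact congrArg _ (eLpNorm_translate m1.1 y)
  have h3 : ‖(mk m1' m2' hw).1.snd‖ = B := by
    rw [Lp.norm_def, eLpNorm_congr_ae (mk_snd m1' m2' hw)]
    exact congrArg _ (eLpNorm_translate m2.1 y)
  rw [h2, h3] at h1
  rw [← h1, ← Real.rpow_mul (norm_nonneg _), mul_one_div_cancel hp0.ne', Real.rpow_one]

end Sobolev

end

noncomputable section

/-! ### Upper bounds for the minimax levels -/

theorem BddWeight.powInt_le {α E : Type*} [MeasurableSpace α] [NormedAddCommGroup E]
    [InnerProductSpace ℝ E] {μ : Measure α} {w : α → ℝ} {b p : ℝ} [Fact (1 ≤ ENNReal.ofReal p)]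
    (h : BddWeight μ w b) (hp : 1 < p) (z : Lp E (ENNReal.ofReal p) μ) : powInt μ w p z ≤ b * ‖z‖ ^ p := by
  rw [BddWeight.norm_rpow_eq hp, powInt, powInt, ← integral_const_mul]
  refine integral_mono (h.integrable hp z) ((BddWeight.one.integrable hp z).const_mul b) fun x => ?_
  have : 0 ≤ ‖z x‖ ^ p := by positivity
  simpa using mul_le_mul_of_nonneg_right (h.le x) this

namespace PLaplaceData

open Filter Topology IsTruncation

variable {N : ℕ} (D : PLaplaceData N) {ε : ℝ}

/-- On the dilated set the scale is just `ε ≤ 1`, so truncation starts only at height `1 / ε ≥ 1`.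
-/
theorem min_le_abs_m (hε : 0 < ε) (hε1 : ε ≤ 1) {x : RN N} (hx : x ∈ D.dilated ε) (t : ℝ) :
    min |t| 1 ≤ |D.m ε x t| := by
  have hs : D.scale ε x = ε := by
    have hx' : ε • x ∈ D.M := hx
    rw [scale, Metric.infDist_zero_of_mem hx', Real.exp_zero, mul_one]
  rw [D.m_eq hε, hs, abs_mul, abs_of_pos (inv_pos.2 hε), inv_mul_eq_div, le_div_iff₀ hε]
  refine le_trans (le_min ?_ ?_) (D.isTruncation.min_le_abs_prim (ε * t))
  · rw [abs_mul, abs_of_pos hε, mul_comm]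
    exact mul_le_mul_of_nonneg_left (min_le_left _ _) hε.le
  · calc min |t| 1 * ε ≤ 1 * 1 := mul_le_mul (min_le_right _ _) hε1 hε.le zero_le_one
      _ = 1 := one_mul 1

/-- For `|t| ≥ 1` the truncated variable is at least 1 in absolute value and the subcritical term
alone suffices; for `|t| ≤ 1` the left side is nonpositive. -/
theorem le_F (hε : 0 < ε) (hε1 : ε ≤ 1) {x : RN N} (hx : x ∈ D.dilated ε) (t : ℝ) :
    D.μ / D.q * (|t| ^ D.r - 1) ≤ D.F ε x t := by
  have hr := D.one_lt_r
  have hc := D.coeffs_pos.2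
  rcases le_total |t| 1 with h | h
  · refine le_trans (mul_nonpos_of_nonneg_of_nonpos hc.le ?_) (D.F_nonneg hε x t)
    exact sub_nonpos.2 (Real.rpow_le_one (abs_nonneg t) h (by linarith))
  · have h1 := D.min_le_abs_m hε hε1 hx t
    rw [min_eq_right h] at h1
    have h2 : 1 ≤ |D.m ε x t| ^ (D.q - D.r) := Real.one_le_rpow h1 D.exponents_pos.2.le
    have h3 : 0 ≤ 1 / D.pStar * |t| ^ D.r * |D.m ε x t| ^ (D.pStar - D.r) := by
      have := D.pStar_pos
      positivity
    have h4 : 0 ≤ D.μ / D.q * |t| ^ D.r := by positivity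
    rw [F]
    have h5 := mul_le_mul_of_nonneg_left h2 h4
    linarith

/-- The penalization weight vanishes on the dilated set, so the penalty of such a `u` is zero and no
constant depends on `ε`. -/
theorem J_le_of_support {a b : ℝ} (hVc : Continuous D.V) (ha : 0 < a)
    (hV : ∀ x, a ≤ D.V x ∧ D.V x ≤ b) {u : D.W}
    (hu : ∀ᵐ x, x ∉ D.dilated ε → D.val u x = 0) :
    D.J ε u ≤ 1 / D.p * max 1 b * ‖u‖ ^ D.p := by
  have hp := D.one_lt_p
  have hb : BddWeight (volume : Measure (RN N)) (fun x => D.V (ε • x)) b :=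
    ⟨(hVc.comp (continuous_const_smul ε)).aestronglyMeasurable,
      fun x => ha.le.trans (hV _).1, fun x => (hV _).2⟩
  have hξ : powInt volume (D.ξ ε) D.p (Sobolev.fstL N (ENNReal.ofReal D.p) u) = 0 := by
    refine integral_eq_zero_of_ae (hu.mono fun x hx => ?_)
    change D.ξ ε x * ‖D.val u x‖ ^ D.p = 0
    by_cases h : x ∈ D.dilated ε
    · rw [ξ, if_pos h, zero_mul]
    · rw [hx h, norm_zero, Real.zero_rpow (by linarith), mul_zero]
  have hβ := D.one_lt_β
  have h1 := hb.powInt_le hp (Sobolev.fstL N (ENNReal.ofReal D.p) u)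
  rw [J, energy, hξ, ← BddWeight.norm_rpow_eq hp, zero_sub, max_eq_right (by norm_num),
    Real.zero_rpow (by linarith), mul_zero, add_zero, D.norm_rpow_W, mul_assoc]
  refine mul_le_mul_of_nonneg_left ?_ (by positivity)
  have h2 : 0 ≤ ‖Sobolev.fstL N (ENNReal.ofReal D.p) u‖ ^ D.p := by positivity
  have h3 : 0 ≤ ‖Sobolev.sndL N (ENNReal.ofReal D.p) u‖ ^ D.p := by positivity
  have h4 := mul_le_mul_of_nonneg_right (le_max_left 1 b) h3
  have h5 := mul_le_mul_of_nonneg_right (le_max_right 1 b) h2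
  linarith

theorem integrable_F (hε : 0 < ε) {v : RN N → ℝ} (hv : MemLp v (ENNReal.ofReal D.r) volume) :
    Integrable (fun x => D.F ε x (v x)) volume := by
  obtain ⟨C, hC0, hC⟩ := D.exists_abs_f_le hε
  have hm : AEStronglyMeasurable (fun x => (x, v x)) volume :=
    aestronglyMeasurable_id.prodMk hv.1
  refine ((D.integrable_rpow_of_memLp hv).const_mul C).mono'
    ((D.continuous_F hε).comp_aestronglyMeasurable hm) (Eventually.of_forall fun x => ?_)
  rw [Real.norm_of_nonneg (D.F_nonneg hε x _)]
  exact D.F_le_of_abs_f_le hε hC x _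

/-- The loss of 1 in `le_F` is charged only on a ball of radius `ρ`, whose volume is independent of
its centre and of `ε`. -/
theorem le_integral_F (hε : 0 < ε) (hε1 : ε ≤ 1) {y : RN N} {ρ : ℝ}
    (hball : Metric.ball y ρ ⊆ D.dilated ε) {v : RN N → ℝ}
    (hv : MemLp v (ENNReal.ofReal D.r) volume) (hv0 : ∀ᵐ x, x ∉ Metric.ball y ρ → v x = 0) :
    D.μ / D.q * (∫ x, |v x| ^ D.r) -
      D.μ / D.q * (volume : Measure (RN N)).real (Metric.ball 0 ρ) ≤ ∫ x, D.F ε x (v x) := by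
  have hr := D.one_lt_r
  set χ : RN N → ℝ := (Metric.ball y ρ).indicator fun _ => 1 with hχ
  have i1 := D.integrable_rpow_of_memLp hv
  have i2 : Integrable χ volume := (integrable_indicator_iff measurableSet_ball).2
    (integrableOn_const measure_ball_lt_top.ne ENNReal.coe_ne_top)
  have e : (volume : Measure (RN N)).real (Metric.ball 0 ρ) = ∫ x, χ x := by
    rw [hχ, integral_indicator_const _ measurableSet_ball, smul_eq_mul, mul_one]
    exact (Measure.addHaar_real_ball_center _ y ρ).symm
  rw [e, ← mul_sub, ← integral_sub i1 i2, ← integral_const_mul]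
  refine integral_mono_ae ((i1.sub i2).const_mul _) (D.integrable_F hε hv) (hv0.mono fun x hx => ?_)
  change D.μ / D.q * (|v x| ^ D.r - χ x) ≤ D.F ε x (v x)
  by_cases h : x ∈ Metric.ball y ρ
  · rw [hχ, Set.indicator_of_mem h]
    exact D.le_F hε hε1 (hball h) _
  · rw [hχ, Set.indicator_of_notMem h, hx h, abs_zero, Real.zero_rpow (by linarith), sub_zero,
      mul_zero]
    exact D.F_nonneg hε x 0

theorem ball_subset_dilated {x₀ : RN N} {ρ : ℝ} (h : Metric.ball x₀ ρ ⊆ D.M) (hε : 0 < ε)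
    (hε1 : ε ≤ 1) : Metric.ball (ε⁻¹ • x₀) ρ ⊆ D.dilated ε := by
  intro x hx
  refine h ?_
  rw [mem_ball_iff_norm] at hx ⊢
  have e : ε • x - x₀ = ε • (x - ε⁻¹ • x₀) := by rw [smul_sub, smul_inv_smul₀ hε.ne']
  rw [e, norm_smul, Real.norm_of_nonneg hε.le]
  exact lt_of_le_of_lt (mul_le_of_le_one_left (norm_nonneg _) hε1) hx

theorem val_sum_smul {n : ℕ} (u : Fin n → D.W) (a : Fin n → ℝ) {e : Fin n → RN N → ℝ}
    (he : ∀ i, D.val (u i) =ᵐ[volume] e i) :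
    ∀ᵐ x, D.val (∑ i, a i • u i) x = ∑ i, a i * e i x := by
  have key : ∀ s : Finset (Fin n), ∀ᵐ x, D.val (∑ i ∈ s, a i • u i) x = ∑ i ∈ s, a i * e i x := by
    intro s
    induction s using Finset.induction_on with
    | empty =>
      simp only [Finset.sum_empty]
      exact Lp.coeFn_zero ℝ (ENNReal.ofReal D.p) (volume : Measure (RN N))
    | insert i s hi ih =>
      rw [Finset.sum_insert hi]
      filter_upwards [ih, D.val_add (a i • u i) (∑ k ∈ s, a k • u k), D.val_smul (a i) (u i), he i]
        with x h1 h2 h3 h4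
      rw [h2, h3, h1, h4, Finset.sum_insert hi]
  exact key Finset.univ

/-- Translates to `y` of one fixed family of bumps; the constants are therefore chosen before the
centre. -/
theorem exists_linear_family (n : ℕ) {ρ : ℝ} (hρ : 0 < ρ) : ∃ K κ : ℝ, 0 ≤ K ∧ 0 < κ ∧
    ∀ y : RN N, ∃ L : (Fin n → ℝ) →L[ℝ] D.W, ∀ a, ‖L a‖ ≤ K * ‖a‖ ∧
      κ * ‖a‖ ^ D.r ≤ ∫ x, |D.val (L a) x| ^ D.r ∧
      ∀ᵐ x, x ∉ Metric.ball y ρ → D.val (L a) x = 0 := by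
  have hN : 0 < N := by
    have := D.one_lt_p.trans D.p_lt_N
    exact_mod_cast (by linarith : (0 : ℝ) < N)
  have : Nonempty (Fin N) := ⟨⟨0, hN⟩⟩
  obtain ⟨e, c, h1, h2, h3, h4⟩ := exists_bumps (E := RN N) hρ n
  obtain ⟨κ, hκ, hlow⟩ := exists_mul_norm_rpow_le_integral (μ := (volume : Measure (RN N)))
    D.one_lt_r (fun i => (h1 i).continuous) h2 h4
  choose K hK0 hK using fun i => Sobolev.exists_translate_bound D.one_lt_p (h1 i) (h2 i)
  refine ⟨∑ i, K i, κ, Finset.sum_nonneg fun i _ => hK0 i, hκ, fun y => ?_⟩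
  choose u hu huK using fun i => hK i y
  refine ⟨∑ i, (ContinuousLinearMap.proj i : (Fin n → ℝ) →L[ℝ] ℝ).smulRight (u i), fun a => ?_⟩
  have hL : (∑ i, (ContinuousLinearMap.proj i : (Fin n → ℝ) →L[ℝ] ℝ).smulRight (u i)) a =
      ∑ i, a i • u i := by
    simp
  rw [hL]
  have hval := D.val_sum_smul u a hu
  refine ⟨?_, ?_, hval.mono fun x hx hxb => ?_⟩
  · rw [Finset.sum_mul]
    refine (norm_sum_le _ _).trans (Finset.sum_le_sum fun i _ => ?_)
    rw [norm_smul, mul_comm]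
    exact mul_le_mul (huK i) (norm_le_pi_norm a i) (norm_nonneg _) (hK0 i)
  · refine (hlow a).trans_eq ?_
    rw [← integral_sub_right_eq_self _ y]
    exact integral_congr_ae (hval.mono fun x hx => by
      change _ = |D.val (∑ i, a i • u i) x| ^ D.r
      rw [hx])
  · rw [hx]
    refine Finset.sum_eq_zero fun i _ => ?_
    rw [h3 i, mul_zero]
    rw [mem_ball_iff_norm, not_lt] at hxb
    exact hxb

/-- Place the bumps around `x₀ / ε`, within a ball of fixed radius contained in the dilated set. On
their span the functional is at most `A ‖a‖^p - B ‖a‖^r + C` with constants independent of `ε` and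
`δ`; this bounds it above by `m` and makes it negative far out. A large ball of the span is then in
the class. -/
theorem exists_mem_Gam (hV : D.V1) (hM : IsSmoothBoundedDomain D.M) (j : ℕ) :
    ∃ m : ℝ, ∀ ε : ℝ, 0 < ε → ε ≤ 1 → ∀ δ, 0 < δ →
      ∃ E ∈ Minimax.Gam D.P δ (D.I ε) j, ∀ u ∈ E, D.I ε u ≤ m := by
  obtain ⟨x₀, hx₀⟩ := hM.isConnected.nonempty
  obtain ⟨ρ, hρ, hball⟩ := Metric.isOpen_iff.1 hM.isOpen x₀ hx₀
  obtain ⟨hVc, a₀, b, ha₀, -, hab⟩ := id hV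
  obtain ⟨S, hS0, hS⟩ := D.exists_embedding
  obtain ⟨K, κ, hK, hκ, hfam⟩ := D.exists_linear_family (j + 1) hρ
  have hp := D.one_lt_p
  have hr := D.one_lt_r
  have hc := D.coeffs_pos.2
  obtain ⟨m, X, hm⟩ := exists_rpow_bound (A := 1 / D.p * max 1 b * K ^ D.p) (B := D.μ / D.q * κ)
    (C := D.μ / D.q * (volume : Measure (RN N)).real (Metric.ball 0 ρ))
    (p := D.p) (r := D.r) (by positivity) (by positivity) (by linarith) D.p_lt_r
  refine ⟨m, fun ε hε hε1 δ hδ => ?_⟩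
  obtain ⟨L, hL⟩ := hfam (ε⁻¹ • x₀)
  have hsub := D.ball_subset_dilated hball hε hε1
  have hI : ∀ a, D.I ε (L a) ≤ 1 / D.p * max 1 b * K ^ D.p * ‖a‖ ^ D.p -
      D.μ / D.q * κ * ‖a‖ ^ D.r +
        D.μ / D.q * (volume : Measure (RN N)).real (Metric.ball 0 ρ) := by
    intro a
    obtain ⟨e1, e2, e3⟩ := hL a
    have f1 := D.J_le_of_support hVc.continuous ha₀ hab
      (e3.mono fun x hx h => hx fun hb => h (hsub hb))
    have f2 := D.le_integral_F hε hε1 hsub (hS (L a)).1 e3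
    have f3 : ‖L a‖ ^ D.p ≤ K ^ D.p * ‖a‖ ^ D.p := by
      rw [← Real.mul_rpow hK (norm_nonneg _)]
      gcongr
    have f4 := mul_le_mul_of_nonneg_left f3 (show 0 ≤ 1 / D.p * max 1 b by positivity)
    have f5 := mul_le_mul_of_nonneg_left e2 hc.le
    rw [D.I_eq hV]
    linarith
  -- The second radius makes `κ * ‖a‖ ^ r` exceed `2 * (S * δ) ^ r`, so that `L a` cannot be within
  -- `δ` of both `P` and `-P`. It may depend on `δ`, since `m` does not depend on `R`.
  set R := max X ((2 * (S * δ) ^ D.r / κ + 1) ^ (1 / D.r)) with hR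
  refine ⟨L '' Metric.closedBall 0 R, Minimax.mem_Gam_of_linear D.convex_P D.zero_mem_P hδ L
    fun a ha => ⟨(hI a).trans_lt ((hm _ (norm_nonneg a)).2 ((le_max_left _ _).trans ha)), ?_⟩, ?_⟩
  · by_contra! hcon
    have g1 := D.integral_abs_rpow_le hS0 hS (L a)
    have g2 : (S * Metric.infDist (L a) D.P) ^ D.r ≤ (S * δ) ^ D.r :=
      Real.rpow_le_rpow (mul_nonneg hS0.le Metric.infDist_nonneg)
        (mul_le_mul_of_nonneg_left hcon.1 hS0.le) (by linarith)
    have g3 : (S * Metric.infDist (-L a) D.P) ^ D.r ≤ (S * δ) ^ D.r :=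
      Real.rpow_le_rpow (mul_nonneg hS0.le Metric.infDist_nonneg)
        (mul_le_mul_of_nonneg_left hcon.2 hS0.le) (by linarith)
    have g4 := (hL a).2.1
    have g5 := Real.rpow_le_rpow (by positivity) ((le_max_right _ _).trans ha)
      (by linarith : 0 ≤ D.r)
    rw [← Real.rpow_mul (by positivity), one_div_mul_cancel (by linarith), Real.rpow_one] at g5
    have g6 := mul_le_mul_of_nonneg_left g5 hκ.le
    have g7 : κ * (2 * (S * δ) ^ D.r / κ + 1) = 2 * (S * δ) ^ D.r + κ := by field_simp
    linarith
  · rintro _ ⟨a, -, rfl⟩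
    exact (hI a).trans (hm _ (norm_nonneg a)).1

end PLaplaceData

end

noncomputable section

/-! ### Admissibility of the penalized functional -/

namespace PLaplaceData

variable {N : ℕ} (D : PLaplaceData N) {ε : ℝ}

/-- The thresholds for cone invariance and for positivity on the boundary are combined; `A` and the
gap themselves do not involve `δ`. -/
theorem exists_admissible_of_split (hV : D.V1) (hM : IsOpen D.M) (hε : 0 < ε)
    {Z : Type*} [NormedAddCommGroup Z] [NormedSpace ℝ Z] {ι : D.W →L[ℝ] Z}
    {dΦ : D.W → D.W →L[ℝ] ℝ} {Ψ : Z → D.W →L[ℝ] ℝ}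
    (h : ConvexSplit.Split D.p D.r (D.J ε) (fun u => ∫ x, D.F ε x (D.val u x)) dΦ ι Ψ)
    (hd : ∀ u w, dΦ u w = ∫ x, D.f ε x (D.val u x) * D.val w x) :
    ∃ (A : D.W → D.W) (G : D.W → ℝ), (∀ u, D.IsCriticalPoint ε u ↔ A u = u) ∧
      ∃ δ₀ > 0, ∀ δ, 0 < δ → δ < δ₀ → Minimax.Admissible D.P δ (D.I ε) A G := by
  have hI : D.I ε = fun u => D.J ε u - ∫ x, D.F ε x (D.val u x) := funext fun u => D.I_eq hV u
  obtain ⟨δ₁, hδ₁, h1⟩ := D.exists_infDist_lt_of_minimizer hV hM hε hd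
  obtain ⟨δ₂, hδ₂, h2⟩ := D.exists_pos_on_boundary hV hM hε
  refine ⟨h.op, h.gap, fun u => ?_, min δ₁ δ₂, lt_min hδ₁ hδ₂, fun δ hδ hlt => ?_⟩
  · rw [IsCriticalPoint, hI]
    exact h.isCritical_iff (D.exists_hasFDerivAt_J hV hM hε) u
  · rw [hI]
    refine h.admissible D.convex_P D.zero_mem_P hδ (fun u hu => ?_) ?_
    · exact h1 δ hδ (hlt.trans_le (min_le_left _ _)) u (h.op u) (h.op_spec u) hu
    · obtain ⟨κ, hκ, hpos⟩ := h2 δ hδ (hlt.trans_le (min_le_right _ _))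
      exact ⟨κ, hκ, fun u hu => hpos u (Minimax.infDist_of_mem_Sg hu).1
        (Minimax.infDist_of_mem_Sg hu).2⟩

theorem exists_admissible (hV : D.V1) (hM : IsSmoothBoundedDomain D.M) (hε : 0 < ε) :
    ∃ (A : D.W → D.W) (G : D.W → ℝ), (∀ u, D.IsCriticalPoint ε u ↔ A u = u) ∧
      ∃ δ₀ > 0, ∀ δ, 0 < δ → δ < δ₀ → Minimax.Admissible D.P δ (D.I ε) A G :=
  (D.exists_split hV hM hε).elim fun _ h => h.elim fun _ h => h.elim fun _ h =>
    D.exists_admissible_of_split hV hM.isOpen hε h.1 h.2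

theorem isSignChanging_of_notMem_O {δ : ℝ} (hδ : 0 < δ) {u : D.W} (hu : u ∉ D.O δ) :
    D.IsSignChanging u := by
  refine ⟨fun h => hu (Or.inl ?_), fun h => hu (Or.inr ?_)⟩
  · change Metric.infDist u D.P < δ
    rwa [Metric.infDist_zero_of_mem (show u ∈ D.P from h)]
  · change Metric.infDist (-u) D.P < δ
    have hm : -u ∈ D.P := by
      change ∀ᵐ x, 0 ≤ D.val (-u) x
      filter_upwards [h, D.val_neg u] with x h1 h2
      rw [h2]
      linarith
    rwa [Metric.infDist_zero_of_mem hm]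

theorem Kstar_eq_Kfix {A : D.W → D.W} (hA : ∀ u, D.IsCriticalPoint ε u ↔ A u = u) (δ c : ℝ) :
    D.Kstar ε δ c = Minimax.Kfix D.P δ (D.I ε) A c := by
  ext u
  change (D.IsCriticalPoint ε u ∧ D.I ε u = c) ∧ u ∉ D.O δ ↔ (A u = u ∧ D.I ε u = c) ∧ u ∉ D.O δ
  rw [hA]

end PLaplaceData

end

/-! ### The multiplicity theorem for sign-changing critical points -/

theorem theorem3p2 {N : ℕ} (D : PLaplaceData N) (hV1 : D.V1) (hV2 : D.V2) :
    ∃ m : ℕ → ℝ, ∀ ε : ℝ, 0 < ε → ε ≤ 1 → ∃ δ₀ : ℝ, 0 < δ₀ ∧ ∀ δ : ℝ, 0 < δ → δ < δ₀ →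
      -- every minimax level is a real number, bounded independently of `ε`, and is the value of
      -- `I_ε` at a sign-changing critical point outside `O`
      (∀ j : ℕ, 1 ≤ j → D.level ε δ j ≤ (m j : EReal) ∧
        ∃ c : ℝ, D.level ε δ j = (c : EReal) ∧ ∃ u ∈ D.Kstar ε δ c, D.IsSignChanging u) ∧
      -- the elements of `K_c^*` change sign
      (∀ c : ℝ, ∀ u ∈ D.Kstar ε δ c, D.IsSignChanging u) ∧
      -- there are infinitely many sign-changing critical points at the minimax levels
      {u : D.W | D.IsSignChanging u ∧ ∃ j : ℕ, 1 ≤ j ∧ ∃ c : ℝ,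
        D.level ε δ j = (c : EReal) ∧ u ∈ D.Kstar ε δ c}.Infinite ∧
      -- multiplicity: coinciding levels
      (∀ j k : ℕ, 1 ≤ j → ∀ c : ℝ,
        (∀ i : ℕ, j ≤ i → i ≤ j + k → D.level ε δ i = (c : EReal)) →
        ((k + 1 : ℕ) : ℕ∞) ≤ genus (D.Kstar ε δ c)) := by
  -- The bounds are fixed before `ε` and `δ` are introduced.
  choose m hm using D.exists_mem_Gam hV1 hV2.1
  refine ⟨m, fun ε hε hε1 => ?_⟩
  obtain ⟨A, G, hA, δ₀, hδ₀, hadm⟩ := D.exists_admissible hV1 hV2.1 hε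
  refine ⟨δ₀, hδ₀, fun δ hδ hlt => ?_⟩
  have h := hadm δ hδ hlt
  have hlev : ∀ j, D.level ε δ j ≤ (m j : EReal) := fun j => by
    obtain ⟨E, hE, hb⟩ := hm j ε hε hε1 δ hδ
    exact Minimax.lev_le_of_mem hE fun u hu _ => hb u hu
  have hsign : ∀ c : ℝ, ∀ u ∈ D.Kstar ε δ c, D.IsSignChanging u := fun c u hu =>
    D.isSignChanging_of_notMem_O hδ hu.2
  refine ⟨fun j hj => ⟨hlev j, ?_⟩, hsign, ?_, fun j k hj c hc => ?_⟩
  · obtain ⟨c, hc, u, hu⟩ := h.exists_level hj (hlev j)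
    rw [← D.Kstar_eq_Kfix hA] at hu
    exact ⟨c, hc, u, hu, hsign c u hu⟩
  · refine (h.infinite_critical fun j _ => hlev j).mono ?_
    rintro u ⟨j, hj, c, hc, hu⟩
    rw [← D.Kstar_eq_Kfix hA] at hu
    exact ⟨hsign c u hu, j, hj, c, hc, hu⟩
  · rw [D.Kstar_eq_Kfix hA]
    exact h.add_one_le_genus hj (hc j le_rfl (Nat.le_add_right j k)) (hc _ (Nat.le_add_right j k) le_rfl)
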